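/- **Theorem 3 (Termination of GEM).** Let $P$ be a finite global policy: every principal $a$ has a finite local policy (a finite list of function-free clauses $H\leftarrow B_1,\dots,B_n$), and only finitely many local policies are non-empty. Every atom has the form $p(\mathit{loc},t_1,\dots,t_n)$, where the term $\mathit{loc}$ is its location; principals are constants. Let $G$ be a goal consisting of one atom whose location is a constant $d$, and let principal $a$ start the GEM evaluation of $G$ by sending the request $\langle id_0,a,G\rangle$ to $d$, when no tables exist yet. Then GEM terminates: 1. there is no infinite execution; in particular only finitely many goals are ever (re)evaluated and only finitely many requests and responses are ever exchanged in an execution; 2. every execution that cannot be continued has either halted by floundering (an atom with non-ground location was selected), or has processed all messages, has executed Terminate for the goal of every table that was created, and the only response that $a$ has received to its request is a response $\langle id_0,\mathit{Ans},\mathit{disposed},\emptyset\rangle$. Here an execution is a sequence of steps; in each step some message in transit (in an arbitrary order, each message being received exactly once) is received and completely processed by its addressee, by the following procedures. *Data.* Identifiers are sequences; the identifier of a subrequest is obtained from that of the request by appending a string, and $i\sqsubset j$ ("$i$ is lower than $j$") means that $j$ is a proper prefix of $i$. The table of a goal $\leftarrow A$ consists of a higher request $HR$, a set $LR$ of lower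 requests, a partial map $AG$ from loop identifiers to integer counters, a set $AS$ of answers, each with the identifiers of the requests to which it has been sent, and an evaluation tree whose root $A\leftarrow A$ has the identifier of the initial $HR$. Nodes carry an identifier, a clause, and a status *new*, *active*, $loop(ID)$, *answer* or *disposed*. A response carries the identifier of the request, a set of answers, a status *active*, $loop(id)$ or *disposed*, and a set of loop identifiers. *Process Request* $\langle id,req,G\rangle$. If some table of a variant of $G$ at this principal has a disposed root, Send Response with status disposed and no loops. Otherwise, if some table of a variant with root identifier $id_1$ has $id\sqsubset id_1$, add the request to $LR$ and Send Response with status active and loops $\{id_1\}$. Otherwise Create Table for (a renaming of) $G$. *Create Table.* Create a table with $HR=\langle id,req,G\rangle$, with $LR,AG,AS$ empty and with a new root; for each clause of the local policy that unifies with $A$ after renaming apart from $A$, add its instance under a most general unifier as a new subnode of the root, with identifier $id\,s$, $s$ unique; then Activate Node. *Activate Node.* If no non-root node is new, or $A$ is (up to renaming) in $AS$, Generate Response. Otherwise make the root active if it is new and select the leftmost new non-root node. If its body is empty, its status becomes answer, its head is added to $AS$ unless subsumed by an answer there, and Activate Node is repeated. Otherwise, if the location of its first body atom $B_1$ is not a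 constant, the computation halts (flounders); else the node becomes active and a request for $B_1$ with the node's identifier is sent to that location. *Send Response.* Send to the requester all answers in $AS$ not yet sent to the request, with the given status and loops, and mark them as sent to it. *Process Response* (for a node $t$ in a tree with root identifier $id_1$). Ignore it if the root is disposed. If the response status is disposed: if $t$ has a loop status, dispose all nodes with a loop status; dispose $t$. Otherwise: add the response's loops to the loop status of $t$ (a non-loop status becomes $loop(Loops)$ if the set $Loops$ is non-empty); add a counter $0$ to $AG$ for every loop that has none; if the response status is $loop(id_3)$, decrease the counter of $id_3$ by one, and if the root is active set its status to $loop(\{id_3\})$. In both cases, for each received answer, renamed apart from the selected atom $B_1$ of $t$, add a new subnode of $t$, whose clause is that of $t$ without $B_1$, instantiated by a most general unifier of $B_1$ and the answer, with identifier $id_1s$, $s$ unique. Finally, if the root is active, or its status is $loop(ID)$ and all loops in $ID$ have counter $0$, Activate Node. *Generate Response* (root identifier $id_1$). (i) If no non-root node has a loop status, Terminate. (ii) Otherwise, if some answer has not been sent to some request in $LR$: set the counter of $id_1$ to the number of non-root nodes in loop $id_1$, add $id_1$ to the loop status of the root (a non-loop status becomes $loop(\{id_1\})$), and Send Response to all of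 $LR$ with status $loop(id_1)$ and no loops. (iii) Otherwise, if $id_1$ is the only loop with a counter in $AG$, Terminate. (iv) Otherwise, let $Loops$ be the set of all loops in $AG$ higher than $id_1$; set each of their counters to the number of non-root nodes in that loop; Send Response to $HR$ with loops $Loops$ and status $loop(id_4)$ if the root has status $loop(ID)$ for some $ID$ that contains an $id_4$ with $id_1\sqsubset id_4$, and status active otherwise; make the root active. *Terminate.* Dispose the root and all non-answer nodes, Send Response with status disposed and no loops to $HR$ and to all of $LR$, then erase $HR$, $LR$ and $AG$. -/

import Mathlib

noncomputable section

namespace GEM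

/-! ### Function-free logic programs -/

/-- Terms of a function-free language. Principals (locations) are constants. -/
inductive Term (C : Type*) where
  | var (n : ℕ) : Term C
  | const (c : C) : Term C

/-- An atom `p(loc, t₁, …, tₙ)`. -/
structure Atom (S C : Type*) where
  pred : S
  loc : Term C
  args : List (Term C)

/-- A clause `head ← body`; a fact is a clause with empty body. -/
structure Clause (S C : Type*) where
  head : Atom S C
  body : List (Atom S C)

abbrev Subst (C : Type*) := ℕ → Term C

def Term.subst {C : Type*} (θ : Subst C) : Term C → Term C
  | .var n => θ n
  | .const c => .const c

def Atom.subst {S C : Type*} (θ : Subst C) (A : Atom S C) : Atom S C :=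
  ⟨A.pred, A.loc.subst θ, A.args.map (Term.subst θ)⟩

def Clause.subst {S C : Type*} (θ : Subst C) (c : Clause S C) : Clause S C :=
  ⟨c.head.subst θ, c.body.map (Atom.subst θ)⟩

/-- The substitution that renames variables by a permutation. -/
def renameBy {C : Type*} (π : Equiv.Perm ℕ) : Subst C := fun n => .var (π n)

def Atom.vars {S C : Type*} (A : Atom S C) : Set ℕ :=
  {n | A.loc = .var n ∨ Term.var n ∈ A.args}

def Clause.vars {S C : Type*} (c : Clause S C) : Set ℕ :=
  {n | n ∈ c.head.vars ∨ ∃ B ∈ c.body, n ∈ B.vars}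

/-- The two atoms are equal up to a renaming of variables. -/
def IsVariant {S C : Type*} (A B : Atom S C) : Prop :=
  ∃ π : Equiv.Perm ℕ, A.subst (renameBy π) = B

/-- `B` is an instance of `A`. -/
def Subsumes {S C : Type*} (A B : Atom S C) : Prop :=
  ∃ σ : Subst C, A.subst σ = B

def IsUnifier {S C : Type*} (θ : Subst C) (A B : Atom S C) : Prop :=
  A.subst θ = B.subst θ

/-- `θ` is a most general unifier of `A` and `B`: every unifier is `θ` followed by a
substitution. -/
def IsMGU {S C : Type*} (θ : Subst C) (A B : Atom S C) : Prop :=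
  IsUnifier θ A B ∧ ∀ σ, IsUnifier σ A B → ∃ τ : Subst C, ∀ n, σ n = (θ n).subst τ

/-- Some variant of the clause `c`, variable disjoint from `A`, has a head unifiable with `A`. -/
def Applicable {S C : Type*} (A : Atom S C) (c : Clause S C) : Prop :=
  ∃ (π : Equiv.Perm ℕ) (θ : Subst C),
    Disjoint A.vars (c.subst (renameBy π)).vars ∧ IsUnifier θ A (c.subst (renameBy π)).head

/-- A global policy: the local policy of every principal, its clauses listed in the order in
which that principal tries them. -/
abbrev Policy (S C : Type*) := C → List (Clause S C)

/-! ### Identifiers, messages, tables -/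

/-- An identifier is obtained from the initial one by successively appending sequences of
characters, one for each level of nested requests. -/
abbrev Identifier := List (List Char)

/-- `i` is lower than `j` (`i ⊏ j`): `j` is a proper prefix of `i`. -/
def Lower (i j : Identifier) : Prop := j <+: i ∧ j ≠ i

structure Request (S C : Type*) where
  id : Identifier
  requester : C
  goal : Atom S C

inductive ResponseStatus where
  | active
  | loop (i : Identifier)
  | disposed

structure Response (S C : Type*) where
  id : Identifier
  ans : List (Atom S C)
  status : ResponseStatus
  loops : Set Identifier

/-- A message together with its addressee. -/
inductive Message (S C : Type*) where
  | request (dest : C) (r : Request S C)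
  | response (dest : C) (r : Response S C)

inductive NodeStatus where
  | new
  | active
  | loop (ids : Set Identifier)
  | answer
  | disposed

/-- A non-root node of an evaluation tree, with clause `head ← body`; `depth` is its distance
from the root. -/
structure Node (S C : Type*) where
  id : Identifier
  head : Atom S C
  body : List (Atom S C)
  status : NodeStatus
  depth : ℕ

def Node.Looping {S C : Type*} (n : Node S C) : Prop := ∃ ids, n.status = .loop ids

def Node.InLoop {S C : Type*} (n : Node S C) (i : Identifier) : Prop :=
  ∃ ids, n.status = .loop ids ∧ i ∈ ids

/-- The table of a goal `← goal`, kept by the principal `owner`. The evaluation tree has the root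
`⟨rootId, goal ← goal, rootStatus⟩`; its other nodes are listed from left to right in preorder,
which together with their depths determines the tree. -/
structure Table (S C : Type*) where
  owner : C
  goal : Atom S C
  hr : Option (Request S C)
  lr : List (Request S C)
  /-- the counter of every loop for which there is one -/
  activeGoals : Identifier → Option ℤ
  /-- the answers, each with the identifiers of the requests to which it has been sent -/
  ansSet : List (Atom S C × Set Identifier)
  rootId : Identifier
  rootStatus : NodeStatus
  nodes : List (Node S C)

/-! ### Sending responses, disposing tables -/

section
open scoped Classical

/-- Send Response: send all answers not yet sent to the request `r`, and record that. -/
def Table.sendResponse {S C : Type*} (t : Table S C) (r : Request S C) (st : ResponseStatus)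
    (loops : Set Identifier) : Table S C × Message S C :=
  ({ t with ansSet := t.ansSet.map fun p => (p.1, insert r.id p.2) },
   .response r.requester
     ⟨r.id, (t.ansSet.filter fun p => r.id ∉ p.2).map Prod.fst, st, loops⟩)

def Table.sendResponses {S C : Type*} (t : Table S C) :
    List (Request S C) → ResponseStatus → Set Identifier → Table S C × List (Message S C)
  | [], _, _ => (t, [])
  | r :: rs, st, loops =>
    let p := t.sendResponse r st loops
    let q := p.1.sendResponses rs st loops
    (q.1, p.2 :: q.2)

/-- Terminate. -/
def Table.terminate {S C : Type*} (t : Table S C) : Table S C × List (Message S C) :=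
  let t₁ : Table S C := { t with
    rootStatus := .disposed
    nodes := t.nodes.map fun n =>
      if n.status = .answer then n else { n with status := .disposed } }
  let p := t₁.sendResponses (t₁.hr.toList ++ t₁.lr) .disposed ∅
  ({ p.1 with hr := none, lr := [], activeGoals := fun _ => none }, p.2)

/-! ### Generate Response -/

/-- The number of subgoals of the table's goal that are involved in loop `i`. -/
def Table.loopCount {S C : Type*} (t : Table S C) (i : Identifier) : ℤ :=
  (t.nodes.countP fun n => n.InLoop i : ℕ)

def Table.HasLoopNode {S C : Type*} (t : Table S C) : Prop := ∃ n ∈ t.nodes, n.Looping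

/-- The goal coordinates a loop and has an answer not yet sent to some lower request. -/
def Table.HasUnsentAnswer {S C : Type*} (t : Table S C) : Prop :=
  ∃ r ∈ t.lr, ∃ p ∈ t.ansSet, r.id ∉ p.2

/-- The only loop with a counter is the one coordinated by the goal. -/
def Table.IsLeader {S C : Type*} (t : Table S C) : Prop :=
  ∀ i, t.activeGoals i ≠ none ↔ i = t.rootId

/-- The loops of the table whose coordinator is higher than the goal. -/
def Table.higherLoops {S C : Type*} (t : Table S C) : Set Identifier :=
  {i | t.activeGoals i ≠ none ∧ Lower t.rootId i}

/-- `i` is a higher loop that is currently being processed. -/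
def Table.ProcessesHigher {S C : Type*} (t : Table S C) (i : Identifier) : Prop :=
  ∃ ids, t.rootStatus = .loop ids ∧ i ∈ ids ∧ Lower t.rootId i

def NodeStatus.addLoop (i : Identifier) : NodeStatus → NodeStatus
  | .loop ids => .loop (insert i ids)
  | _ => .loop {i}

/-- Start a new iteration of the loop coordinated by the goal. -/
def Table.startIteration {S C : Type*} (t : Table S C) : Table S C × List (Message S C) :=
  Table.sendResponses
    { t with
      activeGoals := Function.update t.activeGoals t.rootId (some (t.loopCount t.rootId))
      rootStatus := t.rootStatus.addLoop t.rootId }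
    t.lr (.loop t.rootId) ∅

/-- Answer the higher request `r`, notifying its requester of the higher loops. -/
def Table.reply {S C : Type*} (t : Table S C) (r : Request S C) (st : ResponseStatus) :
    Table S C × Message S C :=
  let t₁ : Table S C := { t with
    activeGoals := fun i =>
      if i ∈ t.higherLoops then some (t.loopCount i) else t.activeGoals i }
  let p := t₁.sendResponse r st t.higherLoops
  ({ p.1 with rootStatus := .active }, p.2)

/-- Generate Response turns the table `t` into `t'` and sends the messages `ms`. -/
inductive GenerateResponse {S C : Type*} (t : Table S C) :
    Table S C → List (Message S C) → Prop
  | noLoop (h : ¬ t.HasLoopNode) :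
      GenerateResponse t t.terminate.1 t.terminate.2
  | iterate (h : t.HasLoopNode) (hu : t.HasUnsentAnswer) :
      GenerateResponse t t.startIteration.1 t.startIteration.2
  | leader (h : t.HasLoopNode) (hu : ¬ t.HasUnsentAnswer) (hl : t.IsLeader) :
      GenerateResponse t t.terminate.1 t.terminate.2
  | replyLoop (h : t.HasLoopNode) (hu : ¬ t.HasUnsentAnswer) (hl : ¬ t.IsLeader)
      (r : Request S C) (hr : t.hr = some r) (i : Identifier) (hi : t.ProcessesHigher i) :
      GenerateResponse t (t.reply r (.loop i)).1 [(t.reply r (.loop i)).2]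
  | replyActive (h : t.HasLoopNode) (hu : ¬ t.HasUnsentAnswer) (hl : ¬ t.IsLeader)
      (r : Request S C) (hr : t.hr = some r) (hi : ∀ i, ¬ t.ProcessesHigher i) :
      GenerateResponse t (t.reply r .active).1 [(t.reply r .active).2]

/-! ### Activate Node -/

/-- The outcome of running a procedure on a table. -/
inductive Outcome (S C : Type*) where
  | done (t : Table S C) (ms : List (Message S C))
  | flounder

/-- There is nothing to activate: no node is new, or the goal itself is among the answers. -/
def Table.Exhausted {S C : Type*} (t : Table S C) : Prop :=
  (∀ n ∈ t.nodes, n.status ≠ .new) ∨ ∃ p ∈ t.ansSet, IsVariant p.1 t.goal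

/-- `n` is the leftmost new node, between the nodes `pre` and `post`. -/
def Table.Selects {S C : Type*} (t : Table S C) (pre : List (Node S C)) (n : Node S C)
    (post : List (Node S C)) : Prop :=
  t.nodes = pre ++ n :: post ∧ n.status = .new ∧ ∀ m ∈ pre, m.status ≠ .new

/-- Set the status of the selected node to `st`, and that of the root to active if it is new. -/
def Table.activate {S C : Type*} (t : Table S C) (pre : List (Node S C)) (n : Node S C)
    (post : List (Node S C)) (st : NodeStatus) : Table S C :=
  { t with
    rootStatus := if t.rootStatus = .new then .active else t.rootStatus
    nodes := pre ++ { n with status := st } :: post }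

def Table.addAnswer {S C : Type*} (t : Table S C) (A : Atom S C) : Table S C :=
  if ∃ p ∈ t.ansSet, Subsumes p.1 A then t else { t with ansSet := t.ansSet ++ [(A, ∅)] }

/-- Activate Node. -/
inductive ActivateNode {S C : Type*} : Table S C → Outcome S C → Prop
  | respond {t t' : Table S C} {ms : List (Message S C)} (h : t.Exhausted)
      (hg : GenerateResponse t t' ms) : ActivateNode t (.done t' ms)
  | fact {t : Table S C} {pre post : List (Node S C)} {n : Node S C} {o : Outcome S C}
      (h : ¬ t.Exhausted) (hs : t.Selects pre n post) (hb : n.body = [])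
      (ho : ActivateNode ((t.activate pre n post .answer).addAnswer n.head) o) :
      ActivateNode t o
  | flounder {t : Table S C} {pre post : List (Node S C)} {n : Node S C} {B : Atom S C}
      {Bs : List (Atom S C)} (h : ¬ t.Exhausted) (hs : t.Selects pre n post)
      (hb : n.body = B :: Bs) (hloc : ∀ c, B.loc ≠ .const c) : ActivateNode t .flounder
  | request {t : Table S C} {pre post : List (Node S C)} {n : Node S C} {B : Atom S C}
      {Bs : List (Atom S C)} {c : C} (h : ¬ t.Exhausted) (hs : t.Selects pre n post)
      (hb : n.body = B :: Bs) (hloc : B.loc = .const c) :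
      ActivateNode t
        (.done (t.activate pre n post .active) [.request c ⟨n.id, t.owner, B⟩])

/-! ### Create Table -/

/-- `ns` lists the subnodes of the root of the tree of `← A` that stem from the given clauses;
`i` is the identifier of the root. -/
inductive InitialNodes {S C : Type*} (A : Atom S C) (i : Identifier) :
    List (Clause S C) → List (Node S C) → Prop
  | nil : InitialNodes A i [] []
  | skip {c : Clause S C} {cs : List (Clause S C)} {ns : List (Node S C)}
      (hc : ¬ Applicable A c) (h : InitialNodes A i cs ns) : InitialNodes A i (c :: cs) ns
  | add {c c' : Clause S C} {cs : List (Clause S C)} {ns : List (Node S C)}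
      {π : Equiv.Perm ℕ} {θ : Subst C} {s : List Char}
      (hc : c' = c.subst (renameBy π)) (hd : Disjoint A.vars c'.vars) (hθ : IsMGU θ A c'.head)
      (hs : ∀ n ∈ ns, n.id ≠ i ++ [s]) (h : InitialNodes A i cs ns) :
      InitialNodes A i (c :: cs)
        (⟨i ++ [s], (c'.subst θ).head, (c'.subst θ).body, .new, 1⟩ :: ns)

/-- Create Table: principal `d`, with local policy `pol`, creates a table for the request `r`
and starts the evaluation. -/
def CreateTable {S C : Type*} (pol : List (Clause S C)) (d : C) (r : Request S C)
    (o : Outcome S C) : Prop :=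
  ∃ ns, InitialNodes r.goal r.id pol ns ∧
    ActivateNode ⟨d, r.goal, some r, [], fun _ => none, [], r.id, .new, ns⟩ o

/-! ### Process Response -/

def NodeStatus.addLoops (loops : Set Identifier) : NodeStatus → NodeStatus
  | .loop ids => .loop (ids ∪ loops)
  | st => if loops = ∅ then st else .loop loops

/-- Dispose the node `i`, and all nodes involved in a loop if node `i` is. -/
def Table.disposeNode {S C : Type*} (t : Table S C) (i : Identifier) : Table S C :=
  { t with
    nodes := t.nodes.map fun n =>
      if n.id = i ∨ ((∃ m ∈ t.nodes, m.id = i ∧ m.Looping) ∧ n.Looping) then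
        { n with status := .disposed }
      else n }

/-- Record that the node `i` is involved in the given loops. -/
def Table.noteLoops {S C : Type*} (t : Table S C) (i : Identifier) (loops : Set Identifier) :
    Table S C :=
  { t with
    nodes := t.nodes.map fun n =>
      if n.id = i then { n with status := n.status.addLoops loops } else n
    activeGoals := fun j =>
      if t.activeGoals j = none ∧ j ∈ loops then some 0 else t.activeGoals j }

/-- Record that a response has been received in the context of loop `i`. -/
def Table.noteLoopResponse {S C : Type*} (t : Table S C) (i : Identifier) : Table S C :=
  { t with
    activeGoals := Function.update t.activeGoals i ((t.activeGoals i).map (· - 1))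
    rootStatus := if t.rootStatus = .active then .loop {i} else t.rootStatus }

def Table.noteResponse {S C : Type*} (t : Table S C) (r : Response S C) : Table S C :=
  match r.status with
  | .disposed => t.disposeNode r.id
  | .active => t.noteLoops r.id r.loops
  | .loop i => (t.noteLoops r.id r.loops).noteLoopResponse i

/-- `ns` lists the subnodes obtained by resolving the selected atom `B` of a node at depth `k`
with clause `H ← B, Bs` against the given answers; `i` is the identifier of the root, and the
identifiers in `used` are already taken. -/
inductive AnswerNodes {S C : Type*} (H B : Atom S C) (Bs : List (Atom S C)) (k : ℕ)
    (i : Identifier) (used : Set Identifier) : List (Atom S C) → List (Node S C) → Prop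
  | nil : AnswerNodes H B Bs k i used [] []
  | skip {A : Atom S C} {As : List (Atom S C)} {ns : List (Node S C)}
      (hA : ¬ Applicable B ⟨A, []⟩) (h : AnswerNodes H B Bs k i used As ns) :
      AnswerNodes H B Bs k i used (A :: As) ns
  | add {A A' : Atom S C} {As : List (Atom S C)} {ns : List (Node S C)}
      {π : Equiv.Perm ℕ} {θ : Subst C} {s : List Char}
      (hA : A' = A.subst (renameBy π)) (hd : Disjoint B.vars A'.vars) (hθ : IsMGU θ B A')
      (hu : i ++ [s] ∉ used) (hs : ∀ n ∈ ns, n.id ≠ i ++ [s])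
      (h : AnswerNodes H B Bs k i used As ns) :
      AnswerNodes H B Bs k i used (A :: As)
        (⟨i ++ [s], H.subst θ, Bs.map (Atom.subst θ), .new, k + 1⟩ :: ns)

/-- Insert `ns` as the rightmost subnodes of the node `i`: after all descendants of that node. -/
def insertSubnodes {S C : Type*} (i : Identifier) (ns : List (Node S C)) :
    List (Node S C) → List (Node S C)
  | [] => []
  | n :: l =>
    if n.id = i then
      n :: (l.takeWhile (fun m => n.depth < m.depth) ++ ns ++
        l.dropWhile (fun m => n.depth < m.depth))
    else n :: insertSubnodes i ns l

/-- The principal is not waiting for a response for any subgoal. -/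
def Table.Resumable {S C : Type*} (t : Table S C) : Prop :=
  t.rootStatus = .active ∨
    ∃ ids, t.rootStatus = .loop ids ∧ ∀ i ∈ ids, t.activeGoals i = some 0

/-- Process Response, for a response `r` that refers to a node of the table `t`. -/
inductive ProcessResponse {S C : Type*} (t : Table S C) (r : Response S C) :
    Outcome S C → Prop
  | ignore (hroot : t.rootStatus = .disposed) : ProcessResponse t r (.done t [])
  | resume {n : Node S C} {B : Atom S C} {Bs : List (Atom S C)} {ns : List (Node S C)}
      {t' : Table S C} {o : Outcome S C} (hroot : t.rootStatus ≠ .disposed)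
      (hn : n ∈ t.nodes) (hid : n.id = r.id) (hb : n.body = B :: Bs)
      (hns : AnswerNodes n.head B Bs n.depth t.rootId {i | ∃ m ∈ t.nodes, m.id = i} r.ans ns)
      (ht : t' = { t.noteResponse r with
        nodes := insertSubnodes r.id ns (t.noteResponse r).nodes })
      (hr : t'.Resumable) (ho : ActivateNode t' o) : ProcessResponse t r o
  | wait {n : Node S C} {B : Atom S C} {Bs : List (Atom S C)} {ns : List (Node S C)}
      {t' : Table S C} (hroot : t.rootStatus ≠ .disposed)
      (hn : n ∈ t.nodes) (hid : n.id = r.id) (hb : n.body = B :: Bs)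
      (hns : AnswerNodes n.head B Bs n.depth t.rootId {i | ∃ m ∈ t.nodes, m.id = i} r.ans ns)
      (ht : t' = { t.noteResponse r with
        nodes := insertSubnodes r.id ns (t.noteResponse r).nodes })
      (hr : ¬ t'.Resumable) : ProcessResponse t r (.done t' [])

end

/-! ### Executions -/

/-- A global state: the tables of all principals, the messages sent but not yet received, the
responses received for requests that do not stem from a table (with their receivers), and
whether the computation has been halted by floundering. -/
structure State (S C : Type*) where
  tables : List (Table S C)
  transit : Multiset (Message S C)
  returned : List (C × Response S C)
  floundered : Bool

/-- The table belongs to principal `d` and its goal is a variant of that of the request, whose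
evaluation is completed. -/
def Table.Completes {S C : Type*} (t : Table S C) (d : C) (r : Request S C) : Prop :=
  t.owner = d ∧ IsVariant t.goal r.goal ∧ t.rootStatus = .disposed

/-- The table belongs to principal `d` and `r` is a lower request for its goal. -/
def Table.FormsLoop {S C : Type*} (t : Table S C) (d : C) (r : Request S C) : Prop :=
  t.owner = d ∧ IsVariant t.goal r.goal ∧ t.rootStatus ≠ .disposed ∧
    ∃ r₁, t.hr = some r₁ ∧ Lower r.id r₁.id

/-- The table belongs to principal `d` and the response refers to one of its nodes. -/
def Table.Awaits {S C : Type*} (t : Table S C) (d : C) (r : Response S C) : Prop :=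
  t.owner = d ∧ ∃ n ∈ t.nodes, n.id = r.id

/-- Replace the table between `l₁` and `l₂` as the outcome says and send its messages. -/
inductive Apply {S C : Type*} (s : State S C) (l₁ l₂ : List (Table S C))
    (rest : Multiset (Message S C)) : Outcome S C → State S C → Prop
  | done (t : Table S C) (ms : List (Message S C)) :
      Apply s l₁ l₂ rest (.done t ms)
        { s with tables := l₁ ++ t :: l₂, transit := rest + (ms : Multiset (Message S C)) }
  | flounder :
      Apply s l₁ l₂ rest .flounder { s with transit := rest, floundered := true }

/-- The addressee of some message in transit receives and processes it. The first three cases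
are Process Request (for a completed goal, for a lower request, and for any other request, whose
goal may be renamed), the fourth one is Process Response; in the last case a response reaches the
issuer of the initial request. Tables of variant goals are told apart by their `rootId`. -/
inductive Step {S C : Type*} (P : Policy S C) : State S C → State S C → Prop
  | completed {s : State S C} {d : C} {r : Request S C} {rest : Multiset (Message S C)}
      {l₁ l₂ : List (Table S C)} {t t' : Table S C} {m : Message S C}
      (hf : s.floundered = false) (hm : s.transit = .request d r ::ₘ rest)
      (ht : s.tables = l₁ ++ t :: l₂) (hc : t.Completes d r)
      (hs : t.sendResponse ⟨r.id, r.requester, t.goal⟩ .disposed ∅ = (t', m)) :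
      Step P s { s with tables := l₁ ++ t' :: l₂, transit := m ::ₘ rest }
  | lower {s : State S C} {d : C} {r : Request S C} {rest : Multiset (Message S C)}
      {l₁ l₂ : List (Table S C)} {t t' : Table S C} {m : Message S C}
      (hf : s.floundered = false) (hm : s.transit = .request d r ::ₘ rest)
      (hn : ∀ u ∈ s.tables, ¬ u.Completes d r)
      (ht : s.tables = l₁ ++ t :: l₂) (hc : t.FormsLoop d r)
      (hs : Table.sendResponse { t with lr := t.lr ++ [⟨r.id, r.requester, t.goal⟩] }
        ⟨r.id, r.requester, t.goal⟩ .active {t.rootId} = (t', m)) :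
      Step P s { s with tables := l₁ ++ t' :: l₂, transit := m ::ₘ rest }
  | create {s s' : State S C} {d : C} {r : Request S C} {rest : Multiset (Message S C)}
      {G : Atom S C} {o : Outcome S C}
      (hf : s.floundered = false) (hm : s.transit = .request d r ::ₘ rest)
      (hn : ∀ u ∈ s.tables, ¬ u.Completes d r ∧ ¬ u.FormsLoop d r)
      (hG : IsVariant r.goal G)
      (hc : CreateTable (P d) d ⟨r.id, r.requester, G⟩ o)
      (ha : Apply s s.tables [] rest o s') :
      Step P s s'
  | response {s s' : State S C} {d : C} {r : Response S C} {rest : Multiset (Message S C)}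
      {l₁ l₂ : List (Table S C)} {t : Table S C} {o : Outcome S C}
      (hf : s.floundered = false) (hm : s.transit = .response d r ::ₘ rest)
      (ht : s.tables = l₁ ++ t :: l₂) (hw : t.Awaits d r)
      (hp : ProcessResponse t r o) (ha : Apply s l₁ l₂ rest o s') :
      Step P s s'
  | returned {s : State S C} {d : C} {r : Response S C} {rest : Multiset (Message S C)}
      (hf : s.floundered = false) (hm : s.transit = .response d r ::ₘ rest)
      (hn : ∀ t ∈ s.tables, ¬ t.Awaits d r) :
      Step P s { s with transit := rest, returned := s.returned ++ [(d, r)] }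

/-- Principal `a` has sent the request `⟨i, a, G⟩` to principal `d`; there are no tables yet. -/
def initial {S C : Type*} (i : Identifier) (a d : C) (G : Atom S C) : State S C :=
  ⟨[], {.request d ⟨i, a, G⟩}, [], false⟩

/-- All messages have been processed, Terminate has been executed for the goal of every table,
and the only response to the initial request `i` of principal `a` that `a` has received is one
with status disposed. -/
def Completed {S C : Type*} (i : Identifier) (a : C) (s : State S C) : Prop :=
  s.floundered = false ∧ s.transit = 0 ∧ (∀ t ∈ s.tables, t.rootStatus = .disposed) ∧
    ∃ ans, s.returned = [(a, ⟨i, ans, .disposed, ∅⟩)]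

end GEM

end

namespace GEM

variable {S C : Type*}

/-! ### Substitutions -/

/-- Apply `θ` first and `τ` afterwards. -/
def Subst.comp (θ τ : Subst C) : Subst C := fun n => (θ n).subst τ

theorem Term.subst_comp (θ τ : Subst C) (t : Term C) :
    t.subst (θ.comp τ) = (t.subst θ).subst τ := by
  cases t <;> rfl

theorem Atom.subst_comp (θ τ : Subst C) (A : Atom S C) :
    A.subst (θ.comp τ) = (A.subst θ).subst τ := by
  simp [Atom.subst, Term.subst_comp, Function.comp_def]

theorem Term.subst_var (t : Term C) : t.subst .var = t := by cases t <;> rfl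

theorem Atom.subst_var (A : Atom S C) : A.subst .var = A := by
  have : (Term.subst (C := C) .var) = id := funext Term.subst_var
  cases A; simp [Atom.subst, this, Term.subst_var]

theorem renameBy_comp (π ρ : Equiv.Perm ℕ) :
    (renameBy π : Subst C).comp (renameBy ρ) = renameBy (ρ * π) := rfl

theorem renameBy_one : (renameBy 1 : Subst C) = .var := rfl

theorem IsVariant.refl (A : Atom S C) : IsVariant A A :=
  ⟨1, by rw [renameBy_one, Atom.subst_var]⟩

theorem IsVariant.trans {A B D : Atom S C} (h : IsVariant A B) (h' : IsVariant B D) :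
    IsVariant A D := by
  obtain ⟨π, rfl⟩ := h
  obtain ⟨ρ, rfl⟩ := h'
  exact ⟨ρ * π, by rw [← renameBy_comp, Atom.subst_comp]⟩

theorem IsVariant.symm {A B : Atom S C} (h : IsVariant A B) : IsVariant B A := by
  obtain ⟨π, rfl⟩ := h
  exact ⟨π⁻¹, by rw [← Atom.subst_comp, renameBy_comp, inv_mul_cancel, renameBy_one,
    Atom.subst_var]⟩

theorem IsVariant.loc_eq {A B : Atom S C} {c : C} (h : IsVariant A B) (hA : A.loc = .const c) :
    B.loc = .const c := by
  obtain ⟨π, rfl⟩ := h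
  simp [Atom.subst, hA, Term.subst]

theorem Subsumes.of_isVariant {A B : Atom S C} (h : IsVariant A B) : Subsumes A B :=
  ⟨_, h.choose_spec⟩

/-! ### Most general unifiers -/

/-- `θ` unifies every equation of the list. -/
def Unifies (θ : Subst C) (E : List (Term C × Term C)) : Prop :=
  ∀ e ∈ E, e.1.subst θ = e.2.subst θ

open scoped Classical in
theorem Term.subst_update_of_eq {σ : Subst C} {x : ℕ} {t : Term C} (h : σ x = t.subst σ) :
    Subst.comp (Function.update .var x t) σ = σ := by
  funext n
  by_cases hn : n = x
  · subst hn; simp [Subst.comp, h]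
  · simp [Subst.comp, hn, Term.subst]

theorem exists_mgu_list (n : ℕ) : ∀ (E : List (Term C × Term C)) (σ : Subst C), E.length = n →
    Unifies σ E → ∃ θ, Unifies θ E ∧ ∀ σ, Unifies σ E → ∃ τ, σ = Subst.comp θ τ := by
  classical
  induction n with
  | zero =>
    intro E σ hE _
    rw [List.length_eq_zero_iff] at hE
    subst hE
    exact ⟨.var, by simp [Unifies], fun σ _ => ⟨σ, by funext n; rfl⟩⟩
  | succ n ih =>
    intro E σ hE hσ
    match E, hE with
    | (s, t) :: E, hE =>
    have hE' : E.length = n := by simpa using hE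
    have bind : ∀ (x : ℕ) (t : Term C) (E₀ : List (Term C × Term C)),
        t ≠ .var x → (∀ σ : Subst C, Unifies σ E₀ ↔ σ x = t.subst σ ∧ Unifies σ E) →
        Unifies σ E₀ →
        ∃ θ, Unifies θ E₀ ∧ ∀ σ, Unifies σ E₀ → ∃ τ, σ = Subst.comp θ τ := by
      intro x t E₀ hne hE₀ hσ
      let u : Subst C := Function.update .var x t
      have key : ∀ σ : Subst C, Unifies σ (E.map fun e => (e.1.subst u, e.2.subst u)) ↔
          Unifies (u.comp σ) E := by
        intro σ
        simp only [Unifies, List.forall_mem_map, Term.subst_comp]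
      have htu : t.subst u = t := by
        cases t with
        | const c => rfl
        | var y =>
          have : y ≠ x := fun h => hne (by rw [h])
          simp [Term.subst, u, this]
      obtain ⟨h1, h2⟩ := (hE₀ σ).1 hσ
      obtain ⟨θ, hθ, hm⟩ := ih (E.map fun e => (e.1.subst u, e.2.subst u)) σ (by simpa using hE')
        ((key σ).2 (by rw [Term.subst_update_of_eq h1]; exact h2))
      refine ⟨u.comp θ, (hE₀ _).2 ⟨?_, (key θ).1 hθ⟩, fun σ' hσ' => ?_⟩
      · rw [Term.subst_comp, htu]; simp [Subst.comp, u]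
      · obtain ⟨h1', h2'⟩ := (hE₀ σ').1 hσ'
        obtain ⟨τ, hτ⟩ := hm σ' ((key σ').2 (by rw [Term.subst_update_of_eq h1']; exact h2'))
        refine ⟨τ, ?_⟩
        have := Term.subst_update_of_eq h1'
        rw [← this]
        funext n
        change (u n).subst σ' = _
        rw [hτ, Term.subst_comp]; rfl
    by_cases hst : s = t
    · subst hst
      have hiff : ∀ σ : Subst C, Unifies σ ((s, s) :: E) ↔ Unifies σ E := by
        intro σ; simp [Unifies]
      obtain ⟨θ, h⟩ := ih E σ hE' ((hiff σ).1 hσ)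
      exact ⟨θ, (hiff θ).2 h.1, fun σ' h' => h.2 σ' ((hiff σ').1 h')⟩
    · cases s with
      | var x =>
        exact bind x t _ (Ne.symm hst) (fun σ => by simp [Unifies, Term.subst]) hσ
      | const c =>
        cases t with
        | var y =>
          refine bind y (.const c) _ hst (fun σ => ?_) hσ
          simp [Unifies, Term.subst, eq_comm]
        | const c' =>
          have := hσ _ (List.mem_cons_self)
          exact absurd this hst

theorem isUnifier_iff {A B : Atom S C} (hp : A.pred = B.pred)
    (hl : A.args.length = B.args.length) (θ : Subst C) :
    IsUnifier θ A B ↔ Unifies θ ((A.loc, B.loc) :: A.args.zip B.args) := by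
  have : ∀ l l' : List (Term C), l.length = l'.length →
      (l.map (Term.subst θ) = l'.map (Term.subst θ) ↔
        ∀ e ∈ l.zip l', e.1.subst θ = e.2.subst θ) := by
    intro l
    induction l with
    | nil => intro l' h; cases l' <;> simp_all
    | cons a l ih =>
      intro l' h
      cases l' with
      | nil => simp at h
      | cons b l' => simp [ih l' (by simpa using h)]
  simp only [IsUnifier, Atom.subst, Unifies, Atom.mk.injEq, hp, true_and, this _ _ hl,
    List.forall_mem_cons]

theorem exists_isMGU {A B : Atom S C} {σ : Subst C} (h : IsUnifier σ A B) :
    ∃ θ, IsMGU θ A B := by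
  have hp : A.pred = B.pred := by
    simpa [Atom.subst] using congrArg Atom.pred (show A.subst σ = B.subst σ from h)
  have hl : A.args.length = B.args.length := by
    simpa [Atom.subst] using
      congrArg (fun A => A.args.length) (show A.subst σ = B.subst σ from h)
  obtain ⟨θ, h1, h2⟩ := exists_mgu_list _ _ σ rfl ((isUnifier_iff hp hl σ).1 h)
  refine ⟨θ, (isUnifier_iff hp hl θ).2 h1, fun σ' h' => ?_⟩
  obtain ⟨τ, rfl⟩ := h2 σ' ((isUnifier_iff hp hl σ').1 h')
  exact ⟨τ, fun _ => rfl⟩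

/-! ### Atoms over a finite signature -/

/-- The constants of an atom. -/
def Atom.consts (A : Atom S C) : Set C := {c | A.loc = .const c ∨ Term.const c ∈ A.args}

open scoped Classical in
/-- Replace the constant `c` by a variable. -/
noncomputable def Term.forget (c : C) : Term C → Term C
  | .var n => .var n
  | .const d => if d = c then .var 0 else .const d

theorem Term.subst_forget {c : C} {t : Term C} (θ : Subst C) (h : t ≠ .const c) :
    t.subst (fun n => (θ n).forget c) = (t.subst θ).forget c := by
  cases t with
  | var n => rfl
  | const d =>
    have : d ≠ c := fun e => h (by rw [e])
    simp [Term.subst, Term.forget, this]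

theorem IsMGU.const_mem {θ : Subst C} {A B : Atom S C} (h : IsMGU θ A B) {n : ℕ} {c : C}
    (hn : θ n = .const c) : c ∈ A.consts ∪ B.consts := by
  by_contra hc
  simp only [Atom.consts, Set.mem_union, Set.mem_ofPred_eq, not_or] at hc
  obtain ⟨⟨h1, h2⟩, h3, h4⟩ := hc
  have hu : IsUnifier (fun n => (θ n).forget c) A B := by
    have e := h.1
    simp only [IsUnifier, Atom.subst, Atom.mk.injEq] at e ⊢
    refine ⟨e.1, ?_, ?_⟩
    · rw [Term.subst_forget θ h1, Term.subst_forget θ h3, e.2.1]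
    · have := congrArg (List.map (Term.forget c)) e.2.2
      rw [List.map_map, List.map_map] at this
      rw [List.map_congr_left (g := Term.forget c ∘ Term.subst θ), this,
        List.map_congr_left (f := Term.forget c ∘ Term.subst θ)]
      · intro t ht
        exact (Term.subst_forget θ (fun e => h4 (e ▸ ht))).symm
      · intro t ht
        exact Term.subst_forget θ (fun e => h2 (e ▸ ht))
  obtain ⟨τ, hτ⟩ := h.2 _ hu
  have := hτ n
  simp [hn, Term.forget, Term.subst] at this

/-- A bound for the predicates, constants and arities of atoms. -/
structure Signature (S C : Type*) where
  preds : Set S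
  consts : Set C
  arity : ℕ

/-- The atom is built over the signature. -/
def Atom.Over (Q : Signature S C) (A : Atom S C) : Prop :=
  A.pred ∈ Q.preds ∧ A.consts ⊆ Q.consts ∧ A.args.length ≤ Q.arity

theorem Atom.Over.subst {Q : Signature S C} {A : Atom S C} (h : A.Over Q) {θ : Subst C}
    (hθ : ∀ n c, θ n = .const c → c ∈ Q.consts) : (A.subst θ).Over Q := by
  have aux : ∀ (t : Term C) c, t.subst θ = .const c → t = .const c ∨ c ∈ Q.consts := by
    intro t c ht
    cases t with
    | var n => exact .inr (hθ n c ht)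
    | const d => exact .inl ht
  refine ⟨h.1, ?_, by simpa [Atom.subst] using h.2.2⟩
  rintro c (hc | hc)
  · exact (aux _ _ hc).elim (fun e => h.2.1 (.inl e)) id
  · obtain ⟨t, ht, e⟩ := List.mem_map.1 hc
    exact (aux _ _ e).elim (fun e => h.2.1 (.inr (e ▸ ht))) id

theorem Atom.Over.rename {Q : Signature S C} {A : Atom S C} (h : A.Over Q)
    (π : Equiv.Perm ℕ) : (A.subst (renameBy π)).Over Q :=
  h.subst fun _ _ e => by simp [renameBy] at e

theorem Atom.Over.of_isVariant {Q : Signature S C} {A B : Atom S C} (h : A.Over Q)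
    (hv : IsVariant A B) : B.Over Q := by
  obtain ⟨π, rfl⟩ := hv
  exact h.rename π

theorem Atom.Over.subst_mgu {Q : Signature S C} {A B D : Atom S C} (hA : A.Over Q)
    (hB : B.Over Q) (hD : D.Over Q) {θ : Subst C} (hθ : IsMGU θ A B) : (D.subst θ).Over Q :=
  hD.subst fun _ _ e => (hθ.const_mem e).elim (fun h => hA.2.1 h) (fun h => hB.2.1 h)

theorem exists_perm_lt (V : Finset ℕ) : ∀ m, V.card ≤ m → ∃ π : Equiv.Perm ℕ, ∀ n ∈ V, π n < m := by
  induction V using Finset.induction_on with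
  | empty => intro m _; exact ⟨1, by simp⟩
  | insert v V hv ih =>
    intro m hm
    rw [Finset.card_insert_of_notMem hv] at hm
    obtain ⟨π, hπ⟩ := ih (m - 1) (by omega)
    refine ⟨Equiv.swap (π v) (m - 1) * π, fun n hn => ?_⟩
    rw [Equiv.Perm.mul_apply]
    rcases Finset.mem_insert.1 hn with rfl | hn
    · rw [Equiv.swap_apply_left]; omega
    · have h1 := hπ n hn
      rw [Equiv.swap_apply_of_ne_of_ne]
      · omega
      · exact fun e => hv (π.injective e ▸ hn)
      · omega

/-- The atoms over the signature with variables below `arity + 1`. -/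
def Signature.canonical (Q : Signature S C) : Set (Atom S C) :=
  {A | A.Over Q ∧ ∀ n ∈ A.vars, n < Q.arity + 1}

theorem Signature.canonical_finite (Q : Signature S C) (hp : Q.preds.Finite)
    (hc : Q.consts.Finite) : Q.canonical.Finite := by
  let T : Set (Term C) := Term.const '' Q.consts ∪ Term.var '' Set.Iio (Q.arity + 1)
  have hT : T.Finite := (hc.image _).union ((Set.finite_Iio _).image _)
  have hL : {l : List (Term C) | l.length ≤ Q.arity ∧ ∀ t ∈ l, t ∈ T}.Finite := by
    have := hT.to_subtype
    refine ((List.finite_length_le T Q.arity).image (List.map Subtype.val)).subset ?_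
    rintro l ⟨h1, h2⟩
    refine ⟨l.attach.map fun t => ⟨t.1, h2 _ t.2⟩, by simpa using h1, ?_⟩
    simp
  refine ((hp.prod (hT.prod hL)).image
    fun x : S × Term C × List (Term C) => Atom.mk x.1 x.2.1 x.2.2).subset ?_
  rintro ⟨p, t, l⟩ ⟨⟨h1, h2, h3⟩, h4⟩
  refine ⟨(p, t, l), ⟨h1, ?_, h3, ?_⟩, rfl⟩
  · cases t with
    | var n => exact .inr ⟨n, h4 n (.inl rfl), rfl⟩
    | const c => exact .inl ⟨c, h2 (.inl rfl), rfl⟩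
  · intro t ht
    cases t with
    | var n => exact .inr ⟨n, h4 n (.inr ht), rfl⟩
    | const c => exact .inl ⟨c, h2 (.inr ht), rfl⟩

theorem Atom.Over.exists_canonical {Q : Signature S C} {A : Atom S C} (h : A.Over Q) :
    ∃ B ∈ Q.canonical, IsVariant A B := by
  classical
  let f : Term C → Finset ℕ := fun t => match t with | .var n => {n} | .const _ => ∅
  have hf : ∀ t, (f t).card ≤ 1 := by intro t; cases t <;> simp [f]
  let V : Finset ℕ := f A.loc ∪ A.args.toFinset.biUnion f
  have hV : V.card ≤ Q.arity + 1 := by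
    refine (Finset.card_union_le _ _).trans ?_
    have h1 : (A.args.toFinset.biUnion f).card ≤ A.args.toFinset.card * 1 :=
      Finset.card_biUnion_le_card_mul _ _ _ fun t _ => hf t
    have h2 := A.args.toFinset_card_le
    have h3 := hf A.loc
    have h4 := h.2.2
    omega
  obtain ⟨π, hπ⟩ := exists_perm_lt V _ hV
  refine ⟨_, ⟨h.rename π, ?_⟩, π, rfl⟩
  have aux : ∀ (t : Term C) n, t.subst (renameBy π) = .var n → ∃ m, t = .var m ∧ π m = n := by
    intro t n ht
    cases t with
    | var m => exact ⟨m, rfl, by simpa [Term.subst, renameBy] using ht⟩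
    | const c => simp [Term.subst] at ht
  rintro n (hn | hn)
  · obtain ⟨m, hm, rfl⟩ := aux _ _ hn
    exact hπ m (by simp [V, hm, f])
  · obtain ⟨t, ht, e⟩ := List.mem_map.1 hn
    obtain ⟨m, rfl, rfl⟩ := aux _ _ e
    refine hπ m ?_
    simp only [V, Finset.mem_union, Finset.mem_biUnion, List.mem_toFinset]
    exact .inr ⟨_, ht, by simp [f]⟩

/-- Only finitely many atoms over a finite signature are pairwise no variants. -/
theorem Signature.exists_bound (Q : Signature S C) (hp : Q.preds.Finite)
    (hc : Q.consts.Finite) : ∃ N, ∀ l : List (Atom S C), (∀ A ∈ l, A.Over Q) →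
      l.Pairwise (fun A B => ¬ IsVariant A B) → l.length ≤ N := by
  classical
  have hfin := Q.canonical_finite hp hc
  refine ⟨hfin.toFinset.card, fun l h1 h2 => ?_⟩
  let f : Atom S C → Atom S C := fun A => if h : A.Over Q then h.exists_canonical.choose else A
  have hf : ∀ A, A.Over Q → f A ∈ Q.canonical ∧ IsVariant A (f A) := by
    intro A h
    simp only [f, dif_pos h]
    exact h.exists_canonical.choose_spec
  have hnd : (l.map f).Nodup := by
    rw [List.Nodup, List.pairwise_map]
    refine h2.imp_of_mem fun {A B} hA hB h e => h ?_
    have := (hf B (h1 B hB)).2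
    rw [← e] at this
    exact (hf A (h1 A hA)).2.trans this.symm
  rw [← List.length_map (f := f), ← List.toFinset_card_of_nodup hnd]
  refine Finset.card_le_card fun B hB => ?_
  simp only [List.mem_toFinset, List.mem_map] at hB
  obtain ⟨A, hA, rfl⟩ := hB
  exact hfin.mem_toFinset.2 (hf A (h1 A hA)).1

/-! ### New nodes -/

theorem exists_fresh_id (i : Identifier) (F : Set Identifier) (hF : F.Finite) :
    ∃ s : List Char, i ++ [s] ∉ F := by
  have hinj : Function.Injective fun s : List Char => i ++ [s] := by
    intro s t h; simpa using h
  exact ((Set.infinite_range_of_injective hinj).exists_notMem_finite hF).elim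
    fun x hx => by obtain ⟨⟨s, rfl⟩, h⟩ := hx; exact ⟨s, h⟩

theorem finite_ids (l : List (Node S C)) : {i | ∃ m ∈ l, m.id = i}.Finite :=
  (l.finite_toSet.image Node.id).subset fun _ ⟨m, hm, e⟩ => ⟨m, hm, e⟩

theorem exists_initialNodes (A : Atom S C) (i : Identifier) (cs : List (Clause S C)) :
    ∃ ns, InitialNodes A i cs ns := by
  induction cs with
  | nil => exact ⟨_, .nil⟩
  | cons c cs ih =>
    obtain ⟨ns, hns⟩ := ih
    by_cases hc : Applicable A c
    · obtain ⟨π, σ, hd, hσ⟩ := hc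
      obtain ⟨θ, hθ⟩ := exists_isMGU hσ
      obtain ⟨s, hs⟩ := exists_fresh_id i _ (finite_ids ns)
      exact ⟨_, .add rfl hd hθ (fun n hn e => hs ⟨n, hn, e⟩) hns⟩
    · exact ⟨_, .skip hc hns⟩

theorem exists_answerNodes (H B : Atom S C) (Bs : List (Atom S C)) (k : ℕ) (i : Identifier)
    {used : Set Identifier} (hu : used.Finite) (As : List (Atom S C)) :
    ∃ ns, AnswerNodes H B Bs k i used As ns := by
  induction As with
  | nil => exact ⟨_, .nil⟩
  | cons A As ih =>
    obtain ⟨ns, hns⟩ := ih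
    by_cases hc : Applicable B ⟨A, []⟩
    · obtain ⟨π, σ, hd, hσ⟩ := hc
      obtain ⟨θ, hθ⟩ := exists_isMGU hσ
      obtain ⟨s, hs⟩ := exists_fresh_id i _ ((finite_ids ns).union hu)
      refine ⟨_, .add rfl (hd.mono_right ?_) hθ (fun h => hs (.inr h))
        (fun n hn e => hs (.inl ⟨n, hn, e⟩)) hns⟩
      exact fun n hn => .inl hn
    · exact ⟨_, .skip hc hns⟩

end GEM

namespace GEM

variable {S C : Type*}

/-! ### Looking up tables -/

/-- The table with the given root identifier. -/
def look (ts : List (Table S C)) (k : Identifier) : Option (Table S C) :=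
  ts.find? fun t => decide (t.rootId = k)

theorem look_eq_some {ts : List (Table S C)} (hnd : (ts.map Table.rootId).Nodup)
    {k : Identifier} {t : Table S C} : look ts k = some t ↔ t ∈ ts ∧ t.rootId = k := by
  induction ts with
  | nil => simp [look]
  | cons u ts ih =>
    simp only [List.map_cons, List.nodup_cons] at hnd
    by_cases hu : u.rootId = k
    · have : look (u :: ts) k = some u := by simp [look, hu]
      rw [this, Option.some_inj]
      constructor
      · rintro rfl; exact ⟨List.mem_cons_self, hu⟩
      · rintro ⟨h1, h2⟩
        rcases List.mem_cons.1 h1 with rfl | h1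
        · rfl
        · exact absurd (List.mem_map.2 ⟨t, h1, h2.trans hu.symm⟩) hnd.1
    · have : look (u :: ts) k = look ts k := by simp [look, hu]
      rw [this, ih hnd.2]
      constructor
      · rintro ⟨h1, h2⟩; exact ⟨List.mem_cons_of_mem _ h1, h2⟩
      · rintro ⟨h1, h2⟩
        rcases List.mem_cons.1 h1 with rfl | h1
        · exact absurd h2 hu
        · exact ⟨h1, h2⟩

theorem look_eq_none {ts : List (Table S C)} {k : Identifier} :
    look ts k = none ↔ ∀ t ∈ ts, t.rootId ≠ k := by
  simp [look]

theorem nodup_replace {l₁ l₂ : List (Table S C)} {t t' : Table S C} (ht : t'.rootId = t.rootId)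
    (h : ((l₁ ++ t :: l₂).map Table.rootId).Nodup) :
    ((l₁ ++ t' :: l₂).map Table.rootId).Nodup := by
  simpa [ht] using h

theorem look_replace {l₁ l₂ : List (Table S C)} {t t' : Table S C} (ht : t'.rootId = t.rootId)
    (h : ((l₁ ++ t :: l₂).map Table.rootId).Nodup) :
    look (l₁ ++ t' :: l₂) = Function.update (look (l₁ ++ t :: l₂)) t.rootId (some t') := by
  have h' := nodup_replace ht h
  funext k
  by_cases hk : k = t.rootId
  · subst hk
    rw [Function.update_self, look_eq_some h']
    exact ⟨by simp, ht⟩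
  · rw [Function.update_of_ne hk]
    ext u
    rw [look_eq_some h', look_eq_some h]
    have : ∀ v : Table S C, v.rootId = t.rootId → u.rootId = k → u ≠ v := by
      rintro v h1 h2 rfl; exact hk (h2.symm.trans h1)
    constructor
    · rintro ⟨h1, h2⟩
      have := this t' ht h2
      simp_all
    · rintro ⟨h1, h2⟩
      have := this t rfl h2
      simp_all

theorem nodup_append {ts : List (Table S C)} {t : Table S C}
    (h : (ts.map Table.rootId).Nodup) (ht : look ts t.rootId = none) :
    ((ts ++ [t]).map Table.rootId).Nodup := by
  rw [look_eq_none] at ht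
  rw [List.map_append, List.nodup_append]
  refine ⟨h, by simp, ?_⟩
  rintro x hx y hy rfl
  obtain ⟨u, hu, rfl⟩ := List.mem_map.1 hx
  simp at hy
  exact ht u hu hy

theorem look_append {ts : List (Table S C)} {t : Table S C}
    (h : (ts.map Table.rootId).Nodup) (ht : look ts t.rootId = none) :
    look (ts ++ [t]) = Function.update (look ts) t.rootId (some t) := by
  have h' := nodup_append h ht
  funext k
  by_cases hk : k = t.rootId
  · subst hk
    rw [Function.update_self, look_eq_some h']
    exact ⟨by simp, rfl⟩
  · rw [Function.update_of_ne hk]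
    ext u
    rw [look_eq_some h', look_eq_some h]
    constructor
    · rintro ⟨h1, h2⟩
      have : u ≠ t := by rintro rfl; exact hk h2.symm
      simp_all
    · rintro ⟨h1, h2⟩
      simp_all

/-! ### The effect of the procedures on a table -/

/-- The identifier of the request to which a message belongs. -/
def Message.id : Message S C → Identifier
  | .request _ r => r.id
  | .response _ r => r.id

open scoped Classical in
/-- The answers of a table that have not been sent to the request `k`. -/
noncomputable def Table.unsent (t : Table S C) (k : Identifier) : List (Atom S C) :=
  (t.ansSet.filter fun p => k ∉ p.2).map Prod.fst

/-- Record that all answers have been sent to the requests in `J`. -/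
def Table.mark (t : Table S C) (J : Set Identifier) : Table S C :=
  { t with ansSet := t.ansSet.map fun p => (p.1, p.2 ∪ J) }

/-- The response of the table `t` to the request `r`. -/
noncomputable def Table.answerTo (t : Table S C) (st : ResponseStatus) (loops : Set Identifier)
    (r : Request S C) : Message S C :=
  .response r.requester ⟨r.id, t.unsent r.id, st, loops⟩

theorem Table.sendResponse_eq (t : Table S C) (r : Request S C) (st : ResponseStatus)
    (loops : Set Identifier) :
    t.sendResponse r st loops = (t.mark {r.id}, t.answerTo st loops r) := by
  simp only [sendResponse, mark, answerTo, unsent, Set.union_singleton]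

theorem Table.mark_mark (t : Table S C) (J K : Set Identifier) :
    (t.mark J).mark K = t.mark (J ∪ K) := by
  simp [mark, Set.union_assoc]

theorem Table.mark_empty (t : Table S C) : t.mark ∅ = t := by
  simp [mark]

theorem Table.unsent_mark (t : Table S C) {J : Set Identifier} {k : Identifier} (h : k ∉ J) :
    (t.mark J).unsent k = t.unsent k := by
  classical
  simp [mark, unsent, List.filter_map, h, Function.comp_def]

theorem Table.sendResponses_fst (t : Table S C) (rs : List (Request S C)) (st : ResponseStatus)
    (loops : Set Identifier) :
    (t.sendResponses rs st loops).1 = t.mark {j | ∃ r ∈ rs, r.id = j} := by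
  induction rs generalizing t with
  | nil => simp [sendResponses, mark_empty, Set.ofPred_false]
  | cons r rs ih =>
    simp only [sendResponses, ih, sendResponse_eq, mark_mark]
    congr 1
    ext j
    simp [eq_comm]

theorem Table.sendResponses_snd (t : Table S C) (rs : List (Request S C)) (st : ResponseStatus)
    (loops : Set Identifier) (h : (rs.map Request.id).Nodup) :
    (t.sendResponses rs st loops).2 = rs.map (t.answerTo st loops) := by
  induction rs generalizing t with
  | nil => rfl
  | cons r rs ih =>
    simp only [List.map_cons, List.nodup_cons] at h
    simp only [sendResponses, sendResponse_eq, List.map_cons, ih _ h.2, List.cons.injEq, true_and]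
    refine List.map_congr_left fun r' hr' => ?_
    have : r'.id ∉ ({r.id} : Set Identifier) := by
      rintro e; exact h.1 (List.mem_map.2 ⟨r', hr', e⟩)
    simp only [answerTo, unsent_mark _ this]

/-- The requests that a table serves. -/
def Table.clients (t : Table S C) : List (Request S C) := t.hr.toList ++ t.lr

open scoped Classical in
/-- The node after termination of its goal. -/
noncomputable def Node.finish (n : Node S C) : Node S C :=
  if n.status = .answer then n else { n with status := .disposed }

theorem Table.terminate_fst (t : Table S C) : t.terminate.1 =
    { t.mark {j | ∃ r ∈ t.clients, r.id = j} with
      rootStatus := .disposed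
      nodes := t.nodes.map Node.finish
      hr := none
      lr := []
      activeGoals := fun _ => none } := by
  simp only [terminate, sendResponses_fst]
  rfl

theorem Table.terminate_snd (t : Table S C) (h : (t.clients.map Request.id).Nodup) :
    t.terminate.2 = t.clients.map (t.answerTo .disposed ∅) := by
  exact sendResponses_snd _ t.clients _ _ h

theorem Table.startIteration_fst (t : Table S C) : t.startIteration.1 =
    { t.mark {j | ∃ r ∈ t.lr, r.id = j} with
      activeGoals := Function.update t.activeGoals t.rootId (some (t.loopCount t.rootId))
      rootStatus := t.rootStatus.addLoop t.rootId } := by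
  simp only [startIteration, sendResponses_fst]
  rfl

theorem Table.startIteration_snd (t : Table S C) (h : (t.lr.map Request.id).Nodup) :
    t.startIteration.2 = t.lr.map (t.answerTo (.loop t.rootId) ∅) := by
  simp only [startIteration]
  rw [sendResponses_snd _ _ _ _ h]
  rfl

open scoped Classical in
theorem Table.reply_fst (t : Table S C) (r : Request S C) (st : ResponseStatus) :
    (t.reply r st).1 = { t.mark {r.id} with
      activeGoals := fun i => if i ∈ t.higherLoops then some (t.loopCount i) else t.activeGoals i
      rootStatus := .active } := by
  simp only [reply, sendResponse_eq]
  rfl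

theorem Table.reply_snd (t : Table S C) (r : Request S C) (st : ResponseStatus) :
    (t.reply r st).2 = t.answerTo st t.higherLoops r := by
  simp only [reply, sendResponse_eq]
  rfl

theorem insertSubnodes_perm {i : Identifier} (ns : List (Node S C)) {l : List (Node S C)}
    (h : ∃ n ∈ l, n.id = i) : (insertSubnodes i ns l).Perm (l ++ ns) := by
  induction l with
  | nil => simp at h
  | cons n l ih =>
    unfold insertSubnodes
    split_ifs with hn
    · rw [List.cons_append]
      refine List.Perm.cons _ ?_
      conv_rhs => rw [← List.takeWhile_append_dropWhile (p := fun m => decide (n.depth < m.depth))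
        (l := l)]
      rw [List.append_assoc, List.append_assoc]
      exact List.Perm.append_left _ List.perm_append_comm
    · rw [List.cons_append]
      refine List.Perm.cons _ (ih ?_)
      obtain ⟨m, hm, e⟩ := h
      rcases List.mem_cons.1 hm with rfl | hm
      · exact absurd e hn
      · exact ⟨m, hm, e⟩

end GEM

namespace GEM

variable {S C : Type*}

/-! ### Evolution of a table -/

/-- The table `t'` is a later version of `t`. -/
structure Table.Evolves (t t' : Table S C) : Prop where
  owner : t'.owner = t.owner
  goal : t'.goal = t.goal
  rootId : t'.rootId = t.rootId
  node : ∀ n ∈ t.nodes, ∃ n' ∈ t'.nodes, n'.id = n.id ∧ n'.body = n.body ∧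
    (n'.status = .new → n.status = .new)
  form : (∀ n ∈ t.nodes, ∃ x, n.id = t.rootId ++ [x]) → ∀ n ∈ t'.nodes, ∃ x, n.id = t.rootId ++ [x]
  nodup : (t.nodes.map Node.id).Nodup → (t'.nodes.map Node.id).Nodup
  hr : t'.rootStatus ≠ .disposed → t'.hr = t.hr ∧ t.rootStatus ≠ .disposed

theorem Table.Evolves.trans {t u v : Table S C} (h : t.Evolves u) (h' : u.Evolves v) :
    t.Evolves v where
  owner := h'.owner.trans h.owner
  goal := h'.goal.trans h.goal
  rootId := h'.rootId.trans h.rootId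
  node n hn := by
    obtain ⟨n', hn', h1, h2, h3⟩ := h.node n hn
    obtain ⟨n'', hn'', h4, h5, h6⟩ := h'.node n' hn'
    exact ⟨n'', hn'', h4.trans h1, h5.trans h2, fun e => h3 (h6 e)⟩
  form hf := by
    have := h'.form
    rw [h.rootId] at this
    exact this (h.form hf)
  nodup hn := h'.nodup (h.nodup hn)
  hr hd := by
    obtain ⟨h1, h2⟩ := h'.hr hd
    obtain ⟨h3, h4⟩ := h.hr h2
    exact ⟨h1.trans h3, h4⟩

/-- Changes that affect only the statuses of the nodes. -/
theorem Table.Evolves.of_map {t t' : Table S C} (f : Node S C → Node S C)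
    (hf : ∀ n, (f n).id = n.id ∧ (f n).body = n.body ∧ ((f n).status = .new → n.status = .new))
    (ho : t'.owner = t.owner) (hg : t'.goal = t.goal) (hi : t'.rootId = t.rootId)
    (hn : t'.nodes = t.nodes.map f)
    (hr : t'.rootStatus ≠ .disposed → t'.hr = t.hr ∧ t.rootStatus ≠ .disposed) :
    t.Evolves t' where
  owner := ho
  goal := hg
  rootId := hi
  node n hm := ⟨f n, hn ▸ List.mem_map_of_mem hm, (hf n).1, (hf n).2.1, (hf n).2.2⟩
  form h n hm := by
    rw [hn] at hm
    obtain ⟨m, hm', rfl⟩ := List.mem_map.1 hm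
    rw [(hf m).1]; exact h m hm'
  nodup h := by
    have : Node.id ∘ f = Node.id := funext fun n => (hf n).1
    rwa [hn, List.map_map, this]
  hr := hr

theorem Table.Evolves.of_nodes_eq {t t' : Table S C}
    (ho : t'.owner = t.owner) (hg : t'.goal = t.goal) (hi : t'.rootId = t.rootId)
    (hn : t'.nodes = t.nodes)
    (hr : t'.rootStatus ≠ .disposed → t'.hr = t.hr ∧ t.rootStatus ≠ .disposed) :
    t.Evolves t' :=
  .of_map id (fun _ => ⟨rfl, rfl, fun h => h⟩) ho hg hi (by simpa using hn) hr

theorem Table.addAnswer_evolves (t : Table S C) (A : Atom S C) : t.Evolves (t.addAnswer A) := by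
  unfold addAnswer
  split_ifs <;> exact .of_nodes_eq rfl rfl rfl rfl fun h => ⟨rfl, h⟩

theorem Table.Selects.activate_evolves {t : Table S C} {pre post : List (Node S C)}
    {n : Node S C} (hs : t.Selects pre n post) {st : NodeStatus} (hst : st ≠ .new) :
    t.Evolves (t.activate pre n post st) where
  owner := rfl
  goal := rfl
  rootId := rfl
  node m hm := by
    rw [hs.1] at hm
    rcases List.mem_append.1 hm with hm | hm
    · exact ⟨m, List.mem_append_left _ hm, rfl, rfl, id⟩
    · rcases List.mem_cons.1 hm with rfl | hm
      · exact ⟨{ m with status := st }, by simp [activate], rfl, rfl, fun h => absurd h hst⟩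
      · exact ⟨m, List.mem_append_right _ (List.mem_cons_of_mem _ hm), rfl, rfl, id⟩
  form h m hm := by
    simp only [activate, List.mem_append, List.mem_cons] at hm
    rcases hm with hm | rfl | hm
    · exact h m (by simp [hs.1, hm])
    · exact h n (by simp [hs.1])
    · exact h m (by simp [hs.1, hm])
  nodup h := by
    simpa [activate, hs.1] using h
  hr h := by
    refine ⟨rfl, fun e => h ?_⟩
    simp [activate, e]

theorem Node.finish_spec (n : Node S C) : n.finish.id = n.id ∧ n.finish.body = n.body ∧
    (n.finish.status = .new → n.status = .new) := by
  unfold finish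
  split_ifs <;> simp

/-- The effect of Generate Response on the parts of the table that do not depend on loops. -/
theorem GenerateResponse.spec {t t' : Table S C} {ms : List (Message S C)}
    (h : GenerateResponse t t' ms) (hc : (t.clients.map Request.id).Nodup)
    (hd : t.rootStatus ≠ .disposed) :
    t.Evolves t' ∧ (t'.lr = t.lr ∨ t'.lr = []) ∧
    (∃ J, (∀ j ∈ J, ∃ r ∈ t.clients, r.id = j) ∧ t'.ansSet = (t.mark J).ansSet) ∧
    ∃ rs st loops, List.Sublist rs t.clients ∧ ms = rs.map (t.answerTo st loops) := by
  have hterm : t.Evolves t.terminate.1 ∧ (t.terminate.1.lr = t.lr ∨ t.terminate.1.lr = []) ∧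
      (∃ J, (∀ j ∈ J, ∃ r ∈ t.clients, r.id = j) ∧
        t.terminate.1.ansSet = (t.mark J).ansSet) ∧
      ∃ rs st loops, List.Sublist rs t.clients ∧ t.terminate.2 = rs.map (t.answerTo st loops) := by
    rw [t.terminate_fst, t.terminate_snd hc]
    exact ⟨.of_map _ Node.finish_spec rfl rfl rfl rfl fun h => absurd rfl h, .inr rfl,
      ⟨_, fun j hj => hj, rfl⟩, _, _, _, List.Sublist.refl _, rfl⟩
  have hreply : ∀ r st, t.hr = some r → t.Evolves (t.reply r st).1 ∧
      ((t.reply r st).1.lr = t.lr ∨ (t.reply r st).1.lr = []) ∧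
      (∃ J, (∀ j ∈ J, ∃ r ∈ t.clients, r.id = j) ∧
        (t.reply r st).1.ansSet = (t.mark J).ansSet) ∧
      ∃ rs st' loops, List.Sublist rs t.clients ∧
        [(t.reply r st).2] = rs.map (t.answerTo st' loops) := by
    intro r st hr
    rw [t.reply_fst, t.reply_snd]
    have hs : List.Sublist [r] t.clients := by
      simp [Table.clients, hr]
    refine ⟨.of_nodes_eq rfl rfl rfl rfl fun _ => ⟨rfl, hd⟩, .inl rfl,
      ⟨{r.id}, fun j hj => ⟨r, hs.subset (List.mem_singleton.2 rfl),
        (Set.mem_singleton_iff.1 hj).symm⟩, rfl⟩, [r], _, _, hs, rfl⟩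
  cases h with
  | noLoop => exact hterm
  | leader => exact hterm
  | iterate =>
    rw [t.startIteration_fst, t.startIteration_snd]
    · exact ⟨.of_nodes_eq rfl rfl rfl rfl fun _ => ⟨rfl, hd⟩, .inl rfl,
        ⟨{j | ∃ r ∈ t.lr, r.id = j}, fun j ⟨r, hr, e⟩ => ⟨r, List.mem_append_right _ hr, e⟩, rfl⟩, _, _, _,
        List.sublist_append_right _ _, rfl⟩
    · exact List.Nodup.sublist ((List.sublist_append_right _ _).map _) hc
  | replyLoop _ _ _ r hr => exact hreply r _ hr
  | replyActive _ _ _ r hr => exact hreply r _ hr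

theorem NodeStatus.addLoops_ne_new {loops : Set Identifier} {st : NodeStatus}
    (h : st.addLoops loops = .new) : st = .new := by
  unfold addLoops at h
  split at h
  · cases h
  · split_ifs at h; exact h

theorem Table.noteLoops_nodes (t : Table S C) (i : Identifier) (loops : Set Identifier) :
    ∃ f : Node S C → Node S C, (t.noteLoops i loops).nodes = t.nodes.map f ∧
      ∀ n, (f n).id = n.id ∧ (f n).body = n.body ∧ ((f n).status = .new → n.status = .new) := by
  refine ⟨_, rfl, fun n => ?_⟩
  split_ifs
  · exact ⟨rfl, rfl, NodeStatus.addLoops_ne_new⟩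
  · exact ⟨rfl, rfl, id⟩

theorem Table.noteResponse_nodes (t : Table S C) (r : Response S C) :
    ∃ f : Node S C → Node S C, (t.noteResponse r).nodes = t.nodes.map f ∧
      ∀ n, (f n).id = n.id ∧ (f n).body = n.body ∧ ((f n).status = .new → n.status = .new) := by
  unfold noteResponse
  split
  · refine ⟨_, rfl, fun n => ?_⟩
    split_ifs
    · exact ⟨rfl, rfl, fun h => by cases h⟩
    · exact ⟨rfl, rfl, id⟩
  · exact noteLoops_nodes _ _ _
  · obtain ⟨f, h1, h2⟩ := noteLoops_nodes t r.id r.loops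
    exact ⟨f, h1, h2⟩

theorem Table.noteResponse_fields (t : Table S C) (r : Response S C) :
    (t.noteResponse r).owner = t.owner ∧ (t.noteResponse r).goal = t.goal ∧
    (t.noteResponse r).rootId = t.rootId ∧ (t.noteResponse r).hr = t.hr ∧
    (t.noteResponse r).lr = t.lr ∧ (t.noteResponse r).ansSet = t.ansSet ∧
    ((t.noteResponse r).rootStatus ≠ .disposed → t.rootStatus ≠ .disposed) := by
  unfold noteResponse
  split
  · exact ⟨rfl, rfl, rfl, rfl, rfl, rfl, id⟩
  · exact ⟨rfl, rfl, rfl, rfl, rfl, rfl, id⟩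
  · refine ⟨rfl, rfl, rfl, rfl, rfl, rfl, fun h e => h ?_⟩
    simp [noteLoopResponse, noteLoops, e]

theorem AnswerNodes.spec {H B : Atom S C} {Bs : List (Atom S C)} {k : ℕ} {i : Identifier}
    {used : Set Identifier} {As : List (Atom S C)} {ns : List (Node S C)}
    (h : AnswerNodes H B Bs k i used As ns) :
    ns.length ≤ As.length ∧ (ns.map Node.id).Nodup ∧ ∀ n ∈ ns, n.id ∉ used ∧
      (∃ x, n.id = i ++ [x]) ∧ n.status = .new ∧ n.body.length = Bs.length := by
  induction h with
  | nil => simp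
  | skip _ _ ih => exact ⟨ih.1.trans (by simp), ih.2⟩
  | add _ _ _ hu hs _ ih =>
    refine ⟨by simpa using ih.1, ?_, ?_⟩
    · rw [List.map_cons, List.nodup_cons]
      refine ⟨fun hm => ?_, ih.2.1⟩
      obtain ⟨n, hn, e⟩ := List.mem_map.1 hm
      exact hs n hn e
    · intro n hn
      rcases List.mem_cons.1 hn with rfl | hn
      · exact ⟨hu, ⟨_, rfl⟩, rfl, by simp⟩
      · exact ih.2.2 n hn

theorem InitialNodes.spec {A : Atom S C} {i : Identifier} {cs : List (Clause S C)}
    {ns : List (Node S C)} (h : InitialNodes A i cs ns) :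
    ns.length ≤ cs.length ∧ (ns.map Node.id).Nodup ∧ ∀ n ∈ ns,
      (∃ x, n.id = i ++ [x]) ∧ n.status = .new ∧ ∃ c ∈ cs, n.body.length = c.body.length := by
  induction h with
  | nil => simp
  | skip _ _ ih =>
    refine ⟨ih.1.trans (by simp), ih.2.1, fun n hn => ?_⟩
    obtain ⟨h1, h2, c, hc, e⟩ := ih.2.2 n hn
    exact ⟨h1, h2, c, List.mem_cons_of_mem _ hc, e⟩
  | add hc _ _ hs _ ih =>
    refine ⟨by simpa using ih.1, ?_, ?_⟩
    · rw [List.map_cons, List.nodup_cons]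
      refine ⟨fun hm => ?_, ih.2.1⟩
      obtain ⟨n, hn, e⟩ := List.mem_map.1 hm
      exact hs n hn e
    · intro n hn
      rcases List.mem_cons.1 hn with rfl | hn
      · exact ⟨⟨_, rfl⟩, rfl, _, List.mem_cons_self, by simp [hc, Clause.subst]⟩
      · obtain ⟨h1, h2, c, hc, e⟩ := ih.2.2 n hn
        exact ⟨h1, h2, c, List.mem_cons_of_mem _ hc, e⟩

/-- The table after recording the response `r` and adding the subnodes `ns`. -/
noncomputable def Table.receive (t : Table S C) (r : Response S C) (ns : List (Node S C)) : Table S C :=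
  { t.noteResponse r with nodes := insertSubnodes r.id ns (t.noteResponse r).nodes }

theorem Table.receive_perm {t : Table S C} {r : Response S C} (ns : List (Node S C))
    (h : ∃ n ∈ t.nodes, n.id = r.id) :
    (t.receive r ns).nodes.Perm ((t.noteResponse r).nodes ++ ns) := by
  refine insertSubnodes_perm ns ?_
  obtain ⟨f, h1, h2⟩ := t.noteResponse_nodes r
  obtain ⟨n, hn, e⟩ := h
  exact ⟨f n, h1 ▸ List.mem_map_of_mem hn, (h2 n).1.trans e⟩

theorem Table.receive_evolves {t : Table S C} {r : Response S C} {ns : List (Node S C)}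
    {H B : Atom S C} {Bs : List (Atom S C)} {k : ℕ} (h : ∃ n ∈ t.nodes, n.id = r.id)
    (hns : AnswerNodes H B Bs k t.rootId {i | ∃ m ∈ t.nodes, m.id = i} r.ans ns) :
    t.Evolves (t.receive r ns) := by
  have hp := receive_perm ns h
  obtain ⟨f, hf1, hf2⟩ := t.noteResponse_nodes r
  obtain ⟨h1, h2, h3, h4, h5, h6, h7⟩ := t.noteResponse_fields r
  refine ⟨h1, h2, h3, fun n hn => ?_, fun hf n hn => ?_, fun hnd => ?_, fun hd => ⟨h4, h7 hd⟩⟩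
  · refine ⟨f n, hp.symm.subset ?_, hf2 n⟩
    rw [hf1]; exact List.mem_append_left _ (List.mem_map_of_mem hn)
  · have := hp.subset hn
    rw [hf1] at this
    rcases List.mem_append.1 this with hn | hn
    · obtain ⟨m, hm, rfl⟩ := List.mem_map.1 hn
      rw [(hf2 m).1]; exact hf m hm
    · exact (hns.spec.2.2 n hn).2.1
  · rw [(hp.map Node.id).nodup_iff, hf1, List.map_append, List.map_map,
      show Node.id ∘ f = Node.id from funext fun n => (hf2 n).1, List.nodup_append]
    refine ⟨hnd, hns.spec.2.1, ?_⟩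
    rintro x hx y hy rfl
    obtain ⟨m, hm, rfl⟩ := List.mem_map.1 hx
    obtain ⟨n, hn, e⟩ := List.mem_map.1 hy
    exact (hns.spec.2.2 n hn).1 ⟨m, hm, e.symm⟩

/-! ### The structural invariant -/

/-- `c` is the principal that issues the request `k`: the initial one or one for a subgoal. -/
def Addr (i : Identifier) (a : C) (V : Identifier → Option (Table S C)) (k : Identifier)
    (c : C) : Prop :=
  (k = i ∧ c = a) ∨ ∃ u, V k.dropLast = some u ∧ u.owner = c ∧
    ∃ n ∈ u.nodes, n.id = k ∧ n.body ≠ [] ∧ n.status ≠ .new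

/-- The table serves the request `j`, or has sent answers to it. -/
def Table.Serves (t : Table S C) (j : Identifier) : Prop :=
  t.rootId = j ∨ (∃ r ∈ t.lr, r.id = j) ∨ ∃ p ∈ t.ansSet, j ∈ p.2

/-- The number of messages in transit for the request `k`. -/
def msgCount (tr : Multiset (Message S C)) (k : Identifier) : ℕ := (tr.map Message.id).count k

/-- Well-formedness of the tables, given by their root identifiers, and of the messages in
transit. -/
structure WellFormed (i : Identifier) (a : C) (V : Identifier → Option (Table S C))
    (tr : Multiset (Message S C)) : Prop where
  root : ∀ {k t}, V k = some t → t.rootId = k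
  pre : ∀ {k t}, V k = some t → i <+: k
  node : ∀ {k t n}, V k = some t → n ∈ t.nodes → ∃ x, n.id = k ++ [x]
  nodup : ∀ {k t}, V k = some t → (t.nodes.map Node.id).Nodup
  hr : ∀ {k t}, V k = some t → t.rootStatus ≠ .disposed →
    ∃ r, t.hr = some r ∧ r.id = k ∧ Addr i a V k r.requester
  lr : ∀ {k t r}, V k = some t → r ∈ t.lr → Addr i a V r.id r.requester ∧ Lower r.id k
  lrNodup : ∀ {k t}, V k = some t → (t.lr.map Request.id).Nodup
  serves : ∀ {k k' t t' j}, V k = some t → V k' = some t' → t.Serves j → t'.Serves j → k = k'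
  servesAddr : ∀ {k t j}, V k = some t → t.Serves j → ∃ c, Addr i a V j c
  req : ∀ {d r}, .request d r ∈ tr → Addr i a V r.id r.requester ∧ msgCount tr r.id = 1 ∧
    ∀ k t, V k = some t → ¬ t.Serves r.id
  resp : ∀ {d r}, .response d r ∈ tr → Addr i a V r.id d

theorem msgCount_cons (m : Message S C) (tr : Multiset (Message S C)) (k : Identifier) :
    msgCount (m ::ₘ tr) k = msgCount tr k + if k = m.id then 1 else 0 := by
  simp [msgCount, Multiset.count_cons]

theorem msgCount_add (tr tr' : Multiset (Message S C)) (k : Identifier) :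
    msgCount (tr + tr') k = msgCount tr k + msgCount tr' k := by
  simp [msgCount]

theorem msgCount_eq_zero {tr : Multiset (Message S C)} {k : Identifier} :
    msgCount tr k = 0 ↔ ∀ m ∈ tr, m.id ≠ k := by
  simp [msgCount, Multiset.count_eq_zero]

theorem Addr.mono {i : Identifier} {a : C} {V : Identifier → Option (Table S C)}
    {k₀ k : Identifier} {t t' : Table S C} {c : C} (h : Addr i a V k c) (ht : V k₀ = some t)
    (he : t.Evolves t') : Addr i a (Function.update V k₀ (some t')) k c := by
  rcases h with h | ⟨u, hu, ho, n, hn, h1, h2, h3⟩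
  · exact .inl h
  · right
    by_cases hk : k.dropLast = k₀
    · rw [hk] at hu ⊢
      obtain rfl : t = u := by simpa [ht] using hu
      obtain ⟨n', hn', e1, e2, e3⟩ := he.node n hn
      exact ⟨t', by simp, he.owner.trans ho, n', hn', e1.trans h1, by rwa [e2],
        fun e => h3 (e3 e)⟩
    · exact ⟨u, by rwa [Function.update_of_ne hk], ho, n, hn, h1, h2, h3⟩

theorem WellFormed.clients_nodup {i : Identifier} {a : C} {V : Identifier → Option (Table S C)}
    {tr : Multiset (Message S C)} (h : WellFormed i a V tr) {k : Identifier} {t : Table S C}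
    (ht : V k = some t) (hd : t.rootStatus ≠ .disposed) :
    (t.clients.map Request.id).Nodup := by
  obtain ⟨r, hr, e, -⟩ := h.hr ht hd
  simp only [Table.clients, hr, Option.toList_some, List.singleton_append, List.map_cons,
    List.nodup_cons]
  refine ⟨fun hm => ?_, h.lrNodup ht⟩
  obtain ⟨r', hr', e'⟩ := List.mem_map.1 hm
  exact (h.lr ht hr').2.2 ((e'.trans e).symm)

theorem WellFormed.update {i : Identifier} {a : C} {V : Identifier → Option (Table S C)}
    {tr tr' : Multiset (Message S C)} (h : WellFormed i a V tr) {k₀ : Identifier}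
    {t t' : Table S C} (ht : V k₀ = some t) (he : t.Evolves t')
    (hlr : ∀ r ∈ t'.lr, r ∈ t.lr ∨ Addr i a V r.id r.requester ∧ Lower r.id k₀)
    (hlrn : (t'.lr.map Request.id).Nodup)
    (hserves : ∀ j, t'.Serves j → t.Serves j ∨
      (∃ c, Addr i a V j c) ∧ (∀ k u, V k = some u → ¬ u.Serves j) ∧
      ∀ d r, .request d r ∈ tr' → r.id ≠ j)
    (hreq : ∀ d r, .request d r ∈ tr' → msgCount tr' r.id = 1 ∧ (.request d r ∈ tr ∨
      Addr i a (Function.update V k₀ (some t')) r.id r.requester ∧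
      ∀ k u, V k = some u → ¬ u.Serves r.id))
    (hresp : ∀ d r, .response d r ∈ tr' → .response d r ∈ tr ∨ Addr i a V r.id d) :
    WellFormed i a (Function.update V k₀ (some t')) tr' := by
  have hV : ∀ {k u}, Function.update V k₀ (some t') k = some u →
      (k = k₀ ∧ u = t') ∨ (k ≠ k₀ ∧ V k = some u) := by
    intro k u hu
    by_cases hk : k = k₀
    · subst hk; left; simpa [eq_comm] using hu
    · right; rw [Function.update_of_ne hk] at hu; exact ⟨hk, hu⟩
  have hroot := h.root ht
  constructor
  · intro k u hu
    rcases hV hu with ⟨rfl, rfl⟩ | ⟨hk, hu⟩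
    · exact he.rootId.trans hroot
    · exact h.root hu
  · intro k u hu
    rcases hV hu with ⟨rfl, rfl⟩ | ⟨hk, hu⟩
    · exact h.pre ht
    · exact h.pre hu
  · intro k u n hu hn
    rcases hV hu with ⟨rfl, rfl⟩ | ⟨hk, hu⟩
    · rw [← hroot]
      exact he.form (fun n hn => by rw [hroot]; exact h.node ht hn) n hn
    · exact h.node hu hn
  · intro k u hu
    rcases hV hu with ⟨rfl, rfl⟩ | ⟨hk, hu⟩
    · exact he.nodup (h.nodup ht)
    · exact h.nodup hu
  · intro k u hu hd
    rcases hV hu with ⟨rfl, rfl⟩ | ⟨hk, hu⟩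
    · obtain ⟨h1, h2⟩ := he.hr hd
      obtain ⟨r, hr, e, ha⟩ := h.hr ht h2
      exact ⟨r, h1.trans hr, e, ha.mono ht he⟩
    · obtain ⟨r, hr, e, ha⟩ := h.hr hu hd
      exact ⟨r, hr, e, ha.mono ht he⟩
  · intro k u r hu hr
    rcases hV hu with ⟨rfl, rfl⟩ | ⟨hk, hu⟩
    · have := (hlr r hr).elim (h.lr ht) id
      exact ⟨this.1.mono ht he, this.2⟩
    · exact ⟨(h.lr hu hr).1.mono ht he, (h.lr hu hr).2⟩
  · intro k u hu
    rcases hV hu with ⟨rfl, rfl⟩ | ⟨hk, hu⟩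
    · exact hlrn
    · exact h.lrNodup hu
  · intro k k' u u' j hu hu' hj hj'
    rcases hV hu with ⟨rfl, rfl⟩ | ⟨hk, hu⟩ <;> rcases hV hu' with ⟨rfl, rfl⟩ | ⟨hk', hu'⟩
    · rfl
    · rcases hserves j hj with hj | ⟨-, hj, -⟩
      · exact h.serves ht hu' hj hj'
      · exact absurd hj' (hj _ _ hu')
    · rcases hserves j hj' with hj' | ⟨-, hj', -⟩
      · exact h.serves ‹V k = some u› ht hj hj'
      · exact absurd hj (hj' _ _ ‹V k = some u›)
    · exact h.serves hu hu' hj hj'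
  · intro k u j hu hj
    rcases hV hu with ⟨rfl, rfl⟩ | ⟨hk, hu⟩
    · rcases hserves j hj with hj | ⟨⟨c, hc⟩, -, -⟩
      · obtain ⟨c, hc⟩ := h.servesAddr ht hj
        exact ⟨c, hc.mono ht he⟩
      · exact ⟨c, hc.mono ht he⟩
    · obtain ⟨c, hc⟩ := h.servesAddr hu hj
      exact ⟨c, hc.mono ht he⟩
  · intro d r hm
    obtain ⟨hc, hm'⟩ := hreq d r hm
    have : Addr i a (Function.update V k₀ (some t')) r.id r.requester ∧
        ∀ k u, V k = some u → ¬ u.Serves r.id := by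
      rcases hm' with hm' | hm'
      · exact ⟨(h.req hm').1.mono ht he, (h.req hm').2.2⟩
      · exact hm'
    refine ⟨this.1, hc, fun k u hu hs => ?_⟩
    rcases hV hu with ⟨rfl, rfl⟩ | ⟨hk, hu⟩
    · rcases hserves _ hs with hs | ⟨-, -, hs⟩
      · exact this.2 _ _ ht hs
      · exact hs d r hm rfl
    · exact this.2 _ _ hu hs
  · intro d r hm
    rcases hresp d r hm with hm | hm
    · exact (h.resp hm).mono ht he
    · exact hm.mono ht he

end GEM

namespace GEM

variable {S C : Type*}

/-! ### The structural invariant is preserved -/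

theorem node_id_inj {t : Table S C} (h : (t.nodes.map Node.id).Nodup) {m n : Node S C}
    (hm : m ∈ t.nodes) (hn : n ∈ t.nodes) (e : m.id = n.id) : m = n :=
  List.inj_on_of_nodup_map h hm hn e

theorem id_ne_of_prefix {i k : Identifier} {x : List Char} (h : i <+: k) : k ++ [x] ≠ i := by
  rintro rfl
  have := h.length_le
  simp at this

section

variable {i : Identifier} {a : C} {V : Identifier → Option (Table S C)}
  {tr : Multiset (Message S C)} {k : Identifier} {t : Table S C}

theorem WellFormed.msgAddr (h : WellFormed i a V tr) {m : Message S C} (hm : m ∈ tr) :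
    ∃ c, Addr i a V m.id c := by
  cases m with
  | request d r => exact ⟨_, (h.req hm).1⟩
  | response d r => exact ⟨_, h.resp hm⟩

/-- Which node an identifier with an addressee belongs to. -/
theorem WellFormed.addr_node (h : WellFormed i a V tr) (ht : V k = some t) {x : List Char} {c : C}
    (ha : Addr i a V (k ++ [x]) c) :
    t.owner = c ∧ ∃ n ∈ t.nodes, n.id = k ++ [x] ∧ n.body ≠ [] ∧ n.status ≠ .new := by
  rcases ha with ⟨e, -⟩ | ⟨u, hu, hc, n, hn⟩
  · exact absurd e (id_ne_of_prefix (h.pre ht))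
  · rw [List.dropLast_concat, ht, Option.some_inj] at hu
    subst hu
    exact ⟨hc, n, hn⟩

theorem WellFormed.addr_of_mem (h : WellFormed i a V tr) (ht : V k = some t) {n : Node S C}
    (hn : n ∈ t.nodes) {c : C} (ha : Addr i a V n.id c) :
    t.owner = c ∧ n.body ≠ [] ∧ n.status ≠ .new := by
  obtain ⟨x, hx⟩ := h.node ht hn
  rw [hx] at ha
  obtain ⟨hc, m, hm, e, h1, h2⟩ := h.addr_node ht ha
  obtain rfl := node_id_inj (h.nodup ht) hm hn (e.trans hx.symm)
  exact ⟨hc, h1, h2⟩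

theorem WellFormed.not_addr_of_new (h : WellFormed i a V tr) (ht : V k = some t) {n : Node S C}
    (hn : n ∈ t.nodes) (hs : n.status = .new) (c : C) : ¬ Addr i a V n.id c :=
  fun ha => (h.addr_of_mem ht hn ha).2.2 hs

theorem WellFormed.not_addr_of_fresh (h : WellFormed i a V tr) (ht : V k = some t) {x : List Char}
    (hn : ¬ ∃ n ∈ t.nodes, n.id = k ++ [x]) (c : C) : ¬ Addr i a V (k ++ [x]) c := fun ha => by
  obtain ⟨-, n, h1, h2, -⟩ := h.addr_node ht ha
  exact hn ⟨n, h1, h2⟩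

theorem WellFormed.msgCount_eq_zero (h : WellFormed i a V tr) {j : Identifier}
    (hj : ∀ c, ¬ Addr i a V j c) : msgCount tr j = 0 := by
  rw [GEM.msgCount_eq_zero]
  rintro m hm rfl
  obtain ⟨c, hc⟩ := h.msgAddr hm
  exact hj c hc

theorem WellFormed.not_serves (h : WellFormed i a V tr) {j : Identifier}
    (hj : ∀ c, ¬ Addr i a V j c) (k : Identifier) (t : Table S C) (ht : V k = some t) :
    ¬ t.Serves j := fun hs => by
  obtain ⟨c, hc⟩ := h.servesAddr ht hs
  exact hj c hc

/-- The table after a fact has been activated. -/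
noncomputable def Table.useFact (t : Table S C) (pre : List (Node S C)) (n : Node S C)
    (post : List (Node S C)) : Table S C :=
  (t.activate pre n post .answer).addAnswer n.head

theorem Table.useFact_ansSet {t : Table S C} {pre post : List (Node S C)} {n : Node S C}
    {p : Atom S C × Set Identifier} (h : p ∈ (t.useFact pre n post).ansSet) :
    p ∈ t.ansSet ∨ p = (n.head, ∅) := by
  unfold useFact addAnswer at h
  split_ifs at h
  · exact .inl h
  · simpa [activate] using h

theorem Table.useFact_fields (t : Table S C) (pre post : List (Node S C)) (n : Node S C) :
    (t.useFact pre n post).owner = t.owner ∧ (t.useFact pre n post).goal = t.goal ∧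
    (t.useFact pre n post).hr = t.hr ∧ (t.useFact pre n post).lr = t.lr ∧
    (t.useFact pre n post).rootId = t.rootId ∧
    (t.useFact pre n post).activeGoals = t.activeGoals ∧
    (t.useFact pre n post).rootStatus = (t.activate pre n post .answer).rootStatus ∧
    (t.useFact pre n post).nodes = pre ++ { n with status := .answer } :: post := by
  unfold useFact addAnswer
  split_ifs <;> exact ⟨rfl, rfl, rfl, rfl, rfl, rfl, rfl, rfl⟩

theorem Table.Selects.useFact_evolves {t : Table S C} {pre post : List (Node S C)} {n : Node S C}
    (hs : t.Selects pre n post) : t.Evolves (t.useFact pre n post) :=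
  (hs.activate_evolves (by simp)).trans (Table.addAnswer_evolves _ _)

theorem Table.useFact_serves {t : Table S C} {pre post : List (Node S C)} {n : Node S C}
    {j : Identifier} (h : (t.useFact pre n post).Serves j) : t.Serves j := by
  obtain ⟨-, -, -, h4, h5, -⟩ := t.useFact_fields pre post n
  unfold Serves at h
  rw [h4, h5] at h
  rcases h with h | h | ⟨p, hp, hj⟩
  · exact .inl h
  · exact .inr (.inl h)
  · rcases useFact_ansSet hp with hp | rfl
    · exact .inr (.inr ⟨p, hp, hj⟩)
    · simp at hj

theorem WellFormed.useFact (h : WellFormed i a V tr) (ht : V k = some t)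
    {pre post : List (Node S C)} {n : Node S C} (hs : t.Selects pre n post) :
    WellFormed i a (Function.update V k (some (t.useFact pre n post))) tr := by
  obtain ⟨-, -, -, h4, -⟩ := t.useFact_fields pre post n
  refine h.update ht hs.useFact_evolves ?_ ?_ ?_ ?_ ?_
  · rw [h4]; exact fun r hr => .inl hr
  · rw [h4]; exact h.lrNodup ht
  · exact fun j hj => .inl (Table.useFact_serves hj)
  · exact fun d r hm => ⟨(h.req hm).2.1, .inl hm⟩
  · exact fun d r hm => .inl hm

theorem Table.Selects.mem {t : Table S C} {pre post : List (Node S C)} {n : Node S C}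
    (hs : t.Selects pre n post) : n ∈ t.nodes := by simp [hs.1]

theorem WellFormed.sendRequest (h : WellFormed i a V tr) (ht : V k = some t)
    {pre post : List (Node S C)} {n : Node S C} (hs : t.Selects pre n post) {B : Atom S C}
    (hb : n.body ≠ []) (c : C) :
    WellFormed i a (Function.update V k (some (t.activate pre n post .active)))
      (.request c ⟨n.id, t.owner, B⟩ ::ₘ tr) := by
  have hna := h.not_addr_of_new ht hs.mem hs.2.1
  refine h.update (t' := t.activate pre n post .active) ht (hs.activate_evolves (by simp)) (fun r hr => .inl hr)
    (show (t.lr.map Request.id).Nodup from h.lrNodup ht) (fun j hj => .inl hj) ?_ ?_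
  · intro d r hm
    rw [msgCount_cons]
    rcases Multiset.mem_cons.1 hm with hm | hm
    · cases hm
      refine ⟨by simp [h.msgCount_eq_zero hna, Message.id], .inr ⟨.inr ?_, h.not_serves hna⟩⟩
      obtain ⟨x, hx⟩ := h.node ht hs.mem
      exact ⟨t.activate pre n post .active,
        by rw [hx, List.dropLast_concat, Function.update_self], rfl,
        { n with status := .active }, by simp [Table.activate], rfl, hb, by simp⟩
    · have hne : r.id ≠ n.id := by
        intro e
        have := (h.req hm).1
        rw [e] at this
        exact hna _ this
      exact ⟨by simp [(h.req hm).2.1, Message.id, hne], .inl hm⟩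
  · intro d r hm
    rcases Multiset.mem_cons.1 hm with hm | hm
    · cases hm
    · exact .inl hm

theorem WellFormed.clients (h : WellFormed i a V tr) (ht : V k = some t)
    (hd : t.rootStatus ≠ .disposed) {r : Request S C} (hr : r ∈ t.clients) :
    Addr i a V r.id r.requester ∧ t.Serves r.id := by
  rcases List.mem_append.1 hr with hr | hr
  · obtain ⟨r', hr', e, ha⟩ := h.hr ht hd
    rw [hr', Option.mem_toList] at hr
    cases hr
    exact ⟨by rwa [e], .inl ((h.root ht).trans e.symm)⟩
  · exact ⟨(h.lr ht hr).1, .inr (.inl ⟨r, hr, rfl⟩)⟩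

/-- A table sends responses to requests that it serves. -/
theorem WellFormed.respond (h : WellFormed i a V tr) (ht : V k = some t)
    (hd : t.rootStatus ≠ .disposed) {t' : Table S C} {ms : List (Message S C)}
    (hg : GenerateResponse t t' ms) :
    WellFormed i a (Function.update V k (some t')) (tr + ms) := by
  obtain ⟨he, hlr, ⟨J, hJ, hans⟩, rs, st, loops, hrs, rfl⟩ :=
    hg.spec (h.clients_nodup ht hd) hd
  have hser : ∀ j, t'.Serves j → t.Serves j := by
    rintro j (hj | ⟨r, hr, hj⟩ | ⟨p, hp, hj⟩)
    · exact .inl (he.rootId.symm.trans hj)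
    · rcases hlr with hlr | hlr
      · exact .inr (.inl ⟨r, hlr ▸ hr, hj⟩)
      · simp [hlr] at hr
    · rw [hans] at hp
      obtain ⟨q, hq, rfl⟩ := List.mem_map.1 hp
      rcases hj with hj | hj
      · exact .inr (.inr ⟨q, hq, hj⟩)
      · obtain ⟨r, hr, rfl⟩ := hJ j hj
        exact (h.clients ht hd hr).2
  refine h.update ht he ?_ ?_ (fun j hj => .inl (hser j hj)) ?_ ?_
  · intro r hr
    rcases hlr with hlr | hlr
    · exact .inl (hlr ▸ hr)
    · simp [hlr] at hr
  · rcases hlr with hlr | hlr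
    · rw [hlr]; exact h.lrNodup ht
    · simp [hlr]
  · intro d r hm
    rw [Multiset.mem_add] at hm
    rcases hm with hm | hm
    · refine ⟨?_, .inl hm⟩
      rw [msgCount_add, (h.req hm).2.1, GEM.msgCount_eq_zero.2, add_zero]
      intro m hm' e
      obtain ⟨r', hr', rfl⟩ := List.mem_map.1 (Multiset.mem_coe.1 hm')
      have := (h.clients ht hd (hrs.subset hr')).2
      rw [show r'.id = r.id from e] at this
      exact (h.req hm).2.2 _ _ ht this
    · obtain ⟨r', hr', e⟩ := List.mem_map.1 (Multiset.mem_coe.1 hm)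
      cases e
  · intro d r hm
    rw [Multiset.mem_add] at hm
    rcases hm with hm | hm
    · exact .inl hm
    · obtain ⟨r', hr', e⟩ := List.mem_map.1 (Multiset.mem_coe.1 hm)
      cases e
      exact .inr (h.clients ht hd (hrs.subset hr')).1

theorem WellFormed.dropMsg {m : Message S C} (h : WellFormed i a V (m ::ₘ tr)) :
    WellFormed i a V tr := by
  refine ⟨h.root, h.pre, h.node, h.nodup, h.hr, h.lr, h.lrNodup, h.serves, h.servesAddr,
    fun {d r} hm => ?_, fun hm => h.resp (Multiset.mem_cons_of_mem hm)⟩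
  obtain ⟨h1, h2, h3⟩ := h.req (Multiset.mem_cons_of_mem hm)
  refine ⟨h1, ?_, h3⟩
  have h0 : 0 < msgCount tr r.id := by
    rw [Nat.pos_iff_ne_zero, Ne, GEM.msgCount_eq_zero]
    exact fun h => h _ hm rfl
  rw [msgCount_cons] at h2
  omega

theorem Table.receive_serves {t : Table S C} {r : Response S C} {ns : List (Node S C)}
    {j : Identifier} : (t.receive r ns).Serves j ↔ t.Serves j := by
  obtain ⟨h1, h2, h3, h4, h5, h6, h7⟩ := t.noteResponse_fields r
  simp only [Serves, receive, h3, h5, h6]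

theorem WellFormed.receive {r : Response S C} {d : C} (h : WellFormed i a V (.response d r ::ₘ tr))
    (ht : V k = some t) (hn : ∃ n ∈ t.nodes, n.id = r.id) {ns : List (Node S C)}
    {H B : Atom S C} {Bs : List (Atom S C)} {l : ℕ}
    (hns : AnswerNodes H B Bs l t.rootId {i | ∃ m ∈ t.nodes, m.id = i} r.ans ns) :
    WellFormed i a (Function.update V k (some (t.receive r ns))) tr := by
  have h' := h.dropMsg
  obtain ⟨h1, h2, h3, h4, h5, h6, h7⟩ := t.noteResponse_fields r
  refine h'.update ht (Table.receive_evolves hn hns) ?_ ?_ ?_ ?_ ?_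
  · exact fun r' hr' => .inl (h5 ▸ hr')
  · rw [show (t.receive r ns).lr = t.lr from h5]; exact h'.lrNodup ht
  · exact fun j hj => .inl (Table.receive_serves.1 hj)
  · exact fun d r hm => ⟨(h'.req hm).2.1, .inl hm⟩
  · exact fun d r hm => .inl hm

/-- The response to a request that is not served by a new table. -/
theorem WellFormed.answerRequest {d : C} {r : Request S C}
    (h : WellFormed i a V (.request d r ::ₘ tr)) (ht : V k = some t) {G : Atom S C}
    {t₀ : Table S C} (ht₀ : t₀ = t ∨ Lower r.id k ∧ t₀ = { t with lr := t.lr ++ [⟨r.id, r.requester, G⟩] })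
    {st : ResponseStatus} {loops : Set Identifier} :
    WellFormed i a (Function.update V k (some (t₀.mark {r.id})))
      (t.answerTo st loops ⟨r.id, r.requester, G⟩ ::ₘ tr) := by
  have h' := h.dropMsg
  obtain ⟨hr1, hr2, hr3⟩ := h.req (Multiset.mem_cons_self _ _)
  have hr2' : msgCount tr r.id = 0 := by
    rw [msgCount_cons] at hr2
    simpa [Message.id] using hr2
  have hev : t.Evolves (t₀.mark {r.id}) := by
    rcases ht₀ with rfl | ⟨-, rfl⟩ <;> exact .of_nodes_eq rfl rfl rfl rfl fun h => ⟨rfl, h⟩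
  refine h'.update ht hev ?_ ?_ ?_ ?_ ?_
  · rcases ht₀ with rfl | ⟨hl, rfl⟩
    · exact fun r hr => .inl hr
    · intro r' hr'
      rcases List.mem_append.1 hr' with hr' | hr'
      · exact .inl hr'
      · obtain rfl := List.mem_singleton.1 hr'
        exact .inr ⟨hr1, hl⟩
  · rcases ht₀ with rfl | ⟨hl, rfl⟩
    · exact (show (t₀.lr.map Request.id).Nodup from h.lrNodup ht)
    · simp only [Table.mark, List.map_append, List.map_cons, List.map_nil]
      rw [List.nodup_append]
      refine ⟨h.lrNodup ht, by simp, ?_⟩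
      rintro x hx y hy rfl
      obtain ⟨r', hr', rfl⟩ := List.mem_map.1 hx
      exact hr3 _ _ ht (.inr (.inl ⟨r', hr', by simpa using hy⟩))
  · intro j hj
    by_cases hjr : j = r.id
    · subst hjr
      refine .inr ⟨⟨_, hr1⟩, hr3, fun d' r' hm e => ?_⟩
      rcases Multiset.mem_cons.1 hm with hm | hm
      · cases hm
      · exact GEM.msgCount_eq_zero.1 hr2' _ hm e
    · left
      have : t₀.rootId = t.rootId ∧ t₀.ansSet = t.ansSet ∧
          ∀ r' ∈ t₀.lr, r'.id = j → r' ∈ t.lr := by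
        rcases ht₀ with rfl | ⟨-, rfl⟩
        · exact ⟨rfl, rfl, fun _ h _ => h⟩
        · refine ⟨rfl, rfl, fun r' hr' e => ?_⟩
          rcases List.mem_append.1 hr' with hr' | hr'
          · exact hr'
          · obtain rfl := List.mem_singleton.1 hr'
            exact absurd e.symm hjr
      rcases hj with hj | ⟨r', hr', hj⟩ | ⟨p, hp, hj⟩
      · exact .inl (this.1.symm.trans hj)
      · exact .inr (.inl ⟨r', this.2.2 r' hr' hj, hj⟩)
      · obtain ⟨q, hq, rfl⟩ := List.mem_map.1 hp
        rcases hj with hj | hj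
        · exact .inr (.inr ⟨q, this.2.1 ▸ hq, hj⟩)
        · exact absurd hj hjr
  · intro d' r' hm
    rcases Multiset.mem_cons.1 hm with hm | hm
    · cases hm
    · refine ⟨?_, .inl hm⟩
      rw [msgCount_cons, (h'.req hm).2.1, if_neg, add_zero]
      intro e
      exact GEM.msgCount_eq_zero.1 hr2' _ hm e
  · intro d' r' hm
    rcases Multiset.mem_cons.1 hm with hm | hm
    · cases hm
      exact .inr hr1
    · exact .inl hm

theorem WellFormed.unserved (h : WellFormed i a V tr) {d : C} {r : Request S C}
    (hm : .request d r ∈ tr) : V r.id = none := by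
  cases e : V r.id with
  | none => rfl
  | some t => exact absurd (.inl (h.root e)) ((h.req hm).2.2 _ _ e)

/-- The table for a new goal, before the evaluation is started. -/
def newTable (d : C) (r : Request S C) (ns : List (Node S C)) : Table S C :=
  ⟨d, r.goal, some r, [], fun _ => none, [], r.id, .new, ns⟩

theorem WellFormed.create {d : C} {r : Request S C} (h : WellFormed i a V (.request d r ::ₘ tr))
    {G : Atom S C} {pol : List (Clause S C)} {ns : List (Node S C)}
    (hns : InitialNodes G r.id pol ns) :
    WellFormed i a (Function.update V r.id (some (newTable d ⟨r.id, r.requester, G⟩ ns))) tr := by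
  have h' := h.dropMsg
  have hV0 := h.unserved (Multiset.mem_cons_self _ _)
  obtain ⟨hr1, hr2, hr3⟩ := h.req (Multiset.mem_cons_self _ _)
  have hr2' : msgCount tr r.id = 0 := by
    rw [msgCount_cons] at hr2
    simpa [Message.id] using hr2
  set t := newTable d ⟨r.id, r.requester, G⟩ ns with ht
  have hV : ∀ {k u}, Function.update V r.id (some t) k = some u →
      (k = r.id ∧ u = t) ∨ (k ≠ r.id ∧ V k = some u) := by
    intro k u hu
    by_cases hk : k = r.id
    · subst hk; left; simpa [eq_comm] using hu
    · right; rw [Function.update_of_ne hk] at hu; exact ⟨hk, hu⟩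
  have hmono : ∀ {k c}, Addr i a V k c → Addr i a (Function.update V r.id (some t)) k c := by
    rintro k c (hk | ⟨u, hu, hk⟩)
    · exact .inl hk
    · refine .inr ⟨u, ?_, hk⟩
      rw [Function.update_of_ne]
      · exact hu
      · rintro e; rw [e, hV0] at hu; cases hu
  have hpre : i <+: r.id := by
    rcases hr1 with ⟨e, -⟩ | ⟨u, hu, -⟩
    · rw [e]
    · exact (h.pre hu).trans (List.dropLast_prefix _)
  have hser : ∀ j, t.Serves j → j = r.id := by
    rintro j (hj | ⟨r', hr', -⟩ | ⟨p, hp, -⟩)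
    · exact hj.symm
    · simp [ht, newTable] at hr'
    · simp [ht, newTable] at hp
  constructor
  · intro k u hu
    rcases hV hu with ⟨rfl, rfl⟩ | ⟨hk, hu⟩
    · rfl
    · exact h.root hu
  · intro k u hu
    rcases hV hu with ⟨rfl, rfl⟩ | ⟨hk, hu⟩
    · exact hpre
    · exact h.pre hu
  · intro k u n hu hn
    rcases hV hu with ⟨rfl, rfl⟩ | ⟨hk, hu⟩
    · exact (hns.spec.2.2 n hn).1
    · exact h.node hu hn
  · intro k u hu
    rcases hV hu with ⟨rfl, rfl⟩ | ⟨hk, hu⟩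
    · exact hns.spec.2.1
    · exact h.nodup hu
  · intro k u hu hd
    rcases hV hu with ⟨rfl, rfl⟩ | ⟨hk, hu⟩
    · exact ⟨_, rfl, rfl, hmono hr1⟩
    · obtain ⟨r, hr, e, ha⟩ := h.hr hu hd
      exact ⟨r, hr, e, hmono ha⟩
  · intro k u r hu hr
    rcases hV hu with ⟨rfl, rfl⟩ | ⟨hk, hu⟩
    · simp [ht, newTable] at hr
    · exact ⟨hmono (h.lr hu hr).1, (h.lr hu hr).2⟩
  · intro k u hu
    rcases hV hu with ⟨rfl, rfl⟩ | ⟨hk, hu⟩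
    · exact List.nodup_nil
    · exact h.lrNodup hu
  · intro k k' u u' j hu hu' hj hj'
    rcases hV hu with ⟨rfl, rfl⟩ | ⟨hk, hu⟩ <;> rcases hV hu' with ⟨rfl, rfl⟩ | ⟨hk', hu'⟩
    · rfl
    · rw [hser j hj] at hj'
      exact absurd hj' (hr3 _ _ hu')
    · rw [hser j hj'] at hj
      exact absurd hj (hr3 _ _ ‹V k = some u›)
    · exact h.serves hu hu' hj hj'
  · intro k u j hu hj
    rcases hV hu with ⟨rfl, rfl⟩ | ⟨hk, hu⟩
    · rw [hser j hj]; exact ⟨_, hmono hr1⟩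
    · obtain ⟨c, hc⟩ := h.servesAddr hu hj
      exact ⟨c, hmono hc⟩
  · intro d' r' hm
    obtain ⟨h1, h2, h3⟩ := h'.req hm
    refine ⟨hmono h1, h2, fun k u hu hs => ?_⟩
    rcases hV hu with ⟨rfl, rfl⟩ | ⟨hk, hu⟩
    · exact GEM.msgCount_eq_zero.1 hr2' _ hm (hser _ hs)
    · exact h3 _ _ hu hs
  · exact fun hm => hmono (h'.resp hm)

end

end GEM

namespace GEM

variable {S C : Type*}

/-! ### Well-formed states -/

/-- Well-formedness of a list of tables and the messages in transit. -/
structure Good (i : Identifier) (a : C) (ts : List (Table S C)) (tr : Multiset (Message S C)) :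
    Prop where
  nodup : (ts.map Table.rootId).Nodup
  wf : WellFormed i a (look ts) tr

section

variable {i : Identifier} {a : C} {tr : Multiset (Message S C)} {l₁ l₂ ts : List (Table S C)}
  {t : Table S C}

theorem Good.look_mem (h : Good i a ts tr) (ht : t ∈ ts) : look ts t.rootId = some t :=
  (look_eq_some h.nodup).2 ⟨ht, rfl⟩

theorem Good.look_mid (h : Good i a (l₁ ++ t :: l₂) tr) :
    GEM.look (l₁ ++ t :: l₂) t.rootId = some t := h.look_mem (by simp)

theorem Good.replace (h : Good i a (l₁ ++ t :: l₂) tr) {t' : Table S C}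
    {tr' : Multiset (Message S C)} (he : t'.rootId = t.rootId)
    (hw : WellFormed i a (Function.update (GEM.look (l₁ ++ t :: l₂)) t.rootId (some t')) tr') :
    Good i a (l₁ ++ t' :: l₂) tr' :=
  ⟨nodup_replace he h.nodup, by rwa [look_replace he h.nodup]⟩

theorem Good.useFact (h : Good i a (l₁ ++ t :: l₂) tr)
    {pre post : List (Node S C)} {n : Node S C} (hs : t.Selects pre n post) :
    Good i a (l₁ ++ t.useFact pre n post :: l₂) tr :=
  h.replace (t.useFact_fields pre post n).2.2.2.2.1 (h.wf.useFact h.look_mid hs)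

theorem Good.sendRequest (h : Good i a (l₁ ++ t :: l₂) tr)
    {pre post : List (Node S C)} {n : Node S C} (hs : t.Selects pre n post) {B : Atom S C}
    (hb : n.body ≠ []) (c : C) :
    Good i a (l₁ ++ t.activate pre n post .active :: l₂)
      (.request c ⟨n.id, t.owner, B⟩ ::ₘ tr) :=
  h.replace rfl (h.wf.sendRequest h.look_mid hs hb c)

theorem Good.respond (h : Good i a (l₁ ++ t :: l₂) tr) (hd : t.rootStatus ≠ .disposed)
    {t' : Table S C} {ms : List (Message S C)} (hg : GenerateResponse t t' ms) :
    Good i a (l₁ ++ t' :: l₂) (tr + ms) :=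
  h.replace (hg.spec (h.wf.clients_nodup h.look_mid hd) hd).1.rootId
    (h.wf.respond h.look_mid hd hg)

theorem Good.receive {r : Response S C} {d : C}
    (h : Good i a (l₁ ++ t :: l₂) (.response d r ::ₘ tr))
    (hn : ∃ n ∈ t.nodes, n.id = r.id) {ns : List (Node S C)}
    {H B : Atom S C} {Bs : List (Atom S C)} {l : ℕ}
    (hns : AnswerNodes H B Bs l t.rootId {i | ∃ m ∈ t.nodes, m.id = i} r.ans ns) :
    Good i a (l₁ ++ t.receive r ns :: l₂) tr :=
  h.replace (t.noteResponse_fields r).2.2.1 (h.wf.receive h.look_mid hn hns)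

theorem Good.completed {d : C} {r : Request S C}
    (h : Good i a (l₁ ++ t :: l₂) (.request d r ::ₘ tr)) (G : Atom S C)
    (st : ResponseStatus) (loops : Set Identifier) :
    Good i a (l₁ ++ t.mark {r.id} :: l₂)
      (t.answerTo st loops ⟨r.id, r.requester, G⟩ ::ₘ tr) :=
  h.replace rfl (h.wf.answerRequest h.look_mid (.inl rfl))

theorem Good.lower {d : C} {r : Request S C}
    (h : Good i a (l₁ ++ t :: l₂) (.request d r ::ₘ tr)) {G : Atom S C}
    (hl : Lower r.id t.rootId) (st : ResponseStatus) (loops : Set Identifier) :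
    Good i a (l₁ ++
        ({ t with lr := t.lr ++ [⟨r.id, r.requester, G⟩] } : Table S C).mark {r.id} :: l₂)
      (t.answerTo st loops ⟨r.id, r.requester, G⟩ ::ₘ tr) :=
  h.replace rfl (h.wf.answerRequest h.look_mid (.inr ⟨hl, rfl⟩))

theorem Good.create {d : C} {r : Request S C} (h : Good i a ts (.request d r ::ₘ tr))
    {G : Atom S C} {pol : List (Clause S C)} {ns : List (Node S C)}
    (hns : InitialNodes G r.id pol ns) :
    Good i a (ts ++ [newTable d ⟨r.id, r.requester, G⟩ ns]) tr := by
  have hu := h.wf.unserved (Multiset.mem_cons_self _ _)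
  exact ⟨nodup_append h.nodup hu, by
    rw [look_append h.nodup hu]; exact h.wf.create hns⟩

theorem Good.dropMsg {m : Message S C} (h : Good i a ts (m ::ₘ tr)) : Good i a ts tr :=
  ⟨h.nodup, h.wf.dropMsg⟩

theorem Good.hr (h : Good i a ts tr) (ht : t ∈ ts) (hd : t.rootStatus ≠ .disposed) :
    ∃ r, t.hr = some r ∧ r.id = t.rootId := by
  obtain ⟨r, h1, h2, -⟩ := h.wf.hr (h.look_mem ht) hd
  exact ⟨r, h1, h2⟩

theorem Good.formsLoop (h : Good i a ts tr) (ht : t ∈ ts) {d : C} {r : Request S C}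
    (hf : t.FormsLoop d r) : Lower r.id t.rootId := by
  obtain ⟨-, -, h1, r₁, h2, h3⟩ := hf
  obtain ⟨r₂, h4, h5⟩ := h.hr ht h1
  obtain rfl : r₁ = r₂ := by simpa [h2] using h4
  rwa [h5] at h3

end

theorem good_initial (i : Identifier) (a d : C) (G : Atom S C) :
    Good i a [] ({.request d ⟨i, a, G⟩} : Multiset (Message S C)) := by
  have hl : ∀ k, look ([] : List (Table S C)) k = none := fun k => rfl
  refine ⟨by simp, ?_⟩
  constructor
  any_goals (intros; simp_all [Addr, msgCount, Message.id])

/-! ### Activate Node -/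

theorem Table.useFact_rootStatus {t : Table S C} {pre post : List (Node S C)} {n : Node S C}
    (h : t.rootStatus ≠ .disposed) : (t.useFact pre n post).rootStatus ≠ .disposed := by
  rw [(t.useFact_fields pre post n).2.2.2.2.2.2.1]
  simp only [activate]
  split_ifs <;> simp [h]

theorem ActivateNode.rec_on_table {Mid : Table S C → Prop} {Q : Outcome S C → Prop}
    (fact : ∀ {t pre post n}, Mid t → ¬ t.Exhausted → t.Selects pre n post → n.body = [] →
      Mid (t.useFact pre n post))
    (respond : ∀ {t t' ms}, Mid t → t.Exhausted → GenerateResponse t t' ms → Q (.done t' ms))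
    (flounder : Q .flounder)
    (request : ∀ {t pre post n B Bs c}, Mid t → ¬ t.Exhausted → t.Selects pre n post →
      n.body = B :: Bs → B.loc = .const c →
      Q (.done (t.activate pre n post .active) [.request c ⟨n.id, t.owner, B⟩]))
    {t : Table S C} {o : Outcome S C} (h : ActivateNode t o) (ht : Mid t) : Q o := by
  induction h with
  | respond h hg => exact respond ht h hg
  | fact h hs hb _ ih => exact ih (fact ht h hs hb)
  | flounder => exact flounder
  | request h hs hb hl => exact request ht h hs hb hl

theorem exists_generateResponse {t : Table S C} {r : Request S C} (hr : t.hr = some r) :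
    ∃ t' ms, GenerateResponse t t' ms := by
  by_cases h : t.HasLoopNode
  · by_cases hu : t.HasUnsentAnswer
    · exact ⟨_, _, .iterate h hu⟩
    · by_cases hl : t.IsLeader
      · exact ⟨_, _, .leader h hu hl⟩
      · by_cases hi : ∃ i, t.ProcessesHigher i
        · exact ⟨_, _, .replyLoop h hu hl r hr _ hi.choose_spec⟩
        · exact ⟨_, _, .replyActive h hu hl r hr (not_exists.1 hi)⟩
  · exact ⟨_, _, .noLoop h⟩

open scoped Classical in
theorem Table.exists_selects {t : Table S C} (h : ∃ n ∈ t.nodes, n.status = .new) :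
    ∃ pre n post, t.Selects pre n post := by
  have : ∀ l : List (Node S C), (∃ n ∈ l, n.status = .new) → ∃ pre n post,
      l = pre ++ n :: post ∧ n.status = .new ∧ ∀ m ∈ pre, m.status ≠ .new := by
    intro l
    induction l with
    | nil => simp
    | cons m l ih =>
      intro h
      by_cases hm : m.status = .new
      · exact ⟨[], m, l, rfl, hm, by simp⟩
      · obtain ⟨pre, n, post, rfl, h2, h3⟩ := ih (by simpa [hm] using h)
        exact ⟨m :: pre, n, post, rfl, h2, by simpa [hm] using h3⟩
  exact this _ h

open scoped Classical in
theorem exists_activateNode (t : Table S C) {r : Request S C} (hr : t.hr = some r) :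
    ∃ o, ActivateNode t o := by
  generalize hc : t.nodes.countP (fun n => n.status = .new) = c
  induction c generalizing t with
  | zero =>
    obtain ⟨t', ms, hg⟩ := exists_generateResponse hr
    rw [List.countP_eq_zero] at hc
    exact ⟨_, .respond (.inl fun n hn => by simpa using hc n hn) hg⟩
  | succ c ih =>
    by_cases he : t.Exhausted
    · obtain ⟨t', ms, hg⟩ := exists_generateResponse hr
      exact ⟨_, .respond he hg⟩
    · obtain ⟨pre, n, post, hs⟩ : ∃ pre n post, t.Selects pre n post := by
        refine Table.exists_selects ?_
        by_contra hn
        push Not at hn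
        exact he (.inl hn)
      cases hb : n.body with
      | nil =>
        obtain ⟨-, -, h1, -, -, -, -, h2⟩ := t.useFact_fields pre post n
        obtain ⟨o, ho⟩ := ih (t.useFact pre n post) (h1.trans hr) (by
          rw [h2]
          rw [hs.1] at hc
          simp only [List.countP_append, List.countP_cons, hs.2.1] at hc ⊢
          simp at hc ⊢
          omega)
        exact ⟨o, .fact he hs hb ho⟩
      | cons B Bs =>
        by_cases hl : ∃ c, B.loc = .const c
        · exact ⟨_, .request he hs hb hl.choose_spec⟩
        · exact ⟨_, .flounder he hs hb (not_exists.1 hl)⟩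

theorem exists_apply (s : State S C) (l₁ l₂ : List (Table S C)) (rest : Multiset (Message S C))
    (o : Outcome S C) : ∃ s', Apply s l₁ l₂ rest o s' := by
  cases o with
  | done t ms => exact ⟨_, .done t ms⟩
  | flounder => exact ⟨_, .flounder⟩

theorem exists_step (P : Policy S C) {i : Identifier} {a : C} {s : State S C}
    (h : Good i a s.tables s.transit) (hf : s.floundered = false) (ht : s.transit ≠ 0) :
    ∃ s', Step P s s' := by
  obtain ⟨m, hm⟩ := Multiset.exists_mem_of_ne_zero ht
  obtain ⟨rest, hrest⟩ := Multiset.exists_cons_of_mem hm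
  rw [hrest] at h
  cases m with
  | request d r =>
    by_cases hc : ∃ t ∈ s.tables, t.Completes d r
    · obtain ⟨t, ht, hc⟩ := hc
      obtain ⟨l₁, l₂, hl⟩ := List.append_of_mem ht
      exact ⟨_, .completed hf hrest hl hc rfl⟩
    · push Not at hc
      by_cases hl : ∃ t ∈ s.tables, t.FormsLoop d r
      · obtain ⟨t, ht, hl⟩ := hl
        obtain ⟨l₁, l₂, hl'⟩ := List.append_of_mem ht
        exact ⟨_, .lower hf hrest hc hl' hl rfl⟩
      · push Not at hl
        obtain ⟨ns, hns⟩ := exists_initialNodes r.goal r.id (P d)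
        obtain ⟨o, ho⟩ := exists_activateNode (newTable d r ns) rfl
        obtain ⟨s', hs'⟩ := exists_apply s s.tables [] rest o
        exact ⟨s', .create hf hrest (fun u hu => ⟨hc u hu, hl u hu⟩) (IsVariant.refl _)
          ⟨ns, hns, ho⟩ hs'⟩
  | response d r =>
    by_cases hw : ∃ t ∈ s.tables, t.Awaits d r
    · obtain ⟨t, ht, hw⟩ := hw
      obtain ⟨l₁, l₂, hl⟩ := List.append_of_mem ht
      suffices ∃ o, ProcessResponse t r o by
        obtain ⟨o, ho⟩ := this
        obtain ⟨s', hs'⟩ := exists_apply s l₁ l₂ rest o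
        exact ⟨s', .response hf hrest hl hw ho hs'⟩
      by_cases hd : t.rootStatus = .disposed
      · exact ⟨_, .ignore hd⟩
      obtain ⟨n, hn, hid⟩ := hw.2
      have ha := h.wf.resp (Multiset.mem_cons_self _ _)
      rw [← hid] at ha
      have hb := (h.wf.addr_of_mem (h.look_mem ht) hn ha).2.1
      obtain ⟨B, Bs, hb⟩ := List.exists_cons_of_ne_nil hb
      obtain ⟨ns, hns⟩ := exists_answerNodes n.head B Bs n.depth t.rootId
        (finite_ids t.nodes) r.ans
      by_cases hr : (t.receive r ns).Resumable
      · obtain ⟨q, hq, -⟩ := h.hr ht hd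
        obtain ⟨o, ho⟩ := exists_activateNode (t.receive r ns)
          ((t.noteResponse_fields r).2.2.2.1.trans hq)
        exact ⟨o, .resume hd hn hid hb hns rfl hr ho⟩
      · exact ⟨_, .wait hd hn hid hb hns rfl hr⟩
    · push Not at hw
      exact ⟨_, .returned hf hrest hw⟩

theorem Good.step {P : Policy S C} {i : Identifier} {a : C} {s s' : State S C}
    (h : Good i a s.tables s.transit) (hs : Step P s s') : Good i a s'.tables s'.transit := by
  have hact : ∀ {l₁ l₂ t tr o s'}, Good i a (l₁ ++ t :: l₂) tr → t.rootStatus ≠ .disposed →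
      Good i a s.tables tr → ActivateNode t o → Apply s l₁ l₂ tr o s' →
      Good i a s'.tables s'.transit := by
    intro l₁ l₂ t tr o s' h hd h' ho ha
    refine ActivateNode.rec_on_table
      (Mid := fun t => Good i a (l₁ ++ t :: l₂) tr ∧ t.rootStatus ≠ .disposed)
      (Q := fun o => ∀ s', Apply s l₁ l₂ tr o s' → Good i a s'.tables s'.transit)
      ?_ ?_ ?_ ?_ ho ⟨h, hd⟩ s' ha
    · exact fun hm _ hs _ => ⟨hm.1.useFact hs, Table.useFact_rootStatus hm.2⟩
    · rintro t t' ms hm - hg s' ⟨⟩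
      exact hm.1.respond hm.2 hg
    · rintro s' ⟨⟩
      exact h'
    · rintro t pre post n B Bs c hm - hs hb - s' ⟨⟩
      have := hm.1.sendRequest (B := B) hs (by simp [hb]) c
      rwa [← Multiset.singleton_add, add_comm] at this
  cases hs with
  | completed hf hm ht hc hs =>
    rw [hm, ht] at h
    rw [Table.sendResponse_eq] at hs
    cases hs
    exact h.completed _ _ _
  | @lower d r rest l₁ l₂ t t' m hf hm hn ht hc hs =>
    have hl := h.formsLoop (t := t) (by simp [ht]) hc
    rw [hm, ht] at h
    rw [Table.sendResponse_eq] at hs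
    cases hs
    exact h.lower hl _ _
  | @create _ d r rest G o hf hm hn hG hc ha =>
    obtain ⟨ns, hns, ho⟩ := hc
    rw [hm] at h
    exact hact (h.create hns) (by simp [newTable]) h.dropMsg ho ha
  | @response _ d r rest l₁ l₂ t o hf hm ht hw hp ha =>
    rw [hm] at h
    have h0 := h
    rw [ht] at h
    cases hp with
    | ignore =>
      cases ha
      simpa using h.dropMsg
    | resume hroot hn hid hb hns ht' hr ho =>
      obtain rfl : _ = t.receive r _ := ht'
      refine hact (h.receive hw.2 hns) ?_ h0.dropMsg ho ha
      rcases hr with hr | ⟨ids, hr, -⟩ <;> simp [hr]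
    | wait hroot hn hid hb hns ht' hr =>
      obtain rfl : _ = t.receive r _ := ht'
      cases ha
      simpa using h.receive hw.2 hns
  | returned hf hm hn =>
    rw [hm] at h
    exact h.dropMsg

theorem Good.reachable {P : Policy S C} {i : Identifier} {a d : C} {G : Atom S C} {s : State S C}
    (h : Relation.ReflTransGen (Step P) (initial i a d G) s) : Good i a s.tables s.transit := by
  induction h with
  | refl => exact good_initial i a d G
  | tail _ h ih => exact ih.step h

end GEM

namespace GEM

variable {S C : Type*}

/-! ### The invariant of the loop processing -/

/-- What a principal is doing for a goal: it has answered and waits to be called (`quiet`); a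
response in the context of loop `h` is under way to some of its subgoals (`called h`); it
evaluates a new subgoal (`run`); it waits for the responses of its subgoals involved in loop `j`
(`wait`); or it is about to activate a node (`ready`). In the last three cases `w` is the higher
loop in the context of which it has to answer, if any. -/
inductive Phase where
  | quiet
  | called (h : Identifier)
  | run (w : Option Identifier)
  | wait (w : Option Identifier) (j : Identifier)
  | ready (w : Option Identifier)

/-- The higher loop in the context of which the goal has to be answered. -/
def Phase.wave : Phase → Option Identifier
  | .quiet => none
  | .called h => some h
  | .run w => w
  | .wait w _ => w
  | .ready w => w

/-- The loop in the context of which responses to the subgoals are awaited. -/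
def Phase.pending : Phase → Option Identifier
  | .called h => some h
  | .wait _ j => some j
  | _ => none

/-- The evaluation of the goal has been completed. -/
def Table.Done (t : Table S C) : Prop := t.rootStatus = .disposed

section

variable (V : Identifier → Option (Table S C)) (tr : Multiset (Message S C))
  (ph : Identifier → Phase)

/-- The request `k` is processed by a table of its own, which has yet to answer it. -/
def Busy (k : Identifier) : Prop := ∃ t, V k = some t ∧ ¬ t.Done ∧ ph k ≠ .quiet

/-- No response to the request `k` is under way. -/
def Idle (k : Identifier) : Prop := msgCount tr k = 0 ∧ ¬ Busy V ph k

/-- The goal of some table above or at `k` has been completed. -/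
def Dead (k : Identifier) : Prop := ∃ j t, V j = some t ∧ t.Done ∧ j <+: k

/-- Some response in the context of loop `j` will be given to the request `k`. -/
def Sup (k j : Identifier) : Prop :=
  (∃ h, V j = some h ∧ ¬ h.Done ∧ ∃ r ∈ h.lr, r.id = k) ∨
    ∃ z, V k = some z ∧ ¬ z.Done ∧ ∃ n ∈ z.nodes, n.InLoop j

/-- The higher loops of the table of the request `k` belong to `J`. -/
def ChildLoops (k : Identifier) (J : Set Identifier) : Prop :=
  ∀ z, V k = some z → ¬ z.Done → ∀ n ∈ z.nodes, ∀ j, n.InLoop j → j ≠ k → j ∈ J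

/-- Every table of the request `k` is completed. -/
def ChildDone (k : Identifier) : Prop := ∀ z, V k = some z → z.Done

/-- The loops recorded in the uncompleted table `t` at `k` are consistent with the other tables. -/
structure LoopsOK (i k : Identifier) (t : Table S C) : Prop where
  counter : ∀ j, t.activeGoals j ≠ none ↔ ∃ n ∈ t.nodes, n.InLoop j
  pre : ∀ n ∈ t.nodes, ∀ j, n.InLoop j → i <+: j ∧ j <+: k
  nonempty : ∀ n ∈ t.nodes, n.Looping → ∃ j, n.InLoop j
  sup : ∀ n ∈ t.nodes, ∀ j, n.InLoop j → Sup V n.id j ∨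
    Dead V k ∧ ∃ d r, .response d r ∈ tr ∧ r.id = n.id

/-- The node that has sent the lower request `l` to the table at `k` knows that it is in a loop. -/
def LowerOK (k l : Identifier) : Prop :=
  ∀ k' u, V k' = some u → ∀ n ∈ u.nodes, n.id = l → u.Done ∧ Dead V k ∨ ¬ u.Done ∧ (n.InLoop k ∨
    n.status = .active ∧ ∃ d q, .response d q ∈ tr ∧ q.id = l ∧ k ∈ q.loops)

/-- Nothing can be done for the goal until a subgoal is answered again. -/
structure Table.Resting (t : Table S C) (k : Identifier) : Prop where
  root : t.rootStatus = .active
  exhausted : t.Exhausted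
  notActive : ∀ n ∈ t.nodes, n.status ≠ .active
  synced : ∀ p ∈ t.ansSet, ∀ r ∈ t.clients, r.id ∈ p.2
  higher : ∃ n ∈ t.nodes, ∃ j, n.InLoop j ∧ j ≠ k

/-- A response to the node `n` of the table at `k` in the context of loop `h` is under way. -/
def LoopPending (i k : Identifier) (n : Node S C) (ids : Set Identifier) (h : Identifier) : Prop :=
  (ph k).pending = some h ∧ h ∈ ids ∧
    (Busy V ph n.id ∧ msgCount tr n.id = 0 ∧ (ph n.id).wave = some h ∨
      ∃ d r, .response d r ∈ tr ∧ r.id = n.id ∧ msgCount tr n.id = 1 ∧ ¬ Busy V ph n.id ∧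
        r.status = .loop h ∧ (∀ j ∈ r.loops, i <+: j ∧ j <+: k ∧ Sup V n.id j) ∧
        ChildLoops V n.id (ids ∪ r.loops))

/-- The node `n` waits for the first response. -/
def FirstPending (i k : Identifier) (n : Node S C) : Prop :=
  (∃ d r, .request d r ∈ tr ∧ r.id = n.id ∧ msgCount tr n.id = 1) ∨
  (Busy V ph n.id ∧ msgCount tr n.id = 0 ∧ (ph n.id).wave = none) ∨
  ∃ d r, .response d r ∈ tr ∧ r.id = n.id ∧ msgCount tr n.id = 1 ∧ ¬ Busy V ph n.id ∧
    (r.status = .disposed ∧ r.loops = ∅ ∧ ChildDone V n.id ∨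
      r.status = .active ∧ r.loops.Nonempty ∧
      (∀ j ∈ r.loops, i <+: j ∧ j <+: k ∧ Sup V n.id j) ∧ ChildLoops V n.id r.loops)

/-- The status of the node `n` of the table at `k` agrees with the state of its subgoal. -/
structure NodeOK (i k : Identifier) (n : Node S C) : Prop where
  answer : n.status = .answer → n.body = []
  disposed : n.status = .disposed → msgCount tr n.id = 0 ∧ ChildDone V n.id
  active : n.status = .active → FirstPending V tr ph i k n
  loop : ∀ ids, n.status = .loop ids →
    Idle V tr ph n.id ∧ ChildLoops V n.id ids ∨ ∃ h, LoopPending V tr ph i k n ids h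

/-- The status of the root, when an iteration of all loops that it records is completed. -/
def Table.RootReady (t : Table S C) (k : Identifier) : Option Identifier → Prop
  | none => t.rootStatus = .active ∨ t.rootStatus = .loop {k} ∧ t.activeGoals k = some 0
  | some h => h ≠ k ∧ t.activeGoals h = some 0 ∧
      (t.rootStatus = .loop {h} ∨ t.rootStatus = .loop {h, k} ∧ t.activeGoals k = some 0)

/-- The status of the root during an iteration of loop `j`. -/
def Table.RootWaiting (t : Table S C) (k j : Identifier) : Option Identifier → Prop
  | none => j = k ∧ t.rootStatus = .loop {k}
  | some h => h ≠ k ∧ (j = h ∧ t.rootStatus = .loop {h} ∨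
      j = k ∧ t.rootStatus = .loop {h, k} ∧ t.activeGoals h = some 0)

/-- The counters of all higher loops are set to the number of nodes involved. -/
def Table.Counted (t : Table S C) (k : Identifier) : Prop :=
  ∀ j, j ≠ k → t.activeGoals j ≠ none → t.activeGoals j = some (t.loopCount j)

open scoped Classical in
/-- The number of nodes to which a response is under way. -/
noncomputable def pendingCount (t : Table S C) : ℕ :=
  t.nodes.countP fun n => ¬ Idle V tr ph n.id

/-- The table `t` at `k` is in the given phase. -/
def PhaseOK (k : Identifier) (t : Table S C) : Phase → Prop
  | .quiet => t.Resting k ∧ t.Counted k ∧ ∀ n ∈ t.nodes, Idle V tr ph n.id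
  | .called h => t.Resting k ∧ t.Counted k ∧ h ≠ k ∧ (∃ n ∈ t.nodes, n.InLoop h) ∧
      ∀ n ∈ t.nodes, ¬ Idle V tr ph n.id ↔ n.InLoop h
  | .run w => t.RootReady k w ∧ ∃ n ∈ t.nodes, n.status = .active ∧
      ∀ m ∈ t.nodes, m ≠ n → Idle V tr ph m.id ∧ m.status ≠ .active
  | .wait w j => t.RootWaiting k j w ∧ (∀ n ∈ t.nodes, n.status ≠ .active) ∧
      (∀ n ∈ t.nodes, ¬ Idle V tr ph n.id → n.InLoop j) ∧
      t.activeGoals j = some (pendingCount V tr ph t : ℤ) ∧ 0 < pendingCount V tr ph t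
  | .ready w => (t.RootReady k w ∨ w = none ∧ t.rootStatus = .new) ∧
      ∀ n ∈ t.nodes, Idle V tr ph n.id ∧ n.status ≠ .active

/-- The goal of the initial request is being evaluated or its issuer has been answered. -/
def TopOK (i : Identifier) (a : C) (ret : List (C × Response S C)) (t : Table S C) : Prop :=
  ¬ t.Done ∧ ret = [] ∧ msgCount tr i = 0 ∨
  (t.Done ∧ ∃ ans, ret = [] ∧ msgCount tr i = 1 ∧ .response a ⟨i, ans, .disposed, ∅⟩ ∈ tr) ∨
  t.Done ∧ ∃ ans, msgCount tr i = 0 ∧ ret = [(a, ⟨i, ans, .disposed, ∅⟩)]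

/-- The uncompleted table `t` at `k`, below a completed one, waits for being disposed. -/
structure ZombieOK (k : Identifier) (t : Table S C) : Prop where
  resting : t.Resting k
  loops : ∀ n ∈ t.nodes, ∀ j, n.InLoop j → Dead V j
  child : ∀ n ∈ t.nodes, ¬ ChildDone V n.id → n.Looping

/-- A message for the table `t` at or below a completed one. -/
def DeadMsgOK (t : Table S C) (m : Message S C) : Prop :=
  ∃ d r, m = .response d r ∧ (¬ t.Done → r.status = .disposed ∧ r.ans = [] ∧
    ∃ n ∈ t.nodes, n.id = r.id ∧ n.Looping)

/-- The invariant of the states of an execution after the initial one. -/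
structure Inv (i : Identifier) (a : C) (ret : List (C × Response S C)) : Prop where
  loops : ∀ {k t}, V k = some t → ¬ t.Done → LoopsOK V tr i k t
  lower : ∀ {k t}, V k = some t → ¬ t.Done → ∀ r ∈ t.lr, LowerOK V tr k r.id
  deadMsg : ∀ {k t}, V k = some t → Dead V k → ∀ m ∈ tr, (∃ x, m.id = k ++ [x]) → DeadMsgOK t m
  zombie : ∀ {k t}, V k = some t → ¬ t.Done → Dead V k → ZombieOK V k t
  node : ∀ {k t}, V k = some t → ¬ Dead V k → ∀ n ∈ t.nodes, NodeOK V tr ph i k n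
  phase : ∀ {k t}, V k = some t → ¬ Dead V k → PhaseOK V tr ph k t (ph k)
  top : ∃ t, V i = some t ∧ TopOK tr i a ret t

end

/-! ### Consequences of the invariant -/

section

variable {i : Identifier} {a : C} {V V' : Identifier → Option (Table S C)}
  {tr tr' : Multiset (Message S C)} {ph ph' : Identifier → Phase} {k k₀ j : Identifier}
  {t t' : Table S C} {ret ret' : List (C × Response S C)}

theorem not_done_of_not_dead (ht : V k = some t) (h : ¬ Dead V k) : ¬ t.Done :=
  fun hd => h ⟨k, t, ht, hd, List.prefix_rfl⟩

theorem Dead.mono_prefix (h : Dead V k) (hj : k <+: j) : Dead V j := by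
  obtain ⟨l, t, h1, h2, h3⟩ := h
  exact ⟨l, t, h1, h2, h3.trans hj⟩

theorem prefix_concat {k : Identifier} {x : List Char} : k <+: k ++ [x] := List.prefix_append _ _

theorem prefix_antisymm {j k : Identifier} (h : j <+: k) (h' : k <+: j) : j = k :=
  h.eq_of_length (h.length_le.antisymm h'.length_le)

theorem prefix_of_prefix_concat {j k : Identifier} {x : List Char} (h : j <+: k ++ [x])
    (hne : j ≠ k ++ [x]) : j <+: k := by
  rcases List.prefix_concat_iff.1 h with h | h
  · exact absurd h hne
  · exact h

theorem concat_ne_of_prefix {j k : Identifier} {x : List Char} (h : j <+: k) : k ++ [x] ≠ j :=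
  id_ne_of_prefix h

/-- A table below an uncompleted one is dead only if the parent is. -/
theorem Dead.parent {x : List Char} (h : Dead V (k ++ [x])) (hk : ∀ t, V (k ++ [x]) = some t → ¬ t.Done) :
    Dead V k := by
  obtain ⟨l, t, h1, h2, h3⟩ := h
  refine ⟨l, t, h1, h2, prefix_of_prefix_concat h3 ?_⟩
  rintro rfl
  exact hk t h1 h2

theorem msg_unique (h : msgCount tr k = 1) {m m' : Message S C} (hm : m ∈ tr) (hm' : m' ∈ tr)
    (e : m.id = k) (e' : m'.id = k) : m = m' := by
  obtain ⟨rest, rfl⟩ := Multiset.exists_cons_of_mem hm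
  rw [msgCount_cons, if_pos e.symm] at h
  rcases Multiset.mem_cons.1 hm' with h' | h'
  · exact h'.symm
  · exact absurd e' (msgCount_eq_zero.1 (by omega) _ h')

theorem Node.InLoop.looping {n : Node S C} (h : n.InLoop j) : n.Looping := by
  obtain ⟨ids, h, -⟩ := h
  exact ⟨ids, h⟩

theorem Idle.not_active {n : Node S C} (hi : Idle V tr ph n.id) (hn : NodeOK V tr ph i k n) :
    n.status ≠ .active := by
  intro hs
  rcases hn.active hs with ⟨d, r, -, -, h⟩ | ⟨h, -⟩ | ⟨d, r, -, -, h, -⟩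
  · simp [hi.1] at h
  · exact hi.2 h
  · simp [hi.1] at h

theorem Idle.childLoops {n : Node S C} (hi : Idle V tr ph n.id) (hn : NodeOK V tr ph i k n)
    {ids : Set Identifier} (hs : n.status = .loop ids) : ChildLoops V n.id ids := by
  rcases hn.loop ids hs with h | ⟨h, -, -, ⟨h1, -⟩ | ⟨d, r, -, -, h1, -⟩⟩
  · exact h.2
  · exact absurd h1 hi.2
  · simp [hi.1] at h1

theorem WellFormed.idle_of_not_addr (h : WellFormed i a V tr) (ha : ∀ c, ¬ Addr i a V k c) :
    Idle V tr ph k :=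
  ⟨h.msgCount_eq_zero ha, fun ⟨t, ht, _⟩ => h.not_serves ha _ t ht (.inl (h.root ht))⟩

theorem WellFormed.idle_of_new (h : WellFormed i a V tr) (ht : V k = some t) {n : Node S C}
    (hn : n ∈ t.nodes) (hs : n.status = .new) : Idle V tr ph n.id :=
  h.idle_of_not_addr (h.not_addr_of_new ht hn hs)

/-- The parent of a table. -/
theorem WellFormed.parent (h : WellFormed i a V tr) (ht : V k = some t) (hk : k ≠ i) :
    ∃ k' x u n, k = k' ++ [x] ∧ V k' = some u ∧ n ∈ u.nodes ∧ n.id = k ∧ n.body ≠ [] ∧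
      n.status ≠ .new := by
  obtain ⟨c, hc⟩ := h.servesAddr ht (.inl (h.root ht))
  rcases hc with ⟨e, -⟩ | ⟨u, hu, -, n, hn, h1, h2, h3⟩
  · exact absurd e hk
  · obtain ⟨x, hx⟩ := h.node hu hn
    exact ⟨_, x, u, n, h1.symm.trans hx, hu, hn, h1, h2, h3⟩

theorem WellFormed.node_unique (h : WellFormed i a V tr) {k' : Identifier} {u : Table S C}
    (ht : V k = some t) (hu : V k' = some u) {n m : Node S C} (hn : n ∈ t.nodes)
    (hm : m ∈ u.nodes) (e : n.id = m.id) : k = k' ∧ t = u ∧ n = m := by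
  obtain ⟨x, hx⟩ := h.node ht hn
  obtain ⟨y, hy⟩ := h.node hu hm
  rw [hx, hy] at e
  obtain ⟨rfl, -⟩ := List.append_inj' e rfl
  rw [ht, Option.some_inj] at hu
  subst hu
  exact ⟨rfl, rfl, node_id_inj (h.nodup ht) hn hm (by rw [hx, hy, e])⟩

/-- An idle node with an uncompleted subgoal is involved in a loop. -/
theorem WellFormed.looping_of_idle (h : WellFormed i a V tr) (ht : V k = some t) {n : Node S C}
    (hn : n ∈ t.nodes) (hok : NodeOK V tr ph i k n) (hi : Idle V tr ph n.id)
    (hz : ¬ ChildDone V n.id) : ∃ ids, n.status = .loop ids ∧ ChildLoops V n.id ids := by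
  simp only [ChildDone, not_forall] at hz
  obtain ⟨z, hz, hd⟩ := hz
  obtain ⟨c, hc⟩ := h.servesAddr hz (.inl (h.root hz))
  obtain ⟨-, h1, h2⟩ := h.addr_of_mem ht hn hc
  cases hs : n.status with
  | new => exact absurd hs h2
  | answer => exact absurd (hok.answer hs) h1
  | disposed => exact absurd ((hok.disposed hs).2 z hz) hd
  | active => exact absurd hs (hi.not_active hok)
  | loop ids => exact ⟨ids, rfl, hi.childLoops hok hs⟩

section

variable (h : Inv V tr ph i a ret) (hw : WellFormed i a V tr)

include h hw

/-- All tables below a table with idle nodes are quiet. -/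
theorem Inv.quiet_below (ht : V k₀ = some t) (hl : ¬ Dead V k₀)
    (hi : ∀ n ∈ t.nodes, Idle V tr ph n.id) {u : Table S C} (hu : V k = some u)
    (hk : k₀ <+: k) (hne : k ≠ k₀) (hd : ¬ Dead V k) : ph k = .quiet := by
  obtain ⟨l, hl'⟩ : ∃ l, k.length = l := ⟨_, rfl⟩
  induction l using Nat.strong_induction_on generalizing k u with
  | _ l ih =>
  have hki : k ≠ i := by
    rintro rfl
    exact hne (prefix_antisymm hk (hw.pre ht)).symm
  obtain ⟨k', x, v, n, rfl, hv, hn, hid, -, -⟩ := hw.parent hu hki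
  have hk' := prefix_of_prefix_concat hk (Ne.symm hne)
  have hd' : ¬ Dead V k' := fun h => hd (h.mono_prefix prefix_concat)
  have hidle : Idle V tr ph n.id := by
    by_cases e : k' = k₀
    · subst e
      rw [hv, Option.some_inj] at ht
      subst ht
      exact hi n hn
    · have hq := ih k'.length (by rw [← hl']; simp) hv hk' e hd' rfl
      have := h.phase hv hd'
      rw [hq] at this
      exact this.2.2 n hn
  by_contra hq
  exact hidle.2 (hid ▸ ⟨u, hu, not_done_of_not_dead hu hd, hq⟩)

theorem Inv.idle_below (ht : V k₀ = some t) (hl : ¬ Dead V k₀)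
    (hi : ∀ n ∈ t.nodes, Idle V tr ph n.id) {u : Table S C} (hu : V k = some u)
    (hk : k₀ <+: k) (hd : ¬ Dead V k) : ∀ n ∈ u.nodes, Idle V tr ph n.id := by
  by_cases e : k = k₀
  · subst e
    rw [hu, Option.some_inj] at ht
    subst ht
    exact hi
  · have hq := h.quiet_below hw ht hl hi hu hk e hd
    have := h.phase hu hd
    rw [hq] at this
    exact this.2.2

/-- A table with idle nodes records all loops of the tables below it, except their own ones. -/
theorem Inv.loop_below (ht : V k₀ = some t) (hl : ¬ Dead V k₀)
    (hi : ∀ n ∈ t.nodes, Idle V tr ph n.id) {u : Table S C} (hu : V k = some u)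
    (hk : k₀ <+: k) (hd : ¬ Dead V k) {m : Node S C} (hm : m ∈ u.nodes) (hj : m.InLoop j)
    (hjk : j <+: k₀) : ∃ n ∈ t.nodes, n.InLoop j := by
  obtain ⟨l, hl'⟩ : ∃ l, k.length = l := ⟨_, rfl⟩
  induction l using Nat.strong_induction_on generalizing k u m with
  | _ l ih =>
  by_cases e : k = k₀
  · subst e
    rw [hu, Option.some_inj] at ht
    subst ht
    exact ⟨m, hm, hj⟩
  have hki : k ≠ i := by
    rintro rfl
    exact e (prefix_antisymm hk (hw.pre ht)).symm
  obtain ⟨k', x, v, n, rfl, hv, hn, hid, -, -⟩ := hw.parent hu hki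
  have hk' := prefix_of_prefix_concat hk (Ne.symm e)
  have hd' : ¬ Dead V k' := fun h => hd (h.mono_prefix prefix_concat)
  have hidle := h.idle_below hw ht hl hi hv hk' hd' n hn
  have hud := not_done_of_not_dead hu hd
  obtain ⟨ids, hs, hc⟩ := hw.looping_of_idle hv hn (h.node hv hd' n hn) hidle
    (fun hc => hud (hc u (hid ▸ hu)))
  refine ih k'.length (by rw [← hl']; simp) hv hk' hd' hn
    ⟨ids, hs, hc u (hid ▸ hu) hud m hm j hj ?_⟩ rfl
  rw [hid]
  exact (concat_ne_of_prefix (hjk.trans hk')).symm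

/-- The subgoals for which a lower request has been sent to a table with idle nodes. -/
theorem Inv.lower_inLoop (ht : V k₀ = some t) (hl : ¬ Dead V k₀)
    (hi : ∀ n ∈ t.nodes, Idle V tr ph n.id) {r : Request S C} (hr : r ∈ t.lr) :
    ∃ k u n, V k = some u ∧ k₀ <+: k ∧ ¬ Dead V k ∧ n ∈ u.nodes ∧ n.id = r.id ∧ n.InLoop k₀ ∧
      Idle V tr ph n.id := by
  have htd := not_done_of_not_dead ht hl
  obtain ⟨ha, hlow⟩ := hw.lr ht hr
  rcases ha with ⟨e, -⟩ | ⟨u, hu, -, n, hn, hid, -⟩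
  · exact absurd (prefix_antisymm (e ▸ hlow.1) (hw.pre ht)) fun e' => hlow.2 (e'.trans e.symm)
  obtain ⟨x, hx⟩ := hw.node hu hn
  set k := r.id.dropLast
  have hk : k₀ <+: k := prefix_of_prefix_concat (x := x) (by rw [← hx, hid]; exact hlow.1)
    (by rw [← hx, hid]; exact hlow.2)
  rcases h.lower ht htd r hr _ u hu n hn hid with ⟨-, hd⟩ | ⟨hud, hn'⟩
  · exact absurd hd hl
  have hd : ¬ Dead V k := by
    intro hd
    have hz := h.zombie hu hud hd
    rcases hn' with hn' | ⟨hn', -⟩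
    · exact hl (hz.loops n hn _ hn')
    · exact hz.resting.notActive n hn hn'
  have hidle := h.idle_below hw ht hl hi hu hk hd n hn
  refine ⟨k, u, n, hu, hk, hd, hn, hid, ?_, hidle⟩
  rcases hn' with hn' | ⟨hn', -⟩
  · exact hn'
  · exact absurd hn' (hidle.not_active (h.node hu hd n hn))

/-- The parent of a live table. -/
theorem Inv.live_parent (ht : V k = some t) (hl : ¬ Dead V k) (hk : k ≠ i) :
    ∃ k' x u n, k = k' ++ [x] ∧ V k' = some u ∧ ¬ Dead V k' ∧ n ∈ u.nodes ∧ n.id = k ∧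
      NodeOK V tr ph i k' n := by
  obtain ⟨k', x, u, n, rfl, hu, hn, hid, -, -⟩ := hw.parent ht hk
  have hd' : ¬ Dead V k' := fun h => hl (h.mono_prefix prefix_concat)
  exact ⟨k', x, u, n, rfl, hu, hd', hn, hid, h.node hu hd' n hn⟩

end

end

end GEM

namespace GEM

variable {S C : Type*}

section

variable {i : Identifier} {a : C} {V V' : Identifier → Option (Table S C)}
  {tr tr' : Multiset (Message S C)} {ph ph' : Identifier → Phase} {k k₀ j : Identifier}
  {t t' : Table S C} {ret ret' : List (C × Response S C)}

/-! ### Frame lemmas -/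

theorem update_some {u : Table S C} :
    Function.update V k₀ (some t') k = some u ↔ k = k₀ ∧ u = t' ∨ k ≠ k₀ ∧ V k = some u := by
  by_cases hk : k = k₀
  · subst hk; simp [eq_comm]
  · simp [hk]

/-- `t'` is a version of `t` that serves and loops at least as much. -/
structure Table.Grows (t t' : Table S C) : Prop where
  done : t'.Done ↔ t.Done
  lr : ∀ r ∈ t.lr, ∃ r' ∈ t'.lr, r'.id = r.id
  loop : ∀ n ∈ t.nodes, ∃ n' ∈ t'.nodes, n'.id = n.id ∧ ∀ j, n.InLoop j → n'.InLoop j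

theorem dead_update (ht : V k₀ = some t) (hd : t'.Done ↔ t.Done) :
    Dead (Function.update V k₀ (some t')) k ↔ Dead V k := by
  constructor
  · rintro ⟨l, u, hu, h1, h2⟩
    rcases update_some.1 hu with ⟨rfl, rfl⟩ | ⟨-, hu⟩
    · exact ⟨_, _, ht, hd.1 h1, h2⟩
    · exact ⟨_, _, hu, h1, h2⟩
  · rintro ⟨l, u, hu, h1, h2⟩
    by_cases hl : l = k₀
    · subst hl
      rw [ht, Option.some_inj] at hu
      subst hu
      exact ⟨_, t', update_some.2 (.inl ⟨rfl, rfl⟩), hd.2 h1, h2⟩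
    · exact ⟨_, u, update_some.2 (.inr ⟨hl, hu⟩), h1, h2⟩

theorem Sup.update (h : Sup V k j) (ht : V k₀ = some t) (hg : t.Grows t') :
    Sup (Function.update V k₀ (some t')) k j := by
  rcases h with ⟨u, hu, hd, r, hr, e⟩ | ⟨z, hz, hd, n, hn, hj⟩
  · by_cases hk : j = k₀
    · subst hk
      rw [ht, Option.some_inj] at hu
      subst hu
      obtain ⟨r', hr', e'⟩ := hg.lr r hr
      exact .inl ⟨t', by simp, fun h => hd (hg.done.1 h), r', hr', e'.trans e⟩
    · exact .inl ⟨u, update_some.2 (.inr ⟨hk, hu⟩), hd, r, hr, e⟩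
  · by_cases hk : k = k₀
    · subst hk
      rw [ht, Option.some_inj] at hz
      subst hz
      obtain ⟨n', hn', -, e'⟩ := hg.loop n hn
      exact .inr ⟨t', by simp, fun h => hd (hg.done.1 h), n', hn', e' j hj⟩
    · exact .inr ⟨z, update_some.2 (.inr ⟨hk, hz⟩), hd, n, hn, hj⟩

theorem ChildDone.update (h : ChildDone V k) (ht : V k₀ = some t) (hd : t'.Done ↔ t.Done) :
    ChildDone (Function.update V k₀ (some t')) k := by
  intro z hz
  rcases update_some.1 hz with ⟨rfl, rfl⟩ | ⟨-, hz⟩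
  · exact hd.2 (h t ht)
  · exact h z hz

theorem NodeOK.frame {n : Node S C} (h : NodeOK V tr ph i k n)
    (hc : msgCount tr' n.id = msgCount tr n.id) (hm : ∀ m ∈ tr, m.id = n.id → m ∈ tr')
    (hp : Idle V tr ph n.id ∨ (ph' k).pending = (ph k).pending) (hb : Busy V' ph' n.id ↔ Busy V ph n.id)
    (hwv : Busy V ph n.id → (ph' n.id).wave = (ph n.id).wave)
    (hcd : ChildDone V n.id → ChildDone V' n.id)
    (hcl : ∀ J, ¬ Busy V ph n.id → ChildLoops V n.id J → ChildLoops V' n.id J)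
    (hs : ∀ j, j <+: k → Sup V n.id j → Sup V' n.id j) : NodeOK V' tr' ph' i k n where
  answer := h.answer
  disposed hst := by
    obtain ⟨h1, h2⟩ := h.disposed hst
    exact ⟨hc.trans h1, hcd h2⟩
  active hst := by
    rcases h.active hst with ⟨d, r, h1, h2, h3⟩ | ⟨h1, h2, h3⟩ | ⟨d, r, h1, h2, h3, h4, h5⟩
    · exact .inl ⟨d, r, hm _ h1 h2, h2, hc.trans h3⟩
    · exact .inr (.inl ⟨hb.2 h1, hc.trans h2, (hwv h1).trans h3⟩)
    · refine .inr (.inr ⟨d, r, hm _ h1 h2, h2, hc.trans h3, fun hb' => h4 (hb.1 hb'), ?_⟩)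
      rcases h5 with ⟨h5, h6, h7⟩ | ⟨h5, h6, h7, h8⟩
      · exact .inl ⟨h5, h6, hcd h7⟩
      · exact .inr ⟨h5, h6, fun j hj => ⟨(h7 j hj).1, (h7 j hj).2.1,
          hs j (h7 j hj).2.1 (h7 j hj).2.2⟩, hcl _ h4 h8⟩
  loop ids hst := by
    rcases h.loop ids hst with ⟨⟨h1, h2⟩, h3⟩ | ⟨l, h1, h2, h3⟩
    · exact .inl ⟨⟨hc.trans h1, fun hb' => h2 (hb.1 hb')⟩, hcl _ h2 h3⟩
    · replace hp := hp.resolve_left fun hi => by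
        rcases h3 with ⟨h3, -⟩ | ⟨d, r, -, -, h3, -⟩
        · exact hi.2 h3
        · simp [hi.1] at h3
      refine .inr ⟨l, hp.trans h1, h2, ?_⟩
      rcases h3 with ⟨h3, h4, h5⟩ | ⟨d, r, h3, h4, h5, h6, h7, h8, h9⟩
      · exact .inl ⟨hb.2 h3, hc.trans h4, (hwv h3).trans h5⟩
      · exact .inr ⟨d, r, hm _ h3 h4, h4, hc.trans h5, fun hb' => h6 (hb.1 hb'), h7,
          fun j hj => ⟨(h8 j hj).1, (h8 j hj).2.1, hs j (h8 j hj).2.1 (h8 j hj).2.2⟩,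
          hcl _ h6 h9⟩

open scoped Classical in
theorem pendingCount_congr
    (h : ∀ n ∈ t.nodes, Idle V' tr' ph' n.id ↔ Idle V tr ph n.id) :
    pendingCount V' tr' ph' t = pendingCount V tr ph t := by
  unfold pendingCount
  refine List.countP_congr fun n hn => ?_
  simp [h n hn]

theorem PhaseOK.frame {p : Phase} (hp : PhaseOK V tr ph k t p)
    (h : ∀ n ∈ t.nodes, Idle V' tr' ph' n.id ↔ Idle V tr ph n.id) :
    PhaseOK V' tr' ph' k t p := by
  cases p with
  | quiet => exact ⟨hp.1, hp.2.1, fun n hn => (h n hn).2 (hp.2.2 n hn)⟩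
  | called l =>
    obtain ⟨h1, h2, h3, h4, h5⟩ := hp
    exact ⟨h1, h2, h3, h4, fun n hn => by rw [h n hn]; exact h5 n hn⟩
  | run w =>
    obtain ⟨h1, n, h2, h3, h4⟩ := hp
    exact ⟨h1, n, h2, h3, fun m hm hne => ⟨(h m hm).2 (h4 m hm hne).1, (h4 m hm hne).2⟩⟩
  | wait w l =>
    obtain ⟨h1, h2, h3, h4, h5⟩ := hp
    refine ⟨h1, h2, fun n hn hi => h3 n hn (fun hi' => hi ((h n hn).2 hi')), ?_, ?_⟩
    · rw [pendingCount_congr h]; exact h4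
    · rw [pendingCount_congr h]; exact h5
  | ready w => exact ⟨hp.1, fun n hn => ⟨(h n hn).2 (hp.2 n hn).1, (hp.2 n hn).2⟩⟩

/-- A change of a single table that neither completes it nor removes loops or lower requests. -/
theorem Inv.update (h : Inv V tr ph i a ret) (hw : WellFormed i a V tr)
    (hw' : WellFormed i a (Function.update V k₀ (some t')) tr')
    (ht : V k₀ = some t) (hg : t.Grows t') (hl : ¬ Dead V k₀ ∨ t.Done)
    (hresp : ∀ d q, .response d q ∈ tr → .response d q ∈ tr' ∨ ¬ Dead V k₀ ∧ ∃ x, q.id = k₀ ++ [x])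
    (hact : ∀ n ∈ t.nodes, n.status = .active → ∀ j d q, .response d q ∈ tr → q.id = n.id →
      j ∈ q.loops → ∃ n' ∈ t'.nodes, n'.id = n.id ∧ (n'.InLoop j ∨
        n'.status = .active ∧ ∃ d q, .response d q ∈ tr' ∧ q.id = n.id ∧ j ∈ q.loops))
    (hnew : ∀ m ∈ tr', m ∈ tr ∨ ∀ k x, m.id = k ++ [x] → ¬ Dead V k)
    (hown : ¬ t'.Done → LoopsOK (Function.update V k₀ (some t')) tr' i k₀ t')
    (hlower : ¬ t'.Done → ∀ r ∈ t'.lr, (∀ r' ∈ t.lr, r'.id ≠ r.id) →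
      LowerOK (Function.update V k₀ (some t')) tr' k₀ r.id)
    (hnode : ∀ k u, Function.update V k₀ (some t') k = some u → ¬ Dead V k → ∀ n ∈ u.nodes,
      NodeOK (Function.update V k₀ (some t')) tr' ph' i k n)
    (hphase : ∀ k u, Function.update V k₀ (some t') k = some u → ¬ Dead V k →
      PhaseOK (Function.update V k₀ (some t')) tr' ph' k u (ph' k))
    (htop : ∃ t, Function.update V k₀ (some t') i = some t ∧ TopOK tr' i a ret' t) :
    Inv (Function.update V k₀ (some t')) tr' ph' i a ret' := by
  have hdead : ∀ {k}, Dead (Function.update V k₀ (some t')) k ↔ Dead V k := dead_update ht hg.done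
  constructor
  · intro k u hu hd
    rcases update_some.1 hu with ⟨rfl, rfl⟩ | ⟨hk, hu'⟩
    · exact hown hd
    have hlo := h.loops hu' hd
    refine ⟨hlo.counter, hlo.pre, hlo.nonempty, fun n hn j hj => ?_⟩
    rcases hlo.sup n hn j hj with hs | ⟨hs, d, q, hq, e⟩
    · exact .inl (hs.update ht hg)
    · refine .inr ⟨hdead.2 hs, d, q, ?_, e⟩
      rcases hresp d q hq with hq | ⟨hl', x, hx⟩
      · exact hq
      · obtain ⟨y, hy⟩ := hw.node hu' hn
        rw [← e, hx] at hy
        exact absurd (List.append_inj' hy rfl).1.symm hk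
  · have key : ∀ k l, LowerOK V tr k l → (∃ c, Addr i a V l c) →
        LowerOK (Function.update V k₀ (some t')) tr' k l := by
      intro k l hlo ⟨c, ha⟩ k' v hv n hn e
      rcases update_some.1 hv with ⟨rfl, rfl⟩ | ⟨hk', hv'⟩
      · obtain ⟨y, hy⟩ := hw'.node hv hn
        rw [← e, hy] at ha
        obtain ⟨-, n₀, hn₀, e₀, -⟩ := hw.addr_node ht ha
        have e₁ : n₀.id = n.id := e₀.trans hy.symm
        rcases hlo _ _ ht n₀ hn₀ (e₁.trans e) with ⟨h1, h2⟩ | ⟨h1, h2⟩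
        · exact .inl ⟨hg.done.2 h1, hdead.2 h2⟩
        · refine .inr ⟨fun hd => h1 (hg.done.1 hd), ?_⟩
          rcases h2 with h2 | ⟨h2, d, q, hq, eq, hkq⟩
          · obtain ⟨n', hn', en, hnl⟩ := hg.loop n₀ hn₀
            obtain rfl := node_id_inj (hw'.nodup hv) hn' hn (en.trans e₁)
            exact .inl (hnl _ h2)
          · obtain ⟨n', hn', en, hnl⟩ := hact n₀ hn₀ h2 k d q hq (eq.trans (e₁.trans e).symm) hkq
            obtain rfl := node_id_inj (hw'.nodup hv) hn' hn (en.trans e₁)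
            rw [e₁, e] at hnl
            exact hnl
      · rcases hlo _ _ hv' n hn e with ⟨h1, h2⟩ | ⟨h1, h2⟩
        · exact .inl ⟨h1, hdead.2 h2⟩
        · refine .inr ⟨h1, ?_⟩
          rcases h2 with h2 | ⟨h2, d, q, hq, eq, hkq⟩
          · exact .inl h2
          · refine .inr ⟨h2, d, q, ?_, eq, hkq⟩
            rcases hresp d q hq with hq | ⟨hl', x, hx⟩
            · exact hq
            · obtain ⟨y, hy⟩ := hw.node hv' hn
              rw [e, ← eq, hx] at hy
              exact absurd (List.append_inj' hy rfl).1.symm hk'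
    intro k u hu hd r hr
    rcases update_some.1 hu with ⟨rfl, rfl⟩ | ⟨hk, hu'⟩
    · by_cases hr' : ∃ r' ∈ t.lr, r'.id = r.id
      · obtain ⟨r', hr', e⟩ := hr'
        rw [← e]
        exact key _ _ (h.lower ht (fun h => hd (hg.done.2 h)) r' hr') ⟨_, (hw.lr ht hr').1⟩
      · push Not at hr'
        exact hlower hd r hr hr'
    · exact key _ _ (h.lower hu' hd r hr) ⟨_, (hw.lr hu' hr).1⟩
  · intro k u hu hd m hm ⟨x, hx⟩
    rw [hdead] at hd
    rcases hnew m hm with hm | hm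
    · rcases update_some.1 hu with ⟨rfl, rfl⟩ | ⟨hk, hu'⟩
      · have htd := hl.resolve_left (not_not.2 hd)
        obtain ⟨d, r, e, -⟩ := h.deadMsg ht hd m hm ⟨x, hx⟩
        exact ⟨d, r, e, fun h => absurd (hg.done.2 htd) h⟩
      · exact h.deadMsg hu' hd m hm ⟨x, hx⟩
    · exact absurd hd (hm k x hx)
  · intro k u hu hnd hd
    rw [hdead] at hd
    rcases update_some.1 hu with ⟨rfl, rfl⟩ | ⟨hk, hu'⟩
    · exact absurd (hg.done.2 (hl.resolve_left (not_not.2 hd))) hnd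
    · have hz := h.zombie hu' hnd hd
      exact ⟨hz.resting, fun n hn j hj => hdead.2 (hz.loops n hn j hj),
        fun n hn hc => hz.child n hn fun hc' => hc (hc'.update ht hg.done)⟩
  · intro k u hu hd
    rw [hdead] at hd
    exact hnode k u hu hd
  · intro k u hu hd
    rw [hdead] at hd
    exact hphase k u hu hd
  · exact htop

theorem busy_update_iff (ht : V k₀ = some t) (hd : t'.Done ↔ t.Done)
    (hq : ph' k₀ = .quiet ↔ ph k₀ = .quiet) (hph : k ≠ k₀ → ph' k = ph k) :
    Busy (Function.update V k₀ (some t')) ph' k ↔ Busy V ph k := by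
  by_cases hk : k = k₀
  · subst hk
    simp [Busy, ht, hd, hq]
  · simp [Busy, hk, hph hk]

/-- A change of a live table that concerns only itself and the messages for its nodes, and does
not affect how its requester sees it. -/
theorem Inv.update_own (h : Inv V tr ph i a ret) (hw : WellFormed i a V tr)
    (hw' : WellFormed i a (Function.update V k₀ (some t')) tr')
    (ht : V k₀ = some t) (hl : ¬ Dead V k₀) (hg : t.Grows t') {p : Phase}
    (hq : ph k₀ ≠ .quiet) (hq' : p ≠ .quiet) (hwave : p.wave = (ph k₀).wave)
    (hmsg : ∀ m : Message S C, (¬ ∃ x, m.id = k₀ ++ [x]) → (m ∈ tr' ↔ m ∈ tr))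
    (hcnt : ∀ j, (¬ ∃ x, j = k₀ ++ [x]) → msgCount tr' j = msgCount tr j)
    (hact : ∀ n ∈ t.nodes, n.status = .active → ∀ j d q, .response d q ∈ tr → q.id = n.id →
      j ∈ q.loops → ∃ n' ∈ t'.nodes, n'.id = n.id ∧ (n'.InLoop j ∨
        n'.status = .active ∧ ∃ d q, .response d q ∈ tr' ∧ q.id = n.id ∧ j ∈ q.loops))
    (hlr : t'.lr = t.lr)
    (hown : LoopsOK (Function.update V k₀ (some t')) tr' i k₀ t')
    (hnode : ∀ n ∈ t'.nodes,
      NodeOK (Function.update V k₀ (some t')) tr' (Function.update ph k₀ p) i k₀ n)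
    (hphase : PhaseOK (Function.update V k₀ (some t')) tr' (Function.update ph k₀ p) k₀ t' p) :
    Inv (Function.update V k₀ (some t')) tr' (Function.update ph k₀ p) i a ret := by
  have htd := not_done_of_not_dead ht hl
  have htd' : ¬ t'.Done := fun h => htd (hg.done.1 h)
  have hph : ∀ {k}, k ≠ k₀ → Function.update ph k₀ p k = ph k :=
    fun hk => Function.update_of_ne hk _ _
  have hbusy : ∀ {k}, Busy (Function.update V k₀ (some t')) (Function.update ph k₀ p) k ↔
      Busy V ph k := by
    intro k
    refine busy_update_iff ht hg.done ?_ hph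
    simp [hq, hq']
  have hnc : ∀ {k u n}, V k = some u → k ≠ k₀ → n ∈ u.nodes → ¬ ∃ x, n.id = k₀ ++ [x] := by
    rintro k u n hu hk hn ⟨x, hx⟩
    obtain ⟨y, hy⟩ := hw.node hu hn
    rw [hx] at hy
    exact hk (List.append_inj' hy rfl).1.symm
  refine h.update hw hw' ht hg (.inl hl) ?_ hact ?_ (fun _ => hown)
    (fun _ r hr hr' => absurd rfl (hr' r (hlr ▸ hr))) ?_ ?_ ?_
  · intro d q hq
    by_cases hx : ∃ x, q.id = k₀ ++ [x]
    · exact .inr ⟨hl, hx⟩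
    · exact .inl ((hmsg (.response d q) hx).2 hq)
  · intro m hm
    by_cases hx : ∃ x, m.id = k₀ ++ [x]
    · obtain ⟨x, hx⟩ := hx
      refine .inr fun k y hy => ?_
      rw [hx] at hy
      rwa [← (List.append_inj' hy rfl).1]
    · exact .inl ((hmsg m hx).1 hm)
  · intro k u hu hd n hn
    rcases update_some.1 hu with ⟨rfl, rfl⟩ | ⟨hk, hu'⟩
    · exact hnode n hn
    · have hx := hnc hu' hk hn
      refine (h.node hu' hd n hn).frame (hcnt _ hx)
        (fun m hm e => (hmsg m (by rwa [e])).2 hm) (.inr (by rw [hph hk])) hbusy ?_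
        (fun hc => hc.update ht hg.done) ?_ (fun j _ hs => hs.update ht hg)
      · intro _
        by_cases e : n.id = k₀
        · rw [e, Function.update_self, hwave]
        · rw [hph e]
      · intro J hb hc z hz
        rcases update_some.1 hz with ⟨e, rfl⟩ | ⟨-, hz⟩
        · exact absurd ⟨t, e ▸ ht, htd, e ▸ hq⟩ hb
        · exact hc z hz
  · intro k u hu hd
    rcases update_some.1 hu with ⟨rfl, rfl⟩ | ⟨hk, hu'⟩
    · rw [Function.update_self]
      exact hphase
    · rw [hph hk]
      refine (h.phase hu' hd).frame fun n hn => ?_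
      unfold Idle
      rw [hbusy, hcnt _ (hnc hu' hk hn)]
  · obtain ⟨u, hu, htop⟩ := h.top
    have hi : ¬ ∃ x, i = k₀ ++ [x] := by
      rintro ⟨x, hx⟩
      exact concat_ne_of_prefix (hw.pre ht) hx.symm
    have key : ∀ v : Table S C, (v.Done ↔ u.Done) → TopOK tr' i a ret v := by
      intro v hv
      unfold TopOK
      rw [hv, hcnt i hi]
      rcases htop with h | ⟨h1, ans, h2, h3, h4⟩ | h
      · exact .inl h
      · exact .inr (.inl ⟨h1, ans, h2, h3, (hmsg (.response a ⟨i, ans, .disposed, ∅⟩) hi).2 h4⟩)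
      · exact .inr (.inr h)
    by_cases hk : i = k₀
    · subst hk
      rw [ht, Option.some_inj] at hu
      subst hu
      exact ⟨t', by simp, key t' hg.done⟩
    · exact ⟨u, update_some.2 (.inr ⟨hk, hu⟩), key u Iff.rfl⟩

end

end GEM

namespace GEM

variable {S C : Type*}

section

variable {i : Identifier} {a : C} {V V' : Identifier → Option (Table S C)}
  {tr tr' : Multiset (Message S C)} {ph ph' : Identifier → Phase} {k k₀ j : Identifier}
  {t t' : Table S C} {ret ret' : List (C × Response S C)}

/-! ### Activating a node -/

theorem LoopsOK.transfer (h : LoopsOK V tr i k₀ t) (ht : V k₀ = some t) (hl : ¬ Dead V k₀)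
    (hg : t.Grows t')
    (hn : ∀ n ∈ t'.nodes, n.Looping → ∃ m ∈ t.nodes, m.id = n.id ∧ m.status = n.status)
    (hag : ∀ j, t'.activeGoals j ≠ none ↔ t.activeGoals j ≠ none) :
    LoopsOK (Function.update V k₀ (some t')) tr' i k₀ t' := by
  have hin : ∀ n ∈ t'.nodes, ∀ j, n.InLoop j → ∃ m ∈ t.nodes, m.id = n.id ∧ m.InLoop j := by
    intro n hn' j hj
    obtain ⟨m, hm, h1, h2⟩ := hn n hn' hj.looping
    exact ⟨m, hm, h1, by unfold Node.InLoop; rw [h2]; exact hj⟩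
  refine ⟨fun j => ?_, fun n hn' j hj => ?_, fun n hn' hlo => ?_, fun n hn' j hj => ?_⟩
  · rw [hag, h.counter]
    constructor
    · rintro ⟨n, hn', hj⟩
      obtain ⟨n', h1, -, h2⟩ := hg.loop n hn'
      exact ⟨n', h1, h2 j hj⟩
    · rintro ⟨n, hn', hj⟩
      obtain ⟨m, hm, -, hj⟩ := hin n hn' j hj
      exact ⟨m, hm, hj⟩
  · obtain ⟨m, hm, -, hj⟩ := hin n hn' j hj
    exact h.pre m hm j hj
  · obtain ⟨m, hm, h1, h2⟩ := hn n hn' hlo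
    obtain ⟨j, hj⟩ := h.nonempty m hm (by unfold Node.Looping; rw [h2]; exact hlo)
    exact ⟨j, by unfold Node.InLoop; rw [← h2]; exact hj⟩
  · obtain ⟨m, hm, e, hj⟩ := hin n hn' j hj
    rcases h.sup m hm j hj with hs | ⟨hd, -⟩
    · rw [← e]
      exact .inl (hs.update ht hg)
    · exact absurd hd hl

/-- A node for which no message is received or sent. -/
theorem NodeOK.own_frame {n : Node S C} (h : NodeOK V tr ph i k₀ n) (ht : V k₀ = some t)
    (hg : t.Grows t') {p : Phase} (hid : ∃ x, n.id = k₀ ++ [x])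
    (hc : msgCount tr' n.id = msgCount tr n.id)
    (hm : ∀ m ∈ tr, m.id = n.id → m ∈ tr')
    (hp : Idle V tr ph n.id ∨ p.pending = (ph k₀).pending) :
    NodeOK (Function.update V k₀ (some t')) tr' (Function.update ph k₀ p) i k₀ n := by
  have hne : n.id ≠ k₀ := by
    obtain ⟨x, hx⟩ := hid
    rw [hx]
    exact concat_ne_of_prefix List.prefix_rfl
  refine h.frame hc hm (by rwa [Function.update_self]) (by simp [Busy, hne]) (by simp [hne])
    (by simp [ChildDone, hne]) (by simp [ChildLoops, hne]) (fun j _ hs => hs.update ht hg)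

theorem idle_own {n : Node S C} {p : Phase} (hid : ∃ x, n.id = k₀ ++ [x])
    (hc : msgCount tr' n.id = msgCount tr n.id) :
    Idle (Function.update V k₀ (some t')) tr' (Function.update ph k₀ p) n.id ↔
      Idle V tr ph n.id := by
  have hne : n.id ≠ k₀ := by
    obtain ⟨x, hx⟩ := hid
    rw [hx]
    exact concat_ne_of_prefix List.prefix_rfl
  simp [Idle, Busy, hne, hc]

theorem Table.Selects.grows {pre post : List (Node S C)} {n : Node S C}
    (hs : t.Selects pre n post) {st : NodeStatus} (hn : t'.nodes = pre ++ { n with status := st } :: post)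
    (hlr : t'.lr = t.lr) (hd : t'.Done ↔ t.Done) : t.Grows t' where
  done := hd
  lr r hr := ⟨r, hlr ▸ hr, rfl⟩
  loop m hm := by
    rw [hs.1] at hm
    rw [hn]
    rcases List.mem_append.1 hm with hm | hm
    · exact ⟨m, List.mem_append_left _ hm, rfl, fun _ h => h⟩
    · rcases List.mem_cons.1 hm with rfl | hm
      · refine ⟨{ m with status := st }, by simp, rfl, fun j ⟨ids, h, _⟩ => ?_⟩
        rw [hs.2.1] at h
        cases h
      · exact ⟨m, List.mem_append_right _ (List.mem_cons_of_mem _ hm), rfl, fun _ h => h⟩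

theorem Table.Selects.mem_activate {pre post : List (Node S C)} {n : Node S C}
    (hs : t.Selects pre n post) (hnd : (t.nodes.map Node.id).Nodup) {st : NodeStatus} {m : Node S C}
    (hm : m ∈ pre ++ { n with status := st } :: post) :
    m = { n with status := st } ∨ m ∈ t.nodes ∧ m.id ≠ n.id := by
  rw [hs.1, List.map_append, List.map_cons, List.nodup_append, List.nodup_cons] at hnd
  rcases List.mem_append.1 hm with hm | hm
  · exact .inr ⟨by simp [hs.1, hm], hnd.2.2 _ (List.mem_map_of_mem hm) _ List.mem_cons_self⟩
  · rcases List.mem_cons.1 hm with rfl | hm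
    · exact .inl rfl
    · refine .inr ⟨by simp [hs.1, hm], fun e => hnd.2.1.1 ?_⟩
      rw [← e]
      exact List.mem_map_of_mem hm

theorem Table.activate_done {pre post : List (Node S C)} {n : Node S C} {st : NodeStatus} :
    (t.activate pre n post st).Done ↔ t.Done := by
  unfold Done activate
  dsimp only
  split_ifs with h <;> simp [h]

theorem Table.useFact_done {pre post : List (Node S C)} {n : Node S C} :
    (t.useFact pre n post).Done ↔ t.Done := by
  unfold Done
  rw [(t.useFact_fields pre post n).2.2.2.2.2.2.1]
  exact activate_done

/-- The status of the root after activating a node. -/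
theorem Table.rootReady_activate {pre post : List (Node S C)} {n : Node S C} {st : NodeStatus}
    {w : Option Identifier} (h : t.RootReady k w ∨ w = none ∧ t.rootStatus = .new)
    (hr : t'.rootStatus = (t.activate pre n post st).rootStatus)
    (hag : t'.activeGoals = t.activeGoals) : t'.RootReady k w := by
  rcases h with h | ⟨rfl, h⟩
  · have hne : t.rootStatus ≠ .new := by
      cases w with
      | none => rcases h with h | ⟨h, -⟩ <;> simp [h]
      | some l => rcases h with ⟨-, -, h | ⟨h, -⟩⟩ <;> simp [h]
    have : t'.rootStatus = t.rootStatus := by rw [hr]; simp [activate, hne]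
    unfold RootReady
    rw [this, hag]
    exact h
  · left
    rw [hr]
    simp [activate, h]

section

variable (h : Inv V tr ph i a ret) (hw : WellFormed i a V tr) (ht : V k₀ = some t)
  (hl : ¬ Dead V k₀) {w : Option Identifier} (hp : ph k₀ = .ready w)
  {pre post : List (Node S C)} {n : Node S C} (hs : t.Selects pre n post)

include h hw ht hl hp hs

theorem Inv.useFact (hb : n.body = []) :
    Inv (Function.update V k₀ (some (t.useFact pre n post))) tr ph i a ret := by
  obtain ⟨-, -, f3, f4, f5, f6, f7, f8⟩ := t.useFact_fields pre post n
  have hg : t.Grows (t.useFact pre n post) := hs.grows f8 f4 Table.useFact_done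
  have hph := h.phase ht hl
  rw [hp] at hph
  have hlo := h.loops ht (not_done_of_not_dead ht hl)
  have hmem : ∀ m ∈ (t.useFact pre n post).nodes,
      m = { n with status := .answer } ∨ m ∈ t.nodes ∧ m.id ≠ n.id := by
    rw [f8]
    exact fun m hm => hs.mem_activate (hw.nodup ht) hm
  have hph' : Function.update ph k₀ (.ready w) = ph := by rw [← hp, Function.update_eq_self]
  have hnew := hw.idle_of_new (ph := ph) ht hs.mem hs.2.1
  have key := h.update_own hw (hw.useFact ht hs) (p := .ready w) ht hl hg (by simp [hp]) (by simp)
    (by rw [hp]) (fun _ _ => Iff.rfl) (fun _ _ => rfl) ?_ f4 ?_ ?_ ?_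
  · rwa [hph'] at key
  · intro m hm hst
    exact absurd hst (hph.2 m hm).2
  · refine hlo.transfer ht hl hg (fun m hm hlp => ?_) (fun j => by rw [f6])
    rcases hmem m hm with rfl | ⟨hm, -⟩
    · obtain ⟨ids, e⟩ := hlp; cases e
    · exact ⟨m, hm, rfl, rfl⟩
  · intro m hm
    rcases hmem m hm with rfl | ⟨hm, -⟩
    · exact ⟨fun _ => hb, by simp, by simp, by simp⟩
    · exact (h.node ht hl m hm).own_frame ht hg (hw.node ht hm) rfl (fun _ h _ => h)
        (.inl (hph.2 m hm).1)
  · refine ⟨.inl (Table.rootReady_activate hph.1 f7 f6), fun m hm => ?_⟩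
    rcases hmem m hm with rfl | ⟨hm, -⟩
    · exact ⟨(idle_own (n := n) (hw.node ht hs.mem) rfl).2 hnew, by simp⟩
    · exact ⟨(idle_own (hw.node ht hm) rfl).2 (hph.2 m hm).1, (hph.2 m hm).2⟩

theorem Inv.sendRequest {B : Atom S C} (hb : n.body ≠ []) (c : C) :
    Inv (Function.update V k₀ (some (t.activate pre n post .active)))
      (.request c ⟨n.id, t.owner, B⟩ ::ₘ tr) (Function.update ph k₀ (.run w)) i a ret := by
  have hg : t.Grows (t.activate pre n post .active) := hs.grows rfl rfl Table.activate_done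
  have hph := h.phase ht hl
  rw [hp] at hph
  have hlo := h.loops ht (not_done_of_not_dead ht hl)
  have hmem : ∀ m ∈ (t.activate pre n post .active).nodes,
      m = { n with status := .active } ∨ m ∈ t.nodes ∧ m.id ≠ n.id :=
    fun m hm => hs.mem_activate (hw.nodup ht) hm
  have hnew := hw.idle_of_new (ph := ph) ht hs.mem hs.2.1
  obtain ⟨x, hx⟩ := hw.node ht hs.mem
  have hcnt : ∀ j, j ≠ n.id → msgCount (.request c ⟨n.id, t.owner, B⟩ ::ₘ tr) j = msgCount tr j := by
    intro j hj
    simp [msgCount_cons, Message.id, hj]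
  refine h.update_own hw (hw.sendRequest ht hs hb c) (p := .run w) ht hl hg (by simp [hp])
    (by simp) (by rw [hp]; rfl) ?_ ?_ ?_ rfl ?_ ?_ ?_
  · intro m hm
    rw [Multiset.mem_cons, or_iff_right]
    rintro rfl
    exact hm ⟨x, hx⟩
  · intro j hj
    exact hcnt j fun e => hj ⟨x, e.trans hx⟩
  · intro m hm hst
    exact absurd hst (hph.2 m hm).2
  · refine hlo.transfer ht hl hg (fun m hm hlp => ?_) (fun j => Iff.rfl)
    rcases hmem m hm with rfl | ⟨hm, -⟩
    · obtain ⟨ids, e⟩ := hlp; cases e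
    · exact ⟨m, hm, rfl, rfl⟩
  · intro m hm
    rcases hmem m hm with rfl | ⟨hm, hne⟩
    · refine ⟨by simp, by simp, fun _ => .inl ⟨_, _, Multiset.mem_cons_self _ _, rfl, ?_⟩, by simp⟩
      simp [msgCount_cons, Message.id, hnew.1]
    · exact (h.node ht hl m hm).own_frame ht hg (hw.node ht hm) (hcnt _ hne)
        (fun _ h _ => Multiset.mem_cons_of_mem h) (.inl (hph.2 m hm).1)
  · refine ⟨Table.rootReady_activate hph.1 rfl rfl, { n with status := .active },
      by simp [Table.activate], rfl, fun m hm hne => ?_⟩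
    rcases hmem m hm with rfl | ⟨hm, hne⟩
    · exact absurd rfl hne
    · exact ⟨(idle_own (hw.node ht hm) (hcnt _ hne)).2 (hph.2 m hm).1, (hph.2 m hm).2⟩

end

end

end GEM

namespace GEM

variable {S C : Type*}

section

variable {i : Identifier} {a : C} {V V' : Identifier → Option (Table S C)}
  {tr tr' : Multiset (Message S C)} {ph ph' : Identifier → Phase} {k k₀ j : Identifier}
  {t t' : Table S C} {ret ret' : List (C × Response S C)}

/-! ### Starting an iteration -/

theorem ChildLoops.update {J : Set Identifier} (h : ChildLoops V k J) (ht : V k₀ = some t)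
    (hd : t'.Done ↔ t.Done) (hn : t'.nodes = t.nodes) :
    ChildLoops (Function.update V k₀ (some t')) k J := by
  intro z hz hzd n hm
  rcases update_some.1 hz with ⟨rfl, rfl⟩ | ⟨-, hz⟩
  · exact h t ht (fun e => hzd (hd.2 e)) n (hn ▸ hm)
  · exact h z hz hzd n hm

theorem msgCount_clients {rs : List (Request S C)} (hnd : (rs.map Request.id).Nodup)
    {st : ResponseStatus} {J : Set Identifier} (j : Identifier) [Decidable (∃ r ∈ rs, r.id = j)] :
    msgCount (tr + (↑(rs.map (t.answerTo st J)) : Multiset (Message S C))) j =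
      msgCount tr j + if ∃ r ∈ rs, r.id = j then 1 else 0 := by
  rw [msgCount_add]
  congr 1
  have : (Multiset.map Message.id ((rs.map (t.answerTo st J) : List (Message S C)) :
      Multiset (Message S C))) = (rs.map Request.id : List Identifier) := by
    rw [Multiset.map_coe, List.map_map]
    rfl
  unfold msgCount
  rw [this]
  split_ifs with h
  · obtain ⟨r, hr, rfl⟩ := h
    exact Multiset.count_eq_one_of_mem (Multiset.coe_nodup.2 hnd)
      (Multiset.mem_coe.2 (List.mem_map_of_mem hr))
  · refine Multiset.count_eq_zero.2 fun hm => h ?_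
    obtain ⟨r, hr, e⟩ := List.mem_map.1 (Multiset.mem_coe.1 hm)
    exact ⟨r, hr, e⟩

open scoped Classical in
/-- The phases after the start of an iteration of loop `k₀`. -/
noncomputable def iteratePhase (V : Identifier → Option (Table S C)) (ph : Identifier → Phase)
    (w : Option Identifier) (k₀ k : Identifier) : Phase :=
  if k = k₀ then .wait w k₀
  else if ∃ u, V k = some u ∧ ¬ Dead V k ∧ ∃ n ∈ u.nodes, n.InLoop k₀ then .called k₀
  else ph k

theorem Inv.iterate (h : Inv V tr ph i a ret) (hw : WellFormed i a V tr) (ht : V k₀ = some t)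
    (hl : ¬ Dead V k₀) {w : Option Identifier} (hp : ph k₀ = .ready w) (hu : t.HasUnsentAnswer)
    (hw' : WellFormed i a (Function.update V k₀ (some t.startIteration.1))
      (tr + t.startIteration.2)) :
    Inv (Function.update V k₀ (some t.startIteration.1)) (tr + t.startIteration.2)
      (iteratePhase V ph w k₀) i a ret := by
  classical
  have htd := not_done_of_not_dead ht hl
  have hroot := hw.root ht
  have hlrn := hw.lrNodup ht
  have hph := h.phase ht hl
  rw [hp] at hph
  obtain ⟨hrs, hidle⟩ := hph
  have hid : ∀ n ∈ t.nodes, Idle V tr ph n.id := fun n hn => (hidle n hn).1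
  have hlo := h.loops ht htd
  rw [t.startIteration_snd hlrn, hroot] at hw' ⊢
  have hfst := t.startIteration_fst
  rw [hroot] at hfst
  generalize t.startIteration.1 = t' at hfst hw' ⊢
  generalize hTR : (tr + (↑(t.lr.map (t.answerTo (.loop k₀) ∅)) : Multiset (Message S C))) = tr' at hw' ⊢
  have hnodes : t'.nodes = t.nodes := by rw [hfst]; rfl
  have hlr : t'.lr = t.lr := by rw [hfst]; rfl
  have hag : t'.activeGoals = Function.update t.activeGoals k₀ (some (t.loopCount k₀)) := by
    rw [hfst]
  have hrst : t'.rootStatus = t.rootStatus.addLoop k₀ := by rw [hfst]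
  have htd' : ¬ t'.Done := by
    unfold Table.Done
    rw [hrst]
    cases t.rootStatus <;> simp [NodeStatus.addLoop]
  have hdone : t'.Done ↔ t.Done := iff_of_false htd' htd
  have hg : t.Grows t' := ⟨hdone, fun r hr => ⟨r, hlr ▸ hr, rfl⟩,
    fun n hn => ⟨n, hnodes ▸ hn, rfl, fun _ h => h⟩⟩
  have hmono : ∀ m ∈ tr, m ∈ tr' := fun m hm => by
    rw [← hTR]; exact Multiset.mem_add.2 (.inl hm)
  have hnewm : ∀ m ∈ tr', m ∈ tr ∨ ∃ r ∈ t.lr, t.answerTo (.loop k₀) ∅ r = m := fun m hm => by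
    rw [← hTR, Multiset.mem_add] at hm
    exact hm.imp_right fun hm => List.mem_map.1 (Multiset.mem_coe.1 hm)
  have hsent : ∀ r ∈ t.lr, t.answerTo (.loop k₀) ∅ r ∈ tr' := fun r hr => by
    rw [← hTR]
    exact Multiset.mem_add.2 (.inr (Multiset.mem_coe.2 (List.mem_map_of_mem hr)))
  have hcnt : ∀ j, msgCount tr' j = msgCount tr j + if ∃ r ∈ t.lr, r.id = j then 1 else 0 := by
    intro j
    rw [← hTR]
    exact msgCount_clients hlrn j
  have hlow : ∀ r ∈ t.lr, ∀ x k, r.id = k ++ [x] → k₀ <+: k := by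
    intro r hr x k e
    obtain ⟨-, h1, h2⟩ := hw.lr ht hr
    rw [e] at h1 h2
    exact prefix_of_prefix_concat h1 h2
  set ph' := iteratePhase V ph w k₀ with hph'
  let Inn : Identifier → Prop := fun k =>
    ∃ u, V k = some u ∧ ¬ Dead V k ∧ ∃ n ∈ u.nodes, n.InLoop k₀
  have ph0 : ph' k₀ = .wait w k₀ := by simp [hph', iteratePhase]
  have ph1 : ∀ k, k ≠ k₀ → Inn k → ph' k = .called k₀ := fun k h1 h2 => by
    rw [hph', iteratePhase, if_neg h1, if_pos h2]
  have ph2 : ∀ k, k ≠ k₀ → ¬ Inn k → ph' k = ph k := fun k h1 h2 => by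
    rw [hph', iteratePhase, if_neg h1, if_neg h2]
  have hInpre : ∀ k, Inn k → k₀ <+: k := by
    rintro k ⟨u, hu, hd, n, hn, hj⟩
    exact ((h.loops hu (not_done_of_not_dead hu hd)).pre n hn _ hj).2
  have hbusy0 : Busy V ph k₀ := ⟨t, ht, htd, by simp [hp]⟩
  have hbusy0' : Busy (Function.update V k₀ (some t')) ph' k₀ := ⟨t', by simp, htd', by simp [ph0]⟩
  have hbusyIn : ∀ k, k ≠ k₀ → Inn k → Busy (Function.update V k₀ (some t')) ph' k := by
    intro k h1 h2
    obtain ⟨u, hu, hd, -⟩ := id h2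
    exact ⟨u, by simp [h1, hu], not_done_of_not_dead hu hd, by simp [ph1 k h1 h2]⟩
  have hbusyOut : ∀ k, k ≠ k₀ → ¬ Inn k →
      (Busy (Function.update V k₀ (some t')) ph' k ↔ Busy V ph k) := by
    intro k h1 h2
    simp [Busy, h1, ph2 k h1 h2]
  have hbelow : ∀ {k u}, V k = some u → k₀ <+: k → ¬ Dead V k → ∀ m ∈ u.nodes, m.id ≠ k₀ := by
    intro k u hu hk _ m hm
    obtain ⟨x, hx⟩ := hw.node hu hm
    rw [hx]
    exact concat_ne_of_prefix hk
  -- the nodes below the coordinator that are called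
  have key : ∀ {k u}, V k = some u → k₀ <+: k → ¬ Dead V k → ∀ m ∈ u.nodes,
      Idle V tr ph m.id ∧
      ((∃ r ∈ t.lr, r.id = m.id) ∧ V m.id = none ∨ (¬ ∃ r ∈ t.lr, r.id = m.id) ∧ Inn m.id ↔
        m.InLoop k₀) ∧
      ((∃ r ∈ t.lr, r.id = m.id) → V m.id = none) := by
    intro k u hu hk hd m hm
    have hi := h.idle_below hw ht hl hid hu hk hd m hm
    have hserve : (∃ r ∈ t.lr, r.id = m.id) → V m.id = none := by
      intro hr
      cases hz : V m.id with
      | none => rfl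
      | some z =>
        exact absurd (hw.serves ht hz (.inr (.inl hr)) (.inl (hw.root hz))).symm
          (hbelow hu hk hd m hm)
    refine ⟨hi, ⟨?_, fun hj => ?_⟩, hserve⟩
    · rintro (⟨⟨r, hr, e⟩, -⟩ | ⟨-, z, hz, hzd, n, hn, hj⟩)
      · obtain ⟨k', u', n, hu', -, -, hn, e', hj, -⟩ := h.lower_inLoop hw ht hl hid hr
        obtain ⟨-, -, rfl⟩ := hw.node_unique hu hu' hm hn (e.symm.trans e'.symm)
        exact hj
      · have hzd' := not_done_of_not_dead hz hzd
        obtain ⟨ids, hs, hc⟩ := hw.looping_of_idle hu hm (h.node hu hd m hm) hi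
          fun hc => hzd' (hc z hz)
        exact ⟨ids, hs, hc z hz hzd' n hn _ hj (hbelow hu hk hd m hm).symm⟩
    · by_cases hr : ∃ r ∈ t.lr, r.id = m.id
      · exact .inl ⟨hr, hserve hr⟩
      · rcases (h.loops hu (not_done_of_not_dead hu hd)).sup m hm _ hj with hs | ⟨hd', -⟩
        · rcases hs with ⟨v, hv, -, hr'⟩ | ⟨z, hz, hzd, n, hn, hj'⟩
          · rw [ht, Option.some_inj] at hv
            subst hv
            exact absurd hr' hr
          · refine .inr ⟨hr, z, hz, fun hd' => hd ?_, n, hn, hj'⟩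
            obtain ⟨x, hx⟩ := hw.node hu hm
            rw [hx] at hd' hz
            exact hd'.parent fun z' hz' => by
              rw [hz, Option.some_inj] at hz'
              exact hz' ▸ hzd
        · exact absurd hd' hd
  have hidle' : ∀ {k u}, V k = some u → k₀ <+: k → ¬ Dead V k → ∀ m ∈ u.nodes,
      (¬ Idle (Function.update V k₀ (some t')) tr' ph' m.id ↔ m.InLoop k₀) := by
    intro k u hu hk hd m hm
    obtain ⟨hi, h1, -⟩ := key hu hk hd m hm
    have hne := hbelow hu hk hd m hm
    rw [← h1]
    constructor
    · intro hn
      by_cases hr : ∃ r ∈ t.lr, r.id = m.id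
      · exact .inl ⟨hr, (key hu hk hd m hm).2.2 hr⟩
      · refine .inr ⟨hr, ?_⟩
        by_contra hIn
        refine hn ⟨?_, ?_⟩
        · rw [hcnt, if_neg hr, hi.1]
        · rw [hbusyOut _ hne hIn]; exact hi.2
    · rintro (⟨hr, -⟩ | ⟨-, hIn⟩) hi'
      · have := hi'.1
        rw [hcnt, if_pos hr] at this
        omega
      · exact hi'.2 (hbusyIn _ hne hIn)
  have houtside : ∀ {k u}, V k = some u → ¬ k₀ <+: k → ∀ m ∈ u.nodes,
      msgCount tr' m.id = msgCount tr m.id ∧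
      (Busy (Function.update V k₀ (some t')) ph' m.id ↔ Busy V ph m.id) ∧
      (ph' m.id).wave = (ph m.id).wave := by
    intro k u hu hk m hm
    obtain ⟨x, hx⟩ := hw.node hu hm
    have hr : ¬ ∃ r ∈ t.lr, r.id = m.id := by
      rintro ⟨r, hr, e⟩
      exact hk (hlow r hr x k (e.trans hx))
    refine ⟨by rw [hcnt, if_neg hr, add_zero], ?_⟩
    by_cases e : m.id = k₀
    · rw [e, ph0, hp]
      exact ⟨iff_of_true hbusy0' hbusy0, rfl⟩
    · have hIn : ¬ Inn m.id := by
        intro hIn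
        refine hk (prefix_of_prefix_concat (x := x) ?_ ?_)
        · rw [← hx]; exact hInpre _ hIn
        · rw [← hx]; exact Ne.symm e
      exact ⟨hbusyOut _ e hIn, by rw [ph2 _ e hIn]⟩
  have hloopk₀ : ∃ n ∈ t.nodes, n.InLoop k₀ := by
    obtain ⟨r, hr, -⟩ := hu
    obtain ⟨k', u, n, hu, hk', hd, hn, -, hj, -⟩ := h.lower_inLoop hw ht hl hid hr
    exact h.loop_below hw ht hl hid hu hk' hd hn hj List.prefix_rfl
  have hV' : ∀ {k u}, Function.update V k₀ (some t') k = some u → ∃ v, V k = some v ∧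
      v.nodes = u.nodes := by
    intro k u hu
    rcases update_some.1 hu with ⟨rfl, rfl⟩ | ⟨-, hu⟩
    · exact ⟨t, ht, hnodes.symm⟩
    · exact ⟨u, hu, rfl⟩
  refine h.update hw hw' ht hg (.inl hl) (fun d q hq => .inl (hmono _ hq)) ?_ ?_ ?_
    (fun _ r hr hr' => absurd rfl (hr' r (hlr ▸ hr))) ?_ ?_ ?_
  · intro n hn hst
    exact absurd hst (hidle n hn).2
  · intro m hm
    refine (hnewm m hm).imp_right ?_
    rintro ⟨r, hr, rfl⟩ k x hx
    obtain ⟨k', u, n, hu, hk', hd, hn, e, -⟩ := h.lower_inLoop hw ht hl hid hr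
    obtain ⟨y, hy⟩ := hw.node hu hn
    have : k' ++ [y] = k ++ [x] := by rw [← hy, e]; exact hx
    rwa [← (List.append_inj' this rfl).1]
  · intro _
    refine hlo.transfer ht hl hg (fun n hn _ => ⟨n, hnodes ▸ hn, rfl, rfl⟩) fun j => ?_
    rw [hag]
    by_cases e : j = k₀
    · subst e
      simp only [Function.update_self, ne_eq, reduceCtorEq, not_false_eq_true, true_iff]
      exact (hlo.counter _).2 hloopk₀
    · rw [Function.update_of_ne e]
  · intro k u hu hd n hn
    obtain ⟨v, hv, e⟩ := hV' hu
    rw [← e] at hn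
    have hok := h.node hv hd n hn
    by_cases hk : k₀ <+: k
    · obtain ⟨hi, h1, h2⟩ := key hv hk hd n hn
      have hi' := hidle' hv hk hd n hn
      have hne := hbelow hv hk hd n hn
      by_cases hj : n.InLoop k₀
      · obtain ⟨ids, hs, hj'⟩ := id hj
        refine ⟨by simp [hs], by simp [hs], by simp [hs], fun ids' hs' => .inr ⟨k₀, ?_, ?_, ?_⟩⟩
        · by_cases e : k = k₀
          · rw [e, ph0]; rfl
          · rw [ph1 k e ⟨v, hv, hd, n, hn, hj⟩]; rfl
        · rw [hs] at hs'; cases hs'; exact hj'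
        · rcases h1.2 hj with ⟨⟨r, hr, er⟩, hz⟩ | ⟨hr, hIn⟩
          · refine .inr ⟨r.requester, _, hsent r hr, er, ?_, ?_, rfl, by simp, ?_⟩
            · rw [hcnt, if_pos ⟨r, hr, er⟩, hi.1]
            · rintro ⟨z, hz', -⟩
              rw [Function.update_of_ne hne, hz] at hz'
              cases hz'
            · intro z hz'
              rw [Function.update_of_ne hne, hz] at hz'
              cases hz'
          · refine .inl ⟨hbusyIn _ hne hIn, ?_, by rw [ph1 _ hne hIn]; rfl⟩
            rw [hcnt, if_neg hr, hi.1]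
      · have hi'' := not_not.1 (fun hn => hj (hi'.1 hn))
        refine hok.frame (hi''.1.trans hi.1.symm) (fun m hm _ => hmono m hm) (.inl hi)
          (iff_of_false hi''.2 hi.2) (fun hb => absurd hb hi.2) (fun hc => hc.update ht hdone)
          (fun J _ hc => hc.update ht hdone hnodes) (fun j _ hs => hs.update ht hg)
    · obtain ⟨h1, h2, h3⟩ := houtside hv hk n hn
      have hkk : ph' k = ph k := by
        refine ph2 k ?_ fun hIn => hk (hInpre k hIn)
        rintro rfl
        exact hk List.prefix_rfl
      exact hok.frame h1 (fun m hm _ => hmono m hm) (.inr (by rw [hkk])) h2 (fun _ => h3)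
        (fun hc => hc.update ht hdone) (fun J _ hc => hc.update ht hdone hnodes)
        (fun j _ hs => hs.update ht hg)
  · intro k u hu hd
    rcases update_some.1 hu with ⟨rfl, rfl⟩ | ⟨hk, hu'⟩
    · rw [ph0]
      have hpc : (pendingCount (Function.update V k (some u)) tr' ph' u : ℤ) = t.loopCount k := by
        unfold pendingCount Table.loopCount
        rw [hnodes]
        congr 1
        refine List.countP_congr fun n hn => ?_
        simpa using hidle' ht List.prefix_rfl hl n hn
      refine ⟨?_, ?_, ?_, ?_, ?_⟩
      · unfold Table.RootWaiting
        rcases hrs with hrs | ⟨rfl, hrs⟩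
        · cases w with
          | none =>
            refine ⟨rfl, ?_⟩
            rcases hrs with hrs | ⟨hrs, -⟩ <;> simp [hrst, hrs, NodeStatus.addLoop]
          | some l =>
            obtain ⟨h1, h2, h3⟩ := hrs
            refine ⟨h1, .inr ⟨rfl, ?_, by rw [hag, Function.update_of_ne h1, h2]⟩⟩
            rcases h3 with h3 | ⟨h3, -⟩
            · rw [hrst, h3]
              simp [NodeStatus.addLoop, Set.pair_comm]
            · rw [hrst, h3]
              simp only [NodeStatus.addLoop]
              rw [Set.insert_eq_of_mem (by simp)]
        · exact ⟨rfl, by simp [hrst, hrs, NodeStatus.addLoop]⟩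
      · rw [hnodes]; exact fun n hn => (hidle n hn).2
      · rw [hnodes]
        exact fun n hn hi => (hidle' ht List.prefix_rfl hl n hn).1 hi
      · rw [hag, Function.update_self, hpc]
      · rw [← Int.natCast_pos, hpc]
        unfold Table.loopCount
        rw [Int.natCast_pos, List.countP_pos_iff]
        simpa using hloopk₀
    · have hphk := h.phase hu' hd
      by_cases hb : k₀ <+: k
      · have hq := h.quiet_below hw ht hl hid hu' hb hk hd
        rw [hq] at hphk
        by_cases hIn : Inn k
        · rw [ph1 k hk hIn]
          obtain ⟨v, hv, -, hn⟩ := hIn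
          rw [hu', Option.some_inj] at hv
          subst hv
          exact ⟨hphk.1, hphk.2.1, Ne.symm hk, hn, hidle' hu' hb hd⟩
        · rw [ph2 k hk hIn, hq]
          refine ⟨hphk.1, hphk.2.1, fun n hn => ?_⟩
          by_contra hc
          exact hIn ⟨u, hu', hd, n, hn, (hidle' hu' hb hd n hn).1 hc⟩
      · rw [ph2 k hk fun hIn => hb (hInpre k hIn)]
        refine hphk.frame fun n hn => ?_
        obtain ⟨h1, h2, -⟩ := houtside hu' hb n hn
        unfold Idle
        rw [h1, h2]
  · obtain ⟨u, hu, htop⟩ := h.top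
    have hi0 : msgCount tr' i = msgCount tr i := by
      rw [hcnt, if_neg, add_zero]
      rintro ⟨r, hr, e⟩
      obtain ⟨-, h1, h2⟩ := hw.lr ht hr
      rw [e] at h1 h2
      exact h2 (prefix_antisymm h1 (hw.pre ht))
    have aux : ∀ v : Table S C, (v.Done ↔ u.Done) → TopOK tr' i a ret v := by
      intro v hv
      unfold TopOK
      rw [hv, hi0]
      rcases htop with h | ⟨h1, ans, h2, h3, h4⟩ | h
      · exact .inl h
      · exact .inr (.inl ⟨h1, ans, h2, h3, hmono _ h4⟩)
      · exact .inr (.inr h)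
    by_cases hk : i = k₀
    · subst hk
      rw [ht, Option.some_inj] at hu
      subst hu
      exact ⟨t', by simp, aux t' hdone⟩
    · exact ⟨u, update_some.2 (.inr ⟨hk, hu⟩), aux u Iff.rfl⟩

end

end GEM

namespace GEM

variable {S C : Type*}

section

variable {i : Identifier} {a : C} {V V' : Identifier → Option (Table S C)}
  {tr tr' : Multiset (Message S C)} {ph ph' : Identifier → Phase} {k k₀ j : Identifier}
  {t t' : Table S C} {ret ret' : List (C × Response S C)}

/-! ### Answering the higher request -/

theorem Inv.top_update (h : Inv V tr ph i a ret) (ht : V k₀ = some t) (hd : t'.Done ↔ t.Done)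
    (hc : msgCount tr' i = msgCount tr i) (hm : ∀ m ∈ tr, m.id = i → m ∈ tr') :
    ∃ t, Function.update V k₀ (some t') i = some t ∧ TopOK tr' i a ret t := by
  obtain ⟨u, hu, htop⟩ := h.top
  have aux : ∀ v : Table S C, (v.Done ↔ u.Done) → TopOK tr' i a ret v := by
    intro v hv
    unfold TopOK
    rw [hv, hc]
    rcases htop with h | ⟨h1, ans, h2, h3, h4⟩ | h
    · exact .inl h
    · exact .inr (.inl ⟨h1, ans, h2, h3, hm _ h4 rfl⟩)
    · exact .inr (.inr h)
  by_cases hk : i = k₀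
  · subst hk
    rw [ht, Option.some_inj] at hu
    subst hu
    exact ⟨t', by simp, aux t' hd⟩
  · exact ⟨u, update_some.2 (.inr ⟨hk, hu⟩), aux u Iff.rfl⟩

/-- The node that waits for the response of a table. -/
theorem Inv.busy_parent (h : Inv V tr ph i a ret) (hw : WellFormed i a V tr) (ht : V k = some t)
    (hl : ¬ Dead V k) (hk : k ≠ i) (hq : ph k ≠ .quiet) :
    ∃ k' x u n, k = k' ++ [x] ∧ V k' = some u ∧ ¬ Dead V k' ∧ n ∈ u.nodes ∧ n.id = k ∧
      msgCount tr k = 0 ∧ (n.status = .active ∧ (ph k).wave = none ∨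
        ∃ ids l, n.status = .loop ids ∧ (ph k).wave = some l ∧ (ph k').pending = some l ∧
          l ∈ ids) := by
  obtain ⟨k', x, u, n, e, hu, hd, hn, hid, hok⟩ := h.live_parent hw ht hl hk
  have htd := not_done_of_not_dead ht hl
  have hbusy : Busy V ph n.id := hid ▸ ⟨t, ht, htd, hq⟩
  obtain ⟨c, hc⟩ := hw.servesAddr ht (.inl (hw.root ht))
  rw [← hid] at hc
  obtain ⟨-, h1, h2⟩ := hw.addr_of_mem hu hn hc
  refine ⟨k', x, u, n, e, hu, hd, hn, hid, ?_⟩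
  cases hs : n.status with
  | new => exact absurd hs h2
  | answer => exact absurd (hok.answer hs) h1
  | disposed => exact absurd ((hok.disposed hs).2 t (hid ▸ ht)) htd
  | active =>
    rcases hok.active hs with ⟨d, r, hr, e', -⟩ | ⟨-, h3, h4⟩ | ⟨d, r, -, -, -, h3, -⟩
    · have := hw.unserved hr
      rw [e', hid, ht] at this
      cases this
    · rw [hid] at h3 h4
      exact ⟨h3, .inl ⟨rfl, h4⟩⟩
    · exact absurd hbusy h3
  | loop ids =>
    rcases hok.loop ids hs with ⟨h3, -⟩ | ⟨l, h3, h4, ⟨-, h5, h6⟩ | ⟨d, r, -, -, -, h5, -⟩⟩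
    · exact absurd hbusy h3.2
    · rw [hid] at h5 h6
      exact ⟨h5, .inr ⟨ids, l, rfl, h6, h3, h4⟩⟩
    · exact absurd hbusy h5

theorem Table.loop_of_not_isLeader (hlo : LoopsOK V tr i k t) (hroot : t.rootId = k)
    (h : t.HasLoopNode) (hl : ¬ t.IsLeader) : ∃ n ∈ t.nodes, ∃ j, n.InLoop j ∧ j ≠ k := by
  by_contra hc
  push Not at hc
  refine hl fun j => ?_
  rw [hlo.counter, hroot]
  constructor
  · rintro ⟨n, hn, hj⟩
    exact hc n hn j hj
  · rintro rfl
    obtain ⟨n, hn, hl⟩ := h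
    obtain ⟨j, hj⟩ := hlo.nonempty n hn hl
    exact ⟨n, hn, hc n hn j hj ▸ hj⟩

theorem Table.mem_higherLoops (hlo : LoopsOK V tr i k t) (hroot : t.rootId = k) :
    j ∈ t.higherLoops ↔ (∃ n ∈ t.nodes, n.InLoop j) ∧ j ≠ k := by
  unfold higherLoops Lower
  rw [Set.mem_ofPred_eq, hlo.counter, hroot]
  constructor
  · rintro ⟨h1, -, h2⟩
    exact ⟨h1, h2⟩
  · rintro ⟨⟨n, hn, hj⟩, h2⟩
    exact ⟨⟨n, hn, hj⟩, (hlo.pre n hn j hj).2, h2⟩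

/-- The status of the response to the higher request in the context of the loop `w`. -/
def waveStatus : Option Identifier → ResponseStatus
  | none => .active
  | some l => .loop l

theorem Table.not_processesHigher (hroot : t.rootId = k)
    (hr : t.RootReady k none ∨ t.rootStatus = .new) : ¬ t.ProcessesHigher j := by
  rintro ⟨ids, h, hj, hlow⟩
  rw [hroot] at hlow
  rcases hr with (hr | ⟨hr, -⟩) | hr <;> rw [hr] at h <;> cases h
  exact hlow.2 (Set.mem_singleton_iff.1 hj)

theorem Table.processesHigher_iff (hlo : LoopsOK V tr i k t) (hroot : t.rootId = k)
    {l : Identifier} (hr : t.RootReady k (some l)) : t.ProcessesHigher j ↔ j = l := by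
  unfold ProcessesHigher
  rw [hroot]
  obtain ⟨h1, h2, h3⟩ := hr
  have hlow : Lower k l := by
    obtain ⟨n, hn, hj⟩ := (hlo.counter l).1 (by simp [h2])
    exact ⟨(hlo.pre n hn l hj).2, h1⟩
  constructor
  · rintro ⟨ids, h, hj, hlow⟩
    rcases h3 with h3 | ⟨h3, -⟩ <;> rw [h3] at h <;> cases h
    · exact hj
    · exact hj.resolve_right hlow.2
  · rintro rfl
    rcases h3 with h3 | ⟨h3, -⟩
    · exact ⟨_, h3, rfl, hlow⟩
    · exact ⟨_, h3, .inl rfl, hlow⟩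

theorem Inv.reply (h : Inv V tr ph i a ret) (hw : WellFormed i a V tr) (ht : V k₀ = some t)
    (hl : ¬ Dead V k₀) {w : Option Identifier} (hp : ph k₀ = .ready w) (hex : t.Exhausted)
    (hln : t.HasLoopNode) (hun : ¬ t.HasUnsentAnswer) (hld : ¬ t.IsLeader) {r : Request S C}
    (hr : t.hr = some r)
    (hw' : WellFormed i a (Function.update V k₀ (some (t.reply r (waveStatus w)).1))
      (tr + ([(t.reply r (waveStatus w)).2] : List _))) :
    Inv (Function.update V k₀ (some (t.reply r (waveStatus w)).1))
      (tr + ([(t.reply r (waveStatus w)).2] : List _)) (Function.update ph k₀ .quiet) i a ret := by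
  classical
  have htd := not_done_of_not_dead ht hl
  have hroot := hw.root ht
  have hrid : r.id = k₀ := by
    obtain ⟨r', h1, h2, -⟩ := hw.hr ht htd
    rw [hr] at h1
    cases h1
    exact h2
  have hph := h.phase ht hl
  rw [hp] at hph
  obtain ⟨hrs, hidle⟩ := hph
  have hlo := h.loops ht htd
  obtain ⟨nl, hnl, jl, hjl, hjk⟩ := Table.loop_of_not_isLeader hlo hroot hln hld
  have hki : k₀ ≠ i := by
    rintro rfl
    obtain ⟨h1, h2⟩ := hlo.pre nl hnl jl hjl
    exact hjk (prefix_antisymm h2 h1)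
  obtain ⟨k', x, u, n, hk', hu, hd', hn, hnid, hmc, hst⟩ :=
    h.busy_parent hw ht hl hki (by simp [hp])
  have hk'ne : k' ≠ k₀ := by
    rintro rfl
    exact concat_ne_of_prefix List.prefix_rfl hk'.symm
  rw [hp] at hst
  have hhl : ∀ j, j ∈ t.higherLoops ↔ (∃ n ∈ t.nodes, n.InLoop j) ∧ j ≠ k₀ :=
    fun j => Table.mem_higherLoops hlo hroot
  rw [t.reply_snd] at hw' ⊢
  have hfst := t.reply_fst r (waveStatus w)
  generalize (t.reply r (waveStatus w)).1 = t' at hfst hw' ⊢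
  generalize hM : t.answerTo (waveStatus w) t.higherLoops r = M at hw' ⊢
  have hTR : tr + (([M] : List (Message S C)) : Multiset (Message S C)) = M ::ₘ tr := by
    rw [← Multiset.singleton_add, add_comm]; rfl
  rw [hTR] at hw' ⊢
  have hMid : M.id = k₀ := by rw [← hM]; exact hrid
  have hnodes : t'.nodes = t.nodes := by rw [hfst]; rfl
  have hlr : t'.lr = t.lr := by rw [hfst]; rfl
  have hag : ∀ j, t'.activeGoals j =
      if j ∈ t.higherLoops then some (t.loopCount j) else t.activeGoals j := by rw [hfst]; simp
  have hrst : t'.rootStatus = .active := by rw [hfst]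
  have htd' : ¬ t'.Done := by simp [Table.Done, hrst]
  have hdone : t'.Done ↔ t.Done := iff_of_false htd' htd
  have hg : t.Grows t' := ⟨hdone, fun r hr => ⟨r, hlr ▸ hr, rfl⟩,
    fun n hn => ⟨n, hnodes ▸ hn, rfl, fun _ h => h⟩⟩
  have hcnt : ∀ j, j ≠ k₀ → msgCount (M ::ₘ tr) j = msgCount tr j := by
    intro j hj
    rw [msgCount_cons, hMid, if_neg hj, add_zero]
  have hcnt0 : msgCount (M ::ₘ tr) k₀ = 1 := by rw [msgCount_cons, hMid, if_pos rfl, hmc]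
  have hmono : ∀ m ∈ tr, m ∈ M ::ₘ tr := fun m hm => Multiset.mem_cons_of_mem hm
  have hph1 : ∀ {k}, k ≠ k₀ → Function.update ph k₀ .quiet k = ph k :=
    fun hk => Function.update_of_ne hk _ _
  have hbusy0 : ¬ Busy (Function.update V k₀ (some t')) (Function.update ph k₀ .quiet) k₀ := by
    rintro ⟨-, -, -, hq⟩
    simp at hq
  have hbusy : ∀ {k}, k ≠ k₀ →
      (Busy (Function.update V k₀ (some t')) (Function.update ph k₀ .quiet) k ↔ Busy V ph k) := by
    intro k hk
    simp [Busy, hk]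
  have hresp : ∀ j ∈ t.higherLoops, i <+: j ∧ j <+: k' ∧
      Sup (Function.update V k₀ (some t')) n.id j := by
    intro j hj
    obtain ⟨⟨m, hm, hj⟩, hne⟩ := (hhl j).1 hj
    obtain ⟨h1, h2⟩ := hlo.pre m hm j hj
    refine ⟨h1, prefix_of_prefix_concat (hk' ▸ h2) (hk' ▸ hne), .inr ⟨t', by simp [hnid], htd', m,
      hnodes ▸ hm, hj⟩⟩
  have hchild : ChildLoops (Function.update V k₀ (some t')) n.id t.higherLoops := by
    intro z hz _ m hm j hj hne
    rw [hnid, Function.update_self, Option.some_inj] at hz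
    subst hz
    exact (hhl j).2 ⟨⟨m, hnodes ▸ hm, hj⟩, hnid ▸ hne⟩
  have hself : ∀ m ∈ t.nodes, m.id ≠ k₀ := by
    intro m hm
    obtain ⟨y, hy⟩ := hw.node ht hm
    rw [hy]
    exact concat_ne_of_prefix List.prefix_rfl
  refine h.update hw hw' ht hg (.inl hl) (fun d q hq => .inl (hmono _ hq)) ?_ ?_ ?_
    (fun _ r hr hr' => absurd rfl (hr' r (hlr ▸ hr))) ?_ ?_ ?_
  · intro n hn hst
    exact absurd hst (hidle n hn).2
  · intro m hm
    rcases Multiset.mem_cons.1 hm with rfl | hm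
    · refine .inr fun k y e => ?_
      rw [hMid, hk'] at e
      rwa [← (List.append_inj' e rfl).1]
    · exact .inl hm
  · intro _
    refine hlo.transfer ht hl hg (fun n hn _ => ⟨n, hnodes ▸ hn, rfl, rfl⟩) fun j => ?_
    rw [hag]
    split_ifs with hj
    · simpa using hj.1
    · rfl
  · intro k v hv hd m hm
    rcases update_some.1 hv with ⟨rfl, rfl⟩ | ⟨hk, hv⟩
    · rw [hnodes] at hm
      exact (h.node ht hl m hm).own_frame ht hg (hw.node ht hm) (hcnt _ (hself m hm))
        (fun m hm _ => hmono m hm) (.inl (hidle m hm).1)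
    · by_cases hmk : m.id = k₀
      · obtain ⟨rfl, rfl, rfl⟩ := hw.node_unique hu hv hn hm (hnid.trans hmk.symm)
        have hmem : .response r.requester ⟨r.id, t.unsent r.id, waveStatus w, t.higherLoops⟩ ∈
            M ::ₘ tr := by
          rw [← hM]
          exact Multiset.mem_cons_self _ _
        rcases hst with ⟨hst, hwv⟩ | ⟨ids, l, hst, hwv, hpe, hli⟩
        · obtain rfl : w = none := hwv
          refine ⟨by simp [hst], by simp [hst], fun _ => .inr (.inr ⟨_, _, hmem, hrid.trans hnid.symm,
            by rw [hnid]; exact hcnt0, by rw [hnid]; exact hbusy0, .inr ⟨rfl,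
              ⟨jl, (hhl jl).2 ⟨⟨nl, hnl, hjl⟩, hjk⟩⟩, hresp, hchild⟩⟩), by simp [hst]⟩
        · obtain rfl : w = some l := hwv
          refine ⟨by simp [hst], by simp [hst], by simp [hst], fun ids' hs' => .inr ⟨l,
            by rw [hph1 hk]; exact hpe, ?_, .inr ⟨_, _, hmem, hrid.trans hnid.symm,
            by rw [hnid]; exact hcnt0, by rw [hnid]; exact hbusy0, rfl, hresp, ?_⟩⟩⟩
          · rw [hst] at hs'; cases hs'; exact hli
          · exact fun z hz hzd m hm j hj hne => .inr (hchild z hz hzd m hm j hj hne)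
      · exact (h.node hv hd m hm).frame (hcnt _ hmk) (fun m hm _ => hmono m hm)
          (.inr (by rw [hph1 hk])) (hbusy hmk) (fun _ => by rw [hph1 hmk])
          (fun hc => hc.update ht hdone) (fun J _ hc => hc.update ht hdone hnodes)
          (fun j _ hs => hs.update ht hg)
  · intro k v hv hd
    rcases update_some.1 hv with ⟨rfl, rfl⟩ | ⟨hk, hv⟩
    · rw [Function.update_self]
      have hans : v.ansSet = (t.mark {r.id}).ansSet := by rw [hfst]
      refine ⟨⟨hrst, ?_, ?_, ?_, ⟨nl, hnodes ▸ hnl, jl, hjl, hjk⟩⟩, ?_, ?_⟩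
      · rcases hex with hex | ⟨p, hp, hv⟩
        · exact .inl (hnodes ▸ hex)
        · refine .inr ⟨(p.1, p.2 ∪ {r.id}), hans ▸ List.mem_map.2 ⟨p, hp, rfl⟩, ?_⟩
          rw [hfst]
          exact hv
      · rw [hnodes]; exact fun n hn => (hidle n hn).2
      · intro p hp q hq
        rw [hans] at hp
        obtain ⟨p', hp', rfl⟩ := List.mem_map.1 hp
        rw [Table.clients, hlr, show v.hr = t.hr by rw [hfst]; rfl] at hq
        rcases List.mem_append.1 hq with hq | hq
        · rw [hr] at hq
          obtain rfl : q = r := by simpa using hq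
          exact .inr rfl
        · left
          by_contra hc
          exact hun ⟨q, hq, p', hp', hc⟩
      · intro j hj hne
        rw [hag] at hne ⊢
        split_ifs at hne ⊢ with hjh
        · rw [Table.loopCount, Table.loopCount, hnodes]
        · exact absurd ((hhl j).2 ⟨(hlo.counter j).1 hne, hj⟩) hjh
      · rw [hnodes]
        exact fun m hm => (idle_own (hw.node ht hm) (hcnt _ (hself m hm))).2 (hidle m hm).1
    · rw [hph1 hk]
      refine (h.phase hv hd).frame fun m hm => ?_
      by_cases hmk : m.id = k₀
      · refine iff_of_false (fun hi => ?_) fun hi => hi.2 ?_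
        · rw [hmk] at hi
          have := hi.1
          omega
        · rw [hmk]
          exact ⟨t, ht, htd, by simp [hp]⟩
      · unfold Idle
        rw [hbusy hmk, hcnt _ hmk]
  · exact h.top_update ht hdone (hcnt i hki.symm) fun m hm _ => hmono m hm

end

end GEM

namespace GEM

variable {S C : Type*}

section

variable {i : Identifier} {a : C} {V V' : Identifier → Option (Table S C)}
  {tr tr' : Multiset (Message S C)} {ph ph' : Identifier → Phase} {k k₀ j : Identifier}
  {t t' : Table S C} {ret ret' : List (C × Response S C)}

/-! ### Completing a goal -/

theorem dead_update_done (hd : t'.Done) :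
    Dead (Function.update V k₀ (some t')) k ↔ (∃ j t, j ≠ k₀ ∧ V j = some t ∧ t.Done ∧ j <+: k) ∨ k₀ <+: k := by
  constructor
  · rintro ⟨j, u, hu, h1, h2⟩
    rcases update_some.1 hu with ⟨rfl, rfl⟩ | ⟨hj, hu⟩
    · exact .inr h2
    · exact .inl ⟨j, u, hj, hu, h1, h2⟩
  · rintro (⟨j, u, hj, hu, h1, h2⟩ | h)
    · exact ⟨j, u, update_some.2 (.inr ⟨hj, hu⟩), h1, h2⟩
    · exact ⟨k₀, t', by simp, hd, h⟩

theorem dead_update_of_not_done (ht : V k₀ = some t) (htd : ¬ t.Done) (hd : t'.Done) :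
    Dead (Function.update V k₀ (some t')) k ↔ Dead V k ∨ k₀ <+: k := by
  rw [dead_update_done hd]
  refine or_congr_left ⟨fun ⟨j, u, _, h⟩ => ⟨j, u, h⟩, fun ⟨j, u, h1, h2⟩ => ⟨j, u, ?_, h1, h2⟩⟩
  rintro rfl
  rw [ht, Option.some_inj] at h1
  exact htd (h1 ▸ h2.1)

theorem WellFormed.parent_owner (hw : WellFormed i a V tr) {c : C} (h : Addr i a V i c) : c = a := by
  rcases h with ⟨-, h⟩ | ⟨u, hu, -, n, hn, h, -⟩
  · exact h
  · obtain ⟨x, hx⟩ := hw.node hu hn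
    exact absurd (hx.symm.trans h) (concat_ne_of_prefix (hw.pre hu))

theorem Table.terminate_fields (t : Table S C) : t.terminate.1.Done ∧
    t.terminate.1.nodes = t.nodes.map Node.finish := by
  rw [t.terminate_fst]
  exact ⟨rfl, rfl⟩

theorem WellFormed.node_of_msg (hw : WellFormed i a V tr) (hu : V k = some t) {m : Message S C}
    (hm : m ∈ tr) {x : List Char} (e : m.id = k ++ [x]) : ∃ n ∈ t.nodes, n.id = m.id := by
  obtain ⟨c, hc⟩ := hw.msgAddr hm
  rw [e] at hc ⊢
  obtain ⟨-, n, hn, hid, -⟩ := hw.addr_node hu hc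
  exact ⟨n, hn, hid⟩

theorem Inv.terminate (h : Inv V tr ph i a ret) (hw : WellFormed i a V tr) (ht : V k₀ = some t)
    (hl : ¬ Dead V k₀) {w : Option Identifier} (hp : ph k₀ = .ready w)
    (hloop : ∀ n ∈ t.nodes, ∀ j, n.InLoop j → j = k₀) (hun : ¬ t.HasUnsentAnswer) :
    Inv (Function.update V k₀ (some t.terminate.1)) (tr + t.terminate.2) ph i a ret := by
  classical
  have htd := not_done_of_not_dead ht hl
  have hroot := hw.root ht
  obtain ⟨r, hr, hrid, hra⟩ := hw.hr ht htd
  have hph := h.phase ht hl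
  rw [hp] at hph
  obtain ⟨hrs, hidle⟩ := hph
  have hid : ∀ n ∈ t.nodes, Idle V tr ph n.id := fun n hn => (hidle n hn).1
  have hlo := h.loops ht htd
  obtain rfl : w = none := by
    cases w with
    | none => rfl
    | some l =>
      rcases hrs with ⟨h1, h2, -⟩ | ⟨h1, -⟩
      · obtain ⟨n, hn, hj⟩ := (hlo.counter l).1 (by simp [h2])
        exact absurd (hloop n hn l hj) h1
      · cases h1
  obtain ⟨htd', hnodes⟩ := t.terminate_fields
  have hcn := hw.clients_nodup ht htd
  rw [t.terminate_snd hcn]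
  generalize t.terminate.1 = t' at htd' hnodes ⊢
  generalize hTR : tr + (↑(t.clients.map (t.answerTo .disposed ∅)) : Multiset (Message S C)) = tr'
  have hclients : t.clients = r :: t.lr := by simp [Table.clients, hr]
  rw [hclients] at hcn hTR
  have hmono : ∀ m ∈ tr, m ∈ tr' := fun m hm => by
    rw [← hTR]; exact Multiset.mem_add.2 (.inl hm)
  have hnewm : ∀ m ∈ tr', m ∈ tr ∨ ∃ q, (q = r ∨ q ∈ t.lr) ∧ t.answerTo .disposed ∅ q = m := by
    intro m hm
    rw [← hTR, Multiset.mem_add] at hm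
    refine hm.imp_right fun hm => ?_
    obtain ⟨q, hq, e⟩ := List.mem_map.1 (Multiset.mem_coe.1 hm)
    exact ⟨q, List.mem_cons.1 hq, e⟩
  have hsent : ∀ q, q = r ∨ q ∈ t.lr → t.answerTo .disposed ∅ q ∈ tr' := fun q hq => by
    rw [← hTR]
    exact Multiset.mem_add.2 (.inr (Multiset.mem_coe.2 (List.mem_map_of_mem (List.mem_cons.2 hq))))
  have hlow : ∀ q ∈ t.lr, ∀ x k, q.id = k ++ [x] → k₀ <+: k := by
    intro r hr x k e
    obtain ⟨-, h1, h2⟩ := hw.lr ht hr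
    rw [e] at h1 h2
    exact prefix_of_prefix_concat h1 h2
  have hlrk : ∀ q ∈ t.lr, q.id ≠ k₀ := fun q hq => Ne.symm (hw.lr ht hq).2.2
  have hcnt : ∀ j, msgCount tr' j =
      msgCount tr j + if ∃ q ∈ r :: t.lr, q.id = j then 1 else 0 := by
    intro j
    rw [← hTR]
    exact msgCount_clients hcn j
  have hcnt1 : ∀ j, j ≠ k₀ → (∀ q ∈ t.lr, q.id ≠ j) → msgCount tr' j = msgCount tr j := by
    intro j h1 h2
    rw [hcnt, if_neg, add_zero]
    rintro ⟨q, hq, e⟩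
    rcases List.mem_cons.1 hq with rfl | hq
    · exact h1 (e.symm.trans hrid)
    · exact h2 q hq e
  have hdead : ∀ {k}, Dead (Function.update V k₀ (some t')) k ↔ Dead V k ∨ k₀ <+: k :=
    dead_update_of_not_done ht htd htd'
  have hcd : ∀ {k}, ChildDone V k → ChildDone (Function.update V k₀ (some t')) k := by
    intro k hc z hz
    rcases update_some.1 hz with ⟨rfl, rfl⟩ | ⟨-, hz⟩
    · exact htd'
    · exact hc z hz
  have hmk₀ : k₀ ≠ i → msgCount tr k₀ = 0 := fun hki => by
    obtain ⟨_, _, _, _, _, _, _, _, _, hmc, _⟩ := h.busy_parent hw ht hl hki (by simp [hp])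
    exact hmc
  have hlowdead : ∀ {k}, Dead V k → k₀ ≠ k := fun hd e => hl (e ▸ hd)
  constructor
  · intro k u hu hd
    rcases update_some.1 hu with ⟨rfl, rfl⟩ | ⟨hk, hu'⟩
    · exact absurd htd' hd
    have hlo' := h.loops hu' hd
    refine ⟨hlo'.counter, hlo'.pre, hlo'.nonempty, fun n hn j hj => ?_⟩
    obtain ⟨y, hy⟩ := hw.node hu' hn
    have hjk := (hlo'.pre n hn j hj).2
    rcases hlo'.sup n hn j hj with (⟨v, hv, hvd, q, hq, e⟩ | ⟨z, hz, hzd, m, hm, hj'⟩) |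
      ⟨hs, d, q, hq, e⟩
    · by_cases ej : j = k₀
      · subst ej
        rw [ht, Option.some_inj] at hv
        subst hv
        exact .inr ⟨hdead.2 (.inr hjk), _, _, hsent q (.inr hq), e⟩
      · exact .inl (.inl ⟨v, update_some.2 (.inr ⟨ej, hv⟩), hvd, q, hq, e⟩)
    · refine .inl (.inr ⟨z, update_some.2 (.inr ⟨?_, hz⟩), hzd, m, hm, hj'⟩)
      intro e
      rw [e, ht, Option.some_inj] at hz
      subst hz
      have := hloop m hm j hj'
      rw [← e, hy] at this
      exact concat_ne_of_prefix hjk this.symm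
    · exact .inr ⟨hdead.2 (.inl hs), d, q, hmono _ hq, e⟩
  · intro k u hu hd q hq k' v hv n hn e
    rcases update_some.1 hu with ⟨rfl, rfl⟩ | ⟨hk, hu'⟩
    · exact absurd htd' hd
    have hold := h.lower hu' hd q hq
    rcases update_some.1 hv with ⟨rfl, rfl⟩ | ⟨hk', hv'⟩
    · rw [hnodes] at hn
      obtain ⟨n₀, hn₀, rfl⟩ := List.mem_map.1 hn
      rcases hold _ _ ht n₀ hn₀ (n₀.finish_spec.1.symm.trans e) with ⟨h1, -⟩ | ⟨-, h1 | ⟨h1, -⟩⟩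
      · exact absurd h1 htd
      · exact absurd (hloop _ hn₀ _ h1) hk
      · exact absurd h1 (hidle _ hn₀).2
    · rcases hold _ _ hv' n hn e with ⟨h1, h2⟩ | ⟨h1, h2 | ⟨h2, d, p, hp', h3⟩⟩
      · exact .inl ⟨h1, hdead.2 (.inl h2)⟩
      · exact .inr ⟨h1, .inl h2⟩
      · exact .inr ⟨h1, .inr ⟨h2, d, p, hmono _ hp', h3⟩⟩
  · intro k u hu hd m hm ⟨x, hx⟩
    have hlive : ∀ {v}, V k = some v → k₀ <+: k → ¬ Dead V k → m ∉ tr := by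
      intro v hv hb hd' hm
      obtain ⟨n, hn, e⟩ := hw.node_of_msg hv hm hx
      exact msgCount_eq_zero.1 (h.idle_below hw ht hl hid hv hb hd' n hn).1 m hm e.symm
    rcases update_some.1 hu with ⟨rfl, rfl⟩ | ⟨hk, hu'⟩
    · rcases hnewm m hm with hm | ⟨q, hq, rfl⟩
      · exact absurd hm (hlive ht List.prefix_rfl hl)
      · exact ⟨_, _, rfl, fun h => absurd htd' h⟩
    · rcases hnewm m hm with hm | ⟨q, hq, rfl⟩
      · by_cases hd' : Dead V k
        · exact h.deadMsg hu' hd' m hm ⟨x, hx⟩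
        · exact absurd hm (hlive hu' ((hdead.1 hd).resolve_left hd') hd')
      · refine ⟨_, _, rfl, fun _ => ⟨rfl, ?_⟩⟩
        have hx' : q.id = k ++ [x] := hx
        rcases hq with rfl | hq
        · exfalso
          rw [hrid] at hx'
          rcases hdead.1 hd with hd' | hd'
          · exact hl (hx' ▸ hd'.mono_prefix prefix_concat)
          · exact concat_ne_of_prefix hd' hx'.symm
        · refine ⟨?_, ?_⟩
          · unfold Table.unsent
            rw [List.map_eq_nil_iff, List.filter_eq_nil_iff]
            intro p hp' hc
            exact hun ⟨q, hq, p, hp', by simpa using hc⟩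
          · obtain ⟨k', v, n, hv, -, -, hn, e, hj, -⟩ := h.lower_inLoop hw ht hl hid hq
            obtain ⟨y, hy⟩ := hw.node hv hn
            have : k' ++ [y] = k ++ [x] := by rw [← hy, e, hx']
            obtain rfl := (List.append_inj' this rfl).1
            rw [hu', Option.some_inj] at hv
            subst hv
            exact ⟨n, hn, e, hj.looping⟩
  · intro k u hu hnd hd
    rcases update_some.1 hu with ⟨rfl, rfl⟩ | ⟨hk, hu'⟩
    · exact absurd htd' hnd
    by_cases hd' : Dead V k
    · have hz := h.zombie hu' hnd hd'
      exact ⟨hz.resting, fun n hn j hj => hdead.2 (.inl (hz.loops n hn j hj)),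
        fun n hn hc => hz.child n hn fun hc' => hc (hcd hc')⟩
    · have hb := (hdead.1 hd).resolve_left hd'
      have hphk := h.phase hu' hd'
      rw [h.quiet_below hw ht hl hid hu' hb hk hd'] at hphk
      refine ⟨hphk.1, fun n hn j hj => hdead.2 (.inr ?_), fun n hn hc => ?_⟩
      · rcases List.prefix_or_prefix_of_prefix hb ((h.loops hu' hnd).pre n hn j hj).2 with h1 | h1
        · exact h1
        · obtain ⟨m, hm, hj'⟩ := h.loop_below hw ht hl hid hu' hb hd' hn hj h1
          rw [hloop m hm j hj']
      · obtain ⟨ids, hs, -⟩ := hw.looping_of_idle hu' hn (h.node hu' hd' n hn) (hphk.2.2 n hn)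
          fun hc' => hc (hcd hc')
        exact ⟨ids, hs⟩
  all_goals
    have hlive : ∀ {k u}, Function.update V k₀ (some t') k = some u →
        ¬ Dead (Function.update V k₀ (some t')) k → V k = some u ∧ ¬ Dead V k ∧ ¬ k₀ <+: k := by
      intro k u hu hd
      rw [hdead, not_or] at hd
      rcases update_some.1 hu with ⟨rfl, rfl⟩ | ⟨hk, hu'⟩
      · exact absurd List.prefix_rfl hd.2
      · exact ⟨hu', hd⟩
    have hother : ∀ {k u}, V k = some u → ¬ k₀ <+: k → ∀ n ∈ u.nodes, n.id ≠ k₀ →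
        msgCount tr' n.id = msgCount tr n.id ∧
        (Busy (Function.update V k₀ (some t')) ph n.id ↔ Busy V ph n.id) := by
      intro k u hu hk n hn hne
      obtain ⟨y, hy⟩ := hw.node hu hn
      exact ⟨hcnt1 _ hne fun q hq e => hk (hlow q hq y k (e.trans hy)), by simp [Busy, hne]⟩
    have hcnt0 : k₀ ≠ i → msgCount tr' k₀ = 1 := by
      intro hki
      rw [hcnt, if_pos ⟨r, List.mem_cons_self, hrid⟩, hmk₀ hki]
    have hbusy0 : ¬ Busy (Function.update V k₀ (some t')) ph k₀ := by
      rintro ⟨z, hz, hzd, -⟩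
      rw [Function.update_self, Option.some_inj] at hz
      exact hzd (hz ▸ htd')
    have hki : ∀ {k u}, V k = some u → ∀ n ∈ u.nodes, n.id = k₀ → k₀ ≠ i := by
      rintro k u hu n hn e e'
      obtain ⟨y, hy⟩ := hw.node hu hn
      exact concat_ne_of_prefix (hw.pre hu) (hy.symm.trans (e.trans e'))
  · intro k u hu hd n hn
    obtain ⟨hu, hd, hk⟩ := hlive hu hd
    by_cases hne : n.id = k₀
    · have hki := hki hu n hn hne
      obtain ⟨k', x, v, m, -, hv, hd', hm, hmid, hmc, hst⟩ :=
        h.busy_parent hw ht hl hki (by simp [hp])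
      obtain ⟨rfl, rfl, rfl⟩ := hw.node_unique hu hv hn hm (hne.trans hmid.symm)
      rw [hp] at hst
      rcases hst with ⟨hst, -⟩ | ⟨ids, l, -, hwv, -⟩
      · refine ⟨by simp [hst], by simp [hst], fun _ => .inr (.inr ⟨_, _, hsent r (.inl rfl),
          hrid.trans hne.symm, hne ▸ hcnt0 hki, hne ▸ hbusy0, .inl ⟨rfl, rfl, ?_⟩⟩), by simp [hst]⟩
        intro z hz
        rw [hne, Function.update_self, Option.some_inj] at hz
        exact hz ▸ htd'
      · cases hwv
    · obtain ⟨h1, h2⟩ := hother hu hk n hn hne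
      refine (h.node hu hd n hn).frame h1 (fun m hm _ => hmono m hm) (.inr rfl) h2 (fun _ => rfl)
        hcd ?_ ?_
      · intro J _ hc z hz
        rw [Function.update_of_ne hne] at hz
        exact hc z hz
      · rintro j hj (⟨v, hv, h3⟩ | ⟨z, hz, h3⟩)
        · refine .inl ⟨v, update_some.2 (.inr ⟨?_, hv⟩), h3⟩
          rintro rfl
          exact hk hj
        · exact .inr ⟨z, by rwa [Function.update_of_ne hne], h3⟩
  · intro k u hu hd
    obtain ⟨hu, hd, hk⟩ := hlive hu hd
    refine (h.phase hu hd).frame fun n hn => ?_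
    by_cases hne : n.id = k₀
    · refine iff_of_false (fun hi => ?_) fun hi => hi.2 ?_
      · have := hi.1
        rw [hne, hcnt0 (hki hu n hn hne)] at this
        omega
      · exact ⟨t, hne ▸ ht, htd, by simp [hne, hp]⟩
    · obtain ⟨h1, h2⟩ := hother hu hk n hn hne
      unfold Idle
      rw [h1, h2]
  · obtain ⟨u, hu, htop⟩ := h.top
    have hlri : ∀ q ∈ t.lr, q.id ≠ i := by
      rintro q hq e
      obtain ⟨-, h1, h2⟩ := hw.lr ht hq
      rw [e] at h1 h2
      exact h2 (prefix_antisymm h1 (hw.pre ht))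
    by_cases hk : i = k₀
    · subst hk
      rw [ht, Option.some_inj] at hu
      subst hu
      rcases htop with ⟨-, h1, h2⟩ | ⟨h1, -⟩ | ⟨h1, -⟩
      · refine ⟨t', by simp, .inr (.inl ⟨htd', t.unsent i, h1, ?_, ?_⟩)⟩
        · rw [hcnt, h2, if_pos ⟨r, List.mem_cons_self, hrid⟩]
        · have := hsent r (.inl rfl)
          unfold Table.answerTo at this
          rwa [hrid, hw.parent_owner hra] at this
      · exact absurd h1 htd
      · exact absurd h1 htd
    · refine ⟨u, update_some.2 (.inr ⟨hk, hu⟩), ?_⟩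
      unfold TopOK
      rw [hcnt1 i hk hlri]
      rcases htop with h | ⟨h1, ans, h2, h3, h4⟩ | h
      · exact .inl h
      · exact .inr (.inl ⟨h1, ans, h2, h3, hmono _ h4⟩)
      · exact .inr (.inr h)

/-- A goal that is not in a loop, or leads its loop, has completed its evaluation. -/
theorem Inv.generateResponse_terminate (h : Inv V tr ph i a ret) (hw : WellFormed i a V tr)
    (ht : V k₀ = some t) (hl : ¬ Dead V k₀) {w : Option Identifier} (hp : ph k₀ = .ready w)
    (hc : ¬ t.HasLoopNode ∨ ¬ t.HasUnsentAnswer ∧ t.IsLeader) :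
    Inv (Function.update V k₀ (some t.terminate.1)) (tr + t.terminate.2) ph i a ret := by
  have hlo := h.loops ht (not_done_of_not_dead ht hl)
  have hid : ∀ n ∈ t.nodes, Idle V tr ph n.id := by
    have hph := h.phase ht hl
    rw [hp] at hph
    exact fun n hn => (hph.2 n hn).1
  refine h.terminate hw ht hl hp (fun n hn j hj => ?_) ?_
  · rcases hc with hc | ⟨-, hc⟩
    · exact absurd ⟨n, hn, hj.looping⟩ hc
    · exact ((hc j).1 ((hlo.counter j).2 ⟨n, hn, hj⟩)).trans (hw.root ht)
  · rcases hc with hc | ⟨hc, -⟩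
    · rintro ⟨q, hq, -⟩
      obtain ⟨k', v, n, hv, hk, hd, hn, e, hj, -⟩ := h.lower_inLoop hw ht hl hid hq
      obtain ⟨m, hm, hj'⟩ := h.loop_below hw ht hl hid hv hk hd hn hj List.prefix_rfl
      exact hc ⟨m, hm, hj'.looping⟩
    · exact hc

end

end GEM

namespace GEM

variable {S C : Type*}

section

variable {i : Identifier} {a : C} {V V' : Identifier → Option (Table S C)}
  {tr tr' : Multiset (Message S C)} {ph ph' : Identifier → Phase} {k k₀ j : Identifier}
  {t t' : Table S C} {ret ret' : List (C × Response S C)}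

/-! ### Disposing the goals below a completed one -/

theorem Table.unsent_eq_nil (h : ∀ p ∈ t.ansSet, k ∈ p.2) : t.unsent k = [] := by
  unfold unsent
  rw [List.map_eq_nil_iff, List.filter_eq_nil_iff]
  intro p hp hc
  simp [h p hp] at hc

theorem Inv.disposeZombie {d : C} {r : Response S C} (h : Inv V (.response d r ::ₘ tr) ph i a ret)
    (hw : WellFormed i a V (.response d r ::ₘ tr)) (ht : V k₀ = some t) (hd₀ : Dead V k₀)
    (htd : ¬ t.Done) (hrn : ∃ n ∈ t.nodes, n.id = r.id) {t₁ : Table S C}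
    (hn₁ : ∀ n ∈ t₁.nodes, ∃ m ∈ t.nodes, m.id = n.id) (hhr₁ : t₁.hr = t.hr) (hlr₁ : t₁.lr = t.lr)
    (hans₁ : t₁.ansSet = t.ansSet) :
    Inv (Function.update V k₀ (some t₁.terminate.1)) (tr + t₁.terminate.2) ph i a ret := by
  classical
  have hz₀ := h.zombie ht htd hd₀
  obtain ⟨r₀, hr, hrid, hra⟩ := hw.hr ht htd
  have hcl₁ : t₁.clients = t.clients := by rw [Table.clients, hhr₁, hlr₁]; rfl
  have hcn := hw.clients_nodup ht htd
  obtain ⟨htd', hnodes⟩ := t₁.terminate_fields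
  rw [t₁.terminate_snd (hcl₁ ▸ hcn), hcl₁]
  generalize t₁.terminate.1 = t' at htd' hnodes ⊢
  generalize hTR : tr + (↑(t.clients.map (t₁.answerTo .disposed ∅)) : Multiset (Message S C)) = tr'
  have hunsent : ∀ q ∈ t.clients, t₁.unsent q.id = [] := fun q hq =>
    Table.unsent_eq_nil fun p hp => hz₀.resting.synced p (hans₁ ▸ hp) q hq
  have hclients : t.clients = r₀ :: t.lr := by simp [Table.clients, hr]
  rw [hclients] at hcn hTR hunsent
  have hmono : ∀ m ∈ tr, m ∈ tr' := fun m hm => by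
    rw [← hTR]; exact Multiset.mem_add.2 (.inl hm)
  have hnewm : ∀ m ∈ tr', m ∈ tr ∨ ∃ q ∈ r₀ :: t.lr, t₁.answerTo .disposed ∅ q = m := by
    intro m hm
    rw [← hTR, Multiset.mem_add] at hm
    exact hm.imp_right fun hm => List.mem_map.1 (Multiset.mem_coe.1 hm)
  have hsent : ∀ q ∈ r₀ :: t.lr, t₁.answerTo .disposed ∅ q ∈ tr' := fun q hq => by
    rw [← hTR]
    exact Multiset.mem_add.2 (.inr (Multiset.mem_coe.2 (List.mem_map_of_mem hq)))
  have hlow : ∀ q ∈ t.lr, ∀ x k, q.id = k ++ [x] → k₀ <+: k := by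
    intro r hr x k e
    obtain ⟨-, h1, h2⟩ := hw.lr ht hr
    rw [e] at h1 h2
    exact prefix_of_prefix_concat h1 h2
  obtain ⟨nr, hnr, hnrid⟩ := hrn
  obtain ⟨xr, hxr⟩ := hw.node ht hnr
  have hkeep : ∀ {k u n}, V k = some u → k ≠ k₀ → n ∈ u.nodes → n.id ≠ r.id := by
    intro k u n hu hk hn e
    exact hk (hw.node_unique hu ht hn hnr (e.trans hnrid.symm)).1
  have hmono' : ∀ {k u n}, V k = some u → k ≠ k₀ → n ∈ u.nodes →
      ∀ m ∈ (.response d r ::ₘ tr : Multiset (Message S C)), m.id = n.id → m ∈ tr' := by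
    intro k u n hu hk hn m hm e
    rcases Multiset.mem_cons.1 hm with rfl | hm
    · exact absurd e.symm (hkeep hu hk hn)
    · exact hmono m hm
  have hcnt : ∀ j, j ≠ r.id → j ≠ k₀ → (∀ q ∈ t.lr, q.id ≠ j) →
      msgCount tr' j = msgCount (.response d r ::ₘ tr : Multiset (Message S C)) j := by
    intro j h0 h1 h2
    rw [msgCount_cons, if_neg (show ¬ j = (Message.response d r).id from h0), add_zero, ← hTR, msgCount_clients hcn, if_neg, add_zero]
    rintro ⟨q, hq, e⟩
    rcases List.mem_cons.1 hq with rfl | hq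
    · exact h1 (e.symm.trans hrid)
    · exact h2 q hq e
  have hdead : ∀ {k}, Dead (Function.update V k₀ (some t')) k ↔ Dead V k := by
    intro k
    rw [dead_update_of_not_done ht htd htd', or_iff_left_of_imp]
    exact fun hk => hd₀.mono_prefix hk
  have hcd : ∀ {k}, ChildDone V k → ChildDone (Function.update V k₀ (some t')) k := by
    intro k hc z hz
    rcases update_some.1 hz with ⟨rfl, rfl⟩ | ⟨-, hz⟩
    · exact htd'
    · exact hc z hz
  constructor
  · intro k u hu hd
    rcases update_some.1 hu with ⟨rfl, rfl⟩ | ⟨hk, hu'⟩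
    · exact absurd htd' hd
    have hlo' := h.loops hu' hd
    refine ⟨hlo'.counter, hlo'.pre, hlo'.nonempty, fun n hn j hj => ?_⟩
    obtain ⟨y, hy⟩ := hw.node hu' hn
    have hjk := (hlo'.pre n hn j hj).2
    rcases hlo'.sup n hn j hj with (⟨v, hv, hvd, q, hq, e⟩ | ⟨z, hz, hzd, m, hm, hj'⟩) |
      ⟨hs, d', q, hq, e⟩
    · by_cases ej : j = k₀
      · subst ej
        rw [ht, Option.some_inj] at hv
        subst hv
        exact .inr ⟨hdead.2 (hd₀.mono_prefix hjk), _, _, hsent q (List.mem_cons_of_mem _ hq), e⟩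
      · exact .inl (.inl ⟨v, update_some.2 (.inr ⟨ej, hv⟩), hvd, q, hq, e⟩)
    · by_cases e : n.id = k₀
      · refine .inr ⟨hdead.2 ?_, _, _, hsent r₀ List.mem_cons_self, hrid.trans e.symm⟩
        rw [hy] at e
        rw [← e] at hd₀
        exact hd₀.parent fun v hv => by
          rw [e, ht, Option.some_inj] at hv
          exact hv ▸ htd
      · exact .inl (.inr ⟨z, update_some.2 (.inr ⟨e, hz⟩), hzd, m, hm, hj'⟩)
    · exact .inr ⟨hdead.2 hs, d', q, hmono' hu' hk hn _ hq e, e⟩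
  · intro k u hu hd q hq k' v hv n hn e
    rcases update_some.1 hu with ⟨rfl, rfl⟩ | ⟨hk, hu'⟩
    · exact absurd htd' hd
    have hold := h.lower hu' hd q hq
    rcases update_some.1 hv with ⟨rfl, rfl⟩ | ⟨hk', hv'⟩
    · rw [hnodes] at hn
      obtain ⟨n₁, hn₁', rfl⟩ := List.mem_map.1 hn
      obtain ⟨n₀, hn₀, e₀⟩ := hn₁ n₁ hn₁'
      rcases hold _ _ ht n₀ hn₀ (e₀.trans (n₁.finish_spec.1.symm.trans e)) with
        ⟨h1, -⟩ | ⟨-, h1 | ⟨h1, -⟩⟩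
      · exact absurd h1 htd
      · exact .inl ⟨htd', hdead.2 (hz₀.loops n₀ hn₀ _ h1)⟩
      · exact absurd h1 (hz₀.resting.notActive n₀ hn₀)
    · rcases hold _ _ hv' n hn e with ⟨h1, h2⟩ | ⟨h1, h2 | ⟨h2, d', p, hp', h3, h4⟩⟩
      · exact .inl ⟨h1, hdead.2 h2⟩
      · exact .inr ⟨h1, .inl h2⟩
      · exact .inr ⟨h1, .inr ⟨h2, d', p, hmono' hv' hk' hn _ hp' (h3.trans e.symm), h3, h4⟩⟩
  · intro k u hu hd m hm ⟨x, hx⟩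
    rw [hdead] at hd
    rcases update_some.1 hu with ⟨rfl, rfl⟩ | ⟨hk, hu'⟩
    · rcases hnewm m hm with hm | ⟨q, hq, rfl⟩
      · obtain ⟨d', q, e, -⟩ := h.deadMsg ht hd m (Multiset.mem_cons_of_mem hm) ⟨x, hx⟩
        exact ⟨d', q, e, fun h => absurd htd' h⟩
      · exact ⟨_, _, rfl, fun h => absurd htd' h⟩
    · rcases hnewm m hm with hm | ⟨q, hq, rfl⟩
      · exact h.deadMsg hu' hd m (Multiset.mem_cons_of_mem hm) ⟨x, hx⟩
      · refine ⟨_, _, rfl, fun hud => ⟨rfl, hunsent q hq, ?_⟩⟩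
        have hx' : q.id = k ++ [x] := hx
        have hz := h.zombie hu' hud hd
        obtain ⟨-, n, hn, hnid, -⟩ := hw.addr_node (x := x) hu' (c := q.requester) (by
          rw [← hx']
          exact (hw.clients ht htd (hclients ▸ hq)).1)
        refine ⟨n, hn, hnid.trans hx'.symm, ?_⟩
        rcases List.mem_cons.1 hq with rfl | hq
        · refine hz.child n hn fun hc => htd (hc t ?_)
          rw [hnid, ← hx', hrid, ht]
        · rcases h.lower ht htd q hq _ _ hu' n hn (hnid.trans hx'.symm) with
            ⟨h1, -⟩ | ⟨-, h1 | ⟨h1, -⟩⟩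
          · exact absurd h1 hud
          · exact h1.looping
          · exact absurd h1 (hz.resting.notActive n hn)
  · intro k u hu hnd hd
    rcases update_some.1 hu with ⟨rfl, rfl⟩ | ⟨hk, hu'⟩
    · exact absurd htd' hnd
    have hz := h.zombie hu' hnd (hdead.1 hd)
    exact ⟨hz.resting, fun n hn j hj => hdead.2 (hz.loops n hn j hj),
      fun n hn hc => hz.child n hn fun hc' => hc (hcd hc')⟩
  all_goals
    have hother : ∀ {k u}, V k = some u → ¬ Dead V k → ∀ n ∈ u.nodes, n.id ≠ k₀ ∧
        msgCount tr' n.id = msgCount (.response d r ::ₘ tr : Multiset (Message S C)) n.id ∧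
        (Busy (Function.update V k₀ (some t')) ph n.id ↔ Busy V ph n.id) := by
      intro k u hu hk n hn
      obtain ⟨y, hy⟩ := hw.node hu hn
      have hne : n.id ≠ k₀ := by
        intro e
        rw [hy] at e
        rw [← e] at hd₀
        exact hk (hd₀.parent fun v hv => by
          rw [e, ht, Option.some_inj] at hv
          exact hv ▸ htd)
      refine ⟨hne, hcnt _ (hkeep hu ?_ hn) hne fun q hq e => hk ?_, by simp [Busy, hne]⟩
      · rintro rfl
        exact hk hd₀
      · exact hd₀.mono_prefix (hlow q hq y k (e.trans hy))
    have hlive : ∀ {k u}, Function.update V k₀ (some t') k = some u → ¬ Dead V k →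
        V k = some u ∧ k ≠ k₀ := by
      intro k u hu hd
      rcases update_some.1 hu with ⟨rfl, rfl⟩ | ⟨hk, hu'⟩
      · exact absurd hd₀ hd
      · exact ⟨hu', hk⟩
  · intro k u hu hd n hn
    rw [hdead] at hd
    obtain ⟨hu, hk⟩ := hlive hu hd
    obtain ⟨hne, h1, h2⟩ := hother hu hd n hn
    refine (h.node hu hd n hn).frame h1 (hmono' hu hk hn) (.inr rfl) h2 (fun _ => rfl)
      hcd ?_ ?_
    · intro J _ hc z hz
      rw [Function.update_of_ne hne] at hz
      exact hc z hz
    · rintro j hj (⟨v, hv, h3⟩ | ⟨z, hz, h3⟩)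
      · refine .inl ⟨v, update_some.2 (.inr ⟨?_, hv⟩), h3⟩
        rintro rfl
        exact hd (hd₀.mono_prefix hj)
      · exact .inr ⟨z, by rwa [Function.update_of_ne hne], h3⟩
  · intro k u hu hd
    rw [hdead] at hd
    obtain ⟨hu, hk⟩ := hlive hu hd
    refine (h.phase hu hd).frame fun n hn => ?_
    obtain ⟨-, h1, h2⟩ := hother hu hd n hn
    unfold Idle
    rw [h1, h2]
  · obtain ⟨u, hu, htop⟩ := h.top
    have hik : i ≠ k₀ := by
      rintro rfl
      obtain ⟨l, v, hv, hvd, hl⟩ := hd₀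
      obtain rfl := prefix_antisymm hl (hw.pre hv)
      rw [ht, Option.some_inj] at hv
      exact htd (hv ▸ hvd)
    have hir : i ≠ r.id := by
      rw [← hnrid, hxr]
      exact (concat_ne_of_prefix (hw.pre ht)).symm
    have hc := hcnt i hir hik (by
      rintro q hq e
      obtain ⟨-, h1, h2⟩ := hw.lr ht hq
      rw [e] at h1 h2
      exact h2 (prefix_antisymm h1 (hw.pre ht)))
    refine ⟨u, update_some.2 (.inr ⟨hik, hu⟩), ?_⟩
    unfold TopOK
    rw [hc]
    rcases htop with h | ⟨h1, ans, h2, h3, h4⟩ | h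
    · exact .inl h
    · refine .inr (.inl ⟨h1, ans, h2, h3, hmono _ ((Multiset.mem_cons.1 h4).resolve_left ?_)⟩)
      rintro e
      cases e
      exact hir rfl
    · exact .inr (.inr h)

open scoped Classical in
theorem Table.disposeNode_looping {n : Node S C} (hn : n ∈ t.nodes) (hl : n.Looping) :
    ∀ m ∈ (t.disposeNode n.id).nodes, ¬ m.Looping ∧ (m.status ≠ .disposed → m ∈ t.nodes) := by
  intro m hm
  obtain ⟨m₀, hm₀, rfl⟩ := List.mem_map.1 hm
  split_ifs with h
  · exact ⟨fun ⟨ids, e⟩ => (by cases e), fun e => absurd rfl e⟩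
  · rw [not_or, not_and] at h
    exact ⟨h.2 ⟨n, hn, rfl, hl⟩, fun _ => hm₀⟩

/-- A disposed response to a goal below a completed one makes it complete its evaluation. -/
theorem Inv.zombie_receive {d : C} {r : Response S C} (h : Inv V (.response d r ::ₘ tr) ph i a ret)
    (hw : WellFormed i a V (.response d r ::ₘ tr)) (ht : V k₀ = some t) (hd₀ : Dead V k₀)
    (htd : ¬ t.Done) (hrn : ∃ n ∈ t.nodes, n.id = r.id) {H B : Atom S C} {Bs : List (Atom S C)}
    {l : ℕ} {ns : List (Node S C)}
    (hns : AnswerNodes H B Bs l t.rootId {i | ∃ m ∈ t.nodes, m.id = i} r.ans ns) :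
    (t.receive r ns).Resumable ∧ ∀ o, ActivateNode (t.receive r ns) o → ∃ t' ms, o = .done t' ms ∧
      t'.Done ∧ t'.rootId = t.rootId ∧
        Inv (Function.update V k₀ (some t')) (tr + ms) ph i a ret := by
  have hz := h.zombie ht htd hd₀
  obtain ⟨x, hx⟩ : ∃ x, r.id = k₀ ++ [x] := by
    obtain ⟨n, hn, e⟩ := hrn
    rw [← e]
    exact hw.node ht hn
  obtain ⟨_, _, e, hdm⟩ := h.deadMsg ht hd₀ (.response d r) (Multiset.mem_cons_self _ _) ⟨x, hx⟩
  cases e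
  obtain ⟨hst, hans, n, hn, hnid, hnl⟩ := hdm htd
  rw [hans] at hns
  cases hns
  have hnote : t.noteResponse r = t.disposeNode n.id := by
    unfold Table.noteResponse
    rw [hst, hnid]
  obtain ⟨-, -, -, f4, f5, f6, -⟩ := t.noteResponse_fields r
  have hmem : ∀ m ∈ (t.receive r []).nodes, m ∈ (t.disposeNode n.id).nodes := by
    intro m hm
    have := (Table.receive_perm [] hrn).subset hm
    rwa [List.append_nil, hnote] at this
  have hnl' : ¬ (t.receive r []).HasLoopNode := by
    rintro ⟨m, hm, hml⟩
    exact (Table.disposeNode_looping hn hnl m (hmem m hm)).1 hml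
  have hroot : (t.receive r []).rootStatus = .active := by
    have : (t.receive r []).rootStatus = (t.noteResponse r).rootStatus := rfl
    rw [this, hnote]
    exact hz.resting.root
  have hex : (t.receive r []).Exhausted := by
    rcases hz.resting.exhausted with he | ⟨p, hp, hv⟩
    · refine .inl fun m hm hs => he m ?_ hs
      exact (Table.disposeNode_looping hn hnl m (hmem m hm)).2 (by simp [hs])
    · refine .inr ⟨p, ?_, ?_⟩
      · rw [show (t.receive r []).ansSet = t.ansSet from f6]
        exact hp
      · rw [show (t.receive r []).goal = t.goal from (t.noteResponse_fields r).2.1]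
        exact hv
  refine ⟨.inl hroot, fun o ho => ?_⟩
  cases ho with
  | fact hne => exact absurd hex hne
  | flounder hne => exact absurd hex hne
  | request hne => exact absurd hex hne
  | respond _ hg =>
    cases hg with
    | iterate h1 => exact absurd h1 hnl'
    | leader h1 => exact absurd h1 hnl'
    | replyLoop h1 => exact absurd h1 hnl'
    | replyActive h1 => exact absurd h1 hnl'
    | noLoop =>
      refine ⟨_, _, rfl, (Table.terminate_fields _).1,
        by rw [Table.terminate_fst]; exact (t.noteResponse_fields r).2.2.1,
        h.disposeZombie hw ht hd₀ htd hrn (fun m hm => ?_) f4 f5 f6⟩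
      obtain ⟨m₀, hm₀, e⟩ := List.mem_map.1 (hmem m hm)
      refine ⟨m₀, hm₀, ?_⟩
      rw [← e]
      split_ifs <;> rfl

/-- A message that does not concern any uncompleted goal can be dropped. -/
theorem Inv.drop {m : Message S C} (h : Inv V (m ::ₘ tr) ph i a ret)
    (hne : ∀ {k u n}, V k = some u → ¬ u.Done → n ∈ u.nodes → n.id ≠ m.id)
    (htop : ∃ t, V i = some t ∧ TopOK tr i a ret' t) : Inv V tr ph i a ret' := by
  have hcnt : ∀ j, j ≠ m.id → msgCount tr j = msgCount (m ::ₘ tr) j := by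
    intro j hj
    rw [msgCount_cons, if_neg hj, add_zero]
  have hkeep : ∀ j, j ≠ m.id → ∀ m' ∈ m ::ₘ tr, m'.id = j → m' ∈ tr := by
    rintro j hj m' hm rfl
    rcases Multiset.mem_cons.1 hm with rfl | hm
    · exact absurd rfl hj
    · exact hm
  refine ⟨fun hu hud => ?_, fun hu hud q hq k' v hv n hn e => ?_,
    fun hu hd m hm => h.deadMsg hu hd m (Multiset.mem_cons_of_mem hm), h.zombie,
    fun hu hd n hn => ?_, fun hu hd => ?_, htop⟩
  · have hlo := h.loops hu hud
    refine ⟨hlo.counter, hlo.pre, hlo.nonempty, fun n hn j hj => ?_⟩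
    rcases hlo.sup n hn j hj with hs | ⟨hs, d', q, hq, e⟩
    · exact .inl hs
    · exact .inr ⟨hs, d', q, hkeep _ (hne hu hud hn) _ hq e, e⟩
  · rcases h.lower hu hud q hq _ _ hv n hn e with h1 | ⟨h1, h2 | ⟨h2, d', p, hp, h3, h4⟩⟩
    · exact .inl h1
    · exact .inr ⟨h1, .inl h2⟩
    · exact .inr ⟨h1, .inr ⟨h2, d', p, hkeep _ (hne hv h1 hn) _ hp (h3.trans e.symm), h3, h4⟩⟩
  · have hx := hne hu (not_done_of_not_dead hu hd) hn
    exact (h.node hu hd n hn).frame (hcnt _ hx) (hkeep _ hx) (.inr rfl) Iff.rfl (fun _ => rfl)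
      (fun h => h) (fun _ _ h => h) (fun _ _ h => h)
  · refine (h.phase hu hd).frame fun n hn => ?_
    unfold Idle
    rw [hcnt _ (hne hu (not_done_of_not_dead hu hd) hn)]

/-- Responses to a completed goal are ignored. -/
theorem Inv.ignore {d : C} {r : Response S C} (h : Inv V (.response d r ::ₘ tr) ph i a ret)
    (hw : WellFormed i a V (.response d r ::ₘ tr)) (ht : V k₀ = some t) (htd : t.Done)
    (hrn : ∃ n ∈ t.nodes, n.id = r.id) : Inv V tr ph i a ret := by
  obtain ⟨nr, hnr, hnrid⟩ := hrn
  refine h.drop (fun hu hud hn e => ?_) ?_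
  · obtain ⟨-, rfl, -⟩ := hw.node_unique hu ht hn hnr (Eq.trans e hnrid.symm)
    exact hud htd
  · have hi : i ≠ r.id := by
      obtain ⟨x, hx⟩ := hw.node ht hnr
      rw [← hnrid, hx]
      exact (concat_ne_of_prefix (hw.pre ht)).symm
    have := h.top_update (t' := t) (tr' := tr) ht Iff.rfl ?_ ?_
    · rwa [← ht, Function.update_eq_self] at this
    · rw [msgCount_cons, if_neg (show ¬ i = (Message.response d r).id from hi), add_zero]
    · intro m hm e
      rcases Multiset.mem_cons.1 hm with rfl | hm
      · exact absurd e.symm hi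
      · exact hm

/-- The response to the initial request. -/
theorem Inv.returned {d : C} {r : Response S C} (h : Inv V (.response d r ::ₘ tr) ph i a ret)
    (hw : WellFormed i a V (.response d r ::ₘ tr))
    (hn : ∀ k t, V k = some t → t.owner = d → ∀ n ∈ t.nodes, n.id ≠ r.id) :
    Inv V tr ph i a (ret ++ [(d, r)]) := by
  obtain ⟨hi, hd⟩ : r.id = i ∧ d = a := by
    rcases hw.resp (Multiset.mem_cons_self _ _) with h | ⟨u, hu, ho, n, hn', e, -⟩
    · exact h
    · exact absurd e (hn _ u hu ho n hn')
  refine h.drop (fun hu _ hn e => ?_) ?_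
  · obtain ⟨x, hx⟩ := hw.node hu hn
    exact concat_ne_of_prefix (hw.pre hu) (hx.symm.trans (e.trans hi))
  · obtain ⟨t, ht, htop⟩ := h.top
    have hc : msgCount (.response d r ::ₘ tr : Multiset (Message S C)) i = msgCount tr i + 1 := by
      rw [msgCount_cons, if_pos (show i = (Message.response d r).id from hi.symm)]
    refine ⟨t, ht, .inr (.inr ?_)⟩
    rcases htop with ⟨-, -, h3⟩ | ⟨h1, ans, h2, h3, h4⟩ | ⟨-, ans, h3, -⟩
    · omega
    · have := msg_unique h3 h4 (Multiset.mem_cons_self _ _) rfl hi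
      cases this
      exact ⟨h1, ans, by omega, by rw [h2]; rfl⟩
    · omega

end

end GEM

namespace GEM

variable {S C : Type*}

section

variable {i : Identifier} {a : C} {V V' : Identifier → Option (Table S C)}
  {tr tr' : Multiset (Message S C)} {ph ph' : Identifier → Phase} {k k₀ j : Identifier}
  {t t' : Table S C} {ret ret' : List (C × Response S C)}

/-! ### Receiving a response -/

theorem Table.RootReady.resumable {w : Option Identifier} (h : t.RootReady k w) : t.Resumable := by
  cases w with
  | none =>
    rcases h with h | ⟨h1, h2⟩
    · exact .inl h
    · refine .inr ⟨_, h1, fun j hj => ?_⟩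
      rw [Set.mem_singleton_iff.1 hj, h2]
  | some l =>
    obtain ⟨-, h1, h2 | ⟨h2, h3⟩⟩ := h
    · refine .inr ⟨_, h2, fun j hj => ?_⟩
      rw [Set.mem_singleton_iff.1 hj, h1]
    · refine .inr ⟨_, h2, fun j hj => ?_⟩
      rcases hj with rfl | hj
      · exact h1
      · rw [Set.mem_singleton_iff.1 hj, h3]

theorem Table.RootReady.congr {w : Option Identifier} (h : t.RootReady k w)
    (hr : t'.rootStatus = t.rootStatus)
    (hag : ∀ j, t.activeGoals j ≠ none → t'.activeGoals j = t.activeGoals j) : t'.RootReady k w := by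
  have hag' : ∀ j, t.activeGoals j = some 0 → t'.activeGoals j = some 0 := fun j hj => by
    rw [hag j (by simp [hj]), hj]
  cases w with
  | none => exact h.imp (hr.trans ·) fun h => ⟨hr.trans h.1, hag' _ h.2⟩
  | some l =>
    exact ⟨h.1, hag' _ h.2.1, h.2.2.imp (hr.trans ·) fun h => ⟨hr.trans h.1, hag' _ h.2⟩⟩

theorem countP_of_eq_off {l : List (Node S C)} (hnd : (l.map Node.id).Nodup) {n : Node S C}
    (hn : n ∈ l) {p q : Node S C → Bool} (hp : p n) (hq : ¬ q n)
    (h : ∀ m ∈ l, m.id ≠ n.id → p m = q m) : l.countP p = l.countP q + 1 := by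
  obtain ⟨l₁, l₂, rfl⟩ := List.append_of_mem hn
  rw [List.map_append, List.map_cons, List.nodup_append, List.nodup_cons] at hnd
  have h1 : l₁.countP p = l₁.countP q := List.countP_congr fun m hm => by
    rw [h m (by simp [hm]) (hnd.2.2 _ (List.mem_map_of_mem hm) _ List.mem_cons_self)]
  have h2 : l₂.countP p = l₂.countP q := List.countP_congr fun m hm => by
    rw [h m (by simp [hm]) fun e => hnd.2.1.1 (e ▸ List.mem_map_of_mem hm)]
  simp only [List.countP_append, List.countP_cons, hp, hq, h1, h2]
  simp only [if_true, Bool.false_eq_true, if_false]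
  omega

/-- A response to a node of the table turns its status into `st`. -/
structure Table.Receives (t : Table S C) (r : Response S C) (n : Node S C) (ns : List (Node S C))
    (st : NodeStatus) (t' : Table S C) : Prop where
  mem : n ∈ t.nodes
  id : n.id = r.id
  perm : t'.nodes.Perm ((t.nodes.map fun m => if m.id = r.id then { m with status := st } else m) ++ ns)
  fresh : ∀ m ∈ ns, m.status = .new ∧ (∃ x, m.id = t.rootId ++ [x]) ∧ ¬ ∃ m' ∈ t.nodes, m'.id = m.id
  lr : t'.lr = t.lr
  done : t'.Done ↔ t.Done
  inLoop : ∀ j, ({ n with status := st } : Node S C).InLoop j ↔ n.InLoop j ∨ j ∈ r.loops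
  counter : ∀ j, t'.activeGoals j ≠ none ↔ t.activeGoals j ≠ none ∨ j ∈ r.loops

theorem Table.Receives.mem_nodes {r : Response S C} {n : Node S C} {ns : List (Node S C)}
    {st : NodeStatus} (hr : t.Receives r n ns st t') (hnd : (t.nodes.map Node.id).Nodup)
    {m : Node S C} (hm : m ∈ t'.nodes) :
    m = { n with status := st } ∨ m ∈ ns ∨ m ∈ t.nodes ∧ m.id ≠ r.id := by
  rcases List.mem_append.1 (hr.perm.subset hm) with hm | hm
  · obtain ⟨m₀, hm₀, rfl⟩ := List.mem_map.1 hm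
    split_ifs with e
    · rw [node_id_inj hnd hm₀ hr.mem (e.trans hr.id.symm)]
      exact .inl rfl
    · exact .inr (.inr ⟨hm₀, e⟩)
  · exact .inr (.inl hm)

theorem Table.Receives.mem_new {r : Response S C} {n : Node S C} {ns : List (Node S C)}
    {st : NodeStatus} (hr : t.Receives r n ns st t') :
    ({ n with status := st } : Node S C) ∈ t'.nodes ∧
      ∀ m ∈ t.nodes, m.id ≠ r.id → m ∈ t'.nodes := by
  constructor
  · refine hr.perm.symm.subset (List.mem_append_left _ (List.mem_map.2 ⟨n, hr.mem, ?_⟩))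
    rw [if_pos hr.id]
  · intro m hm hne
    refine hr.perm.symm.subset (List.mem_append_left _ (List.mem_map.2 ⟨m, hm, ?_⟩))
    rw [if_neg hne]

theorem Table.Receives.grows {r : Response S C} {n : Node S C} {ns : List (Node S C)}
    {st : NodeStatus} (hr : t.Receives r n ns st t') (hnd : (t.nodes.map Node.id).Nodup) :
    t.Grows t' where
  done := hr.done
  lr q hq := ⟨q, hr.lr ▸ hq, rfl⟩
  loop m hm := by
    by_cases e : m.id = r.id
    · obtain rfl := node_id_inj hnd hm hr.mem (e.trans hr.id.symm)
      exact ⟨_, hr.mem_new.1, rfl, fun j hj => (hr.inLoop j).2 (.inl hj)⟩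
    · exact ⟨m, hr.mem_new.2 m hm e, rfl, fun _ h => h⟩

section

variable {d : C} {r : Response S C} (h : Inv V (.response d r ::ₘ tr) ph i a ret)
  (hw : WellFormed i a V (.response d r ::ₘ tr)) (ht : V k₀ = some t)

include hw ht

theorem Table.Receives.idle {n : Node S C} {ns : List (Node S C)} {st : NodeStatus}
    (hr : t.Receives r n ns st t')
    (hc : msgCount (.response d r ::ₘ tr : Multiset (Message S C)) n.id = 1)
    (hb : ¬ Busy V ph n.id) (p : Phase) :
    Idle (Function.update V k₀ (some t')) tr (Function.update ph k₀ p) n.id ∧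
    (∀ m ∈ ns, Idle (Function.update V k₀ (some t')) tr (Function.update ph k₀ p) m.id) ∧
    ∀ m ∈ t.nodes, m.id ≠ r.id → msgCount tr m.id =
      msgCount (.response d r ::ₘ tr : Multiset (Message S C)) m.id ∧
      (Idle (Function.update V k₀ (some t')) tr (Function.update ph k₀ p) m.id ↔
        Idle V (.response d r ::ₘ tr) ph m.id) := by
  have hself : ∀ m : Node S C, (∃ x, m.id = k₀ ++ [x]) → m.id ≠ k₀ := by
    rintro m ⟨x, hx⟩
    rw [hx]
    exact concat_ne_of_prefix List.prefix_rfl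
  refine ⟨⟨?_, ?_⟩, fun m hm => ?_, fun m hm hne => ?_⟩
  · rw [msgCount_cons, if_pos (show n.id = (Message.response d r).id from hr.id)] at hc
    omega
  · have := hself n (hw.node ht hr.mem)
    simpa [Busy, this] using hb
  · obtain ⟨-, ⟨x, hx⟩, h3⟩ := hr.fresh m hm
    rw [hw.root ht] at hx
    rw [hx] at h3
    have := hw.idle_of_not_addr (ph := ph) (hw.not_addr_of_fresh ht h3)
    rw [← hx] at this
    refine ⟨?_, ?_⟩
    · have h1 := this.1
      rw [msgCount_cons] at h1
      omega
    · have h1 := hself m ⟨x, hx⟩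
      simpa [Busy, h1] using this.2
  · have hcm : msgCount tr m.id =
        msgCount (.response d r ::ₘ tr : Multiset (Message S C)) m.id := by
      rw [msgCount_cons, if_neg (show ¬ m.id = (Message.response d r).id from hne), add_zero]
    exact ⟨hcm, idle_own (hw.node ht hm) hcm⟩

include h

theorem Inv.receive_aux (hl : ¬ Dead V k₀) {n : Node S C} {ns : List (Node S C)}
    {st : NodeStatus} (hr : t.Receives r n ns st t')
    (hw' : WellFormed i a (Function.update V k₀ (some t')) tr)
    (hc : msgCount (.response d r ::ₘ tr : Multiset (Message S C)) n.id = 1)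
    (hb : ¬ Busy V ph n.id)
    (hloops : ∀ j ∈ r.loops, i <+: j ∧ j <+: k₀ ∧ Sup V n.id j)
    (hst : st = .disposed ∧ ChildDone V n.id ∨
      ∃ ids, st = .loop ids ∧ ids.Nonempty ∧ ChildLoops V n.id ids)
    {p : Phase} (hq : ph k₀ ≠ .quiet) (hq' : p ≠ .quiet) (hwave : p.wave = (ph k₀).wave)
    (hpend : ∀ m ∈ t.nodes, m.id ≠ r.id →
      Idle V (.response d r ::ₘ tr) ph m.id ∨ p.pending = (ph k₀).pending)
    (hphase : PhaseOK (Function.update V k₀ (some t')) tr (Function.update ph k₀ p) k₀ t' p) :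
    Inv (Function.update V k₀ (some t')) tr (Function.update ph k₀ p) i a ret := by
  have hnd := hw.nodup ht
  have hg := hr.grows hnd
  have hlo := h.loops ht (not_done_of_not_dead ht hl)
  obtain ⟨x, hx⟩ := hw.node ht hr.mem
  rw [hr.id] at hx
  obtain ⟨hi0, hins, hiother⟩ := hr.idle hw ht hc hb p
  have hM : ∀ m : Message S C, m.id ≠ r.id → (m ∈ tr ↔ m ∈ .response d r ::ₘ tr) := by
    intro m hm
    rw [Multiset.mem_cons, or_iff_right]
    rintro rfl
    exact hm rfl
  refine h.update_own hw hw' ht hl hg hq hq' hwave (fun m hm => hM m fun e => hm ⟨x, e.trans hx⟩)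
    (fun j hj => ?_) ?_ hr.lr ?_ ?_ hphase
  · rw [msgCount_cons, if_neg, add_zero]
    exact fun e => hj ⟨x, e.trans hx⟩
  · intro m hm hs j d' q hq hqm hj
    by_cases e : m.id = r.id
    · obtain rfl := node_id_inj hnd hm hr.mem (e.trans hr.id.symm)
      have := msg_unique hc hq (Multiset.mem_cons_self (Message.response d r) _) hqm hr.id.symm
      cases this
      exact ⟨_, hr.mem_new.1, rfl, .inl ((hr.inLoop j).2 (.inr hj))⟩
    · exact ⟨m, hr.mem_new.2 m hm e, rfl, .inr ⟨hs, d', q,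
        (hM (.response d' q) (fun e' => e (hqm.symm.trans e'))).2 hq, hqm, hj⟩⟩
  · have hcases : ∀ m ∈ t'.nodes, ∀ j, m.InLoop j → (m.id = n.id ∧ j ∈ r.loops) ∨
        ∃ m' ∈ t.nodes, m'.id = m.id ∧ m'.InLoop j := by
      intro m hm j hj
      rcases hr.mem_nodes hnd hm with rfl | hm | ⟨hm, -⟩
      · rcases (hr.inLoop j).1 hj with hj | hj
        · exact .inr ⟨n, hr.mem, rfl, hj⟩
        · exact .inl ⟨rfl, hj⟩
      · obtain ⟨ids, e, -⟩ := hj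
        rw [(hr.fresh m hm).1] at e
        cases e
      · exact .inr ⟨m, hm, rfl, hj⟩
    refine ⟨fun j => ?_, fun m hm j hj => ?_, fun m hm hlp => ?_, fun m hm j hj => ?_⟩
    · rw [hr.counter, hlo.counter]
      constructor
      · rintro (⟨m, hm, hj⟩ | hj)
        · obtain ⟨m', hm', -, h1⟩ := hg.loop m hm
          exact ⟨m', hm', h1 j hj⟩
        · exact ⟨_, hr.mem_new.1, (hr.inLoop j).2 (.inr hj)⟩
      · rintro ⟨m, hm, hj⟩
        rcases hcases m hm j hj with ⟨-, h1⟩ | ⟨m', hm', -, h1⟩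
        · exact .inr h1
        · exact .inl ⟨m', hm', h1⟩
    · rcases hcases m hm j hj with ⟨-, h1⟩ | ⟨m', hm', -, h1⟩
      · exact ⟨(hloops j h1).1, (hloops j h1).2.1⟩
      · exact hlo.pre m' hm' j h1
    · rcases hr.mem_nodes hnd hm with rfl | hm | ⟨hm, -⟩
      · obtain ⟨ids, e⟩ := hlp
        rcases hst with ⟨rfl, -⟩ | ⟨ids, rfl, ⟨j, hj⟩, -⟩
        · cases e
        · exact ⟨j, ids, rfl, hj⟩
      · obtain ⟨ids, e⟩ := hlp
        rw [(hr.fresh m hm).1] at e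
        cases e
      · exact hlo.nonempty m hm hlp
    · rcases hcases m hm j hj with ⟨e, h1⟩ | ⟨m', hm', e, h1⟩
      · rw [e]
        exact .inl ((hloops j h1).2.2.update ht hg)
      · rw [← e]
        exact .inl (((hlo.sup m' hm' j h1).resolve_right fun hd => hl hd.1).update ht hg)
  · intro m hm
    have hself : n.id ≠ k₀ := by
      rw [hr.id, hx]
      exact concat_ne_of_prefix List.prefix_rfl
    rcases hr.mem_nodes hnd hm with rfl | hm | ⟨hm, hne⟩
    · rcases hst with ⟨rfl, hcd⟩ | ⟨ids, rfl, -, hcl⟩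
      · exact ⟨by simp, fun _ => ⟨hi0.1, hcd.update ht hr.done⟩, by simp, by simp⟩
      · refine ⟨by simp, by simp, by simp, fun ids' e => .inl ⟨hi0, ?_⟩⟩
        cases e
        intro z hz
        exact hcl z (by simpa [hself] using hz)
    · have hs := (hr.fresh m hm).1
      exact ⟨by simp [hs], by simp [hs], by simp [hs], by simp [hs]⟩
    · exact (h.node ht hl m hm).own_frame ht hg (hw.node ht hm) (hiother m hm hne).1
        (fun m' hm' e => (hM m' (by rwa [e])).2 hm') (hpend m hm hne)

end

section

open scoped Classical

theorem Table.noteLoops_activeGoals {J : Set Identifier} {l : Identifier} :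
    ((t.noteLoops l J).activeGoals j ≠ none ↔ t.activeGoals j ≠ none ∨ j ∈ J) ∧
    (t.activeGoals j ≠ none → (t.noteLoops l J).activeGoals j = t.activeGoals j) := by
  simp only [noteLoops]
  constructor
  · by_cases h : t.activeGoals j = none <;> by_cases h' : j ∈ J <;> simp [h, h']
  · intro h
    simp [h]

theorem AnswerNodes.fresh {H B : Atom S C} {Bs : List (Atom S C)} {l : ℕ} {l₀ : Identifier}
    {As : List (Atom S C)} {ns : List (Node S C)}
    (h : AnswerNodes H B Bs l l₀ {i | ∃ m ∈ t.nodes, m.id = i} As ns) :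
    ∀ m ∈ ns, m.status = .new ∧ (∃ x, m.id = l₀ ++ [x]) ∧ ¬ ∃ m' ∈ t.nodes, m'.id = m.id := by
  intro m hm
  obtain ⟨h1, h2, h3, -⟩ := h.spec.2.2 m hm
  exact ⟨h3, h2, h1⟩

theorem Table.loopPending_count {d : C} {r : Response S C} {n : Node S C} {ns : List (Node S C)}
    {st : NodeStatus} (hw : WellFormed i a V (.response d r ::ₘ tr)) (ht : V k₀ = some t)
    (hr : t.Receives r n ns st t')
    (hc : msgCount (.response d r ::ₘ tr : Multiset (Message S C)) n.id = 1)
    (hb : ¬ Busy V ph n.id) (p : Phase) :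
    pendingCount V (.response d r ::ₘ tr) ph t =
      pendingCount (Function.update V k₀ (some t')) tr (Function.update ph k₀ p) t' + 1 := by
  obtain ⟨hi0, hins, hiother⟩ := hr.idle hw ht hc hb p
  unfold pendingCount
  rw [hr.perm.countP_eq, List.countP_append, List.countP_map,
    (List.countP_eq_zero (l := ns)).2 fun m hm => by simpa using hins m hm, add_zero]
  refine countP_of_eq_off (hw.nodup ht) hr.mem ?_ ?_ fun m hm hne => ?_
  · simp [Idle, hc]
  · simp only [Function.comp_apply, hr.id, if_true, decide_not, Bool.not_eq_true',
      decide_eq_false_iff_not, not_not]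
    exact hr.id ▸ hi0
  · rw [hr.id] at hne
    simp only [Function.comp_apply, hne, if_false]
    simp [(hiother m hm hne).2]

theorem Inv.receive {d : C} {r : Response S C} (h : Inv V (.response d r ::ₘ tr) ph i a ret)
    (hw : WellFormed i a V (.response d r ::ₘ tr)) (ht : V k₀ = some t) (hl : ¬ Dead V k₀)
    (hrn : ∃ n ∈ t.nodes, n.id = r.id) {H B : Atom S C} {Bs : List (Atom S C)}
    {l : ℕ} {ns : List (Node S C)}
    (hns : AnswerNodes H B Bs l t.rootId {i | ∃ m ∈ t.nodes, m.id = i} r.ans ns) :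
    ∃ p, Inv (Function.update V k₀ (some (t.receive r ns))) tr (Function.update ph k₀ p) i a ret ∧
      if (t.receive r ns).Resumable then ∃ w, p = .ready w else ∀ w, p ≠ .ready w := by
  have hw' := hw.receive ht hrn hns
  obtain ⟨n, hn, hid⟩ := hrn
  have hnd := hw.nodup ht
  have hok := h.node ht hl n hn
  have hph := h.phase ht hl
  have hperm := Table.receive_perm (r := r) ns ⟨n, hn, hid⟩
  have hag' : (t.receive r ns).activeGoals = (t.noteResponse r).activeGoals := rfl
  have hrs' : (t.receive r ns).rootStatus = (t.noteResponse r).rootStatus := rfl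
  have hlr' : (t.receive r ns).lr = t.lr := (t.noteResponse_fields r).2.2.2.2.1
  generalize t.receive r ns = t' at hw' hperm hag' hrs' hlr' ⊢
  have hmem : (.response d r : Message S C) ∈ .response d r ::ₘ tr := Multiset.mem_cons_self _ _
  have hpos : msgCount (.response d r ::ₘ tr : Multiset (Message S C)) n.id ≠ 0 := by
    rw [msgCount_cons, if_pos (show n.id = (Message.response d r).id from hid)]
    omega
  have haddr := hw.resp hmem
  rw [← hid] at haddr
  obtain ⟨-, hb1, hb2⟩ := hw.addr_of_mem ht hn haddr
  have hni : ¬ Idle V (.response d r ::ₘ tr) ph n.id := fun hi => hpos hi.1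
  cases hs : n.status with
  | new => exact absurd hs hb2
  | answer => exact absurd (hok.answer hs) hb1
  | disposed => exact absurd (hok.disposed hs).1 hpos
  | active =>
    obtain ⟨w, hp⟩ : ∃ w, ph k₀ = .run w := by
      cases hp : ph k₀ with
      | run w => exact ⟨w, rfl⟩
      | quiet => rw [hp] at hph; exact absurd hs (hph.1.notActive n hn)
      | called l => rw [hp] at hph; exact absurd hs (hph.1.notActive n hn)
      | wait w l => rw [hp] at hph; exact absurd hs (hph.2.1 n hn)
      | ready w => rw [hp] at hph; exact absurd hs (hph.2 n hn).2
    rw [hp] at hph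
    obtain ⟨hrr, n', hn', -, hoth⟩ := hph
    obtain rfl : n = n' := by
      by_contra hne
      exact hni (hoth n hn hne).1
    have hothid : ∀ m ∈ t.nodes, m.id ≠ r.id → m ≠ n := by
      rintro m - hne rfl
      exact hne hid
    rcases hok.active hs with ⟨d', q, hq, e, h1⟩ | ⟨-, h1, -⟩ | ⟨d', q, hq, e, h1, hb, h2⟩
    · have := msg_unique h1 hq hmem e hid.symm
      cases this
    · exact absurd h1 hpos
    have := msg_unique h1 hq hmem e hid.symm
    cases this
    refine ⟨.ready w, ?_⟩
    have key : ∀ st, t.Receives r n ns st t' → t'.rootStatus = t.rootStatus →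
        (∀ j, t.activeGoals j ≠ none → t'.activeGoals j = t.activeGoals j) → st ≠ .active →
        t'.Resumable ∧ PhaseOK (Function.update V k₀ (some t')) tr
          (Function.update ph k₀ (.ready w)) k₀ t' (.ready w) := by
      intro st hr h3 h4 h5
      have hrr' := hrr.congr h3 h4
      obtain ⟨hi0, hins, hiother⟩ := hr.idle hw ht h1 hb (.ready w)
      refine ⟨hrr'.resumable, .inl hrr', fun m hm => ?_⟩
      rcases hr.mem_nodes hnd hm with rfl | hm | ⟨hm, hne⟩
      · exact ⟨hi0, h5⟩
      · exact ⟨hins m hm, by simp [(hr.fresh m hm).1]⟩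
      · have := hoth m hm (hothid m hm hne)
        exact ⟨(hiother m hm hne).2.2 this.1, this.2⟩
    have hpend : ∀ m ∈ t.nodes, m.id ≠ r.id → Idle V (.response d r ::ₘ tr) ph m.id ∨
        (Phase.ready w).pending = (ph k₀).pending :=
      fun m hm hne => .inl (hoth m hm (hothid m hm hne)).1
    rcases h2 with ⟨h2, h3, h4⟩ | ⟨h2, h3, h4, h5⟩
    · have hnote : t.noteResponse r = t.disposeNode r.id := by
        unfold Table.noteResponse
        rw [h2]
      have hnl : ¬ ∃ m ∈ t.nodes, m.id = r.id ∧ m.Looping := by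
        rintro ⟨m, hm, e, ids, hms⟩
        obtain rfl := node_id_inj hnd hm hn (e.trans hid.symm)
        rw [hs] at hms
        cases hms
      rw [hnote] at hag' hrs' hperm
      have hr : t.Receives r n ns .disposed t' := by
        refine ⟨hn, hid, ?_, hns.fresh, hlr', by rw [Table.Done, hrs']; rfl,
          fun j => ?_, fun j => ?_⟩
        · simpa only [Table.disposeNode, hnl, false_and, or_false] using hperm
        · rw [h3]
          simp [Node.InLoop, hs]
        · rw [hag', h3]
          simp [Table.disposeNode]
      obtain ⟨hres, hphase⟩ := key _ hr hrs' (fun j _ => by rw [hag']; rfl) (by simp)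
      refine ⟨h.receive_aux hw ht hl hr hw' h1 hb (by simp [h3]) (.inl ⟨rfl, h4⟩) (by simp [hp])
        (by simp) (by rw [hp]; rfl) hpend hphase, ?_⟩
      rw [if_pos hres]
      exact ⟨w, rfl⟩
    · have hnote : t.noteResponse r = t.noteLoops r.id r.loops := by
        unfold Table.noteResponse
        rw [h2]
      rw [hnote] at hag' hrs' hperm
      have hr : t.Receives r n ns (.loop r.loops) t' := by
        refine ⟨hn, hid, ?_, hns.fresh, hlr', by rw [Table.Done, hrs']; rfl,
          fun j => ?_, fun j => ?_⟩
        · refine hperm.trans (List.Perm.of_eq ?_)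
          congr 1
          refine List.map_congr_left fun m hm => ?_
          split_ifs with e
          · obtain rfl := node_id_inj hnd hm hn (e.trans hid.symm)
            simp [hs, NodeStatus.addLoops, h3.ne_empty]
          · rfl
        · simp [Node.InLoop, hs]
        · rw [hag']
          exact (Table.noteLoops_activeGoals (l := r.id) (J := r.loops)).1
      obtain ⟨hres, hphase⟩ := key _ hr hrs'
        (fun j hj => by rw [hag']; exact (Table.noteLoops_activeGoals (l := r.id) (J := r.loops)).2 hj) (by simp)
      refine ⟨h.receive_aux hw ht hl hr hw' h1 hb h4 (.inr ⟨_, rfl, h3, h5⟩) (by simp [hp])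
        (by simp) (by rw [hp]; rfl) hpend hphase, ?_⟩
      rw [if_pos hres]
      exact ⟨w, rfl⟩
  | loop ids =>
    rcases hok.loop ids hs with ⟨hi, -⟩ | ⟨l, hpe, hl', ⟨-, h1, -⟩ | ⟨d', q, hq, e, h1, hb, h2, h3, h4⟩⟩
    · exact absurd hi hni
    · exact absurd h1 hpos
    have := msg_unique h1 hq hmem e hid.symm
    cases this
    have hlo := h.loops ht (not_done_of_not_dead ht hl)
    have hnote : t.noteResponse r = (t.noteLoops r.id r.loops).noteLoopResponse l := by
      unfold Table.noteResponse
      rw [h2]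
    rw [hnote] at hag' hrs' hperm
    replace hag' : t'.activeGoals = Function.update (t.noteLoops r.id r.loops).activeGoals l
        (((t.noteLoops r.id r.loops).activeGoals l).map (· - 1)) := hag'
    have hagl : t.activeGoals l ≠ none := (hlo.counter l).2 ⟨n, hn, ids, hs, hl'⟩
    have hagj : ∀ j, j ≠ l → t.activeGoals j ≠ none → t'.activeGoals j = t.activeGoals j := by
      intro j hj hne
      rw [hag', Function.update_of_ne hj]
      exact (Table.noteLoops_activeGoals (l := r.id) (J := r.loops)).2 hne
    have hagl' : t'.activeGoals l = (t.activeGoals l).map (· - 1) := by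
      rw [hag', Function.update_self,
        (Table.noteLoops_activeGoals (l := r.id) (J := r.loops)).2 hagl]
    have hrs'' : t'.rootStatus = if t.rootStatus = .active then .loop {l} else t.rootStatus := hrs'
    have hr : t.Receives r n ns (.loop (ids ∪ r.loops)) t' := by
      refine ⟨hn, hid, ?_, hns.fresh, hlr', ?_, fun j => ?_, fun j => ?_⟩
      · refine hperm.trans (List.Perm.of_eq ?_)
        congr 1
        refine List.map_congr_left fun m hm => ?_
        split_ifs with e
        · obtain rfl := node_id_inj hnd hm hn (e.trans hid.symm)
          simp [hs, NodeStatus.addLoops]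
        · rfl
      · rw [Table.Done, Table.Done, hrs'']
        split_ifs with e <;> simp [e]
      · simp [Node.InLoop, hs]
      · by_cases ej : j = l
        · subst ej
          rw [hagl']
          simp [hagl]
        · rw [hag', Function.update_of_ne ej]
          exact (Table.noteLoops_activeGoals (l := r.id) (J := r.loops)).1
    obtain ⟨w, hpw, hroot, hna, hpend, hcount⟩ : ∃ w, (ph k₀).wave = w ∧ t'.RootWaiting k₀ l w ∧
        (∀ n ∈ t.nodes, n.status ≠ .active) ∧
        (∀ n ∈ t.nodes, ¬ Idle V (.response d r ::ₘ tr) ph n.id → n.InLoop l) ∧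
        t.activeGoals l = some (pendingCount V (.response d r ::ₘ tr) ph t : ℤ) := by
      cases hp : ph k₀ with
      | quiet => rw [hp] at hpe; cases hpe
      | run w => rw [hp] at hpe; cases hpe
      | ready w => rw [hp] at hpe; cases hpe
      | called l' =>
        rw [hp] at hpe hph
        cases hpe
        obtain ⟨h5, h6, h7, -, h8⟩ := hph
        refine ⟨_, rfl, ⟨h7, .inl ⟨rfl, ?_⟩⟩, h5.notActive, fun n hn => (h8 n hn).1, ?_⟩
        · rw [hrs'', if_pos h5.root]
        · rw [h6 l h7 hagl]
          have : t.nodes.countP (fun n => n.InLoop l) = t.nodes.countP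
              fun n => ¬ Idle V (.response d r ::ₘ tr) ph n.id :=
            List.countP_congr fun m hm => by simpa using (h8 m hm).symm
          rw [Table.loopCount, pendingCount, this]
      | wait w l' =>
        rw [hp] at hpe hph
        cases hpe
        obtain ⟨h5, h6, h7, h8, -⟩ := hph
        refine ⟨_, rfl, ?_, h6, h7, h8⟩
        have hne : ∀ K, t.rootStatus = .loop K → t'.rootStatus = .loop K := by
          intro K hK
          rw [hrs'', hK, if_neg (by simp)]
        cases w with
        | none => exact ⟨h5.1, hne _ h5.2⟩
        | some l'' =>
          obtain ⟨h9, h10⟩ := h5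
          refine ⟨h9, h10.imp (fun h => ⟨h.1, hne _ h.2⟩) fun h => ⟨h.1, hne _ h.2.1, ?_⟩⟩
          show t'.activeGoals l'' = some 0
          rw [hagj l'' (h.1 ▸ h9) (by simp [h.2.2]), h.2.2]
    have hq : ph k₀ ≠ .quiet := by
      intro e
      rw [e] at hpe
      cases hpe
    obtain ⟨hi0, hins, hiother⟩ := hr.idle hw ht h1 hb (.wait w l)
    have hcnt := Table.loopPending_count hw ht hr h1 hb (.wait w l)
    have hagl'' : t'.activeGoals l = some ((pendingCount (Function.update V k₀ (some t')) tr
        (Function.update ph k₀ (.wait w l)) t' : ℕ) : ℤ) := by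
      rw [hagl', hcount, hcnt]
      simp
    have hrl : ∃ K, t'.rootStatus = .loop K ∧ l ∈ K := by
      cases w with
      | none => exact ⟨_, hroot.2, hroot.1⟩
      | some l' =>
        rcases hroot.2 with ⟨e, h5⟩ | ⟨e, h5, -⟩
        · exact ⟨_, h5, e⟩
        · exact ⟨_, h5, .inr e⟩
    have hna' : ∀ m ∈ t'.nodes, m.status ≠ .active := by
      intro m hm
      rcases hr.mem_nodes hnd hm with rfl | hm | ⟨hm, hne⟩
      · simp
      · simp [(hr.fresh m hm).1]
      · exact hna m hm
    have hst : NodeStatus.loop (ids ∪ r.loops) = .disposed ∧ ChildDone V n.id ∨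
        ∃ K, NodeStatus.loop (ids ∪ r.loops) = .loop K ∧ K.Nonempty ∧ ChildLoops V n.id K :=
      .inr ⟨_, rfl, ⟨l, .inl hl'⟩, h4⟩
    rcases Nat.eq_zero_or_pos (pendingCount (Function.update V k₀ (some t')) tr
        (Function.update ph k₀ (.wait w l)) t') with h0 | h0
    · rw [h0] at hagl''
      have hrr : t'.RootReady k₀ w := by
        cases w with
        | none =>
          obtain ⟨rfl, h5⟩ := hroot
          exact .inr ⟨h5, hagl''⟩
        | some l' =>
          obtain ⟨h5, ⟨rfl, h6⟩ | ⟨rfl, h6, h7⟩⟩ := hroot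
          · exact ⟨h5, hagl'', .inl h6⟩
          · exact ⟨h5, h7, .inr ⟨h6, hagl''⟩⟩
      have hidle : ∀ m ∈ t'.nodes,
          Idle (Function.update V k₀ (some t')) tr (Function.update ph k₀ (.wait w l)) m.id := by
        rw [pendingCount, List.countP_eq_zero] at h0
        simpa using h0
      refine ⟨.ready w, h.receive_aux hw ht hl hr hw' h1 hb h3 hst hq (by simp) hpw.symm
        (fun m hm hne => .inl ((hiother m hm hne).2.1 (hidle m (hr.mem_new.2 m hm hne))))
        ⟨.inl hrr, fun m hm => ⟨?_, hna' m hm⟩⟩, ?_⟩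
      · have hne : m.id ≠ k₀ := by
          obtain ⟨x, hx⟩ := hw'.node (Function.update_self k₀ (some t') V) hm
          rw [hx]
          exact concat_ne_of_prefix List.prefix_rfl
        simpa [Idle, Busy, hne] using hidle m hm
      · rw [if_pos hrr.resumable]
        exact ⟨w, rfl⟩
    · refine ⟨.wait w l, h.receive_aux hw ht hl hr hw' h1 hb h3 hst hq (by simp) hpw.symm
        (fun m hm hne => .inr hpe.symm) ⟨hroot, hna', fun m hm hi => ?_, hagl'', h0⟩, ?_⟩
      · rcases hr.mem_nodes hnd hm with rfl | hm | ⟨hm, hne⟩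
        · exact absurd hi0 hi
        · exact absurd (hins m hm) hi
        · exact hpend m hm fun hi' => hi ((hiother m hm hne).2.2 hi')
      · rw [if_neg]
        · simp
        · obtain ⟨K, hK, hlK⟩ := hrl
          rintro (h5 | ⟨K', h5, h6⟩)
          · rw [hK] at h5
            cases h5
          · rw [hK] at h5
            cases h5
            have h7 := h6 l hlK
            rw [hagl'', Option.some_inj] at h7
            omega

end

end

end GEM

namespace GEM

variable {S C : Type*}

section

variable {i : Identifier} {a : C} {V V' : Identifier → Option (Table S C)}
  {tr tr' : Multiset (Message S C)} {ph ph' : Identifier → Phase} {k k₀ j : Identifier}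
  {t t' : Table S C} {ret ret' : List (C × Response S C)}

/-! ### Receiving a request -/

/-- The node that has sent a request in transit. -/
theorem Inv.request_parent {d : C} {r : Request S C} (h : Inv V (.request d r ::ₘ tr) ph i a ret)
    (hw : WellFormed i a V (.request d r ::ₘ tr)) :
    ∃ k' x u n, r.id = k' ++ [x] ∧ V k' = some u ∧ ¬ Dead V k' ∧ n ∈ u.nodes ∧ n.id = r.id ∧
      n.status = .active ∧ msgCount tr r.id = 0 ∧ r.id ≠ i := by
  have hmem : (.request d r : Message S C) ∈ .request d r ::ₘ tr := Multiset.mem_cons_self _ _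
  obtain ⟨h1, h2, -⟩ := hw.req hmem
  have hne : r.id ≠ i := by
    intro e
    obtain ⟨t, ht, -⟩ := h.top
    have := hw.unserved hmem
    rw [e, ht] at this
    cases this
  rcases h1 with ⟨e, -⟩ | ⟨u, hu, -, n, hn, hid, h3, h4⟩
  · exact absurd e hne
  obtain ⟨x, hx⟩ := hw.node hu hn
  rw [hid] at hx
  have hl : ¬ Dead V r.id.dropLast := by
    intro hd
    obtain ⟨d', q, e, -⟩ := h.deadMsg hu hd (.request d r) hmem ⟨x, hx⟩
    cases e
  have hok := h.node hu hl n hn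
  have hpos : msgCount (.request d r ::ₘ tr : Multiset (Message S C)) n.id ≠ 0 := by
    rw [hid, h2]
    simp
  refine ⟨_, x, u, n, hx, hu, hl, hn, hid, ?_, ?_, hne⟩
  · cases hs : n.status with
    | new => exact absurd hs h4
    | answer => exact absurd (hok.answer hs) h3
    | disposed => exact absurd (hok.disposed hs).1 hpos
    | active => rfl
    | loop ids =>
      rcases hok.loop ids hs with ⟨h5, -⟩ | ⟨l, -, -, ⟨-, h5, -⟩ | ⟨d', q, hq, e, h5, -⟩⟩
      · exact absurd h5.1 hpos
      · exact absurd h5 hpos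
      · have := msg_unique h5 hq hmem e hid.symm
        cases this
  · rw [msgCount_cons, if_pos (show r.id = (Message.request d r).id from rfl)] at h2
    omega

theorem Inv.create {d d' : C} {r : Request S C} (h : Inv V (.request d r ::ₘ tr) ph i a ret)
    (hw : WellFormed i a V (.request d r ::ₘ tr)) {G : Atom S C} {pol : List (Clause S C)}
    {ns : List (Node S C)} (hns : InitialNodes G r.id pol ns)
    (hw' : WellFormed i a
      (Function.update V r.id (some (newTable d' ⟨r.id, r.requester, G⟩ ns))) tr) :
    Inv (Function.update V r.id (some (newTable d' ⟨r.id, r.requester, G⟩ ns))) tr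
      (Function.update ph r.id (.ready none)) i a ret := by
  obtain ⟨k', x, u₀, n₀, hx, hu₀, hl₀, hn₀, hid₀, hst₀, hmc, hri⟩ := h.request_parent hw
  have hmem : (.request d r : Message S C) ∈ .request d r ::ₘ tr := Multiset.mem_cons_self _ _
  have hV0 := hw.unserved hmem
  have hns' : ∀ n ∈ ns, n.status = .new := fun n hn => (hns.spec.2.2 n hn).2.1
  have hTn : (newTable d' ⟨r.id, r.requester, G⟩ ns).nodes = ns := rfl
  have hTd : ¬ (newTable d' ⟨r.id, r.requester, G⟩ ns).Done := by simp [Table.Done, newTable]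
  have hTlr : (newTable d' ⟨r.id, r.requester, G⟩ ns).lr = [] := rfl
  have hTag : ∀ j, (newTable d' ⟨r.id, r.requester, G⟩ ns).activeGoals j = none := fun _ => rfl
  have hTrs : (newTable d' ⟨r.id, r.requester, G⟩ ns).rootStatus = .new := rfl
  generalize newTable d' ⟨r.id, r.requester, G⟩ ns = T at hw' hTn hTd hTlr hTag hTrs ⊢
  generalize hκ : r.id = κ at *
  have hV : ∀ {k u}, V k = some u → k ≠ κ := by
    rintro k u hu rfl
    rw [hV0] at hu
    cases hu
  have hdead : ∀ {k}, Dead (Function.update V κ (some T)) k ↔ Dead V k := by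
    intro k
    constructor
    · rintro ⟨l, u, hu, h1, h2⟩
      rcases update_some.1 hu with ⟨rfl, rfl⟩ | ⟨-, hu⟩
      · exact absurd h1 hTd
      · exact ⟨l, u, hu, h1, h2⟩
    · rintro ⟨l, u, hu, h1, h2⟩
      exact ⟨l, u, update_some.2 (.inr ⟨hV hu, hu⟩), h1, h2⟩
  have hκl : ¬ Dead V κ := by
    rw [hx]
    intro hd
    exact hl₀ (hd.parent fun z hz => by
      rw [← hx, hV0] at hz
      cases hz)
  have hsup : ∀ {k j}, Sup V k j → Sup (Function.update V κ (some T)) k j := by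
    rintro k j (⟨u, hu, h1⟩ | ⟨u, hu, h1⟩)
    · exact .inl ⟨u, update_some.2 (.inr ⟨hV hu, hu⟩), h1⟩
    · exact .inr ⟨u, update_some.2 (.inr ⟨hV hu, hu⟩), h1⟩
  have hresp : ∀ {d' q}, (.response d' q : Message S C) ∈ .request d r ::ₘ tr →
      .response d' q ∈ tr := by
    intro d' q hq
    rcases Multiset.mem_cons.1 hq with hq | hq
    · cases hq
    · exact hq
  have hcnt : ∀ j, j ≠ κ → msgCount tr j =
      msgCount (.request d r ::ₘ tr : Multiset (Message S C)) j := by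
    intro j hj
    rw [msgCount_cons, if_neg (show ¬ j = (Message.request d r).id from fun e => hj (e.trans hκ)),
      add_zero]
  have hbusy0 : Busy (Function.update V κ (some T)) (Function.update ph κ (.ready none)) κ :=
    ⟨T, by simp, hTd, by simp⟩
  have hbusy : ∀ {k}, k ≠ κ → (Busy (Function.update V κ (some T))
      (Function.update ph κ (.ready none)) k ↔ Busy V ph k) := by
    intro k hk
    simp [Busy, hk]
  constructor
  · intro k u hu hd
    rcases update_some.1 hu with ⟨rfl, rfl⟩ | ⟨hk, hu'⟩
    · have : ∀ n ∈ u.nodes, ∀ ids, n.status ≠ .loop ids := by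
        intro n hn ids
        rw [hns' n (hTn ▸ hn)]
        simp
      refine ⟨fun j => ?_, fun n hn j ⟨ids, e, _⟩ => absurd e (this n hn ids),
        fun n hn ⟨ids, e⟩ => absurd e (this n hn ids),
        fun n hn j ⟨ids, e, _⟩ => absurd e (this n hn ids)⟩
      rw [hTag]
      refine iff_of_false (by simp) ?_
      rintro ⟨n, hn, ids, e, -⟩
      exact this n hn ids e
    · have hlo := h.loops hu' hd
      refine ⟨hlo.counter, hlo.pre, hlo.nonempty, fun n hn j hj => ?_⟩
      rcases hlo.sup n hn j hj with hs | ⟨hs, d', q, hq, e⟩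
      · exact .inl (hsup hs)
      · exact .inr ⟨hdead.2 hs, d', q, hresp hq, e⟩
  · intro k u hu hd q hq k'' v hv n hn e
    rcases update_some.1 hu with ⟨rfl, rfl⟩ | ⟨hk, hu'⟩
    · rw [hTlr] at hq
      simp at hq
    rcases update_some.1 hv with ⟨rfl, rfl⟩ | ⟨hk', hv'⟩
    · exfalso
      obtain ⟨y, hy⟩ := hw'.node hv hn
      rcases (hw.lr hu' hq).1 with ⟨e', -⟩ | ⟨z, hz, -⟩
      · have : i <+: k'' := hw'.pre hv
        exact concat_ne_of_prefix this (hy.symm.trans (e.trans e'))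
      · rw [← e, hy, List.dropLast_concat, hV0] at hz
        cases hz
    · rcases h.lower hu' hd q hq _ _ hv' n hn e with ⟨h1, h2⟩ | ⟨h1, h2 | ⟨h2, d', p, hp, h3⟩⟩
      · exact .inl ⟨h1, hdead.2 h2⟩
      · exact .inr ⟨h1, .inl h2⟩
      · exact .inr ⟨h1, .inr ⟨h2, d', p, hresp hp, h3⟩⟩
  · intro k u hu hd m hm hmx
    rw [hdead] at hd
    rcases update_some.1 hu with ⟨rfl, rfl⟩ | ⟨hk, hu'⟩
    · exact absurd hd hκl
    · exact h.deadMsg hu' hd m (Multiset.mem_cons_of_mem hm) hmx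
  · intro k u hu hnd hd
    rw [hdead] at hd
    rcases update_some.1 hu with ⟨rfl, rfl⟩ | ⟨hk, hu'⟩
    · exact absurd hd hκl
    · have hz := h.zombie hu' hnd hd
      refine ⟨hz.resting, fun n hn j hj => hdead.2 (hz.loops n hn j hj), fun n hn hc => ?_⟩
      by_cases e : n.id = κ
      · obtain ⟨rfl, -⟩ := hw.node_unique hu' hu₀ hn hn₀ (e.trans hid₀.symm)
        exact absurd hd hl₀
      · exact hz.child n hn fun hc' => hc fun z hz => hc' z (by rwa [Function.update_of_ne e] at hz)
  · intro k u hu hd n hn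
    rw [hdead] at hd
    rcases update_some.1 hu with ⟨rfl, rfl⟩ | ⟨hk, hu'⟩
    · have := hns' n (hTn ▸ hn)
      exact ⟨by simp [this], by simp [this], by simp [this], by simp [this]⟩
    · by_cases e : n.id = κ
      · obtain ⟨-, -, rfl⟩ := hw.node_unique hu' hu₀ hn hn₀ (e.trans hid₀.symm)
        refine ⟨by simp [hst₀], by simp [hst₀], fun _ => .inr (.inl ?_), by simp [hst₀]⟩
        rw [e, Function.update_self]
        exact ⟨hbusy0, hmc, rfl⟩
      · refine (h.node hu' hd n hn).frame (hcnt _ e) ?_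
          (.inr (by rw [Function.update_of_ne hk])) (hbusy e)
          (fun _ => by rw [Function.update_of_ne e]) ?_ ?_ (fun j _ hs => hsup hs)
        · intro m hm e'
          rcases Multiset.mem_cons.1 hm with rfl | hm
          · exact absurd (e'.symm.trans hκ) e
          · exact hm
        · exact fun hc z hz => hc z (by rwa [Function.update_of_ne e] at hz)
        · exact fun J _ hc z hz => hc z (by rwa [Function.update_of_ne e] at hz)
  · intro k u hu hd
    rw [hdead] at hd
    rcases update_some.1 hu with ⟨rfl, rfl⟩ | ⟨hk, hu'⟩
    · rw [Function.update_self]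
      refine ⟨.inr ⟨rfl, hTrs⟩, fun n hn => ?_⟩
      have := hns' n (hTn ▸ hn)
      exact ⟨hw'.idle_of_new hu hn this, by simp [this]⟩
    · rw [Function.update_of_ne hk]
      refine (h.phase hu' hd).frame fun n hn => ?_
      by_cases e : n.id = κ
      · refine iff_of_false (fun hi => hi.2 (e ▸ hbusy0)) fun hi => ?_
        have := hi.1
        rw [e, msgCount_cons, if_pos (show κ = (Message.request d r).id from hκ.symm)] at this
        omega
      · unfold Idle
        rw [hbusy e, hcnt _ e]
  · obtain ⟨u, hu, htop⟩ := h.top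
    refine ⟨u, update_some.2 (.inr ⟨hV hu, hu⟩), ?_⟩
    unfold TopOK
    rw [hcnt i (Ne.symm hri)]
    rcases htop with h | ⟨h1, ans, h2, h3, h4⟩ | h
    · exact .inl h
    · exact .inr (.inl ⟨h1, ans, h2, h3, hresp h4⟩)
    · exact .inr (.inr h)

/-- The invariant holds when the initial request has been received. -/
theorem Inv.initial {d : C} {r : Request S C} {pol : List (Clause S C)} {ns : List (Node S C)}
    (hns : InitialNodes r.goal i pol ns) (hr : r.id = i)
    (hw : WellFormed i a (Function.update (fun _ => none) i (some (newTable d r ns))) 0)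
    (hph : ph i = .ready none) :
    Inv (Function.update (fun _ => none) i (some (newTable d r ns))) 0 ph i a [] := by
  have hV : ∀ {k u}, Function.update (fun _ => none) i (some (newTable d r ns)) k = some u →
      k = i ∧ u = newTable d r ns := by
    intro k u hu
    rcases update_some.1 hu with h | ⟨-, h⟩
    · exact h
    · cases h
  have hns' : ∀ n ∈ (newTable d r ns).nodes, n.status = .new :=
    fun n hn => (hns.spec.2.2 n hn).2.1
  have hTd : ¬ (newTable d r ns).Done := by simp [Table.Done, newTable]
  have hdead : ∀ {k}, ¬ Dead (Function.update (fun _ => none) i (some (newTable d r ns))) k := by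
    rintro k ⟨l, u, hu, h1, -⟩
    obtain ⟨-, rfl⟩ := hV hu
    exact hTd h1
  constructor
  · intro k u hu hd
    obtain ⟨rfl, rfl⟩ := hV hu
    have : ∀ n ∈ (newTable d r ns).nodes, ∀ ids, n.status ≠ .loop ids := by
      intro n hn ids
      rw [hns' n hn]
      simp
    refine ⟨fun j => ?_, fun n hn j ⟨ids, e, _⟩ => absurd e (this n hn ids),
      fun n hn ⟨ids, e⟩ => absurd e (this n hn ids),
      fun n hn j ⟨ids, e, _⟩ => absurd e (this n hn ids)⟩
    refine iff_of_false (by simp [newTable]) ?_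
    rintro ⟨n, hn, ids, e, -⟩
    exact this n hn ids e
  · intro k u hu hd q hq
    obtain ⟨rfl, rfl⟩ := hV hu
    simp [newTable] at hq
  · exact fun hu hd => absurd hd hdead
  · exact fun hu _ hd => absurd hd hdead
  · intro k u hu hd n hn
    obtain ⟨rfl, rfl⟩ := hV hu
    have := hns' n hn
    exact ⟨by simp [this], by simp [this], by simp [this], by simp [this]⟩
  · intro k u hu hd
    obtain ⟨rfl, rfl⟩ := hV hu
    rw [hph]
    refine ⟨.inr ⟨rfl, rfl⟩, fun n hn => ?_⟩
    have := hns' n hn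
    exact ⟨hw.idle_of_new hu hn this, by simp [this]⟩
  · exact ⟨_, by simp, .inl ⟨hTd, rfl, rfl⟩⟩

theorem PhaseOK.congr {p : Phase} (hp : PhaseOK V tr ph k t p) (hn : t'.nodes = t.nodes)
    (hag : t'.activeGoals = t.activeGoals) (hr : t'.rootStatus = t.rootStatus)
    (hrest : t.Resting k → t'.Resting k) : PhaseOK V tr ph k t' p := by
  have hc : t.Counted k → t'.Counted k := by
    unfold Table.Counted Table.loopCount
    rw [hn, hag]
    exact id
  have hrr : ∀ w, t.RootReady k w → t'.RootReady k w := fun w h =>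
    h.congr hr fun j _ => by rw [hag]
  cases p with
  | quiet => exact ⟨hrest hp.1, hc hp.2.1, hn ▸ hp.2.2⟩
  | called l => exact ⟨hrest hp.1, hc hp.2.1, hp.2.2.1, hn ▸ hp.2.2.2⟩
  | run w => exact ⟨hrr w hp.1, hn ▸ hp.2⟩
  | wait w l =>
    obtain ⟨h1, h2, h3, h4, h5⟩ := hp
    have hpc : pendingCount V tr ph t' = pendingCount V tr ph t := by
      unfold pendingCount
      rw [hn]
    refine ⟨?_, hn ▸ h2, hn ▸ h3, by rw [hag, hpc]; exact h4, by rw [hpc]; exact h5⟩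
    cases w with
    | none => exact ⟨h1.1, hr.trans h1.2⟩
    | some l' =>
      exact ⟨h1.1, h1.2.imp (fun h => ⟨h.1, hr.trans h.2⟩)
        fun h => ⟨h.1, hr.trans h.2.1, by rw [hag]; exact h.2.2⟩⟩
  | ready w =>
    exact ⟨hp.1.imp (hrr w) fun h => ⟨h.1, hr.trans h.2⟩, hn ▸ hp.2⟩

theorem Inv.answerRequest {d : C} {r : Request S C} (h : Inv V (.request d r ::ₘ tr) ph i a ret)
    (hw : WellFormed i a V (.request d r ::ₘ tr)) (ht : V k₀ = some t) {G : Atom S C}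
    {t₀ : Table S C} {st : ResponseStatus} {J : Set Identifier}
    (hcase : t.Done ∧ st = .disposed ∧ J = ∅ ∧ t₀ = t ∨
      ¬ t.Done ∧ st = .active ∧ J = {k₀} ∧ Lower r.id k₀ ∧
        t₀ = { t with lr := t.lr ++ [⟨r.id, r.requester, G⟩] }) :
    Inv (Function.update V k₀ (some (t₀.mark {r.id})))
      (t.answerTo st J ⟨r.id, r.requester, G⟩ ::ₘ tr) ph i a ret := by
  obtain ⟨k', x, u₀, n₀, hx, hu₀, hl₀, hn₀, hid₀, hst₀, hmc, hri⟩ := h.request_parent hw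
  have hV0 := hw.unserved (Multiset.mem_cons_self (Message.request d r) tr)
  have hw' := hw.answerRequest ht (G := G) (t₀ := t₀) (st := st) (loops := J)
    (hcase.imp (fun h => h.2.2.2) fun h => h.2.2.2)
  have hrk : r.id ≠ k₀ := by
    rintro e
    rw [e, ht] at hV0
    cases hV0
  have hnodes : (t₀.mark {r.id}).nodes = t.nodes := by
    rcases hcase with ⟨-, -, -, rfl⟩ | ⟨-, -, -, -, rfl⟩ <;> rfl
  have hag : (t₀.mark {r.id}).activeGoals = t.activeGoals := by
    rcases hcase with ⟨-, -, -, rfl⟩ | ⟨-, -, -, -, rfl⟩ <;> rfl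
  have hrs : (t₀.mark {r.id}).rootStatus = t.rootStatus := by
    rcases hcase with ⟨-, -, -, rfl⟩ | ⟨-, -, -, -, rfl⟩ <;> rfl
  have hdone : (t₀.mark {r.id}).Done ↔ t.Done := by rw [Table.Done, hrs]; rfl
  have hg : t.Grows (t₀.mark {r.id}) := by
    refine ⟨hdone, fun q hq => ⟨q, ?_, rfl⟩, fun n hn => ⟨n, hnodes ▸ hn, rfl, fun _ h => h⟩⟩
    rcases hcase with ⟨-, -, -, rfl⟩ | ⟨-, -, -, -, rfl⟩
    · exact hq
    · exact List.mem_append_left _ hq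
  have hl : ¬ Dead V k₀ ∨ t.Done := by
    rcases hcase with ⟨h1, -⟩ | ⟨-, -, -, h1, -⟩
    · exact .inr h1
    · refine .inl fun hd => hl₀ (hd.mono_prefix ?_)
      exact prefix_of_prefix_concat (hx ▸ h1.1) (hx ▸ h1.2)
  have hrest : t.Resting k₀ → (t₀.mark {r.id}).Resting k₀ := by
    rintro ⟨h1, h2, h3, h4, h5⟩
    have hans : (t₀.mark {r.id}).ansSet = (t.mark {r.id}).ansSet := by
      rcases hcase with ⟨-, -, -, rfl⟩ | ⟨-, -, -, -, rfl⟩ <;> rfl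
    have hgoal : (t₀.mark {r.id}).goal = t.goal := by
      rcases hcase with ⟨-, -, -, rfl⟩ | ⟨-, -, -, -, rfl⟩ <;> rfl
    have hcl : ∀ q ∈ (t₀.mark {r.id}).clients, q ∈ t.clients ∨ q.id = r.id := by
      rcases hcase with ⟨-, -, -, rfl⟩ | ⟨-, -, -, -, rfl⟩
      · exact fun q hq => .inl hq
      · intro q hq
        rcases List.mem_append.1 hq with hq | hq
        · exact .inl (List.mem_append_left _ hq)
        · rcases List.mem_append.1 hq with hq | hq
          · exact .inl (List.mem_append_right _ hq)
          · obtain rfl := List.mem_singleton.1 hq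
            exact .inr rfl
    refine ⟨hrs.trans h1, ?_, hnodes ▸ h3, ?_, hnodes ▸ h5⟩
    · rcases h2 with h2 | ⟨p, hp, hv⟩
      · exact .inl (hnodes ▸ h2)
      · refine .inr ⟨(p.1, p.2 ∪ {r.id}), hans ▸ List.mem_map.2 ⟨p, hp, rfl⟩, ?_⟩
        rw [hgoal]
        exact hv
    · intro p hp q hq
      rw [hans] at hp
      obtain ⟨p', hp', rfl⟩ := List.mem_map.1 hp
      rcases hcl q hq with hq | hq
      · exact .inl (h4 p' hp' q hq)
      · exact .inr hq
  have hmem : Message.response r.requester ⟨r.id, t.unsent r.id, st, J⟩ ∈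
      t.answerTo st J ⟨r.id, r.requester, G⟩ ::ₘ tr := Multiset.mem_cons_self _ _
  have hMid : (t.answerTo st J ⟨r.id, r.requester, G⟩).id = r.id := rfl
  have hlr : ∀ q ∈ (t₀.mark {r.id}).lr, q ∈ t.lr ∨ q.id = r.id ∧ J = {k₀} := by
    rcases hcase with ⟨-, -, -, rfl⟩ | ⟨-, -, h1, -, rfl⟩
    · exact fun q hq => .inl hq
    · intro q hq
      rcases List.mem_append.1 hq with hq | hq
      · exact .inl hq
      · obtain rfl := List.mem_singleton.1 hq
        exact .inr ⟨rfl, h1⟩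
  have hsup : ¬ t.Done → Sup (Function.update V k₀ (some (t₀.mark {r.id}))) r.id k₀ := by
    intro htd
    refine .inl ⟨_, Function.update_self _ _ _, fun h => htd (hdone.1 h), ?_⟩
    rcases hcase with ⟨h1, -⟩ | ⟨-, -, -, -, rfl⟩
    · exact absurd h1 htd
    · exact ⟨⟨r.id, r.requester, G⟩, by simp [Table.mark], rfl⟩
  generalize t.answerTo st J ⟨r.id, r.requester, G⟩ = M at hw' hmem hMid ⊢
  generalize t₀.mark {r.id} = t' at hw' hnodes hag hrs hdone hg hrest hlr hsup ⊢
  have hresp : ∀ {d' q}, (.response d' q : Message S C) ∈ .request d r ::ₘ tr →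
      .response d' q ∈ M ::ₘ tr := by
    intro d' q hq
    rcases Multiset.mem_cons.1 hq with hq | hq
    · cases hq
    · exact Multiset.mem_cons_of_mem hq
  have hcnt : ∀ j, msgCount (M ::ₘ tr) j =
      msgCount (.request d r ::ₘ tr : Multiset (Message S C)) j := by
    intro j
    rw [msgCount_cons, msgCount_cons, hMid]
    rfl
  have hcnt1 : msgCount (M ::ₘ tr) r.id = 1 := by
    rw [msgCount_cons, hmc, hMid, if_pos rfl]
  have hmsg : ∀ j, j ≠ r.id → ∀ m ∈ (.request d r ::ₘ tr : Multiset (Message S C)),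
      m.id = j → m ∈ M ::ₘ tr := by
    rintro j hj m hm rfl
    rcases Multiset.mem_cons.1 hm with rfl | hm
    · exact absurd rfl hj
    · exact Multiset.mem_cons_of_mem hm
  have hV0' : Function.update V k₀ (some t') r.id = none := by
    rw [Function.update_of_ne hrk, hV0]
  have hbusy : ∀ {k}, Busy (Function.update V k₀ (some t')) ph k ↔ Busy V ph k :=
    busy_update_iff ht hdone Iff.rfl fun _ => rfl
  have hVn : ∀ {k u}, Function.update V k₀ (some t') k = some u →
      ∃ v, V k = some v ∧ v.nodes = u.nodes ∧ (v.Done ↔ u.Done) := by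
    intro k u hu
    rcases update_some.1 hu with ⟨rfl, rfl⟩ | ⟨-, hu⟩
    · exact ⟨t, ht, hnodes.symm, hdone.symm⟩
    · exact ⟨u, hu, rfl, Iff.rfl⟩
  have hparent : ∀ {k u n}, V k = some u → n ∈ u.nodes → n.id = r.id →
      k = k' ∧ u = u₀ ∧ n = n₀ := by
    intro k u n hu hn e
    exact hw.node_unique hu hu₀ hn hn₀ (e.trans hid₀.symm)
  refine h.update hw hw' ht hg hl (fun _ _ hq => .inl (hresp hq)) ?_ ?_ ?_ ?_ ?_ ?_ ?_
  · intro n hn hst j d' q hq e hj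
    exact ⟨n, hnodes ▸ hn, rfl, .inr ⟨hst, d', q, hresp hq, e, hj⟩⟩
  · intro m hm
    rcases Multiset.mem_cons.1 hm with rfl | hm
    · refine .inr fun k y e => ?_
      rw [hMid, hx] at e
      rwa [← (List.append_inj' e rfl).1]
    · exact .inl (Multiset.mem_cons_of_mem hm)
  · intro htd
    have htd' : ¬ t.Done := fun h => htd (hdone.2 h)
    exact (h.loops ht htd').transfer ht (hl.resolve_right htd') hg
      (fun n hn _ => ⟨n, hnodes ▸ hn, rfl, rfl⟩) fun j => by rw [hag]
  · intro htd q hq hqn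
    obtain ⟨e, hJ⟩ := (hlr q hq).resolve_left fun h => hqn q h rfl
    intro k'' v hv n hn e'
    obtain ⟨v', hv', hvn, hvd⟩ := hVn hv
    obtain ⟨rfl, rfl, rfl⟩ := hparent hv' (hvn ▸ hn) (e'.trans e)
    exact .inr ⟨fun h => not_done_of_not_dead hv' hl₀ (hvd.2 h),
      .inr ⟨hst₀, _, _, hmem, e.symm, by rw [hJ]; rfl⟩⟩
  · intro k u hu hd n hn
    obtain ⟨v, hv, hvn, -⟩ := hVn hu
    rw [← hvn] at hn
    by_cases e : n.id = r.id
    · obtain ⟨rfl, rfl, rfl⟩ := hparent hv hn e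
      refine ⟨by simp [hst₀], by simp [hst₀], fun _ => .inr (.inr ⟨_, _, hmem, e.symm, e ▸ hcnt1,
        ?_, ?_⟩), by simp [hst₀]⟩
      · rw [e]
        rintro ⟨z, hz, -⟩
        rw [hV0'] at hz
        cases hz
      · rw [e]
        rcases hcase with ⟨-, rfl, rfl, -⟩ | ⟨h1, rfl, rfl, h2, -⟩
        · refine .inl ⟨rfl, rfl, fun z hz => ?_⟩
          rw [hV0'] at hz
          cases hz
        · refine .inr ⟨rfl, ⟨k₀, rfl⟩, fun j hj => ?_, fun z hz => ?_⟩
          · obtain rfl := Set.mem_singleton_iff.1 hj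
            exact ⟨hw.pre ht, prefix_of_prefix_concat (hx ▸ h2.1) (hx ▸ h2.2), hsup h1⟩
          · rw [hV0'] at hz
            cases hz
    · exact (h.node hv hd n hn).frame (hcnt _) (hmsg _ e) (.inr rfl) hbusy (fun _ => rfl)
        (fun hc => hc.update ht hdone) (fun J _ hc => hc.update ht hdone hnodes)
        (fun j _ hs => hs.update ht hg)
  · intro k u hu hd
    have hidle : ∀ n : Node S C, Idle (Function.update V k₀ (some t')) (M ::ₘ tr) ph n.id ↔
        Idle V (.request d r ::ₘ tr) ph n.id := by
      intro n
      unfold Idle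
      rw [hbusy, hcnt]
    rcases update_some.1 hu with ⟨rfl, rfl⟩ | ⟨hk, hu'⟩
    · exact ((h.phase ht hd).frame fun n _ => hidle n).congr hnodes hag hrs hrest
    · exact (h.phase hu' hd).frame fun n _ => hidle n
  · exact h.top_update ht hdone (hcnt i) (hmsg i hri.symm)

end

end GEM

namespace GEM

variable {S C : Type*}

section

variable {i : Identifier} {a : C} {V V' : Identifier → Option (Table S C)}
  {tr tr' : Multiset (Message S C)} {ph ph' : Identifier → Phase} {k k₀ j : Identifier}
  {t t' : Table S C} {ret ret' : List (C × Response S C)}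

/-! ### The invariant is preserved by all steps -/

/-- No goal is about to activate a node. -/
def Stable (V : Identifier → Option (Table S C)) (ph : Identifier → Phase) : Prop :=
  ∀ k w, ¬ Dead V k → ph k ≠ .ready w

theorem Dead.update (h : Dead V k) (ht : V k₀ = some t) (hd : t.Done → t'.Done) :
    Dead (Function.update V k₀ (some t')) k := by
  obtain ⟨l, u, hu, h1, h2⟩ := h
  by_cases hl : l = k₀
  · subst hl
    rw [ht, Option.some_inj] at hu
    subst hu
    exact ⟨l, t', by simp, hd h1, h2⟩
  · exact ⟨l, u, update_some.2 (.inr ⟨hl, hu⟩), h1, h2⟩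

theorem Inv.generateResponse (h : Inv V tr ph i a ret) (hw : WellFormed i a V tr)
    (ht : V k₀ = some t) (hl : ¬ Dead V k₀) {w : Option Identifier} (hp : ph k₀ = .ready w)
    (hst : ∀ k w, k ≠ k₀ → ¬ Dead V k → ph k ≠ .ready w) (hex : t.Exhausted)
    {ms : List (Message S C)} (hg : GenerateResponse t t' ms) :
    ∃ ph', Inv (Function.update V k₀ (some t')) (tr + ms) ph' i a ret ∧
      Stable (Function.update V k₀ (some t')) ph' := by
  have htd := not_done_of_not_dead ht hl
  have hw' := hw.respond ht htd hg
  have hterm : Stable (Function.update V k₀ (some t.terminate.1)) ph := by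
    intro k w hd
    rw [dead_update_of_not_done ht htd t.terminate_fields.1, not_or] at hd
    refine hst k w ?_ hd.1
    rintro rfl
    exact hd.2 List.prefix_rfl
  have hlo := h.loops ht htd
  have hroot := hw.root ht
  have hrr : t.RootReady k₀ w ∨ w = none ∧ t.rootStatus = .new := by
    have hph := h.phase ht hl
    rw [hp] at hph
    exact hph.1
  have hquiet : ∀ T : Table S C, Stable (Function.update V k₀ (some T))
      (Function.update ph k₀ .quiet) := by
    intro T k w hd
    by_cases hk : k = k₀
    · subst hk
      simp
    · rw [Function.update_of_ne hk]
      exact hst k w hk fun hd' => hd (hd'.update ht fun h => absurd h htd)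
  cases hg with
  | noLoop h1 => exact ⟨ph, h.generateResponse_terminate hw ht hl hp (.inl h1), hterm⟩
  | leader h1 h2 h3 =>
    exact ⟨ph, h.generateResponse_terminate hw ht hl hp (.inr ⟨h2, h3⟩), hterm⟩
  | iterate h1 h2 =>
    refine ⟨_, h.iterate hw ht hl hp h2 hw', fun k w' hd => ?_⟩
    unfold iteratePhase
    split_ifs with h3 h4
    · simp
    · simp
    · exact hst k w' h3 fun hd' => hd (hd'.update ht fun h => absurd h htd)
  | replyLoop h1 h2 h3 r hr l hl' =>
    have hwl : w = some l := by
      cases w with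
      | none => exact absurd hl' (Table.not_processesHigher hroot (hrr.imp_right And.right))
      | some l' =>
        rcases hrr with hrr | ⟨e, -⟩
        · rw [(Table.processesHigher_iff hlo hroot hrr).1 hl']
        · cases e
    subst hwl
    exact ⟨_, h.reply hw ht hl hp hex h1 h2 h3 hr hw', hquiet _⟩
  | replyActive h1 h2 h3 r hr hno =>
    have hwl : w = none := by
      cases w with
      | none => rfl
      | some l' =>
        rcases hrr with hrr | ⟨e, -⟩
        · exact absurd ((Table.processesHigher_iff hlo hroot hrr).2 rfl) (hno l')
        · cases e
    subst hwl
    exact ⟨_, h.reply hw ht hl hp hex h1 h2 h3 hr hw', hquiet _⟩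

/-- The invariant of the states after the initial one, as long as the computation is not
halted. -/
def StepInv (i : Identifier) (a : C) (s : State S C) : Prop :=
  s.floundered = true ∨
    ∃ ph, Inv (look s.tables) s.transit ph i a s.returned ∧ Stable (look s.tables) ph

theorem StepInv.activate {s s' : State S C} {l₁ l₂ : List (Table S C)} {o : Outcome S C}
    (hgood : Good i a (l₁ ++ t :: l₂) tr)
    (h : Inv (look (l₁ ++ t :: l₂)) tr ph i a s.returned)
    (hl : ¬ Dead (look (l₁ ++ t :: l₂)) t.rootId) {w : Option Identifier}
    (hp : ph t.rootId = .ready w)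
    (hst : ∀ k w, k ≠ t.rootId → ¬ Dead (look (l₁ ++ t :: l₂)) k → ph k ≠ .ready w)
    (ho : ActivateNode t o) (ha : Apply s l₁ l₂ tr o s') : StepInv i a s' := by
  refine ActivateNode.rec_on_table
    (Mid := fun t => Good i a (l₁ ++ t :: l₂) tr ∧
      Inv (look (l₁ ++ t :: l₂)) tr ph i a s.returned ∧
      ¬ Dead (look (l₁ ++ t :: l₂)) t.rootId ∧ ph t.rootId = .ready w ∧
      ∀ k w, k ≠ t.rootId → ¬ Dead (look (l₁ ++ t :: l₂)) k → ph k ≠ .ready w)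
    (Q := fun o => ∀ s', Apply s l₁ l₂ tr o s' → StepInv i a s')
    ?_ ?_ ?_ ?_ ho ⟨hgood, h, hl, hp, hst⟩ s' ha
  · rintro t pre post n ⟨h1, h2, h3, h4, h5⟩ - hs hb
    have hid := (t.useFact_fields pre post n).2.2.2.2.1
    refine ⟨h1.useFact hs, ?_⟩
    rw [hid, look_replace hid h1.nodup]
    refine ⟨h2.useFact h1.wf h1.look_mid h3 h4 hs hb, ?_, h4, fun k w hk hd => ?_⟩
    · rwa [dead_update h1.look_mid Table.useFact_done]
    · rw [dead_update h1.look_mid Table.useFact_done] at hd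
      exact h5 k w hk hd
  · rintro t t' ms ⟨h1, h2, h3, h4, h5⟩ hex hg s' ⟨⟩
    obtain ⟨ph', h6, h7⟩ := h2.generateResponse h1.wf h1.look_mid h3 h4 h5 hex hg
    have hid : t'.rootId = t.rootId := by
      have hd := not_done_of_not_dead h1.look_mid h3
      exact (hg.spec (h1.wf.clients_nodup h1.look_mid hd) hd).1.rootId
    refine .inr ⟨ph', ?_⟩
    dsimp only
    rw [look_replace hid h1.nodup]
    exact ⟨h6, h7⟩
  · rintro s' ⟨⟩
    exact .inl rfl
  · rintro t pre post n B Bs c ⟨h1, h2, h3, h4, h5⟩ - hs hb - s' ⟨⟩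
    have h6 := h2.sendRequest h1.wf h1.look_mid h3 h4 hs (B := B) (by simp [hb]) c
    rw [← Multiset.singleton_add, add_comm] at h6
    refine .inr ⟨Function.update ph t.rootId (.run w), ?_⟩
    dsimp only
    rw [look_replace (t := t) (t' := t.activate pre n post .active) rfl h1.nodup]
    refine ⟨h6, fun k w' hd => ?_⟩
    by_cases hk : k = t.rootId
    · rw [hk, Function.update_self]
      simp
    · rw [Function.update_of_ne hk]
      refine h5 k w' hk fun hd' => hd (hd'.update h1.look_mid Table.activate_done.2)

theorem StepInv.step {P : Policy S C} {s s' : State S C} (h : StepInv i a s)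
    (hgood : Good i a s.tables s.transit) (hs : Step P s s') : StepInv i a s' := by
  have hf : s.floundered = false := by cases hs <;> assumption
  rcases h with h | ⟨ph, h, hst⟩
  · rw [hf] at h
    cases h
  cases hs with
  | @completed d r rest l₁ l₂ t t' m hf hm ht hc hs =>
    rw [hm, ht] at h hgood
    rw [ht] at hst
    rw [Table.sendResponse_eq] at hs
    cases hs
    refine .inr ⟨ph, ?_⟩
    dsimp only
    rw [look_replace (t := t) (t' := t.mark {r.id}) rfl hgood.nodup]
    refine ⟨h.answerRequest hgood.wf hgood.look_mid (.inl ⟨hc.2.2, rfl, rfl, rfl⟩),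
      fun k w hd => hst k w fun hd' => hd (hd'.update hgood.look_mid id)⟩
  | @lower d r rest l₁ l₂ t t' m hf hm hn ht hc hs =>
    have hl := hgood.formsLoop (t := t) (by simp [ht]) hc
    rw [hm, ht] at h hgood
    rw [ht] at hst
    rw [Table.sendResponse_eq] at hs
    cases hs
    refine .inr ⟨ph, ?_⟩
    dsimp only
    rw [look_replace (t := t) (t' := ({ t with lr := t.lr ++ [⟨r.id, r.requester, t.goal⟩] } :
      Table S C).mark {r.id}) rfl hgood.nodup]
    refine ⟨h.answerRequest hgood.wf hgood.look_mid (.inr ⟨hc.2.2.1, rfl, rfl, hl, rfl⟩),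
      fun k w hd => hst k w fun hd' => hd (hd'.update hgood.look_mid id)⟩
  | @create _ d r rest G o hf hm hn hG hc ha =>
    obtain ⟨ns, hns, ho⟩ := hc
    rw [hm] at h hgood
    have hu := hgood.wf.unserved (Multiset.mem_cons_self _ _)
    have hlook : look (s.tables ++ [newTable d ⟨r.id, r.requester, G⟩ ns]) =
        Function.update (look s.tables) r.id (some (newTable d ⟨r.id, r.requester, G⟩ ns)) :=
      look_append hgood.nodup hu
    have hgood' := hgood.create (d := d) hns
    have hwf' := hgood'.wf
    rw [hlook] at hwf'
    have h' := h.create hgood.wf hns hwf'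
    have hdead : ∀ {k}, Dead (look s.tables) k → Dead (Function.update (look s.tables) r.id
        (some (newTable d ⟨r.id, r.requester, G⟩ ns))) k := by
      rintro k ⟨l, u, hu', h1, h2⟩
      refine ⟨l, u, update_some.2 (.inr ⟨?_, hu'⟩), h1, h2⟩
      rintro rfl
      rw [hu] at hu'
      cases hu'
    refine StepInv.activate (t := newTable d ⟨r.id, r.requester, G⟩ ns)
      (ph := Function.update ph r.id (.ready none)) hgood' ?_ ?_ (w := none) ?_ ?_ ho ha
    · rw [hlook]
      exact h'
    · rw [hlook]
      rintro ⟨l, u, hu', h1, h2⟩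
      rcases update_some.1 hu' with ⟨rfl, rfl⟩ | ⟨hk, hu'⟩
      · simp [Table.Done, newTable] at h1
      · obtain ⟨k', x, u₀, n₀, hx, hu₀, hl₀, -⟩ := h.request_parent hgood.wf
        replace h2 : l <+: r.id := h2
        refine hl₀ ⟨l, u, hu', h1, prefix_of_prefix_concat (hx ▸ h2) (hx ▸ hk)⟩
    · exact Function.update_self _ _ _
    · intro k w hk hd
      replace hk : k ≠ r.id := hk
      rw [hlook] at hd
      rw [Function.update_of_ne hk]
      exact hst k w fun hd' => hd (hdead hd')
  | @response _ d r rest l₁ l₂ t o hf hm ht hw hp ha =>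
    rw [hm, ht] at h hgood
    rw [ht] at hst
    cases hp with
    | ignore hroot =>
      cases ha
      refine .inr ⟨ph, ?_⟩
      dsimp only
      rw [Multiset.coe_nil, add_zero]
      exact ⟨h.ignore hgood.wf hgood.look_mid hroot hw.2, hst⟩
    | resume hroot hn hid hb hns ht' hr ho =>
      obtain rfl : _ = t.receive r _ := ht'
      have hid' : ∀ ns, (t.receive r ns).rootId = t.rootId := fun _ => (t.noteResponse_fields r).2.2.1
      by_cases hd : Dead (look (l₁ ++ t :: l₂)) t.rootId
      · obtain ⟨-, h1⟩ := h.zombie_receive hgood.wf hgood.look_mid hd hroot hw.2 hns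
        obtain ⟨t', ms, rfl, htd, hid, h2⟩ := h1 _ ho
        cases ha
        refine .inr ⟨ph, ?_⟩
        dsimp only
        rw [look_replace hid hgood.nodup]
        exact ⟨h2, fun k w hd => hst k w fun hd' => hd (hd'.update hgood.look_mid fun _ => htd)⟩
      · obtain ⟨p, h1, h2⟩ := h.receive hgood.wf hgood.look_mid hd hw.2 hns
        rw [if_pos hr] at h2
        obtain ⟨w, rfl⟩ := h2
        have hlook := look_replace (t := t) (hid' ‹List (Node S C)›) hgood.nodup
        have hne := not_done_of_not_dead hgood.look_mid hd
        refine StepInv.activate (hgood.receive hw.2 hns) (hlook ▸ h1) ?_ (w := w) ?_ ?_ ho ha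
        · rw [hlook, hid', dead_update hgood.look_mid]
          · exact hd
          · refine iff_of_false ?_ hne
            rcases hr with hr | ⟨ids, hr, -⟩ <;> simp [Table.Done, hr]
        · rw [hid', Function.update_self]
        · intro k w' hk hdk
          rw [hid'] at hk
          rw [Function.update_of_ne hk]
          rw [hlook] at hdk
          exact hst k w' fun hd' => hdk (hd'.update hgood.look_mid fun h => absurd h hne)
    | wait hroot hn hid hb hns ht' hr =>
      obtain rfl : _ = t.receive r _ := ht'
      have hid' : ∀ ns, (t.receive r ns).rootId = t.rootId := fun _ => (t.noteResponse_fields r).2.2.1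
      by_cases hd : Dead (look (l₁ ++ t :: l₂)) t.rootId
      · exact absurd (h.zombie_receive hgood.wf hgood.look_mid hd hroot hw.2 hns).1 hr
      · obtain ⟨p, h1, h2⟩ := h.receive hgood.wf hgood.look_mid hd hw.2 hns
        rw [if_neg hr] at h2
        cases ha
        refine .inr ⟨Function.update ph t.rootId p, ?_⟩
        dsimp only
        rw [Multiset.coe_nil, add_zero, look_replace (hid' _) hgood.nodup]
        refine ⟨h1, fun k w' hdk => ?_⟩
        by_cases hk : k = t.rootId
        · rw [hk, Function.update_self]
          exact h2 w'
        · rw [Function.update_of_ne hk]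
          exact hst k w' fun hd' => hdk (hd'.update hgood.look_mid fun h => absurd h hroot)
  | returned hf hm hn =>
    rw [hm] at h hgood
    refine .inr ⟨ph, h.returned hgood.wf fun k t ht ho n hn' e => ?_, hst⟩
    obtain ⟨ht, -⟩ := (look_eq_some hgood.nodup).1 ht
    exact hn t ht ⟨ho, n, hn', e⟩

theorem StepInv.initial {P : Policy S C} {d : C} {G : Atom S C} {s' : State S C}
    (hs : Step P (GEM.initial i a d G) s') : StepInv i a s' := by
  have hgood := good_initial (S := S) i a d G
  cases hs with
  | completed hf hm ht hc hs => simp [GEM.initial] at ht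
  | lower hf hm hn ht hc hs => simp [GEM.initial] at ht
  | @create _ d r rest G o hf hm hn hG hc ha =>
    obtain ⟨ns, hns, ho⟩ := hc
    have hm' := (Multiset.singleton_eq_cons_iff _).1 hm
    obtain ⟨e, rfl⟩ := hm'
    cases e
    have hgood' := hgood.create (d := d) (r := ⟨i, a, _⟩) (tr := 0) hns
    have hl0 : look ([] : List (Table S C)) = fun _ => none := rfl
    have hlook : look ([] ++ [newTable d ⟨i, a, G⟩ ns]) =
        Function.update (fun _ => none) i (some (newTable d ⟨i, a, G⟩ ns)) :=
      look_append (by simp) rfl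
    have hwf' := hgood'.wf
    rw [hlook] at hwf'
    refine StepInv.activate (t := newTable d ⟨i, a, G⟩ ns)
      (ph := Function.update (fun _ => .quiet) i (.ready none)) hgood' ?_ ?_ (w := none) ?_ ?_ ho ha
    · rw [hlook]
      exact Inv.initial (r := ⟨i, a, G⟩) hns rfl hwf' (by simp)
    · rw [hlook]
      rintro ⟨l, u, hu', h1, h2⟩
      rcases update_some.1 hu' with ⟨rfl, rfl⟩ | ⟨hk, hu'⟩
      · simp [Table.Done, newTable] at h1
      · cases hu'
    · exact Function.update_self _ _ _
    · intro k w hk _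
      replace hk : k ≠ i := hk
      rw [Function.update_of_ne hk]
      simp
  | response hf hm ht hw hp ha => simp [GEM.initial] at ht
  | returned hf hm hn =>
    have hm' := (Multiset.singleton_eq_cons_iff _).1 hm
    cases hm'.1

theorem StepInv.reachable {P : Policy S C} {d : C} {G : Atom S C} {s : State S C}
    (h : Relation.ReflTransGen (Step P) (GEM.initial i a d G) s) :
    s = GEM.initial i a d G ∨ StepInv i a s := by
  induction h with
  | refl => exact .inl rfl
  | tail h hs ih =>
    right
    rcases ih with rfl | ih
    · exact StepInv.initial hs
    · exact ih.step (Good.reachable h) hs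

/-! ### Final states -/

theorem exists_length_bound (ts : List (Table S C)) :
    ∃ L, ∀ t ∈ ts, t.rootId.length ≤ L := by
  induction ts with
  | nil => exact ⟨0, by simp⟩
  | cons t ts ih =>
    obtain ⟨L, hL⟩ := ih
    refine ⟨max t.rootId.length L, fun u hu => ?_⟩
    rcases List.mem_cons.1 hu with rfl | hu
    · exact le_max_left _ _
    · exact (hL u hu).trans (le_max_right _ _)

section

variable (h : Inv V 0 ph i a ret) (hst : Stable V ph) (hw : WellFormed i a V 0)
  {L : ℕ} (hL : ∀ {k t}, V k = some t → k.length ≤ L)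

include h hw hL

include hst in
/-- Without messages, no live goal is being evaluated. -/
theorem Inv.final_quiet {l : ℕ} (hl : L < k.length + l) (ht : V k = some t) (hd : ¬ Dead V k) :
    ph k = .quiet := by
  induction l generalizing k t with
  | zero =>
    have := hL ht
    omega
  | succ l ih =>
    have key : ∀ n ∈ t.nodes, Idle V 0 ph n.id := by
      intro n hn
      refine ⟨rfl, ?_⟩
      rintro ⟨z, hz, hzd, hq⟩
      obtain ⟨x, hx⟩ := hw.node ht hn
      refine hq (ih (by rw [hx, List.length_append, List.length_singleton]; omega) hz fun hd' => ?_)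
      rw [hx] at hd' hz
      refine hd (hd'.parent fun z' hz' => ?_)
      rw [hz, Option.some_inj] at hz'
      exact hz' ▸ hzd
    have hph := h.phase ht hd
    cases hp : ph k with
    | quiet => rfl
    | called l' =>
      rw [hp] at hph
      obtain ⟨-, -, -, ⟨n, hn, hj⟩, h1⟩ := hph
      exact absurd (key n hn) ((h1 n hn).2 hj)
    | run w =>
      rw [hp] at hph
      obtain ⟨-, n, hn, hs, -⟩ := hph
      exact absurd hs ((key n hn).not_active (h.node ht hd n hn))
    | wait w l' =>
      rw [hp] at hph
      obtain ⟨-, -, -, -, h1⟩ := hph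
      unfold pendingCount at h1
      rw [List.countP_pos_iff] at h1
      obtain ⟨n, hn, h2⟩ := h1
      exact absurd (key n hn) (by simpa using h2)
    | ready w => exact absurd hp (hst k w hd)

/-- Without messages, all loops are coordinated by uncompleted goals. -/
theorem Inv.final_coordinator {l : ℕ} (hl : L < k.length + l) (ht : V k = some t) (hd : ¬ t.Done)
    {n : Node S C} (hn : n ∈ t.nodes) (hj : n.InLoop j) : ∃ u, V j = some u ∧ ¬ u.Done := by
  induction l generalizing k t n with
  | zero =>
    have := hL ht
    omega
  | succ l ih =>
    rcases (h.loops ht hd).sup n hn j hj with (⟨u, hu, hud, -⟩ | ⟨z, hz, hzd, m, hm, hj'⟩) |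
      ⟨-, d, r, hr, -⟩
    · exact ⟨u, hu, hud⟩
    · obtain ⟨x, hx⟩ := hw.node ht hn
      exact ih (by rw [hx, List.length_append, List.length_singleton]; omega) hz hzd hm hj'
    · simp at hr

include hst

theorem Inv.final_done (ht : V k = some t) : t.Done := by
  obtain ⟨u, hu, -⟩ := h.top
  have hud : u.Done := by
    by_contra hud
    have hd : ¬ Dead V i := by
      rintro ⟨l, v, hv, h1, h2⟩
      obtain rfl := prefix_antisymm h2 (hw.pre hv)
      rw [hu, Option.some_inj] at hv
      exact hud (hv ▸ h1)
    have hph := h.phase hu hd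
    rw [h.final_quiet hst hw hL (l := L + 1) (by omega) hu hd] at hph
    obtain ⟨n, hn, j, hj, hne⟩ := hph.1.higher
    obtain ⟨h1, h2⟩ := (h.loops hu hud).pre n hn j hj
    exact hne (prefix_antisymm h2 h1)
  obtain ⟨l, hl⟩ : ∃ l, k.length = l := ⟨_, rfl⟩
  induction l using Nat.strong_induction_on generalizing k t with
  | _ l ih =>
    by_contra htd
    obtain ⟨n, hn, j, hj, hne⟩ := (h.zombie ht htd ⟨i, u, hu, hud, hw.pre ht⟩).resting.higher
    obtain ⟨v, hv, hvd⟩ := h.final_coordinator hw hL (l := L + 1) (by omega) ht htd hn hj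
    have hjk := ((h.loops ht htd).pre n hn j hj).2
    refine hvd (ih j.length ?_ hv rfl)
    rw [← hl]
    exact lt_of_le_of_ne hjk.length_le fun e => hne (hjk.eq_of_length e)

end

/-- Every execution that cannot be continued has floundered or is completed. -/
theorem completed_of_stuck {P : Policy S C} {d : C} {G : Atom S C} {s : State S C}
    (h : Relation.ReflTransGen (Step P) (GEM.initial i a d G) s) (hs : ∀ s', ¬ Step P s s') :
    s.floundered = true ∨ Completed i a s := by
  have hgood := Good.reachable h
  by_cases hf : s.floundered = true
  · exact .inl hf
  rw [Bool.not_eq_true] at hf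
  have htr : s.transit = 0 := by
    by_contra htr
    obtain ⟨s', hs'⟩ := exists_step P hgood hf htr
    exact hs s' hs'
  rcases StepInv.reachable h with rfl | h' | ⟨ph, hinv, hst⟩
  · simp [GEM.initial] at htr
  · exact .inl h'
  rw [htr] at hinv hgood
  obtain ⟨L, hL⟩ := exists_length_bound s.tables
  have hdone : ∀ {k t}, look s.tables k = some t → t.Done := fun ht =>
    hinv.final_done hst hgood.wf (L := L) (fun hu => by
      obtain ⟨h1, rfl⟩ := (look_eq_some hgood.nodup).1 hu
      exact hL _ h1) ht
  refine .inr ⟨hf, htr, fun t ht => hdone (hgood.look_mem ht), ?_⟩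
  obtain ⟨u, hu, h1 | ⟨-, -, -, h1, -⟩ | ⟨-, ans, -, h1⟩⟩ := hinv.top
  · exact absurd (hdone hu) h1.1
  · simp [msgCount] at h1
  · exact ⟨ans, h1⟩

end

end GEM

namespace GEM

variable {S C : Type*}

/-! ### Bounds for the atoms of a computation -/

/-- A finite signature with a bound for the number of its atoms up to variants, and bounds for
the lengths of local policies and of clause bodies. -/
structure Limits (S C : Type*) where
  sig : Signature S C
  atoms : ℕ
  clauses : ℕ
  body : ℕ
  bound : ∀ l : List (Atom S C), (∀ A ∈ l, A.Over sig) →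
    l.Pairwise (fun A B => ¬ IsVariant A B) → l.length ≤ atoms

/-- A clause within the limits. -/
structure Clause.Within (U : Limits S C) (c : Clause S C) : Prop where
  head : c.head.Over U.sig
  body : ∀ B ∈ c.body, B.Over U.sig
  length : c.body.length ≤ U.body

/-- A local policy within the limits. -/
def Limits.Admits (U : Limits S C) (cs : List (Clause S C)) : Prop :=
  cs.length ≤ U.clauses ∧ ∀ c ∈ cs, c.Within U

/-- The clause of a node. -/
def Node.clause (n : Node S C) : Clause S C := ⟨n.head, n.body⟩

structure Table.Within (U : Limits S C) (t : Table S C) : Prop where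
  goal : t.goal.Over U.sig
  loc : t.goal.loc = .const t.owner
  nodes : ∀ n ∈ t.nodes, n.clause.Within U
  ans : ∀ p ∈ t.ansSet, p.1.Over U.sig
  distinct : (t.ansSet.map Prod.fst).Pairwise fun A B => ¬ IsVariant A B

def Message.Within (U : Limits S C) : Message S C → Prop
  | .request d r => r.goal.Over U.sig ∧ r.goal.loc = .const d
  | .response _ r => ∀ A ∈ r.ans, A.Over U.sig

/-- All atoms of a state are within the limits, and no goal is a variant of a goal that depends
on it. -/
structure Within (U : Limits S C) (ts : List (Table S C)) (tr : Multiset (Message S C)) : Prop where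
  table : ∀ t ∈ ts, t.Within U
  msg : ∀ m ∈ tr, m.Within U
  chain : ∀ t ∈ ts, ∀ u ∈ ts, Lower t.rootId u.rootId → ¬ IsVariant t.goal u.goal

theorem exists_forall_mem_le {α : Type*} (f : α → ℕ) (l : List α) : ∃ b, ∀ x ∈ l, f x ≤ b :=
  ⟨(l.map f).sum, fun _ hx => List.single_le_sum (by simp) _ (List.mem_map_of_mem hx)⟩

open scoped Classical in
theorem exists_limits {P : Policy S C} (hP : {c | P c ≠ []}.Finite) (G : Atom S C) :
    ∃ U : Limits S C, G.Over U.sig ∧ ∀ c, U.Admits (P c) := by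
  let cs : List (Clause S C) := hP.toFinset.toList.flatMap P
  have hcs : ∀ d, ∀ c ∈ P d, c ∈ cs := by
    intro d c hc
    refine List.mem_flatMap.2 ⟨d, ?_, hc⟩
    rw [Finset.mem_toList, Set.Finite.mem_toFinset]
    exact List.ne_nil_of_mem hc
  let As : List (Atom S C) := G :: cs.flatMap fun c => c.head :: c.body
  have hterm : ∀ t : Term C, {c | t = .const c}.Finite := by
    intro t
    refine Set.Subsingleton.finite ?_
    rintro c rfl c' h
    cases h
    rfl
  have hcon : ∀ A : Atom S C, A.consts.Finite := by
    intro A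
    refine ((hterm A.loc).union (A.args.finite_toSet.biUnion fun t _ => hterm t)).subset ?_
    rintro c (hc | hc)
    · exact .inl hc
    · exact .inr (Set.mem_biUnion hc rfl)
  obtain ⟨k, hk⟩ := exists_forall_mem_le (fun A : Atom S C => A.args.length) As
  obtain ⟨b, hb⟩ := exists_forall_mem_le (fun c : Clause S C => c.body.length) cs
  obtain ⟨K, hK⟩ := exists_forall_mem_le (fun d => (P d).length) hP.toFinset.toList
  let Q : Signature S C := ⟨{p | ∃ A ∈ As, A.pred = p}, ⋃ A ∈ {A | A ∈ As}, A.consts, k⟩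
  have hQ : ∀ A ∈ As, A.Over Q := fun A hA =>
    ⟨⟨A, hA, rfl⟩, Set.subset_biUnion_of_mem (u := Atom.consts) (s := {A | A ∈ As}) hA, hk A hA⟩
  obtain ⟨N, hN⟩ := Q.exists_bound ((As.finite_toSet.image Atom.pred).subset
    fun p ⟨A, hA, e⟩ => ⟨A, hA, e⟩) (As.finite_toSet.biUnion fun A _ => hcon A)
  refine ⟨⟨Q, N, K, b, hN⟩, hQ G List.mem_cons_self, fun d => ⟨?_, fun c hc => ?_⟩⟩
  · by_cases hd : P d = []
    · simp [hd]
    · exact hK d (by simpa using hd)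
  · have h : ∀ A ∈ c.head :: c.body, A.Over Q := fun A hA =>
      hQ A (List.mem_cons_of_mem _ (List.mem_flatMap.2 ⟨c, hcs d c hc, hA⟩))
    exact ⟨h _ List.mem_cons_self, fun B hB => h B (List.mem_cons_of_mem _ hB), hb c (hcs d c hc)⟩

section

variable {U : Limits S C} {t t' : Table S C}

theorem Clause.Within.subst {c : Clause S C} (h : c.Within U) {A B : Atom S C} {θ : Subst C}
    (hA : A.Over U.sig) (hB : B.Over U.sig) (hθ : IsMGU θ A B) : (c.subst θ).Within U := by
  refine ⟨hA.subst_mgu hB h.head hθ, fun D hD => ?_, by simpa [Clause.subst] using h.length⟩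
  obtain ⟨D', hD', rfl⟩ := List.mem_map.1 hD
  exact hA.subst_mgu hB (h.body D' hD') hθ

theorem Clause.Within.rename {c : Clause S C} (h : c.Within U) (π : Equiv.Perm ℕ) :
    (c.subst (renameBy π)).Within U := by
  refine ⟨h.head.rename π, fun D hD => ?_, by simpa [Clause.subst] using h.length⟩
  obtain ⟨D', hD', rfl⟩ := List.mem_map.1 hD
  exact (h.body D' hD').rename π

theorem InitialNodes.within {A : Atom S C} {i : Identifier} {cs : List (Clause S C)}
    {ns : List (Node S C)} (h : InitialNodes A i cs ns) (hA : A.Over U.sig)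
    (hcs : ∀ c ∈ cs, c.Within U) : ∀ n ∈ ns, n.clause.Within U := by
  induction h with
  | nil => simp
  | skip _ _ ih => exact ih fun c hc => hcs c (List.mem_cons_of_mem _ hc)
  | @add c c' cs ns π θ s hc _ hθ _ _ ih =>
    have hc' : c'.Within U := by
      rw [hc]
      exact (hcs c List.mem_cons_self).rename π
    intro n hn
    rcases List.mem_cons.1 hn with rfl | hn
    · exact hc'.subst hA hc'.head hθ
    · exact ih (fun c hc => hcs c (List.mem_cons_of_mem _ hc)) n hn

theorem AnswerNodes.within {H B : Atom S C} {Bs : List (Atom S C)} {k : ℕ} {i : Identifier}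
    {used : Set Identifier} {As : List (Atom S C)} {ns : List (Node S C)}
    (h : AnswerNodes H B Bs k i used As ns) (hc : Clause.Within U ⟨H, B :: Bs⟩)
    (hAs : ∀ A ∈ As, A.Over U.sig) : ∀ n ∈ ns, n.clause.Within U := by
  have hc' : Clause.Within U ⟨H, Bs⟩ :=
    ⟨hc.head, fun D hD => hc.body D (List.mem_cons_of_mem _ hD),
      (Nat.le_succ _).trans hc.length⟩
  induction h with
  | nil => simp
  | skip _ _ ih => exact ih fun A hA => hAs A (List.mem_cons_of_mem _ hA)
  | @add A A' As ns π θ s hA _ hθ _ _ _ ih =>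
    have hA' : A'.Over U.sig := by
      rw [hA]
      exact (hAs A List.mem_cons_self).rename π
    intro n hn
    rcases List.mem_cons.1 hn with rfl | hn
    · exact hc'.subst (hc.body B List.mem_cons_self) hA' hθ
    · exact ih (fun A hA => hAs A (List.mem_cons_of_mem _ hA)) n hn

theorem Table.Within.length_ansSet (h : t.Within U) : t.ansSet.length ≤ U.atoms := by
  rw [← List.length_map (f := Prod.fst)]
  exact U.bound _ (by simpa using fun A s hA => h.ans (A, s) hA) h.distinct

theorem Table.Within.activate (h : t.Within U) {pre post : List (Node S C)} {n : Node S C}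
    (hs : t.Selects pre n post) (st : NodeStatus) : (t.activate pre n post st).Within U := by
  refine ⟨h.goal, h.loc, fun m hm => ?_, h.ans, h.distinct⟩
  rcases List.mem_append.1 hm with hm | hm
  · exact h.nodes m (by simp [hs.1, hm])
  · rcases List.mem_cons.1 hm with rfl | hm
    · exact h.nodes n hs.mem
    · exact h.nodes m (by simp [hs.1, hm])

theorem Table.Within.useFact (h : t.Within U) {pre post : List (Node S C)} {n : Node S C}
    (hs : t.Selects pre n post) : (t.useFact pre n post).Within U := by
  have h' := h.activate hs .answer
  unfold Table.useFact addAnswer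
  split_ifs with hsub
  · exact h'
  · refine ⟨h'.goal, h'.loc, h'.nodes, fun p hp => ?_, ?_⟩
    · rcases List.mem_append.1 hp with hp | hp
      · exact h'.ans p hp
      · rw [List.mem_singleton.1 hp]
        exact (h.nodes n hs.mem).head
    · dsimp only
      rw [List.map_append, List.pairwise_append]
      refine ⟨h'.distinct, by simp, fun A hA B hB hv => hsub ?_⟩
      obtain ⟨p, hp, rfl⟩ := List.mem_map.1 hA
      obtain rfl : B = n.head := by simpa using hB
      exact ⟨p, hp, .of_isVariant hv⟩

theorem Table.Within.congr (h : t.Within U) (ho : t'.owner = t.owner) (hg : t'.goal = t.goal)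
    (hn : ∀ n ∈ t'.nodes, n.clause.Within U) {J : Set Identifier}
    (ha : t'.ansSet = (t.mark J).ansSet) : t'.Within U := by
  have hfst : t'.ansSet.map Prod.fst = t.ansSet.map Prod.fst := by
    rw [ha]
    simp [Table.mark, Function.comp_def]
  refine ⟨hg ▸ h.goal, by rw [hg, ho, h.loc], hn, fun p hp => ?_, hfst ▸ h.distinct⟩
  have : p.1 ∈ t.ansSet.map Prod.fst := hfst ▸ List.mem_map_of_mem hp
  obtain ⟨q, hq, e⟩ := List.mem_map.1 this
  exact e ▸ h.ans q hq

theorem Table.Within.answerTo (h : t.Within U) (st : ResponseStatus) (loops : Set Identifier)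
    (r : Request S C) : (t.answerTo st loops r).Within U := by
  intro A hA
  obtain ⟨p, hp, rfl⟩ := List.mem_map.1 hA
  exact h.ans p (List.mem_of_mem_filter hp)

/-- A change of the status of nodes. -/
def Table.Restated (t t' : Table S C) : Prop :=
  ∃ f : Node S C → Node S C, t'.nodes = t.nodes.map f ∧ ∀ n, (f n).id = n.id ∧
    (f n).clause = n.clause ∧ ((f n).status = .new → n.status = .new)

theorem Table.Restated.of_eq (h : t'.nodes = t.nodes) : t.Restated t' :=
  ⟨id, by simpa using h, fun _ => ⟨rfl, rfl, id⟩⟩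

theorem Table.Restated.within (h : t.Restated t') (ht : t.Within U) :
    ∀ n ∈ t'.nodes, n.clause.Within U := by
  obtain ⟨f, hf, h⟩ := h
  intro n hn
  rw [hf] at hn
  obtain ⟨m, hm, rfl⟩ := List.mem_map.1 hn
  exact (h m).2.1 ▸ ht.nodes m hm

theorem Table.noteResponse_restated (t : Table S C) (r : Response S C) :
    t.Restated (t.noteResponse r) := by
  unfold noteResponse
  split
  · refine ⟨_, rfl, fun n => ?_⟩
    split_ifs
    · exact ⟨rfl, rfl, fun h => by cases h⟩
    · exact ⟨rfl, rfl, id⟩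
  all_goals
    refine ⟨_, rfl, fun n => ?_⟩
    split_ifs
    · exact ⟨rfl, rfl, NodeStatus.addLoops_ne_new⟩
    · exact ⟨rfl, rfl, id⟩

theorem Table.terminate_restated (t : Table S C) : t.Restated t.terminate.1 := by
  refine ⟨Node.finish, t.terminate_fields.2, fun n => ?_⟩
  unfold Node.finish
  split_ifs
  · exact ⟨rfl, rfl, id⟩
  · exact ⟨rfl, rfl, fun h => by cases h⟩

theorem Table.Within.receive (h : t.Within U) {r : Response S C} {n : Node S C} {B : Atom S C}
    {Bs : List (Atom S C)} {ns : List (Node S C)} {used : Set Identifier} (hn : n ∈ t.nodes)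
    (hid : n.id = r.id) (hb : n.body = B :: Bs)
    (hns : AnswerNodes n.head B Bs n.depth t.rootId used r.ans ns)
    (hr : ∀ A ∈ r.ans, A.Over U.sig) : (t.receive r ns).Within U := by
  obtain ⟨h1, h2, -, -, -, h3, -⟩ := t.noteResponse_fields r
  refine h.congr (J := ∅) h1 h2 (fun m hm => ?_) (by rw [Table.mark_empty]; exact h3)
  rcases List.mem_append.1 ((Table.receive_perm ns ⟨n, hn, hid⟩).subset hm) with hm | hm
  · exact (t.noteResponse_restated r).within h m hm
  · refine hns.within ?_ hr m hm
    have := h.nodes n hn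
    rwa [Node.clause, hb] at this

/-- The table `t` sends its new answers to the requests `rs` and becomes `t'`. -/
structure Delivers (t t' : Table S C) (rs : List (Request S C)) (ms : List (Message S C)) :
    Prop where
  owner : t'.owner = t.owner
  goal : t'.goal = t.goal
  rootId : t'.rootId = t.rootId
  nodes : t.Restated t'
  nodup : (rs.map Request.id).Nodup
  ansSet : t'.ansSet = (t.mark {j | ∃ r ∈ rs, r.id = j}).ansSet
  msgs : ∃ st loops, ms = rs.map (t.answerTo st loops)

theorem Delivers.within {rs : List (Request S C)} {ms : List (Message S C)}
    (h : Delivers t t' rs ms) (ht : t.Within U) : t'.Within U ∧ ∀ m ∈ ms, m.Within U := by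
  refine ⟨ht.congr h.owner h.goal (h.nodes.within ht) h.ansSet, fun m hm => ?_⟩
  obtain ⟨st, loops, rfl⟩ := h.msgs
  obtain ⟨r, -, rfl⟩ := List.mem_map.1 hm
  exact ht.answerTo st loops r

/-- Generate Response terminates the goal, sends a new answer to some lower request, or responds
to the higher request. -/
theorem GenerateResponse.delivers {ms : List (Message S C)} (h : GenerateResponse t t' ms)
    (hc : (t.clients.map Request.id).Nodup) :
    ∃ rs, Delivers t t' rs ms ∧ (t'.rootStatus = .disposed ∨ t'.nodes = t.nodes ∧
      ((∃ r ∈ rs, r ∈ t.lr ∧ ∃ p ∈ t.ansSet, r.id ∉ p.2) ∨ ∃ r, rs = [r] ∧ t.hr = some r)) := by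
  have hterm : Delivers t t.terminate.1 t.clients t.terminate.2 := by
    refine ⟨?_, ?_, ?_, t.terminate_restated, hc, ?_, _, _, t.terminate_snd hc⟩ <;>
      rw [t.terminate_fst] <;> rfl
  have hreply : ∀ r st, Delivers t (t.reply r st).1 [r] [(t.reply r st).2] := by
    intro r st
    rw [t.reply_fst, t.reply_snd]
    refine ⟨rfl, rfl, rfl, .of_eq rfl, by simp, ?_, _, _, rfl⟩
    have : {j | ∃ r' ∈ [r], r'.id = j} = {r.id} := by
      ext j
      simp [eq_comm]
    rw [this]
  cases h with
  | noLoop => exact ⟨_, hterm, .inl t.terminate_fields.1⟩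
  | leader => exact ⟨_, hterm, .inl t.terminate_fields.1⟩
  | iterate _ hu =>
    have hlr : (t.lr.map Request.id).Nodup :=
      List.Nodup.sublist ((List.sublist_append_right _ _).map _) hc
    rw [t.startIteration_fst, t.startIteration_snd hlr]
    obtain ⟨r, hr, p, hp⟩ := hu
    exact ⟨t.lr, ⟨rfl, rfl, rfl, .of_eq rfl, hlr, rfl, _, _, rfl⟩,
      .inr ⟨rfl, .inl ⟨r, hr, hr, p, hp⟩⟩⟩
  | replyLoop _ _ _ r hr => exact ⟨_, hreply r _, .inr ⟨by rw [t.reply_fst]; rfl, .inr ⟨r, rfl, hr⟩⟩⟩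
  | replyActive _ _ _ r hr =>
    exact ⟨_, hreply r _, .inr ⟨by rw [t.reply_fst]; rfl, .inr ⟨r, rfl, hr⟩⟩⟩

end

section

variable {U : Limits S C} {ts l₁ l₂ : List (Table S C)} {tr tr' : Multiset (Message S C)}
  {t t' : Table S C} {i : Identifier} {a : C}

theorem Within.replace (h : Within U (l₁ ++ t :: l₂) tr) (hid : t'.rootId = t.rootId)
    (hg : t'.goal = t.goal) (ht : t'.Within U) (htr : ∀ m ∈ tr', m.Within U) :
    Within U (l₁ ++ t' :: l₂) tr' := by
  have key : ∀ u ∈ l₁ ++ t' :: l₂, ∃ v ∈ l₁ ++ t :: l₂, v.rootId = u.rootId ∧ v.goal = u.goal := by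
    intro u hu
    rcases List.mem_append.1 hu with hu | hu
    · exact ⟨u, by simp [hu], rfl, rfl⟩
    · rcases List.mem_cons.1 hu with rfl | hu
      · exact ⟨t, by simp, hid.symm, hg.symm⟩
      · exact ⟨u, by simp [hu], rfl, rfl⟩
  refine ⟨fun u hu => ?_, htr, fun u hu v hv => ?_⟩
  · rcases List.mem_append.1 hu with hu | hu
    · exact h.table u (by simp [hu])
    · rcases List.mem_cons.1 hu with rfl | hu
      · exact ht
      · exact h.table u (by simp [hu])
  · obtain ⟨u', hu', e1, e2⟩ := key u hu
    obtain ⟨v', hv', e3, e4⟩ := key v hv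
    rw [← e1, ← e2, ← e3, ← e4]
    exact h.chain u' hu' v' hv'

theorem Within.dropMsg {m : Message S C} (h : Within U ts (m ::ₘ tr)) : Within U ts tr :=
  ⟨h.table, fun m hm => h.msg m (Multiset.mem_cons_of_mem hm), h.chain⟩

/-- All requests between the initial one and that of a table have tables. -/
theorem Good.exists_table (h : Good i a ts tr) {k : Identifier} (ht : t ∈ ts) (h1 : i <+: k)
    (h2 : k <+: t.rootId) : ∃ u ∈ ts, u.rootId = k := by
  obtain ⟨l, hl⟩ : ∃ l, t.rootId.length = l := ⟨_, rfl⟩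
  induction l using Nat.strong_induction_on generalizing t with
  | _ l ih =>
    by_cases hk : k = t.rootId
    · exact ⟨t, ht, hk.symm⟩
    · obtain ⟨k', x, u, n, hx, hu, -⟩ := h.wf.parent (h.look_mem ht) fun e =>
        hk (prefix_antisymm h2 (e ▸ h1))
      obtain ⟨hu', rfl⟩ := (look_eq_some h.nodup).1 hu
      refine ih u.rootId.length ?_ hu' (prefix_of_prefix_concat (hx ▸ h2) (hx ▸ hk)) rfl
      rw [← hl, hx]
      simp

theorem Good.exists_chain (h : Good i a ts tr) (hw : Within U ts tr) (ht : t ∈ ts) :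
    ∃ l : List (Table S C), t.rootId.length < i.length + l.length ∧
      (∀ u ∈ l, u ∈ ts ∧ u.rootId <+: t.rootId) ∧
      l.Pairwise fun u v => ¬ IsVariant u.goal v.goal := by
  obtain ⟨n, hn⟩ : ∃ n, t.rootId.length = n := ⟨_, rfl⟩
  induction n using Nat.strong_induction_on generalizing t with
  | _ n ih =>
    by_cases hk : t.rootId = i
    · exact ⟨[t], by simp [hk], by simp [ht], by simp⟩
    · obtain ⟨k', x, u, -, hx, hu, -⟩ := h.wf.parent (h.look_mem ht) hk
      obtain ⟨hu', rfl⟩ := (look_eq_some h.nodup).1 hu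
      have hlen : t.rootId.length = u.rootId.length + 1 := by simp [hx]
      obtain ⟨l, h1, h2, h3⟩ := ih u.rootId.length (by omega) hu' rfl
      have hpre : ∀ v ∈ l, v.rootId <+: t.rootId := fun v hv =>
        (h2 v hv).2.trans (hx ▸ prefix_concat)
      refine ⟨t :: l, by rw [List.length_cons]; omega, ?_, List.pairwise_cons.2 ⟨?_, h3⟩⟩
      · rintro v hv
        rcases List.mem_cons.1 hv with rfl | hv
        · exact ⟨ht, List.prefix_rfl⟩
        · exact ⟨(h2 v hv).1, hpre v hv⟩
      · intro v hv
        refine hw.chain t ht v (h2 v hv).1 ⟨hpre v hv, fun e => ?_⟩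
        have := (h2 v hv).2.length_le
        rw [e] at this
        omega

/-- The depth of the tables is bounded. -/
theorem Good.length_lt (h : Good i a ts tr) (hw : Within U ts tr) (ht : t ∈ ts) :
    t.rootId.length < i.length + U.atoms := by
  obtain ⟨l, h1, h2, h3⟩ := h.exists_chain hw ht
  have := U.bound (l.map Table.goal) (by simpa using fun u hu => (hw.table u (h2 u hu).1).goal)
    (List.pairwise_map.2 h3)
  rw [List.length_map] at this
  omega

theorem Within.create {d : C} {r : Request S C} (h : Within U ts (.request d r ::ₘ tr))
    (hg : Good i a ts (.request d r ::ₘ tr))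
    (hn : ∀ u ∈ ts, ¬ u.Completes d r ∧ ¬ u.FormsLoop d r) {G : Atom S C}
    (hG : IsVariant r.goal G) {pol : List (Clause S C)} {ns : List (Node S C)}
    (hns : InitialNodes G r.id pol ns) (hpol : U.Admits pol) :
    Within U (ts ++ [newTable d ⟨r.id, r.requester, G⟩ ns]) tr := by
  obtain ⟨hr1, hr2⟩ := h.msg _ (Multiset.mem_cons_self _ _)
  have hG1 := hr1.of_isVariant hG
  have hG2 := hG.loc_eq hr2
  have hm := Multiset.mem_cons_self (Message.request d r) tr
  have hun : ∀ u ∈ ts, u.rootId ≠ r.id := look_eq_none.1 (hg.wf.unserved hm)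
  have hpre : i <+: r.id := by
    rcases (hg.wf.req hm).1 with ⟨e, -⟩ | ⟨u, hu, -⟩
    · rw [e]
    · exact (hg.wf.pre hu).trans (List.dropLast_prefix _)
  refine ⟨fun u hu => ?_, h.dropMsg.msg, fun u hu v hv hl => ?_⟩
  · rcases List.mem_append.1 hu with hu | hu
    · exact h.table u hu
    · rw [List.mem_singleton.1 hu]
      exact ⟨hG1, hG2, hns.within hG1 hpol.2, by simp [newTable], by simp [newTable]⟩
  · rcases List.mem_append.1 hu with hu | hu <;> rcases List.mem_append.1 hv with hv | hv
    · exact h.chain u hu v hv hl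
    · rw [List.mem_singleton.1 hv] at hl
      obtain ⟨w, hw, e⟩ := hg.exists_table hu hpre hl.1
      exact absurd e (hun w hw)
    · rw [List.mem_singleton.1 hu] at hl ⊢
      intro hvar
      have hvr : IsVariant v.goal r.goal := hvar.symm.trans hG.symm
      have how : v.owner = d := by
        have h1 := (h.table v hv).loc
        rw [(hvar.loc_eq hG2 : v.goal.loc = _)] at h1
        cases h1
        rfl
      by_cases hd : v.rootStatus = .disposed
      · exact (hn v hv).1 ⟨how, hvr, hd⟩
      · obtain ⟨r₁, h1, h2⟩ := hg.hr hv hd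
        exact (hn v hv).2 ⟨how, hvr, hd, r₁, h1, h2 ▸ hl⟩
    · rw [List.mem_singleton.1 hu, List.mem_singleton.1 hv] at hl
      exact absurd rfl hl.2

end

end GEM

namespace GEM

variable {S C : Type*}

/-! ### A potential that decreases during a computation -/

/-- The cost of a new node with a body of the given length, if its request costs `g`. -/
def Limits.weight (U : Limits S C) (g : ℕ) : ℕ → ℕ
  | 0 => 1
  | l + 1 => 1 + g + U.atoms + U.atoms * U.weight g l

/-- The cost of a request at the given distance from the maximal depth. -/
def Limits.requestCost (U : Limits S C) : ℕ → ℕ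
  | 0 => 1
  | n + 1 => U.clauses * U.weight (U.requestCost n) U.body + 2

/-- The cost of the request `k`, if the initial request is `i`. -/
def Limits.cost (U : Limits S C) (i k : Identifier) : ℕ :=
  U.requestCost (U.atoms - (k.length - i.length))

open scoped Classical in
/-- The cost of a node, if its request costs `g`, `u` answers are still to be sent to it and `v`
answers are still to be received by it. -/
noncomputable def Node.cost (U : Limits S C) (g u v : ℕ) (n : Node S C) : ℕ :=
  match n.body with
  | [] => if n.status = .new then 1 else 0
  | _ :: Bs => (if n.status = .new then 1 + g else 0) + u + v * U.weight g Bs.length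

/-- The cost of the nodes of a table. -/
noncomputable def Table.nodesCost (U : Limits S C) (i : Identifier) (u v : Identifier → ℕ)
    (t : Table S C) : ℕ :=
  (t.nodes.map fun n => n.cost U (U.cost i n.id) (u n.id) (v n.id)).sum

open scoped Classical in
/-- The cost of the termination of a goal. -/
noncomputable def Table.liveCost (t : Table S C) : ℕ := if t.rootStatus = .disposed then 0 else 1

/-- The cost of a list of tables. -/
noncomputable def tablesCost (U : Limits S C) (i : Identifier) (u v : Identifier → ℕ)
    (ts : List (Table S C)) : ℕ :=
  (ts.map fun t => t.liveCost + t.nodesCost U i u v).sum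

/-- The cost of a message. -/
def Message.cost (U : Limits S C) (i : Identifier) : Message S C → ℕ
  | .request _ r => U.cost i r.id
  | .response _ _ => 0

open scoped Classical in
/-- The number of answers of the table that have been sent to the request `k`. -/
noncomputable def Table.sentTo (t : Table S C) (k : Identifier) : ℕ :=
  t.ansSet.countP fun p => k ∈ p.2

/-- The number of answers that have been sent to the request `k`. -/
noncomputable def sentTo (ts : List (Table S C)) (k : Identifier) : ℕ :=
  (ts.map fun t => t.sentTo k).sum

open scoped Classical in
/-- The number of answers to the request `k` that a message carries. -/
noncomputable def Message.load (k : Identifier) : Message S C → ℕ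
  | .request _ _ => 0
  | .response _ r => if r.id = k then r.ans.length else 0

/-- The number of answers to the request `k` in transit. -/
noncomputable def carried (tr : Multiset (Message S C)) (k : Identifier) : ℕ :=
  (tr.map (Message.load k)).sum

/-- The maximal number of answers to the request `k` that are still to be sent. -/
noncomputable def due (U : Limits S C) (ts : List (Table S C)) (k : Identifier) : ℕ :=
  U.atoms - GEM.sentTo ts k

/-- The maximal number of answers to the request `k` that are still to be received. -/
noncomputable def outstanding (U : Limits S C) (ts : List (Table S C))
    (tr : Multiset (Message S C)) (k : Identifier) : ℕ :=
  due U ts k + carried tr k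

noncomputable def potential (U : Limits S C) (i : Identifier) (ts : List (Table S C))
    (tr : Multiset (Message S C)) : ℕ :=
  tablesCost U i (due U ts) (outstanding U ts tr) ts + (tr.map (Message.cost U i)).sum

/-- The weight of the responses in transit, which decreases when a response is forwarded. -/
def responseCost (tr : Multiset (Message S C)) : ℕ :=
  (tr.map fun m => match m with
    | .request _ _ => 0
    | .response _ r => r.id.length + 1).sum

theorem sum_map_add_le {α : Type*} {l : List α} {f g : α → ℕ} (h : ∀ x ∈ l, f x ≤ g x) {x : α}
    (hx : x ∈ l) {c : ℕ} (hc : f x + c ≤ g x) : (l.map f).sum + c ≤ (l.map g).sum := by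
  obtain ⟨l₁, l₂, rfl⟩ := List.append_of_mem hx
  have h1 : (l₁.map f).sum ≤ (l₁.map g).sum := List.sum_le_sum fun y hy => h y (by simp [hy])
  have h2 : (l₂.map f).sum ≤ (l₂.map g).sum := List.sum_le_sum fun y hy => h y (by simp [hy])
  simp only [List.map_append, List.map_cons, List.sum_append, List.sum_cons]
  omega

section

variable {U : Limits S C} {i : Identifier} {u u' v v' : Identifier → ℕ} {t t' : Table S C}
  {l₁ l₂ ts : List (Table S C)} {tr : Multiset (Message S C)} {a : C}

theorem Limits.weight_mono (U : Limits S C) (g : ℕ) : Monotone (U.weight g) := by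
  refine monotone_nat_of_le_succ fun l => ?_
  induction l with
  | zero => simp [weight]; omega
  | succ l ih =>
    have := Nat.mul_le_mul_left U.atoms ih
    rw [weight.eq_def U g (l + 1), weight.eq_def U g (l + 1 + 1)]
    dsimp only
    omega

theorem Node.cost_le {g u u' v v' : ℕ} {n n' : Node S C} (hb : n'.body = n.body)
    (hs : n'.status = .new → n.status = .new) (hu : u' ≤ u) (hv : v' ≤ v) :
    n'.cost U g u' v' ≤ n.cost U g u v := by
  unfold cost
  rw [hb]
  cases n.body with
  | nil =>
    dsimp only
    split_ifs <;> simp_all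
  | cons B Bs =>
    have := Nat.mul_le_mul_right (U.weight g Bs.length) hv
    dsimp only
    split_ifs with h1 h2
    · omega
    · exact absurd (hs h1) h2
    · omega
    · omega

theorem Node.cost_lt {g u u' v v' : ℕ} {n : Node S C} (hb : n.body ≠ []) (hu : u' < u)
    (hv : v' ≤ v) : n.cost U g u' v' + 1 ≤ n.cost U g u v := by
  unfold cost
  cases h : n.body with
  | nil => exact absurd h hb
  | cons B Bs =>
    have := Nat.mul_le_mul_right (U.weight g Bs.length) hv
    dsimp only
    omega

theorem Node.cost_receive {g u v v' m : ℕ} {n n' : Node S C} {B : Atom S C} {Bs : List (Atom S C)}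
    (hb : n.body = B :: Bs) (hb' : n'.body = n.body)
    (hs : n'.status = .new → n.status = .new) (hv : v' + m ≤ v) :
    n'.cost U g u v' + m * U.weight g Bs.length ≤ n.cost U g u v := by
  unfold cost
  rw [hb', hb]
  have := Nat.mul_le_mul_right (U.weight g Bs.length) hv
  rw [add_mul] at this
  dsimp only
  split_ifs with h1 h2
  · omega
  · exact absurd (hs h1) h2
  · omega
  · omega

theorem Node.cost_le_weight {g u v : ℕ} (n : Node S C) (hu : u ≤ U.atoms) (hv : v ≤ U.atoms) :
    n.cost U g u v ≤ U.weight g n.body.length := by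
  unfold cost
  cases n.body with
  | nil =>
    dsimp only
    split_ifs <;> simp [Limits.weight]
  | cons B Bs =>
    have := Nat.mul_le_mul_right (U.weight g Bs.length) hv
    dsimp only
    rw [List.length_cons, Limits.weight]
    split_ifs <;> omega

theorem Table.nodesCost_le (h : t.Restated t') (hu : ∀ k, u' k ≤ u k) (hv : ∀ k, v' k ≤ v k) :
    t'.nodesCost U i u' v' ≤ t.nodesCost U i u v := by
  obtain ⟨f, hf, h⟩ := h
  unfold nodesCost
  rw [hf, List.map_map]
  refine List.sum_le_sum fun n _ => ?_
  obtain ⟨h1, h2, h3⟩ := h n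
  simp only [Function.comp_apply, h1]
  exact Node.cost_le (congrArg Clause.body h2) h3 (hu _) (hv _)

theorem tablesCost_mid : tablesCost U i u v (l₁ ++ t :: l₂) =
    tablesCost U i u v l₁ + (t.liveCost + t.nodesCost U i u v) + tablesCost U i u v l₂ := by
  simp [tablesCost, add_assoc]

theorem tablesCost_le (hu : ∀ k, u' k ≤ u k) (hv : ∀ k, v' k ≤ v k) :
    tablesCost U i u' v' ts ≤ tablesCost U i u v ts :=
  List.sum_le_sum fun _ _ => Nat.add_le_add_left (Table.nodesCost_le (.of_eq rfl) hu hv) _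

theorem tablesCost_lt (hu : ∀ k, u' k ≤ u k) (hv : ∀ k, v' k ≤ v k) (ht : t ∈ ts) {n : Node S C}
    (hn : n ∈ t.nodes) (hb : n.body ≠ []) (h : u' n.id < u n.id) :
    tablesCost U i u' v' ts + 1 ≤ tablesCost U i u v ts := by
  refine sum_map_add_le
    (fun _ _ => Nat.add_le_add_left (Table.nodesCost_le (.of_eq rfl) hu hv) _) ht ?_
  have : t.nodesCost U i u' v' + 1 ≤ t.nodesCost U i u v :=
    sum_map_add_le (fun m _ => Node.cost_le rfl id (hu _) (hv _)) hn (Node.cost_lt hb h (hv _))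
  omega

theorem sentTo_mid (k : Identifier) :
    sentTo (l₁ ++ t :: l₂) k = sentTo l₁ k + t.sentTo k + sentTo l₂ k := by
  simp [sentTo, add_assoc]

theorem carried_cons (m : Message S C) (k : Identifier) :
    carried (m ::ₘ tr) k = carried tr k + m.load k := by
  simp [carried, add_comm]

theorem carried_add (tr tr' : Multiset (Message S C)) (k : Identifier) :
    carried (tr + tr') k = carried tr k + carried tr' k := by
  simp [carried]

theorem carried_eq_zero {k : Identifier} (h : msgCount tr k = 0) : carried tr k = 0 := by
  unfold carried
  rw [Multiset.sum_eq_zero]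
  intro x hx
  obtain ⟨m, hm, rfl⟩ := Multiset.mem_map.1 hx
  cases m with
  | request d r => rfl
  | response d r => exact if_neg (msgCount_eq_zero.1 h _ hm)

theorem Table.sentTo_eq_zero {k : Identifier} (h : ¬ t.Serves k) : t.sentTo k = 0 := by
  classical
  unfold sentTo
  rw [List.countP_eq_zero]
  intro p hp hk
  exact h (.inr (.inr ⟨p, hp, by simpa using hk⟩))

theorem Good.sentTo_le (h : Good i a ts tr) (hw : Within U ts tr) (k : Identifier) :
    sentTo ts k ≤ U.atoms := by
  by_cases hk : ∃ t ∈ ts, t.Serves k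
  · obtain ⟨t, ht, hk⟩ := hk
    obtain ⟨l₁, l₂, rfl⟩ := List.append_of_mem ht
    have hz : ∀ w ∈ l₁ ++ l₂, w.sentTo k = 0 := by
      intro w hwm
      refine Table.sentTo_eq_zero fun hs => ?_
      have hwm' : w ∈ l₁ ++ t :: l₂ := by
        rcases List.mem_append.1 hwm with h | h <;> simp [h]
      have e := h.wf.serves (h.look_mem hwm') (h.look_mem ht) hs hk
      have hnd := h.nodup
      rw [List.map_append, List.map_cons, List.nodup_middle, List.nodup_cons] at hnd
      refine hnd.1 ?_
      rw [← List.map_append]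
      exact e ▸ List.mem_map_of_mem hwm
    have hz' : ∀ l : List (Table S C), (∀ w ∈ l, w ∈ l₁ ++ l₂) → sentTo l k = 0 := by
      intro l hl
      unfold GEM.sentTo
      refine List.sum_eq_zero fun x hx => ?_
      obtain ⟨w, hwm, rfl⟩ := List.mem_map.1 hx
      exact hz w (hl w hwm)
    rw [sentTo_mid, hz' l₁ (by simp +contextual), hz' l₂ (by simp +contextual), zero_add, add_zero]
    exact List.countP_le_length.trans (hw.table t ht).length_ansSet
  · push Not at hk
    unfold GEM.sentTo
    rw [List.sum_eq_zero]
    · exact Nat.zero_le _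
    · intro x hx
      obtain ⟨w, hwm, rfl⟩ := List.mem_map.1 hx
      exact Table.sentTo_eq_zero (hk w hwm)

theorem Delivers.sentTo {rs : List (Request S C)} {ms : List (Message S C)}
    (h : Delivers t t' rs ms) (k : Identifier) :
    t'.sentTo k = t.sentTo k + carried (ms : Multiset (Message S C)) k := by
  classical
  obtain ⟨st, loops, hms⟩ := h.msgs
  have hload : ∀ l : List (Request S C), (l.map Request.id).Nodup →
      ((l.map (t.answerTo st loops)).map (Message.load k)).sum =
        if ∃ r ∈ l, r.id = k then (t.unsent k).length else 0 := by
    intro l hl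
    induction l with
    | nil => simp
    | cons r l ih =>
      rw [List.map_cons, List.nodup_cons] at hl
      rw [List.map_cons, List.map_cons, List.sum_cons, ih hl.2]
      by_cases hr : r.id = k
      · subst hr
        rw [if_neg, if_pos ⟨r, List.mem_cons_self, rfl⟩, add_zero]
        · exact if_pos rfl
        · rintro ⟨q, hq, e⟩
          exact hl.1 (e ▸ List.mem_map_of_mem hq)
      · rw [show (t.answerTo st loops r).load k = 0 from if_neg hr, zero_add]
        simp [hr]
  have hcar : carried (ms : Multiset (Message S C)) k =
      if ∃ r ∈ rs, r.id = k then (t.unsent k).length else 0 := by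
    rw [← hload rs h.nodup, ← hms]
    rfl
  rw [hcar]
  unfold Table.sentTo
  rw [h.ansSet]
  by_cases hk : ∃ r ∈ rs, r.id = k
  · rw [if_pos hk]
    have h1 : (t.unsent k).length = t.ansSet.countP fun p => ¬ k ∈ p.2 := by
      rw [Table.unsent, List.length_map, List.countP_eq_length_filter]
    have h2 := List.length_eq_countP_add_countP (fun p : Atom S C × Set Identifier => decide (k ∈ p.2))
      (l := t.ansSet)
    have h3 : (t.mark {j | ∃ r ∈ rs, r.id = j}).ansSet.countP (fun p => decide (k ∈ p.2)) =
        t.ansSet.length := by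
      rw [← List.length_map (f := fun p : Atom S C × Set Identifier =>
        (p.1, p.2 ∪ {j | ∃ r ∈ rs, r.id = j})) (as := t.ansSet)]
      refine List.countP_eq_length.2 fun p hp => ?_
      obtain ⟨q, hq, rfl⟩ := List.mem_map.1 hp
      simpa using .inr hk
    rw [h1, h3, h2]
    congr 1
    refine List.countP_congr fun p _ => ?_
    simp
  · rw [if_neg hk, add_zero]
    simp only [Table.mark, List.countP_map]
    refine List.countP_congr fun p _ => ?_
    simp only [Function.comp_apply, decide_eq_true_eq]
    exact ⟨fun h => h.resolve_right hk, .inl⟩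

theorem sum_messageCost_delivers {rs : List (Request S C)} {ms : List (Message S C)}
    (h : Delivers t t' rs ms) :
    (((ms : Multiset (Message S C))).map (Message.cost U i)).sum = 0 := by
  obtain ⟨st, loops, rfl⟩ := h.msgs
  refine Multiset.sum_eq_zero fun x hx => ?_
  obtain ⟨m, hm, rfl⟩ := Multiset.mem_map.1 hx
  obtain ⟨r, -, rfl⟩ := List.mem_map.1 (Multiset.mem_coe.1 hm)
  rfl

/-- Sending responses does not increase the potential. -/
theorem Delivers.potential {rs : List (Request S C)} {ms : List (Message S C)}
    (h : Delivers t t' rs ms) (hg : Good i a (l₁ ++ t' :: l₂) (tr + ms))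
    (hw : Within U (l₁ ++ t' :: l₂) (tr + ms)) :
    potential U i (l₁ ++ t' :: l₂) (tr + ms) + t.liveCost ≤
      potential U i (l₁ ++ t :: l₂) tr + t'.liveCost ∧
    ∀ w ∈ l₁ ++ t :: l₂, ∀ n ∈ w.nodes, n.body ≠ [] →
      0 < carried (ms : Multiset (Message S C)) n.id →
      potential U i (l₁ ++ t' :: l₂) (tr + ms) + t.liveCost <
        potential U i (l₁ ++ t :: l₂) tr + t'.liveCost := by
  have hs : ∀ k, GEM.sentTo (l₁ ++ t' :: l₂) k =
      GEM.sentTo (l₁ ++ t :: l₂) k + carried (ms : Multiset (Message S C)) k := by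
    intro k
    rw [sentTo_mid, sentTo_mid, h.sentTo]
    omega
  have hle := hg.sentTo_le hw
  have hu : ∀ k, due U (l₁ ++ t' :: l₂) k + carried (ms : Multiset (Message S C)) k =
      due U (l₁ ++ t :: l₂) k := by
    intro k
    have := hle k
    unfold due
    rw [hs] at this ⊢
    omega
  have hv : ∀ k, outstanding U (l₁ ++ t' :: l₂) (tr + ms) k ≤ outstanding U (l₁ ++ t :: l₂) tr k := by
    intro k
    have := hu k
    unfold outstanding
    rw [carried_add]
    omega
  have hu' : ∀ k, due U (l₁ ++ t' :: l₂) k ≤ due U (l₁ ++ t :: l₂) k :=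
    fun k => (Nat.le_add_right _ _).trans (hu k).le
  have hnode := Table.nodesCost_le (U := U) (i := i) h.nodes
    (fun k => le_refl (due U (l₁ ++ t' :: l₂) k))
    (fun k => le_refl (outstanding U (l₁ ++ t' :: l₂) (tr + ms) k))
  have hmid := tablesCost_mid (U := U) (i := i) (t := t) (l₁ := l₁) (l₂ := l₂)
    (u := due U (l₁ ++ t' :: l₂)) (v := outstanding U (l₁ ++ t' :: l₂) (tr + ms))
  unfold GEM.potential
  rw [tablesCost_mid (t := t'), Multiset.map_add, Multiset.sum_add, sum_messageCost_delivers h]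
  refine ⟨?_, fun w hwm n hn hb hc => ?_⟩
  · have := tablesCost_le (U := U) (i := i) (ts := l₁ ++ t :: l₂) hu' hv
    omega
  · have := tablesCost_lt (U := U) (i := i) hu' hv hwm hn hb (by have := hu n.id; omega)
    omega

end

end GEM

namespace GEM

variable {S C : Type*}

/-! ### Every step decreases the potential -/

section

variable {U : Limits S C} {i : Identifier} {t t' : Table S C} {l₁ l₂ ts : List (Table S C)}
  {tr : Multiset (Message S C)} {a d : C}

theorem potential_request (r : Request S C) :
    potential U i ts (.request d r ::ₘ tr) = potential U i ts tr + U.cost i r.id := by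
  have : outstanding U ts (.request d r ::ₘ tr) = outstanding U ts tr := by
    funext k
    rw [outstanding, carried_cons]
    rfl
  unfold potential
  rw [this, Multiset.map_cons, Multiset.sum_cons]
  simp only [Message.cost]
  omega

theorem Limits.cost_pos (U : Limits S C) (i k : Identifier) : 0 < U.cost i k := by
  unfold cost
  cases U.atoms - (k.length - i.length) <;> simp [requestCost]

theorem potential_response (r : Response S C) :
    potential U i ts tr ≤ potential U i ts (.response d r ::ₘ tr) := by
  unfold potential
  rw [Multiset.map_cons, Multiset.sum_cons]
  have := tablesCost_le (U := U) (i := i) (ts := ts) (fun k => le_refl (due U ts k))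
    (v' := outstanding U ts tr) (v := outstanding U ts (.response d r ::ₘ tr)) (fun k => by
      rw [outstanding, outstanding, carried_cons]
      omega)
  omega

theorem due_congr (h : ∀ k, t'.sentTo k = t.sentTo k) :
    due U (l₁ ++ t' :: l₂) = due U (l₁ ++ t :: l₂) := by
  funext k
  unfold due
  rw [sentTo_mid, sentTo_mid, h]

/-- A change of a table that concerns neither answers nor messages. -/
theorem potential_replace (hs : ∀ k, t'.sentTo k = t.sentTo k) {c : ℕ}
    (h : ∀ u v, t'.liveCost + t'.nodesCost U i u v + c ≤ t.liveCost + t.nodesCost U i u v) :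
    potential U i (l₁ ++ t' :: l₂) tr + c ≤ potential U i (l₁ ++ t :: l₂) tr := by
  have hd := due_congr (U := U) (l₁ := l₁) (l₂ := l₂) hs
  have ho : outstanding U (l₁ ++ t' :: l₂) tr = outstanding U (l₁ ++ t :: l₂) tr := by
    funext k
    rw [outstanding, hd, outstanding]
  unfold potential
  rw [hd, ho, tablesCost_mid, tablesCost_mid]
  have := h (due U (l₁ ++ t :: l₂)) (outstanding U (l₁ ++ t :: l₂) tr)
  omega

theorem Table.activate_liveCost {pre post : List (Node S C)} {n : Node S C} {st : NodeStatus} :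
    (t.activate pre n post st).liveCost = t.liveCost := by
  have h : (t.activate pre n post st).rootStatus = .disposed ↔ t.rootStatus = .disposed := by
    simp only [activate]
    split_ifs with h <;> simp [h]
  unfold liveCost
  by_cases hd : t.rootStatus = .disposed
  · rw [if_pos (h.2 hd), if_pos hd]
  · rw [if_neg (mt h.1 hd), if_neg hd]

theorem Table.nodesCost_mid {pre post : List (Node S C)} {n : Node S C}
    {u v : Identifier → ℕ} (h : t.nodes = pre ++ n :: post) : t.nodesCost U i u v =
      (pre.map fun n => n.cost U (U.cost i n.id) (u n.id) (v n.id)).sum +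
        n.cost U (U.cost i n.id) (u n.id) (v n.id) +
        (post.map fun n => n.cost U (U.cost i n.id) (u n.id) (v n.id)).sum := by
  unfold nodesCost
  rw [h]
  simp [add_assoc]

theorem Table.useFact_sentTo (t : Table S C) (pre post : List (Node S C)) (n : Node S C)
    (k : Identifier) : (t.useFact pre n post).sentTo k = t.sentTo k := by
  unfold useFact addAnswer
  split_ifs
  · rfl
  · simp [Table.sentTo, activate]

theorem potential_useFact {pre post : List (Node S C)} {n : Node S C}
    (hs : t.Selects pre n post) (hb : n.body = []) :
    potential U i (l₁ ++ t.useFact pre n post :: l₂) tr + 1 ≤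
      potential U i (l₁ ++ t :: l₂) tr := by
  refine potential_replace (t.useFact_sentTo pre post n) fun u v => ?_
  obtain ⟨-, -, -, -, -, -, h1, h2⟩ := t.useFact_fields pre post n
  have hl : (t.useFact pre n post).liveCost = t.liveCost := by
    rw [← Table.activate_liveCost (t := t) (pre := pre) (post := post) (n := n) (st := .answer)]
    unfold Table.liveCost
    rw [h1]
  rw [hl, Table.nodesCost_mid hs.1, Table.nodesCost_mid h2]
  have h3 : ∀ g u v, n.cost U g u v = 1 := by
    intro g u v
    simp [Node.cost, hb, hs.2.1]
  have h4 : ∀ g u v, Node.cost U g u v { n with status := .answer } = 0 := by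
    intro g u v
    simp [Node.cost, hb]
  rw [h3, h4]
  omega

theorem potential_sendRequest {pre post : List (Node S C)} {n : Node S C}
    (hs : t.Selects pre n post) (hb : n.body ≠ []) (c q : C) (B : Atom S C) :
    potential U i (l₁ ++ t.activate pre n post .active :: l₂) (.request c ⟨n.id, q, B⟩ ::ₘ tr) <
      potential U i (l₁ ++ t :: l₂) tr := by
  rw [potential_request, ← Nat.add_one_le_iff, add_assoc]
  refine potential_replace (t := t) (t' := t.activate pre n post .active) (fun k => rfl)
    fun u v => ?_
  rw [Table.activate_liveCost, Table.nodesCost_mid hs.1,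
    Table.nodesCost_mid (t := t.activate pre n post .active) rfl]
  have h3 : ∀ g u v, Node.cost U g u v { n with status := .active } + (g + 1) ≤
      n.cost U g u v := by
    intro g u v
    obtain ⟨B, Bs, hb⟩ := List.exists_cons_of_ne_nil hb
    simp only [Node.cost, hb, hs.2.1, if_true, reduceCtorEq, if_false]
    omega
  have := h3 (U.cost i n.id) (u n.id) (v n.id)
  dsimp only
  omega

theorem potential_receive {r : Response S C} {n : Node S C} {B : Atom S C} {Bs : List (Atom S C)}
    {ns : List (Node S C)} (hg : Good i a (l₁ ++ t :: l₂) (.response d r ::ₘ tr))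
    (hd : t.rootStatus ≠ .disposed) (hn : n ∈ t.nodes) (hid : n.id = r.id) (hb : n.body = B :: Bs)
    (hns : AnswerNodes n.head B Bs n.depth t.rootId {i | ∃ m ∈ t.nodes, m.id = i} r.ans ns) :
    potential U i (l₁ ++ t.receive r ns :: l₂) tr ≤
      potential U i (l₁ ++ t :: l₂) (.response d r ::ₘ tr) := by
  classical
  have hs : ∀ k, (t.receive r ns).sentTo k = t.sentTo k := by
    intro k
    unfold Table.sentTo Table.receive
    rw [(t.noteResponse_fields r).2.2.2.2.2.1]
  have hdue := due_congr (U := U) (l₁ := l₁) (l₂ := l₂) hs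
  have hout : outstanding U (l₁ ++ t.receive r ns :: l₂) tr =
      outstanding U (l₁ ++ t :: l₂) tr := by
    funext k
    rw [outstanding, hdue, outstanding]
  have hv : ∀ k, outstanding U (l₁ ++ t :: l₂) tr k ≤
      outstanding U (l₁ ++ t :: l₂) (.response d r ::ₘ tr) k := by
    intro k
    rw [outstanding, outstanding, carried_cons]
    omega
  unfold potential
  rw [Multiset.map_cons, Multiset.sum_cons, hdue, hout, tablesCost_mid, tablesCost_mid]
  set u := due U (l₁ ++ t :: l₂)
  set v' := outstanding U (l₁ ++ t :: l₂) tr with hv'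
  set v := outstanding U (l₁ ++ t :: l₂) (.response d r ::ₘ tr) with hvdef
  have h1 := tablesCost_le (U := U) (i := i) (ts := l₁) (fun k => le_refl (u k)) hv
  have h2 := tablesCost_le (U := U) (i := i) (ts := l₂) (fun k => le_refl (u k)) hv
  have hlive : (t.receive r ns).liveCost ≤ t.liveCost := by
    unfold Table.liveCost
    rw [if_neg hd]
    split_ifs <;> omega
  obtain ⟨x, hx⟩ := hg.wf.node hg.look_mid hn
  have hnew : (ns.map fun n => n.cost U (U.cost i n.id) (u n.id) (v' n.id)).sum ≤
      r.ans.length * U.weight (U.cost i n.id) Bs.length := by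
    refine (List.sum_le_card_nsmul _ (U.weight (U.cost i n.id) Bs.length) ?_).trans ?_
    · intro y hy
      obtain ⟨m, hm, rfl⟩ := List.mem_map.1 hy
      obtain ⟨hfr, ⟨z, hz⟩, -, hlen⟩ := hns.spec.2.2 m hm
      have hcost : U.cost i m.id = U.cost i n.id := by
        unfold Limits.cost
        rw [hz, hx]
        simp
      have hcar : carried tr m.id = 0 := by
        refine carried_eq_zero (hg.dropMsg.wf.msgCount_eq_zero fun c => ?_)
        rw [hz] at hfr ⊢
        exact hg.dropMsg.wf.not_addr_of_fresh hg.look_mid hfr c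
      have hdm : u m.id ≤ U.atoms := Nat.sub_le _ _
      rw [hcost, ← hlen]
      refine m.cost_le_weight hdm ?_
      rw [hv', outstanding, hcar]
      exact hdm
    · rw [List.length_map, smul_eq_mul]
      exact Nat.mul_le_mul_right _ hns.spec.1
  obtain ⟨f, hf, hfn⟩ := t.noteResponse_restated r
  have hold : ((t.noteResponse r).nodes.map fun n => n.cost U (U.cost i n.id) (u n.id) (v' n.id)).sum +
      r.ans.length * U.weight (U.cost i n.id) Bs.length ≤ t.nodesCost U i u v := by
    rw [hf, List.map_map]
    refine sum_map_add_le (fun m _ => ?_) hn ?_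
    · simp only [Function.comp_apply, (hfn m).1]
      exact Node.cost_le (congrArg Clause.body (hfn m).2.1) (hfn m).2.2 le_rfl (hv _)
    · simp only [Function.comp_apply, (hfn n).1]
      refine Node.cost_receive hb (congrArg Clause.body (hfn n).2.1) (hfn n).2.2 ?_
      rw [hv', hvdef, outstanding, outstanding, carried_cons,
        show (Message.response d r).load n.id = r.ans.length from if_pos hid.symm]
      omega
  have hcost : (t.receive r ns).nodesCost U i u v' ≤ t.nodesCost U i u v := by
    refine le_trans (le_of_eq ?_) ((Nat.add_le_add_left hnew _).trans hold)
    unfold Table.nodesCost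
    rw [((Table.receive_perm ns ⟨n, hn, hid⟩).map _).sum_eq, List.map_append, List.sum_append]
  simp only [Message.cost]
  omega

theorem potential_create {r : Request S C} {G : Atom S C} {pol : List (Clause S C)}
    {ns : List (Node S C)} (hg : Good i a ts (.request d r ::ₘ tr)) (hns : InitialNodes G r.id pol ns)
    (hpol : U.Admits pol) (hlen : r.id.length < i.length + U.atoms) :
    potential U i (ts ++ [newTable d ⟨r.id, r.requester, G⟩ ns]) tr <
      potential U i ts (.request d r ::ₘ tr) := by
  set T := newTable d ⟨r.id, r.requester, G⟩ ns with hT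
  have hpre : i.length ≤ r.id.length := by
    rcases (hg.wf.req (Multiset.mem_cons_self _ _)).1 with ⟨e, -⟩ | ⟨u, hu, -⟩
    · rw [e]
    · exact ((hg.wf.pre hu).trans (List.dropLast_prefix _)).length_le
  have hdue : due U (ts ++ [T]) = due U ts := by
    funext k
    unfold due
    rw [sentTo_mid]
    simp [hT, newTable, Table.sentTo, sentTo]
  have hout : outstanding U (ts ++ [T]) tr = outstanding U ts tr := by
    funext k
    rw [outstanding, hdue, outstanding]
  rw [potential_request]
  unfold potential
  rw [hdue, hout, tablesCost_mid]
  obtain ⟨n, hn⟩ : ∃ n, U.atoms - (r.id.length - i.length) = n + 1 :=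
    ⟨U.atoms - (r.id.length - i.length) - 1, by omega⟩
  have hg' := (hg.create (d := d) hns).wf
  have hlook := (hg.create (d := d) hns).look_mem (t := T) (by simp [hT])
  have hcost : T.nodesCost U i (due U ts) (outstanding U ts tr) ≤
      U.clauses * U.weight (U.requestCost n) U.body := by
    refine (List.sum_le_card_nsmul _ (U.weight (U.requestCost n) U.body) ?_).trans ?_
    · intro y hy
      obtain ⟨m, hm, rfl⟩ := List.mem_map.1 hy
      obtain ⟨⟨z, hz⟩, hst, c, hc, hlen'⟩ := hns.spec.2.2 m hm
      have hcm : U.cost i m.id = U.requestCost n := by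
        unfold Limits.cost
        congr 1
        rw [hz, List.length_append, List.length_singleton]
        omega
      have hcar : carried tr m.id = 0 :=
        carried_eq_zero (hg'.msgCount_eq_zero fun c => hg'.not_addr_of_new hlook hm hst c)
      have hdm : due U ts m.id ≤ U.atoms := Nat.sub_le _ _
      rw [hcm]
      refine (m.cost_le_weight hdm ?_).trans (U.weight_mono _ (hlen' ▸ (hpol.2 c hc).length))
      rw [outstanding, hcar]
      exact hdm
    · rw [List.length_map, smul_eq_mul]
      exact Nat.mul_le_mul_right _ (hns.spec.1.trans hpol.1)
  have hr : U.cost i r.id = U.clauses * U.weight (U.requestCost n) U.body + 2 := by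
    unfold Limits.cost
    rw [hn]
    rfl
  have hlive : T.liveCost ≤ 1 := by
    unfold Table.liveCost
    split_ifs <;> omega
  have hnil : tablesCost U i (due U ts) (outstanding U ts tr) [] = 0 := rfl
  omega

end

section

variable {U : Limits S C} {i : Identifier} {t : Table S C} {l₁ l₂ : List (Table S C)}
  {tr : Multiset (Message S C)} {a : C}

/-- The state has floundered, or it is within the limits and its potential is below `c`, or equal
to `c` with responses of cost below `b`. -/
def Progress (U : Limits S C) (i : Identifier) (c b : ℕ) (s : State S C) : Prop :=
  s.floundered = true ∨ Within U s.tables s.transit ∧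
    (potential U i s.tables s.transit < c ∨
      potential U i s.tables s.transit ≤ c ∧ responseCost s.transit < b)

theorem Progress.activate {s s' : State S C} {o : Outcome S C} {c b : ℕ}
    (hg : Good i a (l₁ ++ t :: l₂) tr) (hw : Within U (l₁ ++ t :: l₂) tr)
    (hd : t.rootStatus ≠ .disposed) (hc : potential U i (l₁ ++ t :: l₂) tr ≤ c)
    (hb : responseCost tr + t.rootId.length + 1 < b) (ho : ActivateNode t o)
    (ha : Apply s l₁ l₂ tr o s') : Progress U i c b s' := by
  refine ActivateNode.rec_on_table
    (Mid := fun t => Good i a (l₁ ++ t :: l₂) tr ∧ Within U (l₁ ++ t :: l₂) tr ∧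
      t.rootStatus ≠ .disposed ∧ potential U i (l₁ ++ t :: l₂) tr ≤ c ∧
      responseCost tr + t.rootId.length + 1 < b)
    (Q := fun o => ∀ s', Apply s l₁ l₂ tr o s' → Progress U i c b s')
    ?_ ?_ ?_ ?_ ho ⟨hg, hw, hd, hc, hb⟩ s' ha
  · rintro t pre post n ⟨h1, h2, h3, h4, h5⟩ - hs hnb
    obtain ⟨-, h6, -, -, h7, -⟩ := t.useFact_fields pre post n
    have := potential_useFact (U := U) (i := i) (l₁ := l₁) (l₂ := l₂) (tr := tr) hs hnb
    exact ⟨h1.useFact hs, h2.replace h7 h6 ((h2.table t (by simp)).useFact hs) h2.msg,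
      Table.useFact_rootStatus h3, by omega, by rwa [h7]⟩
  · rintro t t' ms ⟨h1, h2, h3, h4, h5⟩ - hgr s' ⟨⟩
    obtain ⟨rs, hdel, hcase⟩ := hgr.delivers (h1.wf.clients_nodup h1.look_mid h3)
    have hg' := h1.respond h3 hgr
    have hw' := hdel.within (h2.table t (by simp))
    have hw'' : Within U (l₁ ++ t' :: l₂) (tr + ms) := by
      refine h2.replace hdel.rootId hdel.goal hw'.1 fun m hm => ?_
      rcases Multiset.mem_add.1 hm with hm | hm
      · exact h2.msg m hm
      · exact hw'.2 m (Multiset.mem_coe.1 hm)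
    obtain ⟨hle, hlt⟩ := hdel.potential hg' hw''
    have hlive : t.liveCost = 1 := if_neg h3
    have hlive' : t'.liveCost ≤ 1 := by
      unfold Table.liveCost
      split_ifs <;> omega
    refine .inr ⟨hw'', ?_⟩
    dsimp only
    rcases hcase with hdis | ⟨-, ⟨r, hr, hrl, p, hp, hrp⟩ | ⟨r, rfl, hr⟩⟩
    · have : t'.liveCost = 0 := if_pos hdis
      left
      omega
    · left
      obtain ⟨haddr, hlow⟩ := h1.wf.lr h1.look_mid hrl
      rcases haddr with ⟨e, -⟩ | ⟨u, hu, -, n, hn, hid, hnb, -⟩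
      · exact absurd (prefix_antisymm hlow.1 (e ▸ h1.wf.pre h1.look_mid)) hlow.2
      · have := hlt u ((look_eq_some h1.nodup).1 hu).1 n hn hnb ?_
        · omega
        · obtain ⟨st, loops, rfl⟩ := hdel.msgs
          rw [hid]
          classical
          refine lt_of_lt_of_le (b := (t.unsent r.id).length) ?_ ?_
          · rw [List.length_pos_iff]
            refine List.ne_nil_of_mem (a := p.1) (List.mem_map.2 ⟨p, ?_, rfl⟩)
            simp [hp, hrp]
          · refine Multiset.le_sum_of_mem (Multiset.mem_map.2
              ⟨t.answerTo st loops r, Multiset.mem_coe.2 (List.mem_map_of_mem hr), ?_⟩)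
            exact if_pos rfl
    · right
      obtain ⟨st, loops, rfl⟩ := hdel.msgs
      obtain ⟨r', hr', e⟩ := h1.hr (t := t) (by simp) h3
      obtain rfl : r = r' := by simpa [hr] using hr'
      refine ⟨by omega, ?_⟩
      have : responseCost (tr + ((([r].map (t.answerTo st loops) : List (Message S C)) :
          Multiset (Message S C)))) = responseCost tr + (r.id.length + 1) := by
        simp [responseCost, Table.answerTo]
      rw [this, e]
      omega
  · rintro s' ⟨⟩
    exact .inl rfl
  · rintro t pre post n B Bs q ⟨h1, h2, h3, h4, h5⟩ - hs hnb hl s' ⟨⟩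
    have hlt := potential_sendRequest (U := U) (i := i) (l₁ := l₁) (l₂ := l₂) (tr := tr) hs
      (by simp [hnb]) q t.owner B
    have ht := h2.table t (by simp)
    have hB : B.Over U.sig := (ht.nodes n hs.mem).body B (by simp [Node.clause, hnb])
    have hw' : Within U (l₁ ++ t.activate pre n post .active :: l₂)
        (.request q ⟨n.id, t.owner, B⟩ ::ₘ tr) := by
      refine h2.replace rfl rfl (ht.activate hs .active) fun m hm => ?_
      rcases Multiset.mem_cons.1 hm with rfl | hm
      · exact ⟨hB, hl⟩
      · exact h2.msg m hm
    rw [← Multiset.singleton_add, add_comm] at hlt hw'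
    exact .inr ⟨hw', .inl (hlt.trans_le h4)⟩

/-- The response to a request that is not served by a new table. -/
theorem Progress.answerRequest {s : State S C} {d : C} {r : Request S C} {t₀ : Table S C}
    (hw : Within U (l₁ ++ t :: l₂) (.request d r ::ₘ tr)) {st : ResponseStatus}
    {loops : Set Identifier} {b : ℕ}
    (hdel : Delivers t t₀ [⟨r.id, r.requester, t.goal⟩]
      [t.answerTo st loops ⟨r.id, r.requester, t.goal⟩])
    (hg : Good i a (l₁ ++ t₀ :: l₂) (t.answerTo st loops ⟨r.id, r.requester, t.goal⟩ ::ₘ tr))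
    (hlive : t₀.rootStatus = t.rootStatus)
    (hs : s.tables = l₁ ++ t₀ :: l₂)
    (hs' : s.transit = t.answerTo st loops ⟨r.id, r.requester, t.goal⟩ ::ₘ tr) :
    Progress U i (potential U i (l₁ ++ t :: l₂) (.request d r ::ₘ tr)) b s := by
  have hw₀ := hdel.within (hw.table t (by simp))
  have hw' : Within U (l₁ ++ t₀ :: l₂)
      (t.answerTo st loops ⟨r.id, r.requester, t.goal⟩ ::ₘ tr) := by
    refine hw.replace hdel.rootId hdel.goal hw₀.1 fun m hm => ?_
    rcases Multiset.mem_cons.1 hm with rfl | hm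
    · exact hw₀.2 _ (by simp)
    · exact hw.msg m (Multiset.mem_cons_of_mem hm)
  right
  rw [hs, hs']
  refine ⟨hw', .inl ?_⟩
  rw [← Multiset.singleton_add, add_comm] at hg hw' ⊢
  have := (hdel.potential hg hw').1
  have hl : t₀.liveCost = t.liveCost := by
    unfold Table.liveCost
    rw [hlive]
  have hpos := U.cost_pos i r.id
  rw [potential_request]
  replace this : potential U i (l₁ ++ t₀ :: l₂)
    (tr + {t.answerTo st loops ⟨r.id, r.requester, t.goal⟩}) + t.liveCost ≤ _ := this
  omega

theorem Step.not_floundered {P : Policy S C} {s s' : State S C} (h : Step P s s') :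
    s.floundered = false := by
  cases h <;> assumption

theorem Within.step {P : Policy S C} {s s' : State S C} (hw : Within U s.tables s.transit)
    (hP : ∀ c, U.Admits (P c)) (hg : Good i a s.tables s.transit) (hs : Step P s s') :
    Progress U i (potential U i s.tables s.transit) (responseCost s.transit) s' := by
  have hg' := hg.step hs
  cases hs with
  | @completed d r rest l₁ l₂ t t' m hf hm ht hc hs =>
    rw [Table.sendResponse_eq] at hs
    cases hs
    rw [hm, ht] at hw ⊢
    refine Progress.answerRequest (t₀ := t.mark {r.id}) hw ⟨rfl, rfl, rfl, .of_eq rfl, by simp, ?_, _, _, rfl⟩ hg' rfl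
      rfl rfl
    simp [Table.mark, Set.ofPred_eq_eq_singleton']
  | @lower d r rest l₁ l₂ t t' m hf hm hn ht hc hs =>
    rw [Table.sendResponse_eq] at hs
    cases hs
    rw [hm, ht] at hw ⊢
    refine Progress.answerRequest
      (t₀ := ({ t with lr := t.lr ++ [⟨r.id, r.requester, t.goal⟩] } : Table S C).mark {r.id})
      hw ⟨rfl, rfl, rfl, .of_eq rfl, by simp, ?_, _, _, rfl⟩ hg' rfl rfl rfl
    simp [Table.mark, Set.ofPred_eq_eq_singleton']
  | @create _ d r rest G o hf hm hn hG hc ha =>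
    obtain ⟨ns, hns, ho⟩ := hc
    rw [hm] at hg hw ⊢
    have hgood := hg.create (d := d) hns
    have hwith := hw.create hg hn hG hns (hP d)
    have hlen := hgood.length_lt hwith
      (t := newTable d ⟨r.id, r.requester, G⟩ ns) (by simp)
    have hlt := potential_create hg hns (hP d) hlen
    have := Progress.activate hgood hwith (by simp [newTable]) le_rfl
      (Nat.lt_succ_self _) ho ha
    refine this.imp_right fun h => ⟨h.1, .inl ?_⟩
    rcases h.2 with h | h
    · exact h.trans hlt
    · exact h.1.trans_lt hlt
  | @response _ d r rest l₁ l₂ t o hf hm ht hwt hp ha =>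
    rw [hm, ht] at hg hw ⊢
    have hcost : responseCost (.response d r ::ₘ rest) = responseCost rest + (r.id.length + 1) := by
      simp [responseCost, add_comm]
    have hans := hw.msg _ (Multiset.mem_cons_self _ _)
    have hmid := hw.table t (by simp)
    cases hp with
    | ignore hroot =>
      cases ha
      refine .inr ?_
      dsimp only
      rw [Multiset.coe_nil, add_zero, hcost]
      exact ⟨hw.dropMsg, .inr ⟨potential_response r, by omega⟩⟩
    | resume hroot hn hid hb hns ht' hr ho =>
      obtain rfl : _ = t.receive r _ := ht'
      obtain ⟨-, hgoal, hri, -⟩ := t.noteResponse_fields r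
      have hle := potential_receive (U := U) hg hroot hn hid hb hns
      have hwr := hw.dropMsg.replace (t' := t.receive r _) hri hgoal
        (hmid.receive hn hid hb hns hans) hw.dropMsg.msg
      obtain ⟨x, hx⟩ := hg.wf.node hg.look_mid hn
      refine Progress.activate (hg.receive ⟨_, hn, hid⟩ hns) hwr ?_ hle ?_ ho ha
      · rcases hr with hr | ⟨ids, hr, -⟩ <;> simp [hr]
      · rw [show (t.receive r _).rootId = t.rootId from hri, hcost, ← hid, hx, List.length_append,
          List.length_singleton]
        omega
    | wait hroot hn hid hb hns ht' hr =>
      obtain rfl : _ = t.receive r _ := ht'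
      obtain ⟨-, hgoal, hri, -⟩ := t.noteResponse_fields r
      have hle := potential_receive (U := U) hg hroot hn hid hb hns
      have hwr := hw.dropMsg.replace (t' := t.receive r _) hri hgoal
        (hmid.receive hn hid hb hns hans) hw.dropMsg.msg
      cases ha
      refine .inr ?_
      dsimp only
      rw [Multiset.coe_nil, add_zero, hcost]
      exact ⟨hwr, .inr ⟨hle, by omega⟩⟩
  | @returned d r rest hf hm hn =>
    rw [hm] at hw ⊢
    have hcost : responseCost (.response d r ::ₘ rest) = responseCost rest + (r.id.length + 1) := by
      simp [responseCost, add_comm]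
    refine .inr ⟨hw.dropMsg, .inr ⟨potential_response r, ?_⟩⟩
    dsimp only
    omega

/-- There is no infinite execution. -/
theorem no_infinite_run {P : Policy S C} (hP : {c | P c ≠ []}.Finite) {d : C} {G : Atom S C}
    (hG : G.loc = .const d) : ¬ ∃ run : ℕ → State S C, run 0 = initial i a d G ∧
      ∀ n, Step P (run n) (run (n + 1)) := by
  rintro ⟨run, h0, hrun⟩
  obtain ⟨U, hU, hpol⟩ := exists_limits hP G
  have hgood : ∀ n, Good i a (run n).tables (run n).transit := by
    intro n
    induction n with
    | zero => rw [h0]; exact good_initial i a d G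
    | succ n ih => exact ih.step (hrun n)
  have hf : ∀ n, (run n).floundered = false := by
    intro n
    exact (hrun n).not_floundered
  have hwithin : ∀ n, Within U (run n).tables (run n).transit := by
    intro n
    induction n with
    | zero =>
      rw [h0]
      refine ⟨by simp [initial], fun m hm => ?_, by simp [initial]⟩
      rw [Multiset.mem_singleton.1 hm]
      exact ⟨hU, hG⟩
    | succ n ih =>
      rcases ih.step hpol (hgood n) (hrun n) with h | h
      · rw [hf] at h
        cases h
      · exact h.1
  obtain ⟨n, hn⟩ := WellFounded.not_rel_apply_succ (r := Prod.Lex (· < ·) (· < ·))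
    (fun n => (potential U i (run n).tables (run n).transit, responseCost (run n).transit))
  refine hn ?_
  rw [Prod.lex_def]
  rcases (hwithin n).step hpol (hgood n) (hrun n) with h | ⟨-, h | ⟨h1, h2⟩⟩
  · rw [hf] at h
    cases h
  · exact .inl h
  · rcases h1.lt_or_eq with h1 | h1
    · exact .inl h1
    · exact .inr ⟨h1, h2⟩

end

end GEM

theorem theorem3 {S C : Type*} (P : GEM.Policy S C) (hP : {c : C | P c ≠ []}.Finite)
    (i : GEM.Identifier) (a d : C) (G : GEM.Atom S C) (hG : G.loc = GEM.Term.const d) :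
    (¬ ∃ run : ℕ → GEM.State S C,
        run 0 = GEM.initial i a d G ∧ ∀ n, GEM.Step P (run n) (run (n + 1))) ∧
    ∀ s, Relation.ReflTransGen (GEM.Step P) (GEM.initial i a d G) s →
      (∀ s', ¬ GEM.Step P s s') →
      s.floundered = true ∨ GEM.Completed i a s :=
  ⟨GEM.no_infinite_run hP hG, fun _ h hs => GEM.completed_of_stuck h hs⟩
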